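/- Fix a real number $q^{1/2}$ with $-1<q^{1/2}<0$, put $q=(q^{1/2})^2$, $q^{k/2}=(q^{1/2})^k$, $[n]_q=\frac{q^n-q^{-n}}{q-q^{-1}}$, $d_m=[2m]_q-(-1)^m[m]_q$, $(x;p)_\infty=\prod_{k\ge 0}(1-p^kx)$, and let $\epsilon(q)$ be either square root of $q^{1/2}+q^{-1/2}$. Fock space. Let $a_m$ $(m\in\mathbb Z_{\ne0})$, $P$, $Q$ satisfy $[a_m,a_n]=\delta_{m+n,0}\frac{[m]_q}{m}d_m$, $[a_m,P]=[a_m,Q]=0$, $[P,Q]=1$, acting on $V(\Lambda_1)=\bigoplus_{n\in\mathbb Z}\mathbb C[a_{-1},a_{-2},\dots]\,e^{nQ}|\Lambda_1\rangle$, where $|\Lambda_1\rangle=e^{Q/2}|0\rangle$, $P|0\rangle=0$ and $a_m|0\rangle=0$ for $m>0$. Vectors are taken in the completion of $V(\Lambda_1)$ that consists of all formal infinite combinations of the monomials $\prod_m a_{-m}^{\mu_m}e^{nQ}|\Lambda_1\rangle$; an operator acts on such a vector if the infinite sum for each coefficient of the result converges absolutely. Vertex operators. Let $$\Phi_-(z)=\frac1{\epsilon(q)}\exp\Big(\sum_{m>0}\frac{a_{-m}}{d_m}q^{\frac{9m}2}z^m\Big)\exp\Big(-\sum_{m>0}\frac{a_m}{d_m}q^{-\frac{7m}2}z^{-m}\Big)e^Q(-zq^4)^{P+\frac12},$$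 let $x_0^-$ be the coefficient of $w^0$ in $$x^-(w)=\epsilon(q)\exp\Big(-\sum_{m>0}\frac{a_{-m}}{[m]_q}q^{\frac m2}w^m\Big)\exp\Big(\sum_{m>0}\frac{a_m}{[m]_q}q^{\frac m2}w^{-m}\Big)e^{-Q}w^{-P+\frac12},$$ and let $\Phi_0(z)=\Phi_-(z)x_0^--q\,x_0^-\Phi_-(z)$, $\Phi_+(z)=q^{\frac12}(\Phi_0(z)x_0^--x_0^-\Phi_0(z))$ and $\Phi_j^*(z)=(-q^{\frac12})^{j}\,\Phi_{-j}(-q^{-3}z)$ for $j=+,0,-$ (read as $1,0,-1$). Transfer matrix. For $\epsilon\in\{+,0,-\}$ (read as $1,0,-1$) let $$\varphi_\epsilon(z)=\frac{(q^8z^2;q^{12})_\infty(-q^9z^2;q^{12})_\infty}{(q^{12}z^2;q^{12})_\infty(-q^5z^2;q^{12})_\infty}\cdot\frac{(\epsilon\sqrt{-1}q^{9/2}z;q^6)_\infty(-\epsilon\sqrt{-1}q^{7/2}z;q^6)_\infty}{(\epsilon\sqrt{-1}q^{1/2}z;q^6)_\infty(-\epsilon\sqrt{-1}q^{3/2}z;q^6)_\infty}$$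 (the second factor is $1$ for $\epsilon=0$), let $K_0(z)=\frac{\varphi_0(z)}{\varphi_0(z^{-1})}\,\mathrm{id}$ and, in the basis $v_+,v_0,v_-$, $$K_\pm(z)=\frac{\varphi_\pm(z)}{\varphi_\pm(z^{-1})}\,\mathrm{diag}\Big(z^2,\ \frac{\pm\sqrt{-1}q^{3/2}+z}{\pm\sqrt{-1}q^{3/2}+z^{-1}},\ 1\Big),$$ and let $$T_\epsilon(z)=g\sum_{j,k=\pm,0}\Phi_j^*(z^{-1})K_\epsilon(z)_j^k\Phi_k(z),\qquad g=\frac1{1+q}\,\frac{(q^2;q^6)_\infty(-q^3;q^6)_\infty}{(q^6;q^6)_\infty(-q^5;q^6)_\infty}.$$ Theorem. Let $|B\rangle_\epsilon=e^{F(\epsilon)}|\Lambda_1\rangle$ with $$F(\epsilon)=-\frac12\sum_{m>0}\frac{m\,q^{8m}}{[m]_q\,d_m}a_{-m}^2+\sum_{m>0}\Big\{\theta_m\Big(\frac{(q^{\frac m2}-q^{-\frac m2}-(\sqrt{-1})^m)q^{4m}}{d_m}\Big)-\frac{(\epsilon\sqrt{-1})^mq^{3m}}{d_m}\Big\}a_{-m}-Q,$$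 where $\theta_m(x)=x$ for even $m$ and $\theta_m(x)=0$ for odd $m$. Let $\epsilon\in\{+,0,-\}$, and let $z\in\mathbb C$ satisfy $|z|<q^{-2}$, $|z|>q$ if $\epsilon=0$, $|z|>|q^{1/2}|$ if $\epsilon=\pm$, and not be one of the poles $\epsilon\sqrt{-1}q^{1/2}z=1$, $\epsilon\sqrt{-1}q^{3/2}z=-1$ of $K_\epsilon$. Then $|B\rangle_\epsilon\neq0$, all the infinite sums that enter $T_\epsilon(z)|B\rangle_\epsilon$ converge absolutely, and $$T_\epsilon(z)|B\rangle_\epsilon=|B\rangle_\epsilon .$$ -/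

import Mathlib

noncomputable section

namespace IzerginKorepin

open MvPowerSeries

/-! Throughout, `s` stands for `q^{1/2}`, so that `q = s ^ 2` and `q^{k/2} = s ^ k`. -/

/-- The `q`-integer `[n]_q = (q^n - q^{-n}) / (q - q^{-1})`. -/
def qInt (q : ℂ) (n : ℤ) : ℂ := (q ^ n - q ^ (-n)) / (q - q⁻¹)

/-- `[2m]_q - (-1)^m [m]_q`. -/
def den (q : ℂ) (m : ℕ+) : ℂ := qInt q (2 * (m : ℤ)) - (-1) ^ (m : ℕ) * qInt q (m : ℤ)

/-- The value `([m]_q / m) ([2m]_q - (-1)^m [m]_q)` of the commutator `[a_m, a_{-m}]`. -/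
def bosonNorm (q : ℂ) (m : ℕ+) : ℂ := qInt q (m : ℤ) / (m : ℂ) * den q m

/-- The completed Fock space. The variable `X m` is the creation boson `a_{-m}`, and `v n` is the
component of `v` along `e^{nQ}|Λ₁⟩`, a formal infinite combination of the monomials
`∏ a_{-m}^{μ m} e^{nQ}|Λ₁⟩`. Since `|Λ₁⟩ = e^{Q/2}|0⟩`, `[P, Q] = 1` and `P|0⟩ = 0`, the zero mode
`P` acts on `v n` as `n + 1/2`. -/
abbrev Fock : Type := ℤ → MvPowerSeries ℕ+ ℂ

/-- The highest weight vector `|Λ₁⟩`. -/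
def highest : Fock := Pi.single 0 1

/-- The operator `e^{kQ}`. -/
def shift (k : ℤ) (v : Fock) : Fock := fun n => v (n - k)

/-- The boson `a_{-m}`, `m > 0`. -/
def create (m : ℕ+) (v : Fock) : Fock := fun n => X m * v n

/-- The boson `a_m`, `m > 0`: the derivation `[a_m, a_{-m}] ∂ / ∂a_{-m}`. -/
def annihilate (q : ℂ) (m : ℕ+) (v : Fock) : Fock := fun n μ =>
  bosonNorm q m * ((μ m : ℂ) + 1) * coeff (μ + Finsupp.single m 1) (v n)

/-- The monomial `∏ a_m^{ν m}` in the annihilation bosons. -/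
def annihilatePow (q : ℂ) (ν : ℕ+ →₀ ℕ) (v : Fock) : Fock := fun n μ =>
  (ν.prod fun m k => bosonNorm q m ^ k * ((μ m + 1).ascFactorial k : ℂ)) * coeff (μ + ν) (v n)

theorem annihilate_create (q : ℂ) (m k : ℕ+) (v : Fock) :
    annihilate q m (create k v) - create k (annihilate q m v) =
      if m = k then bosonNorm q m • v else 0 := by
  funext n
  refine MvPowerSeries.ext fun μ => ?_
  have e1 : ∀ (f : MvPowerSeries ℕ+ ℂ) (l : ℕ+ →₀ ℕ), coeff l (X k * f) =
      if Finsupp.single k 1 ≤ l then coeff (l - Finsupp.single k 1) f else 0 := by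
    intro f l
    rw [X, coeff_monomial_mul]
    simp
  have e2 : coeff μ ((annihilate q m (create k v) - create k (annihilate q m v)) n) =
      bosonNorm q m * ((μ m : ℂ) + 1) * coeff (μ + Finsupp.single m 1) (X k * v n) -
        coeff μ (X k * (annihilate q m v n)) := rfl
  rw [e2, e1, e1]
  have e3 : ∀ l, coeff l (annihilate q m v n) =
    bosonNorm q m * ((l m : ℂ) + 1) * coeff (l + Finsupp.single m 1) (v n) := fun _ => rfl
  rw [e3]
  have e4 : ∀ l : ℕ+ →₀ ℕ, Finsupp.single k 1 ≤ l ↔ 1 ≤ l k := fun l =>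
    Finsupp.single_le_iff
  simp only [e4]
  by_cases h : m = k
  · subst h
    have e5 : μ + Finsupp.single m 1 - Finsupp.single m 1 = μ := by simp
    have e6 : 1 ≤ (μ + Finsupp.single m 1 : ℕ+ →₀ ℕ) m := by simp
    rw [if_pos e6, e5, if_pos rfl]
    have e7 : coeff μ ((bosonNorm q m • v) n) = bosonNorm q m * coeff μ (v n) := rfl
    rw [e7]
    split_ifs with h1
    · have e8 : μ - Finsupp.single m 1 + Finsupp.single m 1 = μ :=
        tsub_add_cancel_of_le ((e4 μ).2 h1)
      have e9 : (((μ - Finsupp.single m 1 : ℕ+ →₀ ℕ) m : ℕ) : ℂ) = (μ m : ℂ) - 1 := by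
        rw [Finsupp.tsub_apply, Finsupp.single_eq_same, Nat.cast_sub h1]; simp
      rw [e8, e9]; ring
    · have : μ m = 0 := by omega
      rw [this]; simp
  · rw [if_neg h]
    have e5 : (μ + Finsupp.single m 1 : ℕ+ →₀ ℕ) k = μ k := by
      rw [Finsupp.add_apply, Finsupp.single_eq_of_ne (Ne.symm h), add_zero]
    have e6 : (μ - Finsupp.single k 1 : ℕ+ →₀ ℕ) m = μ m := by
      rw [Finsupp.tsub_apply, Finsupp.single_eq_of_ne h, tsub_zero]
    rw [e5, e6]
    have e7 : coeff μ ((0 : Fock) n) = 0 := rfl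
    rw [e7]
    split_ifs with h1
    · rw [tsub_add_eq_add_tsub ((e4 μ).2 h1)]; ring
    · ring

theorem annihilatePow_zero (q : ℂ) (v : Fock) : annihilatePow q 0 v = v := by
  funext n μ
  simp [annihilatePow, coeff_apply]

theorem annihilatePow_add_single (q : ℂ) (m : ℕ+) (ν : ℕ+ →₀ ℕ) (v : Fock) :
    annihilatePow q (ν + Finsupp.single m 1) v = annihilate q m (annihilatePow q ν v) := by
  funext n μ
  have e1 : (ν + Finsupp.single m 1).prod
      (fun i k => bosonNorm q i ^ k * ((μ i + 1).ascFactorial k : ℂ)) =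
      bosonNorm q m * ((μ m : ℂ) + 1) * ν.prod (fun i k =>
        bosonNorm q i ^ k * (((μ + Finsupp.single m 1 : ℕ+ →₀ ℕ) i + 1).ascFactorial k : ℂ)) := by
    have hsub : (ν + Finsupp.single m 1).support = insert m ν.support := by
      ext i
      by_cases h : i = m <;> simp [h]
    rw [Finsupp.prod, hsub, Finsupp.prod_of_support_subset ν (Finset.subset_insert m ν.support)
      _ (by simp), ← Finset.mul_prod_erase _ _ (Finset.mem_insert_self m ν.support),
      ← Finset.mul_prod_erase _ _ (Finset.mem_insert_self m ν.support), ← mul_assoc]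
    congr 1
    · have := Nat.succ_ascFactorial (μ m + 1) (ν m)
      have h2 := Nat.ascFactorial_succ (n := μ m + 1) (k := ν m)
      simp only [Finsupp.add_apply, Finsupp.single_eq_same]
      rw [h2, ← this, pow_succ]
      push_cast
      ring
    · refine Finset.prod_congr rfl fun i hi => ?_
      have h : i ≠ m := Finset.ne_of_mem_erase hi
      simp [Finsupp.single_eq_of_ne h]
  simp only [annihilatePow, annihilate, coeff_apply, e1]
  rw [add_assoc μ, add_comm (Finsupp.single m 1) ν]
  ring

/-- The weight `∑ m μ_m` of a monomial, `a_{±m}` having weight `m`. -/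
def weight (μ : ℕ+ →₀ ℕ) : ℕ := μ.sum fun m k => (m : ℕ) * k

/-- The linear expression `∑_{m>0} r_m a_{-m}`. -/
def linearSeries (r : ℕ+ → ℂ) : MvPowerSeries ℕ+ ℂ := fun μ =>
  ∑ m ∈ μ.support, if μ = Finsupp.single m 1 then r m else 0

/-- The quadratic expression `∑_{m>0} r_m a_{-m}^2`. -/
def quadraticSeries (r : ℕ+ → ℂ) : MvPowerSeries ℕ+ ℂ := fun μ =>
  ∑ m ∈ μ.support, if μ = Finsupp.single m 2 then r m else 0

/-- The exponential of an expression in the creation bosons without constant term. -/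
def expSeries (f : MvPowerSeries ℕ+ ℂ) : MvPowerSeries ℕ+ ℂ := (PowerSeries.exp ℂ).subst f

/-- The term of index `ν` of `exp (∑_{m>0} t_m a_m) = ∑_ν ∏_m (t_m a_m)^{ν m} / (ν m)!`. -/
def annihilateTerm (q : ℂ) (t : ℕ+ → ℂ) (ν : ℕ+ →₀ ℕ) (v : Fock) : Fock :=
  (ν.prod fun m k => t m ^ k / (k.factorial : ℂ)) • annihilatePow q ν v

/-- The vector `exp (∑_{m>0} t_m a_m) v`, each coefficient being an infinite sum. -/
def annihilateExp (q : ℂ) (t : ℕ+ → ℂ) (v : Fock) : Fock := fun n μ =>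
  ∑' ν : ℕ+ →₀ ℕ, coeff μ (annihilateTerm q t ν v n)

/-- All the infinite sums in `annihilateExp q t v` converge (absolutely). -/
def AnnihilateExpConverges (q : ℂ) (t : ℕ+ → ℂ) (v : Fock) : Prop :=
  ∀ (n : ℤ) (μ : ℕ+ →₀ ℕ), Summable fun ν : ℕ+ →₀ ℕ => coeff μ (annihilateTerm q t ν v n)

/-- The coefficients of `P(z) = ∑_{m>0} a_{-m} q^{9m/2} z^m / ([2m]_q - (-1)^m [m]_q)`. -/
def coeffP (s z : ℂ) (m : ℕ+) : ℂ := s ^ (9 * (m : ℕ)) * z ^ (m : ℕ) / den (s ^ 2) m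

/-- The coefficients of `Q(z) = -∑_{m>0} a_m q^{-7m/2} z^{-m} / ([2m]_q - (-1)^m [m]_q)`. -/
def coeffQ (s z : ℂ) (m : ℕ+) : ℂ :=
  -((s ^ (7 * (m : ℕ)))⁻¹ * (z ^ (m : ℕ))⁻¹ / den (s ^ 2) m)

/-- The coefficients of `R^-(w) = -∑_{m>0} a_{-m} q^{m/2} w^m / [m]_q` at `w = 1`. -/
def coeffR (s : ℂ) (m : ℕ+) : ℂ := -(s ^ (m : ℕ) / qInt (s ^ 2) (m : ℤ))

/-- The coefficients of `S^-(w) = ∑_{m>0} a_m q^{m/2} w^{-m} / [m]_q` at `w = 1`. -/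
def coeffS (s : ℂ) (m : ℕ+) : ℂ := s ^ (m : ℕ) / qInt (s ^ 2) (m : ℤ)

/-- The mode `x_k^-`, that is the coefficient of `w^{-k}` in the current
`x^-(w) = e · exp R^-(w) · exp S^-(w) · e^{-Q} w^{-P + 1/2}`, where `e = ε(q)`. In `exp R^-(w)` the
monomial `κ` carries `w^{weight κ}`, in `exp S^-(w)` the monomial `ν` carries `w^{-weight ν}`, and
`w^{-P + 1/2}` is `w^{-(n+1)}` on the component `n + 1`, which `e^{-Q}` moves to `n`. There are
finitely many `ν` of a given weight, so that all sums here are finite. -/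
def currentMode (e s : ℂ) (k : ℤ) (v : Fock) : Fock := fun n μ =>
  e * ∑ p ∈ Finset.HasAntidiagonal.antidiagonal μ, coeff p.1 (expSeries (linearSeries (coeffR s))) *
    ∑ᶠ (ν : ℕ+ →₀ ℕ) (_ : (weight p.1 : ℤ) - weight ν - (n + 1) = -k),
      coeff p.2 (annihilateTerm (s ^ 2) (coeffS s) ν v (n + 1))

/-- The vertex operator
`Φ_-(z) = e^{-1} · exp P(z) · exp Q(z) · e^Q (-z q^4)^{P + 1/2}`, where `e = ε(q)`. The power is
`(-z q^4)^n` on the component `n - 1`, which `e^Q` moves to `n`. -/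
def vertexMinus (e s z : ℂ) (v : Fock) : Fock := fun n =>
  (e⁻¹ * (-z * s ^ 8) ^ n) •
    (expSeries (linearSeries (coeffP s z)) * annihilateExp (s ^ 2) (coeffQ s z) v (n - 1))

/-- `Φ_0(z) = Φ_-(z) x_0^- - q x_0^- Φ_-(z)`. -/
def vertexZero (e s z : ℂ) (v : Fock) : Fock :=
  vertexMinus e s z (currentMode e s 0 v) - s ^ 2 • currentMode e s 0 (vertexMinus e s z v)

/-- `Φ_+(z) = q^{1/2} (Φ_0(z) x_0^- - x_0^- Φ_0(z))`. -/
def vertexPlus (e s z : ℂ) (v : Fock) : Fock :=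
  s • (vertexZero e s z (currentMode e s 0 v) - currentMode e s 0 (vertexZero e s z v))

/-- The vertex operators `Φ_j(z)`, `j = +, 0, -`. -/
def vertex (e s : ℂ) : SignType → ℂ → Fock → Fock
  | .pos, z, v => vertexPlus e s z v
  | .zero, z, v => vertexZero e s z v
  | .neg, z, v => vertexMinus e s z v

/-- All the infinite sums that enter `Φ_-(z) v` converge. -/
def VertexMinusConverges (s z : ℂ) (v : Fock) : Prop :=
  AnnihilateExpConverges (s ^ 2) (coeffQ s z) v

/-- All the infinite sums that enter `Φ_0(z) v` converge. -/
def VertexZeroConverges (e s z : ℂ) (v : Fock) : Prop :=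
  VertexMinusConverges s z v ∧ VertexMinusConverges s z (currentMode e s 0 v)

/-- All the infinite sums that enter `Φ_+(z) v` converge. -/
def VertexPlusConverges (e s z : ℂ) (v : Fock) : Prop :=
  VertexZeroConverges e s z v ∧ VertexZeroConverges e s z (currentMode e s 0 v)

/-- All the infinite sums that enter `Φ_j(z) v` converge. -/
def VertexConverges (e s : ℂ) : SignType → ℂ → Fock → Prop
  | .pos, z, v => VertexPlusConverges e s z v
  | .zero, z, v => VertexZeroConverges e s z v
  | .neg, z, v => VertexMinusConverges s z v

/-- The dual vertex operators `Φ_j^*(z) = (-q^{1/2})^j Φ_{-j}(-q^{-3} z)`. -/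
def dualVertex (e s : ℂ) (j : SignType) (z : ℂ) (v : Fock) : Fock :=
  (-s) ^ ((j : ℤ)) • vertex e s (-j) (-(s ^ 6)⁻¹ * z) v

/-- All the infinite sums that enter `Φ_j^*(z) v` converge. -/
def DualVertexConverges (e s : ℂ) (j : SignType) (z : ℂ) (v : Fock) : Prop :=
  VertexConverges e s (-j) (-(s ^ 6)⁻¹ * z) v

/-- The infinite product `(z; p)_∞ = ∏_{m ≥ 0} (1 - p^m z)`. -/
def qPoch (z p : ℂ) : ℂ := ∏' m : ℕ, (1 - p ^ m * z)

/-- The normalization constant `g`. -/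
def gConst (s : ℂ) : ℂ :=
  1 / (1 + s ^ 2) * (qPoch (s ^ 4) (s ^ 12) * qPoch (-s ^ 6) (s ^ 12)) /
    (qPoch (s ^ 12) (s ^ 12) * qPoch (-s ^ 10) (s ^ 12))

/-- The normalizing function `φ_ε(z)`. -/
def phi (s : ℂ) (ε : SignType) (z : ℂ) : ℂ :=
  qPoch (s ^ 16 * z ^ 2) (s ^ 24) * qPoch (-s ^ 18 * z ^ 2) (s ^ 24) /
      (qPoch (s ^ 24 * z ^ 2) (s ^ 24) * qPoch (-s ^ 10 * z ^ 2) (s ^ 24)) *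
    if ε = 0 then 1 else
      qPoch (ε * Complex.I * s ^ 9 * z) (s ^ 12) * qPoch (-ε * Complex.I * s ^ 7 * z) (s ^ 12) /
        (qPoch (ε * Complex.I * s * z) (s ^ 12) * qPoch (-ε * Complex.I * s ^ 3 * z) (s ^ 12))

/-- The diagonal entries of `K_ε(z)` without the scalar factor `φ_ε(z) / φ_ε(z⁻¹)`. -/
def kDiag (s : ℂ) (ε : SignType) (z : ℂ) (j : SignType) : ℂ :=
  if ε = 0 then 1 else
    match j with
    | .pos => z ^ 2
    | .zero => (ε * Complex.I * s ^ 3 + z) / (ε * Complex.I * s ^ 3 + z⁻¹)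
    | .neg => 1

/-- The diagonal `K`-matrix `K_ε(z)`. -/
def kMatrix (s : ℂ) (ε : SignType) (z : ℂ) : Matrix SignType SignType ℂ :=
  (phi s ε z / phi s ε z⁻¹) • Matrix.diagonal (kDiag s ε z)

/-- The transfer matrix `T_ε(z) = g ∑_{j,k} Φ_j^*(z⁻¹) K_ε(z)_j^k Φ_k(z)`. -/
def transfer (e s : ℂ) (ε : SignType) (z : ℂ) (v : Fock) : Fock :=
  gConst s • ∑ j : SignType, ∑ k : SignType,
    dualVertex e s j z⁻¹ (kMatrix s ε z j k • vertex e s k z v)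

/-- All the infinite sums that enter `T_ε(z) v` converge. -/
def TransferConverges (e s : ℂ) (ε : SignType) (z : ℂ) (v : Fock) : Prop :=
  (∀ k, VertexConverges e s k z v) ∧
    ∀ j k, DualVertexConverges e s j z⁻¹ (kMatrix s ε z j k • vertex e s k z v)

/-- The coefficient of `a_{-m}^2` in `F(ε)`. -/
def quadF (s : ℂ) (m : ℕ+) : ℂ :=
  -(1 / 2) * ((m : ℂ) * s ^ (16 * (m : ℕ)) / (qInt (s ^ 2) (m : ℤ) * den (s ^ 2) m))

/-- The coefficient of `a_{-m}` in `F(ε)`. -/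
def linF (s : ℂ) (ε : SignType) (m : ℕ+) : ℂ :=
  (if Even (m : ℕ) then
      (s ^ (m : ℕ) - (s ^ (m : ℕ))⁻¹ - Complex.I ^ (m : ℕ)) * s ^ (8 * (m : ℕ)) / den (s ^ 2) m
    else 0) -
    (ε * Complex.I) ^ (m : ℕ) * s ^ (6 * (m : ℕ)) / den (s ^ 2) m

/-- The vector `|B⟩_ε = e^{F(ε)}|Λ₁⟩`, where the term `-Q` of `F(ε)` commutes with the others. -/
def groundState (s : ℂ) (ε : SignType) : Fock := fun n =>
  expSeries (quadraticSeries (quadF s) + linearSeries (linF s ε)) * shift (-1) highest n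

end IzerginKorepin

end

/-! Write `q = s ^ 2`. The boundary state is a Gaussian `exp (∑ a_m X_m ^ 2 + ∑ b_m X_m)` in the
creation bosons `X_m`, and all operators in the transfer matrix respect Gaussians. An exponential of
annihilation bosons is a translation of the variables; on a Gaussian it gives a scalar and moves the
linear term (`hasSum_shiftTerm`). An exponential of creation bosons only adds to the linear term
(`gauss_mul_gauss`). The mode `x_0^-` is the average over a circle of such operations
(`currentMode_gaussAvg`). Hence every vector that occurs is a `ket`, an average over circles of
scalars times Gaussians, and absolute convergence reduces to that of the exponents.

The quadratic term of the boundary state acts as a mirror: each vertex operator at `ζ` and each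
current at `q ^ 4 v` also interacts with an image at `ζ⁻¹`, `v⁻¹` (`vertexShift_eq`,
`currentShift_eq`). All exponents are logarithms of rational functions and of infinite products, and
`φ_ε` is the contraction of `Φ_-` with the boundary state (`expSum_vertexArg_self`). So each
coefficient of `T_ε(z)|B⟩_ε` is an explicit scalar times a sum of three averages over tori in two
current variables (`transfer_groundState`). The contours differ: a current belonging to the right
vertex operator runs on a small circle, one belonging to the dual operator on a large one.

Let `|z| = 1`. The small circles can be shrunk to the unit circle, whose measure is invariant under
`v ↦ v⁻¹`. Averaging over these inversions, together with the exchange of the two variables in the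
case of `Φ_+`, replaces `z` by `z⁻¹` in the right vertex operator and absorbs the entries of
`K_ε(z)` (`torusAvg_plusReflected`, `torusAvg_zeroReflected`); this is `K(z) Φ(z)|B⟩ = Φ(z⁻¹)|B⟩`
tested against the dual operator. What remains is the inversion relation `g ∑ Φ_j^*(z⁻¹) Φ_j(z⁻¹) =
1`, again as a contour identity (`torusAvg_unitarity`): with `z⁻¹ = -q ^ 2 m`, moving all contours
to one circle leaves an integrand that is antisymmetric, single residues that cancel, and one double
residue at `v₁ = m`, `v₂ = -q m`. There the linear shifts of the two vertex operators and the two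
currents cancel (`stateShift_residue`), so the Gaussian is that of the boundary state, and the
residue is the inverse of the scalar prefactor (`transferScalar_eq`, `symmPart_mul_crossKernel`).

For general `z`, the sum of averages times `1 + ε √-1 q^{3/2} z` is holomorphic in `z`. It does not
depend on the admissible radii, because the transfer matrix does not mention them
(`clearedIntegral_congr`). The identity therefore extends from the unit circle to the whole annulus,
which is connected (`clearedIntegral_eval`). -/

namespace IzerginKorepin

open MvPowerSeries

/-! ### Gaussian series -/

/-- The coefficient of `x ^ k` in `exp (a * x ^ 2)`. -/
noncomputable def sqExpCoeff {K : Type*} [Field K] (a : K) (k : ℕ) : K :=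
  if Even k then a ^ (k / 2) / ((k / 2).factorial : K) else 0

/-- The coefficient of `x ^ k` in `exp (a * x ^ 2 + b * x)`. -/
noncomputable def hermiteCoeff {K : Type*} [Field K] (a b : K) (k : ℕ) : K :=
  ∑ p ∈ Finset.HasAntidiagonal.antidiagonal k,
    sqExpCoeff a p.1 * (b ^ p.2 / (p.2.factorial : K))

theorem hermiteCoeff_zero {K : Type*} [Field K] (a b : K) : hermiteCoeff a b 0 = 1 := by
  simp [hermiteCoeff, sqExpCoeff]

/-- Coefficient form of the differential equation `y' = 2 a x y` of `exp (a x ^ 2)`; the `if` stands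
for the absent coefficient of index `-1`. -/
theorem succ_mul_sqExpCoeff (a : ℂ) (k : ℕ) :
    ((k : ℂ) + 1) * sqExpCoeff a (k + 1) = 2 * a * (if k = 0 then 0 else sqExpCoeff a (k - 1)) := by
  rcases k with _ | k
  · simp [sqExpCoeff]
  rcases Nat.even_or_odd' k with ⟨j, rfl | rfl⟩
  · have h1 : (2 * j + 1 + 1) / 2 = j + 1 := by omega
    have h2 : Even (2 * j + 1 + 1) := ⟨j + 1, by ring⟩
    have h3 : (j : ℂ) + 1 ≠ 0 := by exact_mod_cast Nat.succ_ne_zero j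
    have h4 : ((j.factorial : ℕ) : ℂ) ≠ 0 := by exact_mod_cast Nat.factorial_ne_zero j
    simp only [sqExpCoeff, h1, h2, if_true, Nat.add_eq_zero_iff, one_ne_zero, and_false, if_false,
      Nat.add_sub_cancel, even_two_mul, Nat.mul_div_cancel_left j (Nat.succ_pos 1),
      Nat.factorial_succ]
    push_cast
    field_simp
    ring
  · have h2 : ¬ Even (2 * j + 1 + 1 + 1) := by
      rw [Nat.not_even_iff_odd]; exact ⟨j + 1, by ring⟩
    have h3 : ¬ Even (2 * j + 1) := by
      rw [Nat.not_even_iff_odd]; exact ⟨j, by ring⟩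
    simp [sqExpCoeff, h2, h3]

/-- Coefficient form of `y' = (b + 2 a x) y`. This three-term recursion drives both the partial
derivatives of `gauss` and its Taylor expansion. -/
theorem succ_mul_hermiteCoeff (a b : ℂ) (k : ℕ) :
    ((k : ℂ) + 1) * hermiteCoeff a b (k + 1) =
      b * hermiteCoeff a b k + 2 * a * (if k = 0 then 0 else hermiteCoeff a b (k - 1)) := by
  set P : PowerSeries ℂ := PowerSeries.mk (sqExpCoeff a)
  set Q : PowerSeries ℂ := PowerSeries.mk fun l => b ^ l / (l.factorial : ℂ)
  have hPQ : ∀ k, hermiteCoeff a b k = PowerSeries.coeff k (P * Q) := fun k => by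
    rw [PowerSeries.coeff_mul]; simp [P, Q, hermiteCoeff]
  have hP : PowerSeries.derivative ℂ P = PowerSeries.X * P * PowerSeries.C (2 * a) := by
    ext k
    rw [PowerSeries.coeff_derivative, PowerSeries.coeff_mul_C]
    rcases k with _ | k
    · simpa [P, mul_comm] using succ_mul_sqExpCoeff a 0
    · rw [PowerSeries.coeff_succ_X_mul]
      have := succ_mul_sqExpCoeff a (k + 1)
      simp only [Nat.add_eq_zero_iff, one_ne_zero, and_false, if_false, Nat.add_sub_cancel] at this
      simp only [P, PowerSeries.coeff_mk]
      rw [mul_comm, this]; ring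
  have hQ : PowerSeries.derivative ℂ Q = Q * PowerSeries.C b := by
    ext k
    rw [PowerSeries.coeff_derivative, PowerSeries.coeff_mul_C]
    simp only [Q, PowerSeries.coeff_mk, Nat.factorial_succ]
    have h3 : (k : ℂ) + 1 ≠ 0 := by exact_mod_cast Nat.succ_ne_zero k
    have h4 : ((k.factorial : ℕ) : ℂ) ≠ 0 := by exact_mod_cast Nat.factorial_ne_zero k
    push_cast
    field_simp
    exact pow_succ b k
  have hD : PowerSeries.derivative ℂ (P * Q) =
      P * Q * PowerSeries.C b + PowerSeries.X * (P * Q) * PowerSeries.C (2 * a) := by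
    rw [Derivation.leibniz, hP, hQ]; simp only [smul_eq_mul]; ring
  have := congrArg (PowerSeries.coeff k) hD
  rw [PowerSeries.coeff_derivative, map_add, PowerSeries.coeff_mul_C, PowerSeries.coeff_mul_C,
    ← hPQ, ← hPQ] at this
  rw [mul_comm, this]
  rcases k with _ | k
  · simp; ring
  · rw [PowerSeries.coeff_succ_X_mul, ← hPQ]; simp; ring

/-- The series `exp (∑ a_m X_m ^ 2 + ∑ b_m X_m)`. -/
noncomputable def gauss (a b : ℕ+ → ℂ) : MvPowerSeries ℕ+ ℂ := fun μ =>
  μ.prod fun m k => hermiteCoeff (a m) (b m) k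

theorem coeff_gauss (a b : ℕ+ → ℂ) (μ : ℕ+ →₀ ℕ) :
    coeff μ (gauss a b) = μ.prod fun m k => hermiteCoeff (a m) (b m) k := rfl

theorem coeff_gauss_of_subset (a b : ℕ+ → ℂ) (μ : ℕ+ →₀ ℕ) {S : Finset ℕ+}
    (hS : μ.support ⊆ S) :
    coeff μ (gauss a b) = ∏ m ∈ S, hermiteCoeff (a m) (b m) (μ m) :=
  Finsupp.prod_of_support_subset _ hS _ fun _ _ => hermiteCoeff_zero _ _

theorem constantCoeff_gauss (a b : ℕ+ → ℂ) : constantCoeff (gauss a b) = 1 := by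
  rw [← coeff_zero_eq_constantCoeff_apply, coeff_gauss, Finsupp.prod_zero_index]

theorem coeff_X_mul' (m : ℕ+) (f : MvPowerSeries ℕ+ ℂ) (l : ℕ+ →₀ ℕ) :
    coeff l (X m * f) = if l m = 0 then 0 else coeff (l - Finsupp.single m 1) f := by
  rw [X, coeff_monomial_mul]
  simp only [Finsupp.single_le_iff, one_mul, Nat.one_le_iff_ne_zero, ite_not]

/-- The variables separate, so the factors at modes other than `m` are untouched and the factor at
`m` obeys the recursion `succ_mul_hermiteCoeff`. -/
theorem pderiv_gauss (a b : ℕ+ → ℂ) (m : ℕ+) :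
    pderiv ℂ m (gauss a b) = (C (b m) + C (2 * a m) * X m) * gauss a b := by
  ext μ
  have hsub : ∀ ν : ℕ+ →₀ ℕ, ν.support ⊆ insert m ν.support := fun ν => Finset.subset_insert _ _
  set S := insert m μ.support with hS
  have hm : m ∈ S := Finset.mem_insert_self _ _
  have h1 : (μ + Finsupp.single m 1).support ⊆ S := by
    refine Finsupp.support_add.trans ?_
    refine Finset.union_subset (Finset.subset_insert _ _) ?_
    exact Finsupp.support_single_subset.trans (by simpa using hm)
  have h2 : (μ - Finsupp.single m 1).support ⊆ S :=
    Finsupp.support_tsub.trans (Finset.subset_insert _ _)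
  rw [coeff_pderiv, add_mul, map_add, mul_assoc, coeff_C_mul, coeff_C_mul, coeff_X_mul',
    coeff_gauss_of_subset _ _ _ h1, coeff_gauss_of_subset _ _ _ h2,
    coeff_gauss_of_subset _ _ _ (Finset.subset_insert m μ.support), ← hS,
    ← Finset.mul_prod_erase _ _ hm, ← Finset.mul_prod_erase _ _ hm, ← Finset.mul_prod_erase _ _ hm]
  have e1 : ∏ x ∈ S.erase m, hermiteCoeff (a x) (b x) ((μ + Finsupp.single m 1 : ℕ+ →₀ ℕ) x) =
      ∏ x ∈ S.erase m, hermiteCoeff (a x) (b x) (μ x) :=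
    Finset.prod_congr rfl fun x hx => by
      simp [Finsupp.single_eq_of_ne (Finset.ne_of_mem_erase hx)]
  have e2 : ∏ x ∈ S.erase m, hermiteCoeff (a x) (b x) ((μ - Finsupp.single m 1 : ℕ+ →₀ ℕ) x) =
      ∏ x ∈ S.erase m, hermiteCoeff (a x) (b x) (μ x) :=
    Finset.prod_congr rfl fun x hx => by
      simp [Finsupp.single_eq_of_ne (Finset.ne_of_mem_erase hx)]
  rw [e1, e2]
  have h := succ_mul_hermiteCoeff (a m) (b m) (μ m)
  simp only [Finsupp.add_apply, Finsupp.single_eq_same, Finsupp.tsub_apply]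
  split_ifs at h ⊢ with h0
  · linear_combination (∏ x ∈ S.erase m, hermiteCoeff (a x) (b x) (μ x)) * h
  · linear_combination (∏ x ∈ S.erase m, hermiteCoeff (a x) (b x) (μ x)) * h

/-- A series with constant term `1` is determined by its logarithmic derivatives. -/
theorem eq_of_pderiv_eq_mul {f g : MvPowerSeries ℕ+ ℂ} (h : ℕ+ → MvPowerSeries ℕ+ ℂ)
    (hf : ∀ m, pderiv ℂ m f = h m * f) (hg : ∀ m, pderiv ℂ m g = h m * g)
    (hg0 : constantCoeff g = 1) (hc : constantCoeff f = constantCoeff g) : f = g := by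
  have hg1 : constantCoeff g ≠ 0 := by rw [hg0]; exact one_ne_zero
  have h1 : g * g⁻¹ = 1 := MvPowerSeries.mul_inv_cancel g hg1
  -- The logarithmic derivatives cancel in the quotient, so all its partial derivatives vanish and
  -- only the constant term remains.
  have : f * g⁻¹ = 1 := by
    refine pderiv.ext (fun m => ?_) ?_
    · rw [Derivation.leibniz, pderiv_inv', hf, hg, pderiv_one]
      simp only [smul_eq_mul]
      linear_combination (-f * g⁻¹ * h m) * h1
    · rw [map_mul, hc, ← map_mul, h1]
  calc f = f * (g * g⁻¹) := by rw [h1, mul_one]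
    _ = g := by rw [mul_left_comm, this, mul_one]

/-- Logarithmic derivatives add under multiplication, which avoids any convolution of Hermite
coefficients. -/
theorem gauss_mul_gauss (a a' b b' : ℕ+ → ℂ) :
    gauss a b * gauss a' b' = gauss (fun m => a m + a' m) fun m => b m + b' m := by
  refine eq_of_pderiv_eq_mul _ (fun m => ?_) (fun m => pderiv_gauss _ _ m)
    (constantCoeff_gauss _ _) ?_
  · rw [Derivation.leibniz, pderiv_gauss, pderiv_gauss]
    simp only [smul_eq_mul, map_add, mul_add]
    ring
  · simp [constantCoeff_gauss]

/-- The power `f ^ d` starts in degree `d`, so the exponential series is finite at each monomial.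
The bound `N` is left free so that one truncation can serve monomials of different degrees. -/
theorem coeff_expSeries {f : MvPowerSeries ℕ+ ℂ} (hf : constantCoeff f = 0) (μ : ℕ+ →₀ ℕ) {N : ℕ}
    (hN : μ.degree + 1 ≤ N) :
    coeff μ (expSeries f) = ∑ d ∈ Finset.range N, ((d.factorial : ℂ))⁻¹ * coeff μ (f ^ d) := by
  rw [expSeries, PowerSeries.coeff_subst (PowerSeries.HasSubst.of_constantCoeff_zero hf)]
  rw [finsum_eq_sum_of_support_subset (s := Finset.range N)]
  · refine Finset.sum_congr rfl fun d _ => ?_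
    rw [PowerSeries.coeff_exp, smul_eq_mul]
    simp
  · intro d hd
    by_contra hd'
    refine hd ?_
    have : coeff μ (f ^ d) = 0 := by
      refine coeff_eq_zero_of_constantCoeff_nilpotent (m := 1) (by simpa using hf) ?_
      have : ¬ d < N := by simpa using hd'
      omega
    simp [this]

theorem pderiv_expSeries {f : MvPowerSeries ℕ+ ℂ} (hf : constantCoeff f = 0) (m : ℕ+) :
    pderiv ℂ m (expSeries f) = pderiv ℂ m f * expSeries f := by
  ext μ
  -- A partial derivative reads a coefficient of degree one higher; the truncation at `N` on the
  -- left matches the one at `N - 1` on the right, since the derivative lowers the power of `f` by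
  -- one.
  set N := μ.degree + 2 with hN
  have h1 : (μ + Finsupp.single m 1).degree + 1 ≤ N := by simp [hN]
  rw [coeff_pderiv, coeff_expSeries hf _ h1, coeff_mul, Finset.sum_mul]
  have h2 : ∀ p ∈ Finset.HasAntidiagonal.antidiagonal μ,
      coeff p.1 (pderiv ℂ m f) * coeff p.2 (expSeries f) =
      ∑ d ∈ Finset.range (N - 1), ((d.factorial : ℂ))⁻¹ *
        (coeff p.1 (pderiv ℂ m f) * coeff p.2 (f ^ d)) := fun p hp => by
    have hp' : p.2.degree + 1 ≤ N - 1 := by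
      have : p.1 + p.2 = μ := by simpa using hp
      rw [hN, ← this, map_add]; omega
    rw [coeff_expSeries hf _ hp', Finset.mul_sum]
    exact Finset.sum_congr rfl fun d _ => by ring
  rw [Finset.sum_congr rfl h2, Finset.sum_comm]
  have h3 : N = (N - 1) + 1 := by omega
  rw [h3, Finset.sum_range_succ', Nat.add_sub_cancel]
  have h0 : coeff (μ + Finsupp.single m 1) (f ^ 0) = 0 := by
    rw [pow_zero, coeff_one, if_neg]
    intro h
    have := DFunLike.congr_fun h m
    simp at this
  rw [h0, mul_zero, zero_mul, add_zero]
  refine Finset.sum_congr rfl fun d _ => ?_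
  rw [← Finset.mul_sum, ← coeff_mul, mul_assoc, ← coeff_pderiv, pderiv_pow, Nat.add_sub_cancel]
  have h4 : ((d + 1 : ℕ) : MvPowerSeries ℕ+ ℂ) = C ((d + 1 : ℕ) : ℂ) := by simp
  rw [h4, mul_assoc, coeff_C_mul, ← mul_assoc, mul_comm (f ^ d), Nat.factorial_succ]
  congr 1
  have h5 : ((d + 1 : ℕ) : ℂ) ≠ 0 := by exact_mod_cast Nat.succ_ne_zero d
  push_cast at h5 ⊢
  field_simp

theorem coeff_linearSeries (r : ℕ+ → ℂ) (μ : ℕ+ →₀ ℕ) :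
    coeff μ (linearSeries r) = ∑ m ∈ μ.support, if μ = Finsupp.single m 1 then r m else 0 := rfl

theorem coeff_quadraticSeries (r : ℕ+ → ℂ) (μ : ℕ+ →₀ ℕ) :
    coeff μ (quadraticSeries r) = ∑ m ∈ μ.support, if μ = Finsupp.single m 2 then r m else 0 := rfl

theorem pderiv_linearSeries (r : ℕ+ → ℂ) (m : ℕ+) : pderiv ℂ m (linearSeries r) = C (r m) := by
  ext μ
  rw [coeff_pderiv, coeff_linearSeries, coeff_C]
  by_cases h : μ = 0
  · subst h
    rw [zero_add, Finsupp.support_single _ one_ne_zero]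
    simp
  · rw [if_neg h, Finset.sum_eq_zero, zero_mul]
    intro k _
    rw [if_neg]
    intro hk
    have h1 : k = m := by
      by_contra hkm
      have := DFunLike.congr_fun hk m
      simp [Finsupp.single_eq_of_ne (Ne.symm hkm)] at this
    subst h1
    exact h (by simpa using hk)

theorem pderiv_quadraticSeries (r : ℕ+ → ℂ) (m : ℕ+) :
    pderiv ℂ m (quadraticSeries r) = C (2 * r m) * X m := by
  ext μ
  rw [coeff_pderiv, coeff_quadraticSeries, coeff_C_mul, coeff_X]
  have key : ∀ k, μ + Finsupp.single m 1 = Finsupp.single k 2 → k = m ∧ μ = Finsupp.single m 1 := by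
    intro k hk
    have h1 : k = m := by
      by_contra hkm
      have := DFunLike.congr_fun hk m
      simp [Finsupp.single_eq_of_ne (Ne.symm hkm)] at this
    subst h1
    refine ⟨rfl, ?_⟩
    have h2 : (Finsupp.single k 2 : ℕ+ →₀ ℕ) = Finsupp.single k 1 + Finsupp.single k 1 := by
      rw [← Finsupp.single_add]
    rw [h2] at hk
    exact add_right_cancel hk
  by_cases h : μ = Finsupp.single m 1
  · subst h
    rw [← Finsupp.single_add, Finsupp.support_single _ (by norm_num)]
    simp
    ring
  · rw [if_neg h, Finset.sum_eq_zero]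
    · simp
    intro k _
    rw [if_neg]
    exact fun hk => h (key k hk).2

/-- Both sides have logarithmic derivatives `b_m + 2 a_m X_m` and constant term `1`. This gives
explicit coefficients for the exponentials that the boundary state and the vertex operators define
by substitution. -/
theorem expSeries_eq_gauss (a b : ℕ+ → ℂ) :
    expSeries (quadraticSeries a + linearSeries b) = gauss a b := by
  have h0 : constantCoeff (quadraticSeries a + linearSeries b) = 0 := by
    rw [map_add, ← coeff_zero_eq_constantCoeff_apply, ← coeff_zero_eq_constantCoeff_apply,
      coeff_linearSeries, coeff_quadraticSeries]
    simp
  refine eq_of_pderiv_eq_mul _ (fun m => ?_) (fun m => pderiv_gauss _ _ m)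
    (constantCoeff_gauss _ _) ?_
  · rw [pderiv_expSeries h0, map_add, pderiv_linearSeries, pderiv_quadraticSeries]
    ring
  · rw [constantCoeff_gauss, ← coeff_zero_eq_constantCoeff_apply,
      coeff_expSeries h0 (N := 1) _ (by simp)]
    simp

theorem expSeries_linearSeries (b : ℕ+ → ℂ) : expSeries (linearSeries b) = gauss 0 b := by
  rw [← expSeries_eq_gauss]
  congr 1
  ext μ
  rw [map_add, coeff_quadraticSeries]
  simp

theorem coeff_gauss_zero_left (b : ℕ+ → ℂ) (μ : ℕ+ →₀ ℕ) :
    coeff μ (gauss 0 b) = μ.prod fun m k => b m ^ k / (k.factorial : ℂ) := by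
  rw [coeff_gauss]
  refine Finsupp.prod_congr fun m _ => ?_
  rw [hermiteCoeff, Finset.sum_eq_single (0, μ m)]
  · simp [sqExpCoeff]
  · rintro ⟨i, j⟩ hij hne
    have hi : i ≠ 0 := by
      rintro rfl
      have h : 0 + j = μ m := Finset.HasAntidiagonal.mem_antidiagonal.1 hij
      exact hne (by rw [← h, zero_add])
    rcases Nat.even_or_odd' i with ⟨l, rfl | rfl⟩
    · have : l ≠ 0 := by omega
      simp [sqExpCoeff, this]
    · simp [sqExpCoeff]
  · simp

end IzerginKorepin

namespace IzerginKorepin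

open MvPowerSeries Filter Topology

/-! ### Translation of Gaussian series -/

theorem hasSum_exp_series (x : ℂ) :
    HasSum (fun k : ℕ => x ^ k / (k.factorial : ℂ)) (Complex.exp x) := by
  rw [Complex.exp_eq_exp_ℂ]
  exact NormedSpace.expSeries_div_hasSum_exp (𝔸 := ℂ) x

theorem hasSum_sqExpCoeff (a x : ℂ) :
    HasSum (fun k => sqExpCoeff a k * x ^ k) (Complex.exp (a * x ^ 2)) := by
  have hinj : Function.Injective (fun i : ℕ => 2 * i) := fun i j h => by
    have : 2 * i = 2 * j := h
    omega
  rw [← hinj.hasSum_iff]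
  · refine (hasSum_exp_series (a * x ^ 2)).congr_fun fun i => ?_
    simp only [Function.comp, sqExpCoeff, even_two_mul, if_true,
      Nat.mul_div_cancel_left i (Nat.succ_pos 1)]
    rw [mul_pow, pow_mul]
    ring
  · intro k hk
    have : ¬ Even k := fun ⟨i, hi⟩ => hk ⟨i, by simp only; omega⟩
    simp [sqExpCoeff, this]

theorem hasSum_hermiteCoeff (a b x : ℂ) :
    HasSum (fun k => hermiteCoeff a b k * x ^ k) (Complex.exp (a * x ^ 2 + b * x)) := by
  have h1 := hasSum_sqExpCoeff a x
  have h2 := hasSum_exp_series (b * x)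
  have h3 : ∀ n, ∑ p ∈ Finset.HasAntidiagonal.antidiagonal n,
      sqExpCoeff a p.1 * x ^ p.1 * ((b * x) ^ p.2 / (p.2.factorial : ℂ)) =
      hermiteCoeff a b n * x ^ n := fun n => by
    rw [hermiteCoeff, Finset.sum_mul]
    refine Finset.sum_congr rfl fun p hp => ?_
    rw [← Finset.HasAntidiagonal.mem_antidiagonal.1 hp, pow_add, mul_pow]
    ring
  have h4 := summable_norm_sum_mul_antidiagonal_of_summable_norm h1.summable.norm h2.summable.norm
  have h5 := tsum_mul_tsum_eq_tsum_sum_antidiagonal_of_summable_norm h1.summable.norm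
    h2.summable.norm
  simp only [h3] at h4 h5
  rw [Complex.exp_add, ← h1.tsum_eq, ← h2.tsum_eq, h5]
  exact h4.of_norm.hasSum

/-- The Taylor expansion of `exp (a * x ^ 2 + b * x)` at `u`. -/
theorem hasSum_choose_mul_hermiteCoeff (a b u : ℂ) (j : ℕ) :
    HasSum (fun k => ((j + k).choose k : ℂ) * u ^ k * hermiteCoeff a b (j + k))
      (Complex.exp (a * u ^ 2 + b * u) * hermiteCoeff a (b + 2 * a * u) j) := by
  induction j using Nat.strong_induction_on with
  | _ j ih =>
  rcases j with _ | j
  · rw [hermiteCoeff_zero, mul_one]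
    refine (hasSum_hermiteCoeff a b u).congr_fun fun k => ?_
    simp [mul_comm]
  set T : ℕ → ℕ → ℂ := fun j k => ((j + k).choose k : ℂ) * u ^ k * hermiteCoeff a b (j + k)
  set E := Complex.exp (a * u ^ 2 + b * u)
  set H := hermiteCoeff a (b + 2 * a * u)
  have hj : HasSum (T j) (E * H j) := ih j (Nat.lt_succ_self j)
  have hj1 : HasSum (fun k => if k = 0 then 0 else T j (k - 1)) (E * H j) := by
    have := (hasSum_nat_add_iff (f := fun k => if k = 0 then 0 else T j (k - 1))
      (g := E * H j) 1).1 (by simpa using hj)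
    simpa using this
  have hj2 : HasSum (fun k => if j = 0 then 0 else T (j - 1) k)
      (E * if j = 0 then 0 else H (j - 1)) := by
    split_ifs with h0
    · simp
    · exact ih (j - 1) (by omega)
  have hrec := succ_mul_hermiteCoeff a (b + 2 * a * u) j
  have hne : (j : ℂ) + 1 ≠ 0 := by exact_mod_cast Nat.succ_ne_zero j
  -- Weight the recursion for `hermiteCoeff a b (j + k + 1)` by the binomial coefficient. Pascal's
  -- rule splits its last term into row `j - 1` and row `j` shifted by one place. After summation
  -- the shifted row contributes `2 a u`, the change of the linear coefficient.
  have key := (((hj.mul_left b).add ((hj2.add (hj1.mul_left u)).mul_left (2 * a))).mul_left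
    ((j : ℂ) + 1)⁻¹)
  have e1 : ((j : ℂ) + 1)⁻¹ * (b * (E * H j) + 2 * a * (E * (if j = 0 then 0 else H (j - 1)) +
      u * (E * H j))) = E * H (j + 1) := by
    rw [inv_mul_eq_iff_eq_mul₀ hne]
    linear_combination (-E) * hrec
  rw [e1] at key
  refine key.congr_fun fun k => ?_
  rw [eq_inv_mul_iff_mul_eq₀ hne]
  have hrec2 := succ_mul_hermiteCoeff a b (j + k)
  have c1 : ((j : ℂ) + 1) * ((j + 1 + k).choose k : ℂ) =
      ((j : ℂ) + k + 1) * ((j + k).choose k : ℂ) := by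
    have h1 := Nat.add_one_mul_choose_eq (j + k) j
    have h2 : (j + k).choose j = (j + k).choose k := by
      rw [← Nat.choose_symm_of_eq_add]; omega
    have h3 : (j + k + 1).choose (j + 1) = (j + 1 + k).choose k := by
      rw [show j + 1 + k = j + k + 1 by ring]
      exact Nat.choose_symm_of_eq_add (by omega)
    rw [h2, h3] at h1
    have h4 : ((j + k + 1 : ℕ) : ℂ) * ((j + k).choose k : ℕ) =
      ((j + 1 + k).choose k : ℕ) * ((j + 1 : ℕ) : ℂ) := by exact_mod_cast h1
    push_cast at h4
    linear_combination -h4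
  have e2 : j + 1 + k = j + k + 1 := by ring
  simp only [T]
  rw [show hermiteCoeff a b (j + 1 + k) = hermiteCoeff a b (j + k + 1) by rw [e2]]
  push_cast at hrec2
  rcases j with _ | j
  · rcases k with _ | k
    · simp at hrec2 c1 ⊢
      linear_combination hrec2
    · simp at hrec2 c1 ⊢
      rw [pow_succ]
      linear_combination u ^ k * u * hermiteCoeff a b (k + 1 + 1) * c1 + u ^ k * u * hrec2
  · rcases k with _ | k
    · simp at hrec2 c1 ⊢
      linear_combination hrec2
    · have c2 : ((j + 1 + (k + 1)).choose (k + 1) : ℂ) =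
          ((j + (k + 1)).choose (k + 1) : ℂ) + ((j + 1 + k).choose k : ℂ) := by
        have : (j + 1 + (k + 1)).choose (k + 1) =
            (j + (k + 1)).choose (k + 1) + (j + 1 + k).choose k := by
          rw [show j + 1 + (k + 1) = (j + 1 + k) + 1 by ring, Nat.choose_succ_succ, add_comm,
            show j + (k + 1) = j + 1 + k by ring]
        exact_mod_cast this
      have e3 : j + 1 + (k + 1) - 1 = j + 1 + k := by omega
      have e4 : j + (k + 1) = j + 1 + k := by omega
      simp only [Nat.add_eq_zero_iff, one_ne_zero, and_false, if_false, Nat.add_sub_cancel, e3]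
        at hrec2 ⊢
      rw [e4] at c2 ⊢
      push_cast at *
      linear_combination u ^ (k + 1) * hermiteCoeff a b (j + 1 + (k + 1) + 1) * c1 +
        ((j + 1 + (k + 1)).choose (k + 1) : ℂ) * u ^ (k + 1) * hrec2 +
        2 * a * u ^ (k + 1) * hermiteCoeff a b (j + 1 + k) * c2

theorem hermiteCoeff_ofReal (a b : ℝ) (k : ℕ) :
    ((hermiteCoeff a b k : ℝ) : ℂ) = hermiteCoeff (a : ℂ) (b : ℂ) k := by
  simp only [hermiteCoeff, sqExpCoeff, Complex.ofReal_sum]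
  refine Finset.sum_congr rfl fun p _ => ?_
  split_ifs <;> push_cast <;> rfl

theorem sqExpCoeff_nonneg {a : ℝ} (ha : 0 ≤ a) (k : ℕ) : 0 ≤ sqExpCoeff a k := by
  rw [sqExpCoeff]; split_ifs <;> positivity

theorem hermiteCoeff_nonneg {a b : ℝ} (ha : 0 ≤ a) (hb : 0 ≤ b) (k : ℕ) :
    0 ≤ hermiteCoeff a b k :=
  Finset.sum_nonneg fun p _ => mul_nonneg (sqExpCoeff_nonneg ha _) (by positivity)

/-- A majorant with nonnegative parameters. The slack `B` lets one bound serve a family of linear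
terms, as needed when `b` varies under an integral. -/
theorem norm_hermiteCoeff_le {a b : ℂ} {B : ℝ} (hb : ‖b‖ ≤ B) (k : ℕ) :
    ‖hermiteCoeff a b k‖ ≤ hermiteCoeff ‖a‖ B k := by
  refine (norm_sum_le _ _).trans (Finset.sum_le_sum fun p _ => ?_)
  rw [norm_mul]
  refine mul_le_mul ?_ ?_ (norm_nonneg _) (sqExpCoeff_nonneg (norm_nonneg _) _)
  · simp only [sqExpCoeff]; split_ifs <;> simp
  · rw [norm_div, norm_pow, Complex.norm_natCast]
    gcongr

theorem hasSum_choose_mul_hermiteCoeff_real (a b u : ℝ) (j : ℕ) :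
    HasSum (fun k => ((j + k).choose k : ℝ) * u ^ k * hermiteCoeff a b (j + k))
      (Real.exp (a * u ^ 2 + b * u) * hermiteCoeff a (b + 2 * a * u) j) := by
  rw [← Complex.hasSum_ofReal]
  push_cast [hermiteCoeff_ofReal]
  exact hasSum_choose_mul_hermiteCoeff a b u j

/-! ### Sums over finitely supported exponents -/

section FinsuppSum

variable {ι : Type*} [DecidableEq ι]

theorem sum_finsupp_box {R : Type*} [CommSemiring R] (F : ι → ℕ → R) (T : (ι →₀ ℕ) → R)
    (S : Finset ι) (hT : ∀ ν : ι →₀ ℕ, ν.support ⊆ S → T ν = ∏ m ∈ S, F m (ν m)) (K : ℕ) :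
    ∑ ν ∈ S.finsupp fun _ => Finset.range K, T ν = ∏ m ∈ S, ∑ k ∈ Finset.range K, F m k := by
  classical
  rw [Finset.prod_sum, Finset.finsupp, Finset.sum_map]
  refine Finset.sum_congr (by congr!) fun p _ => ?_
  rw [Function.Embedding.coeFn_mk, hT _ (Finsupp.support_indicator_subset _ _),
    ← Finset.prod_attach S fun m => F m ((Finsupp.indicator S p) m)]
  exact Finset.prod_congr rfl fun x _ => by rw [Finsupp.indicator_of_mem x.2]

theorem exists_finsupp_box (U : Finset (ι →₀ ℕ)) (S₀ : Finset ι) :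
    ∃ S : Finset ι, S₀ ⊆ S ∧ ∃ K : ℕ, U ⊆ S.finsupp fun _ => Finset.range K := by
  classical
  refine ⟨S₀ ∪ U.biUnion Finsupp.support, Finset.subset_union_left,
    (U.sup fun ν => ν.degree) + 1, fun ν hν => ?_⟩
  rw [Finset.mem_finsupp_iff]
  refine ⟨fun m hm => Finset.mem_union_right _ (Finset.mem_biUnion.2 ⟨ν, hν, hm⟩), fun m _ => ?_⟩
  rw [Finset.mem_range, Nat.lt_succ_iff]
  exact (Finsupp.le_degree m ν).trans (Finset.le_sup (f := fun ν : ι →₀ ℕ => ν.degree) hν)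

/-- Every finite set of exponents lies in a box, and over a box the sum of products is a product of
sums. The set `S₀` makes room for a fixed monomial whose modes contribute even where `ν` vanishes.
-/
theorem summable_finsupp_prod {F : ι → ℕ → ℂ} {T : (ι →₀ ℕ) → ℂ} {S₀ : Finset ι}
    (hT : ∀ (S : Finset ι) (ν : ι →₀ ℕ), S₀ ⊆ S → ν.support ⊆ S → T ν = ∏ m ∈ S, F m (ν m))
    {A : ι → ℝ} (hA : ∀ m K, ∑ k ∈ Finset.range K, ‖F m k‖ ≤ A m)
    {c : ℝ} (hc : ∀ S, S₀ ⊆ S → ∏ m ∈ S, A m ≤ c) : Summable fun ν => ‖T ν‖ := by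
  refine summable_of_sum_le (c := c) (fun ν => norm_nonneg _) fun U => ?_
  obtain ⟨S, hS, K, hU⟩ := exists_finsupp_box U S₀
  calc ∑ ν ∈ U, ‖T ν‖ ≤ ∑ ν ∈ S.finsupp fun _ => Finset.range K, ‖T ν‖ :=
        Finset.sum_le_sum_of_subset_of_nonneg hU fun _ _ _ => norm_nonneg _
    _ = ∏ m ∈ S, ∑ k ∈ Finset.range K, ‖F m k‖ :=
        sum_finsupp_box (fun m k => ‖F m k‖) _ S (fun ν hν => by rw [hT S ν hS hν, norm_prod]) K
    _ ≤ ∏ m ∈ S, A m := Finset.prod_le_prod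
        (fun m _ => Finset.sum_nonneg fun _ _ => norm_nonneg _) fun m _ => hA m K
    _ ≤ c := hc S hS

/-- Two dominated limits: with the modes confined to `S`, let the exponents grow, which gives `∏ L
m` over `S`; then let `S` exhaust all modes. -/
theorem hasSum_finsupp_prod {F : ι → ℕ → ℂ} {T : (ι →₀ ℕ) → ℂ} {S₀ : Finset ι}
    (hT : ∀ (S : Finset ι) (ν : ι →₀ ℕ), S₀ ⊆ S → ν.support ⊆ S → T ν = ∏ m ∈ S, F m (ν m))
    (hsum : Summable fun ν => ‖T ν‖) {L : ι → ℂ} (hL : ∀ m, HasSum (F m) (L m)) {P : ℂ}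
    (hP : Tendsto (fun S : Finset ι => ∏ m ∈ S, L m) atTop (𝓝 P)) : HasSum T P := by
  classical
  have h1 : ∀ S, S₀ ⊆ S → ∑' ν, (if ν.support ⊆ S then T ν else 0) = ∏ m ∈ S, L m := by
    intro S hS
    have h2 : Tendsto (fun K : ℕ => ∑' ν, if ν ∈ S.finsupp (fun _ => Finset.range K)
        then T ν else 0) atTop (𝓝 (∑' ν, (if ν.support ⊆ S then T ν else 0))) := by
      refine tendsto_tsum_of_dominated_convergence hsum (fun ν => ?_)
        (Eventually.of_forall fun K ν => ?_)
      · refine tendsto_const_nhds.congr' ?_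
        filter_upwards [eventually_gt_atTop ν.degree] with K hK
        congr 1
        rw [Finset.mem_finsupp_iff]
        simp only [Finset.mem_range, eq_iff_iff]
        exact ⟨fun h => ⟨h, fun m _ => (Finsupp.le_degree m ν).trans_lt hK⟩, fun h => h.1⟩
      · split_ifs <;> simp
    have h3 : ∀ K : ℕ, ∑' ν, (if ν ∈ S.finsupp (fun _ => Finset.range K) then T ν else 0) =
        ∏ m ∈ S, ∑ k ∈ Finset.range K, F m k := fun K => by
      rw [← sum_finsupp_box F T S (fun ν hν => hT S ν hS hν) K, tsum_eq_sum
        (s := S.finsupp fun _ => Finset.range K) (fun ν hν => if_neg hν)]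
      exact Finset.sum_congr rfl fun ν hν => if_pos hν
    simp only [h3] at h2
    exact tendsto_nhds_unique h2
      (tendsto_finsetProd _ fun m _ => (hL m).tendsto_sum_nat)
  have h4 : Tendsto (fun S : Finset ι => ∑' ν, (if ν.support ⊆ S then T ν else 0)) atTop
      (𝓝 (∑' ν, T ν)) := by
    refine tendsto_tsum_of_dominated_convergence hsum (fun ν => ?_)
      (Eventually.of_forall fun S ν => ?_)
    · refine tendsto_const_nhds.congr' ?_
      filter_upwards [eventually_ge_atTop ν.support] with S hS
      exact (if_pos hS).symm
    · split_ifs <;> simp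
  have h5 : ∑' ν, T ν = P := by
    refine tendsto_nhds_unique h4 (hP.congr' ?_)
    filter_upwards [eventually_ge_atTop S₀] with S hS
    exact (h1 S hS).symm
  rw [← h5]
  exact hsum.of_norm.hasSum

end FinsuppSum

end IzerginKorepin

namespace IzerginKorepin

open MvPowerSeries Filter Topology MeasureTheory

/-! ### Annihilation exponentials on Gaussian vectors -/

/-- The contribution of the monomial `ν` to the coefficient `μ` of the translate by `u` of
`gauss a b`. -/
noncomputable def shiftTerm (a b u : ℕ+ → ℂ) (μ ν : ℕ+ →₀ ℕ) : ℂ :=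
  (ν.prod fun m k => ((μ m + k).choose k : ℂ) * u m ^ k) * coeff (μ + ν) (gauss a b)

theorem shiftTerm_eq_prod (a b u : ℕ+ → ℂ) (μ ν : ℕ+ →₀ ℕ) {S : Finset ℕ+}
    (hμ : μ.support ⊆ S) (hν : ν.support ⊆ S) :
    shiftTerm a b u μ ν = ∏ m ∈ S, (((μ m + ν m).choose (ν m) : ℂ) * u m ^ (ν m) *
      hermiteCoeff (a m) (b m) (μ m + ν m)) := by
  rw [shiftTerm, coeff_gauss_of_subset a b _ (Finsupp.support_add.trans (Finset.union_subset hμ hν)),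
    Finsupp.prod_of_support_subset ν hν _ (by simp), ← Finset.prod_mul_distrib]
  rfl

theorem norm_shiftTerm_le {a b u : ℕ+ → ℂ} {B : ℕ+ → ℝ} (hb : ∀ m, ‖b m‖ ≤ B m)
    (μ ν : ℕ+ →₀ ℕ) : ‖shiftTerm a b u μ ν‖ ≤
      ‖shiftTerm (fun m => (‖a m‖ : ℂ)) (fun m => (B m : ℂ)) (fun m => (‖u m‖ : ℂ)) μ ν‖ := by
  rw [shiftTerm_eq_prod a b u μ ν Finset.subset_union_left Finset.subset_union_right,
    shiftTerm_eq_prod _ _ _ μ ν Finset.subset_union_left Finset.subset_union_right,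
    norm_prod, norm_prod]
  refine Finset.prod_le_prod (fun _ _ => norm_nonneg _) fun m _ => ?_
  simp only [norm_mul, norm_pow, Complex.norm_real, norm_norm]
  gcongr
  rw [← hermiteCoeff_ofReal, Complex.norm_real]
  exact (norm_hermiteCoeff_le (hb m) _).trans (le_abs_self _)

/-- For nonnegative parameters each mode can be summed exactly, to an exponential times a Hermite
coefficient that is `1` off the support of `μ`. The product over all modes is thus bounded by the
exponential of a convergent series. -/
theorem summable_shiftTerm {a b u : ℕ+ → ℂ}
    (h : Summable fun m => ‖a m‖ * ‖u m‖ ^ 2 + ‖b m‖ * ‖u m‖) (μ : ℕ+ →₀ ℕ) :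
    Summable fun ν => ‖shiftTerm a b u μ ν‖ := by
  set H : ℕ+ → ℝ := fun m => hermiteCoeff ‖a m‖ (‖b m‖ + 2 * ‖a m‖ * ‖u m‖) (μ m)
  have hH : ∀ m, 0 ≤ H m := fun m => hermiteCoeff_nonneg (norm_nonneg _) (by positivity) _
  refine summable_finsupp_prod (S₀ := μ.support)
    (F := fun m k => ((μ m + k).choose k : ℂ) * u m ^ k * hermiteCoeff (a m) (b m) (μ m + k))
    (A := fun m => Real.exp (‖a m‖ * ‖u m‖ ^ 2 + ‖b m‖ * ‖u m‖) * H m)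
    (c := Real.exp (∑' m, (‖a m‖ * ‖u m‖ ^ 2 + ‖b m‖ * ‖u m‖)) * ∏ m ∈ μ.support, H m)
    (fun S ν hμ hν => shiftTerm_eq_prod a b u μ ν hμ hν) (fun m K => ?_) (fun S hS => ?_)
  · have hs := hasSum_choose_mul_hermiteCoeff_real ‖a m‖ ‖b m‖ ‖u m‖ (μ m)
    refine le_trans (Finset.sum_le_sum fun k _ => ?_) (sum_le_hasSum (Finset.range K)
      (fun k _ => ?_) hs)
    · rw [norm_mul, norm_mul, norm_pow, Complex.norm_natCast]
      gcongr
      exact norm_hermiteCoeff_le le_rfl _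
    · exact mul_nonneg (by positivity) (hermiteCoeff_nonneg (norm_nonneg _) (norm_nonneg _) _)
  · rw [Finset.prod_mul_distrib, ← Real.exp_sum]
    have : ∏ m ∈ S, H m = ∏ m ∈ μ.support, H m :=
      (Finset.prod_subset hS fun m _ hm => by
        simp only [H, Finsupp.notMem_support_iff.1 hm, hermiteCoeff_zero]).symm
    rw [this]
    refine mul_le_mul_of_nonneg_right (Real.exp_le_exp.2 ?_) (Finset.prod_nonneg fun m _ => hH m)
    exact h.sum_le_tsum S fun m _ => by positivity

/-- Translation by `u` completes mode by mode as `a (x + u) ^ 2 + b (x + u) = a x ^ 2 + (b + 2 a u)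
x + (a u ^ 2 + b u)`; the constants add up to `l`. -/
theorem hasSum_shiftTerm {a b u : ℕ+ → ℂ}
    (h : Summable fun m => ‖a m‖ * ‖u m‖ ^ 2 + ‖b m‖ * ‖u m‖) {l : ℂ}
    (hl : HasSum (fun m => a m * u m ^ 2 + b m * u m) l) (μ : ℕ+ →₀ ℕ) :
    HasSum (shiftTerm a b u μ)
      (Complex.exp l * coeff μ (gauss a fun m => b m + 2 * a m * u m)) := by
  refine hasSum_finsupp_prod (S₀ := μ.support)
    (F := fun m k => ((μ m + k).choose k : ℂ) * u m ^ k * hermiteCoeff (a m) (b m) (μ m + k))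
    (fun S ν hμ hν => shiftTerm_eq_prod a b u μ ν hμ hν) (summable_shiftTerm h μ)
    (fun m => hasSum_choose_mul_hermiteCoeff (a m) (b m) (u m) (μ m)) ?_
  simp only [Finset.prod_mul_distrib, ← Complex.exp_sum]
  refine Tendsto.mul ((Complex.continuous_exp.tendsto l).comp hl) ?_
  refine tendsto_const_nhds.congr' ?_
  filter_upwards [eventually_ge_atTop μ.support] with S hS
  exact coeff_gauss_of_subset _ _ _ hS

/-- Rising factorials divided by factorials are binomial coefficients, so `exp (∑ t_m a_m)` acts as
the translation by `bosonNorm q m * t m`. -/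
theorem coeff_annihilateTerm (q : ℂ) (t : ℕ+ → ℂ) (ν : ℕ+ →₀ ℕ) (v : Fock) (n : ℤ)
    (μ : ℕ+ →₀ ℕ) : coeff μ (annihilateTerm q t ν v n) =
      (ν.prod fun m k => ((μ m + k).choose k : ℂ) * (bosonNorm q m * t m) ^ k) *
        coeff (μ + ν) (v n) := by
  have h1 : coeff μ (annihilateTerm q t ν v n) = (ν.prod fun m k => t m ^ k / (k.factorial : ℂ)) *
      ((ν.prod fun m k => bosonNorm q m ^ k * ((μ m + 1).ascFactorial k : ℂ)) *
        coeff (μ + ν) (v n)) := rfl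
  rw [h1, ← mul_assoc, ← Finsupp.prod_mul]
  congr 1
  refine Finsupp.prod_congr fun m _ => ?_
  rw [Nat.ascFactorial_eq_factorial_mul_choose]
  have : ((ν m).factorial : ℂ) ≠ 0 := by exact_mod_cast Nat.factorial_ne_zero _
  push_cast
  rw [mul_pow]
  field_simp

theorem norm_coeff_gauss_le {a b : ℕ+ → ℂ} {B : ℕ+ → ℝ} (hB : ∀ m, ‖b m‖ ≤ B m)
    (μ : ℕ+ →₀ ℕ) :
    ‖coeff μ (gauss a b)‖ ≤ ∏ m ∈ μ.support, hermiteCoeff ‖a m‖ (B m) (μ m) := by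
  rw [coeff_gauss, Finsupp.prod, norm_prod]
  exact Finset.prod_le_prod (fun _ _ => norm_nonneg _) fun m _ => norm_hermiteCoeff_le (hB m) _

theorem summable_norm_of_bound {a b u : ℕ+ → ℂ} {B : ℕ+ → ℝ} (hB : ∀ m, ‖b m‖ ≤ B m)
    (h : Summable fun m => ‖a m‖ * ‖u m‖ ^ 2 + B m * ‖u m‖) :
    Summable fun m => ‖a m‖ * ‖u m‖ ^ 2 + ‖b m‖ * ‖u m‖ := by
  refine Summable.of_nonneg_of_le (fun m => by positivity) (fun m => ?_) h
  gcongr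
  exact hB m

/-- The vector `∫ f ω * gauss a (b ω)` in the component `k`. -/
noncomputable def gaussAvg {Ω : Type*} [MeasurableSpace Ω] (P : Measure Ω) (k : ℤ) (f : Ω → ℂ)
    (a : ℕ+ → ℂ) (b : Ω → ℕ+ → ℂ) : Fock := fun n μ =>
  if n = k then ∫ ω, f ω * coeff μ (gauss a (b ω)) ∂P else 0

section GaussAvg

variable {Ω : Type*} [MeasurableSpace Ω] {P : Measure Ω} {f : Ω → ℂ} {a : ℕ+ → ℂ}
  {b : Ω → ℕ+ → ℂ} {B : ℕ+ → ℝ}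

theorem coeff_gaussAvg_self (k : ℤ) (μ : ℕ+ →₀ ℕ) :
    coeff μ (gaussAvg P k f a b k) = ∫ ω, f ω * coeff μ (gauss a (b ω)) ∂P := by
  change gaussAvg P k f a b k μ = _
  rw [gaussAvg, if_pos rfl]

theorem gaussAvg_of_ne {k n : ℤ} (h : n ≠ k) : gaussAvg P k f a b n = 0 := by
  funext μ
  rw [gaussAvg, if_neg h]; rfl

theorem measurable_hermiteCoeff {g : Ω → ℂ} (hg : Measurable g) (c : ℂ) (k : ℕ) :
    Measurable fun ω => hermiteCoeff c (g ω) k := by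
  unfold hermiteCoeff
  fun_prop

theorem measurable_coeff_gauss (hb : ∀ m, Measurable fun ω => b ω m) (μ : ℕ+ →₀ ℕ) :
    Measurable fun ω => coeff μ (gauss a (b ω)) := by
  simp only [coeff_gauss, Finsupp.prod]
  exact Finset.measurable_fun_prod _ fun m _ => measurable_hermiteCoeff (hb m) _ _

theorem integrable_mul_coeff_gauss (hf : Integrable f P) (hb : ∀ m, Measurable fun ω => b ω m)
    (hB : ∀ ω m, ‖b ω m‖ ≤ B m) (μ : ℕ+ →₀ ℕ) :
    Integrable (fun ω => f ω * coeff μ (gauss a (b ω))) P := by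
  refine hf.mul_bdd (c := ∏ m ∈ μ.support, hermiteCoeff ‖a m‖ (B m) (μ m))
    (measurable_coeff_gauss hb μ).aestronglyMeasurable (Eventually.of_forall fun ω => ?_)
  exact norm_coeff_gauss_le (hB ω) μ

theorem gaussAvg_sub {f' : Ω → ℂ} (hf : Integrable f P) (hf' : Integrable f' P)
    (hb : ∀ m, Measurable fun ω => b ω m) (hB : ∀ ω m, ‖b ω m‖ ≤ B m) (k : ℤ) :
    gaussAvg P k f a b - gaussAvg P k f' a b = gaussAvg P k (fun ω => f ω - f' ω) a b := by
  funext n μ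
  change gaussAvg P k f a b n μ - gaussAvg P k f' a b n μ = _
  simp only [gaussAvg]
  split_ifs
  · rw [← integral_sub (integrable_mul_coeff_gauss hf hb hB μ)
      (integrable_mul_coeff_gauss hf' hb hB μ)]
    simp only [sub_mul]
  · simp

theorem smul_gaussAvg (c : ℂ) (k : ℤ) :
    c • gaussAvg P k f a b = gaussAvg P k (fun ω => c * f ω) a b := by
  funext n μ
  change c * gaussAvg P k f a b n μ = _
  simp only [gaussAvg]
  split_ifs
  · rw [← integral_const_mul]
    simp only [mul_assoc]
  · simp

theorem coeff_annihilateTerm_gaussAvg (q : ℂ) (t : ℕ+ → ℂ) (k : ℤ) (μ ν : ℕ+ →₀ ℕ) :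
    coeff μ (annihilateTerm q t ν (gaussAvg P k f a b) k) =
      ∫ ω, f ω * shiftTerm a (b ω) (fun m => bosonNorm q m * t m) μ ν ∂P := by
  rw [coeff_annihilateTerm, coeff_gaussAvg_self, ← integral_const_mul]
  exact integral_congr_ae (Eventually.of_forall fun ω => by simp only [shiftTerm]; ring)

theorem annihilateTerm_gaussAvg_of_ne (q : ℂ) (t : ℕ+ → ℂ) {k n : ℤ} (h : n ≠ k)
    (μ ν : ℕ+ →₀ ℕ) : coeff μ (annihilateTerm q t ν (gaussAvg P k f a b) n) = 0 := by
  rw [coeff_annihilateTerm, gaussAvg_of_ne h, map_zero, mul_zero]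

theorem integrable_mul_shiftTerm (hf : Integrable f P) (hb : ∀ m, Measurable fun ω => b ω m)
    (hB : ∀ ω m, ‖b ω m‖ ≤ B m) (u : ℕ+ → ℂ) (μ ν : ℕ+ →₀ ℕ) :
    Integrable (fun ω => f ω * shiftTerm a (b ω) u μ ν) P := by
  have := (integrable_mul_coeff_gauss hf hb hB (μ + ν) (a := a)).const_mul
    (ν.prod fun m k => ((μ m + k).choose k : ℂ) * u m ^ k)
  refine this.congr (Eventually.of_forall fun ω => ?_)
  simp only [shiftTerm]; ring

/-- The bound `B` on the linear terms is uniform in `ω`, so the majorant factors out of the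
integral. This is what permits the exchange of the sum over `ν` with the average. -/
theorem summable_integral_shiftTerm (hf : Integrable f P) (hb : ∀ m, Measurable fun ω => b ω m)
    (hB : ∀ ω m, ‖b ω m‖ ≤ B m) {u : ℕ+ → ℂ}
    (h : Summable fun m => ‖a m‖ * ‖u m‖ ^ 2 + B m * ‖u m‖) [Nonempty Ω] (μ : ℕ+ →₀ ℕ) :
    Summable fun ν => ∫ ω, ‖f ω * shiftTerm a (b ω) u μ ν‖ ∂P := by
  have hB0 : ∀ m, 0 ≤ B m := fun m => (norm_nonneg _).trans (hB (Classical.arbitrary Ω) m)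
  have h1 := summable_shiftTerm (a := fun m => (‖a m‖ : ℂ)) (b := fun m => (B m : ℂ))
    (u := fun m => (‖u m‖ : ℂ)) (by simpa [abs_of_nonneg (hB0 _)] using h) μ
  refine Summable.of_nonneg_of_le (fun ν => integral_nonneg fun ω => norm_nonneg _) (fun ν => ?_)
    (h1.mul_left (∫ ω, ‖f ω‖ ∂P))
  rw [← integral_mul_const]
  refine integral_mono (integrable_mul_shiftTerm hf hb hB u μ ν).norm (hf.norm.mul_const _)
    fun ω => ?_
  simp only [norm_mul]
  exact mul_le_mul_of_nonneg_left (norm_shiftTerm_le (hB ω) μ ν) (norm_nonneg _)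

theorem hasSum_annihilateTerm_gaussAvg [Nonempty Ω] (hf : Integrable f P)
    (hb : ∀ m, Measurable fun ω => b ω m) (hB : ∀ ω m, ‖b ω m‖ ≤ B m) (q : ℂ) (t : ℕ+ → ℂ)
    (h : Summable fun m => ‖a m‖ * ‖bosonNorm q m * t m‖ ^ 2 + B m * ‖bosonNorm q m * t m‖)
    {l : Ω → ℂ} (hl : ∀ ω, HasSum (fun m => a m * (bosonNorm q m * t m) ^ 2 +
      b ω m * (bosonNorm q m * t m)) (l ω)) (k : ℤ) (μ : ℕ+ →₀ ℕ) :
    HasSum (fun ν => coeff μ (annihilateTerm q t ν (gaussAvg P k f a b) k))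
      (∫ ω, f ω * Complex.exp (l ω) *
        coeff μ (gauss a fun m => b ω m + 2 * a m * (bosonNorm q m * t m)) ∂P) := by
  simp only [coeff_annihilateTerm_gaussAvg]
  have h1 := hasSum_integral_of_summable_integral_norm (E := ℂ) (μ := P)
    (fun ν => integrable_mul_shiftTerm hf hb hB (a := a) (fun m => bosonNorm q m * t m) μ ν)
    (summable_integral_shiftTerm hf hb hB h μ)
  have h2 : ∀ ω, ∑' ν, f ω * shiftTerm a (b ω) (fun m => bosonNorm q m * t m) μ ν =
      f ω * Complex.exp (l ω) *
        coeff μ (gauss a fun m => b ω m + 2 * a m * (bosonNorm q m * t m)) := fun ω => by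
    rw [((hasSum_shiftTerm (summable_norm_of_bound (hB ω) h) (hl ω) μ).mul_left (f ω)).tsum_eq,
      mul_assoc]
  simp only [h2] at h1
  exact h1

theorem annihilateExpConverges_gaussAvg [Nonempty Ω] (hf : Integrable f P)
    (hb : ∀ m, Measurable fun ω => b ω m) (hB : ∀ ω m, ‖b ω m‖ ≤ B m) (q : ℂ) (t : ℕ+ → ℂ)
    (h : Summable fun m => ‖a m‖ * ‖bosonNorm q m * t m‖ ^ 2 + B m * ‖bosonNorm q m * t m‖)
    (k : ℤ) : AnnihilateExpConverges q t (gaussAvg P k f a b) := by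
  intro n μ
  by_cases hn : n = k
  · subst hn
    simp only [coeff_annihilateTerm_gaussAvg]
    exact (hasSum_integral_of_summable_integral_norm (E := ℂ) (μ := P)
      (fun ν => integrable_mul_shiftTerm hf hb hB (a := a) (fun m => bosonNorm q m * t m) μ ν)
      (summable_integral_shiftTerm hf hb hB h μ)).summable
  · simp only [annihilateTerm_gaussAvg_of_ne q t hn]
    exact summable_zero

/-- Under the integral every Gaussian acquires the scalar of the translation and the two linear
shifts, one from the annihilation part and one from the creation part. The product with the creation
exponential is a finite convolution in each coefficient, so only the annihilation part needs an
exchange of limits. -/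
theorem vertexMinus_gaussAvg [Nonempty Ω] (hf : Integrable f P)
    (hb : ∀ m, Measurable fun ω => b ω m) (hB : ∀ ω m, ‖b ω m‖ ≤ B m) (e s z : ℂ)
    {u : ℕ+ → ℂ} (hu : ∀ m, bosonNorm (s ^ 2) m * coeffQ s z m = u m)
    (h : Summable fun m => ‖a m‖ * ‖u m‖ ^ 2 + B m * ‖u m‖)
    {l E : Ω → ℂ} (hl : ∀ ω, HasSum (fun m => a m * u m ^ 2 + b ω m * u m) (l ω))
    (hE : ∀ ω, Complex.exp (l ω) = E ω) (k : ℤ)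
    (hEi : Integrable (fun ω => f ω * E ω) P) :
    vertexMinus e s z (gaussAvg P k f a b) =
      gaussAvg P (k + 1) (fun ω => e⁻¹ * (-z * s ^ 8) ^ (k + 1) * (f ω * E ω)) a
        (fun ω m => b ω m + (2 * a m * u m + coeffP s z m)) := by
  simp only [← hu, ← hE] at h hl hEi ⊢
  funext n μ
  by_cases hn : n = k + 1
  · subst hn
    have h1 : ∀ κ, coeff κ (annihilateExp (s ^ 2) (coeffQ s z) (gaussAvg P k f a b) (k + 1 - 1)) =
        ∫ ω, f ω * Complex.exp (l ω) * coeff κ (gauss a fun m => b ω m +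
          2 * a m * (bosonNorm (s ^ 2) m * coeffQ s z m)) ∂P := by
      intro κ
      rw [add_sub_cancel_right]
      exact (hasSum_annihilateTerm_gaussAvg hf hb hB _ _ h hl k κ).tsum_eq
    change e⁻¹ * (-z * s ^ 8) ^ (k + 1) * coeff μ (expSeries (linearSeries (coeffP s z)) *
      annihilateExp (s ^ 2) (coeffQ s z) (gaussAvg P k f a b) (k + 1 - 1)) = _
    rw [gaussAvg, if_pos rfl, coeff_mul, expSeries_linearSeries]
    simp only [h1]
    simp only [mul_assoc (e⁻¹ * (-z * s ^ 8) ^ (k + 1)), integral_const_mul]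
    congr 1
    simp only [← integral_const_mul]
    rw [← integral_finsetSum]
    · refine integral_congr_ae (Eventually.of_forall fun ω => ?_)
      have h2 := congrArg (coeff μ) (gauss_mul_gauss 0 a (coeffP s z) (fun m => b ω m +
        2 * a m * (bosonNorm (s ^ 2) m * coeffQ s z m)))
      rw [coeff_mul] at h2
      have h3 : (fun m => (0 : ℕ+ → ℂ) m + a m) = a := by funext m; simp
      have h4 : (fun m => coeffP s z m + (b ω m +
          2 * a m * (bosonNorm (s ^ 2) m * coeffQ s z m))) = fun m => b ω m +
          (2 * a m * (bosonNorm (s ^ 2) m * coeffQ s z m) + coeffP s z m) := by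
        funext m; ring
      rw [h3, h4] at h2
      simp only
      rw [← h2, Finset.mul_sum]
      exact Finset.sum_congr rfl fun p _ => by ring
    · intro p _
      refine Integrable.const_mul ?_ _
      refine integrable_mul_coeff_gauss (B := fun m => B m +
        ‖2 * a m * (bosonNorm (s ^ 2) m * coeffQ s z m)‖) hEi (fun m => ?_)
        (fun ω m => ?_) p.2
      · exact (hb m).add_const _
      · exact (norm_add_le _ _).trans (add_le_add_left (hB ω m) _)
  · have h1 : annihilateExp (s ^ 2) (coeffQ s z) (gaussAvg P k f a b) (n - 1) = 0 := by
      funext κ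
      rw [annihilateExp]
      simp only [annihilateTerm_gaussAvg_of_ne (s ^ 2) _ (show n - 1 ≠ k by omega), tsum_zero]
      rfl
    rw [vertexMinus, h1, mul_zero, smul_zero, gaussAvg_of_ne hn]

end GaussAvg

end IzerginKorepin

namespace IzerginKorepin

open MvPowerSeries Filter Topology MeasureTheory

/-! ### Modes of the current on Gaussian vectors -/

/-- The normalized measure on the parameter interval of a circle. -/
noncomputable def circ : Measure ℝ :=
  (ENNReal.ofReal (2 * Real.pi))⁻¹ • volume.restrict (Set.Ioc 0 (2 * Real.pi))

instance : IsFiniteMeasure circ := by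
  refine ⟨?_⟩
  have h : ENNReal.ofReal (2 * Real.pi) ≠ 0 := by
    simpa using Real.pi_pos
  rw [circ, Measure.smul_apply, Measure.restrict_apply_univ, Real.volume_Ioc, smul_eq_mul]
  exact ENNReal.mul_lt_top (ENNReal.inv_lt_top.2 (pos_iff_ne_zero.2 h)) ENNReal.ofReal_lt_top

theorem integral_circ (F : ℂ → ℂ) (R : ℝ) :
    ∫ θ, F (circleMap 0 R θ) ∂circ = Real.circleAverage F 0 R := by
  have h : (0 : ℝ) ≤ 2 * Real.pi := by positivity
  rw [circ, integral_smul_measure, Real.circleAverage, intervalIntegral.integral_of_le h,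
    ENNReal.toReal_inv, ENNReal.toReal_ofReal h]

/-- Extraction of the constant Laurent coefficient by averaging over a circle. The constant `c`
permits circles in the variable `w = q ^ 4 v`. -/
theorem integral_circ_zpow (c : ℂ) {R : ℝ} (hR : 0 < R) (j : ℤ) :
    ∫ θ, (c * circleMap 0 R θ) ^ j ∂circ = if j = 0 then 1 else 0 := by
  rw [integral_circ (fun w => (c * w) ^ j) R]
  split_ifs with h
  · subst h
    simp [Real.circleAverage_const]
  · rw [Real.circleAverage_eq_circleIntegral hR.ne']
    have h1 : ∮ w in C(0, R), (w - 0)⁻¹ • (c * w) ^ j =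
        ∮ w in C(0, R), c ^ j * (w - 0) ^ (j - 1) := by
      refine circleIntegral.integral_congr hR.le fun w hw => ?_
      have hw0 : w ≠ 0 := by
        rintro rfl
        simp at hw
        exact hR.ne hw
      simp only [sub_zero, smul_eq_mul]
      rw [mul_zpow, zpow_sub_one₀ hw0]
      ring
    rw [h1, circleIntegral.integral_const_mul, circleIntegral.integral_sub_zpow_of_ne (by omega)]
    simp

theorem weight_le_mul (ν : ℕ+ →₀ ℕ) {m : ℕ+} (hm : m ∈ ν.support) : (m : ℕ) * ν m ≤ weight ν :=
  Finset.single_le_sum (f := fun m : ℕ+ => (m : ℕ) * ν m) (fun _ _ => Nat.zero_le _) hm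

theorem finite_weight_eq (N : ℕ) : {ν : ℕ+ →₀ ℕ | weight ν = N}.Finite := by
  refine ((Finset.Icc (1 : ℕ+) N.succPNat).finsupp fun _ => Finset.range (N + 1)).finite_toSet.subset
    fun ν hν => ?_
  have hν' : weight ν = N := hν
  rw [Finset.mem_coe, Finset.mem_finsupp_iff]
  refine ⟨fun m hm => ?_, fun m _ => ?_⟩
  · have h1 := weight_le_mul ν hm
    have h2 : 0 < ν m := Nat.pos_of_ne_zero (Finsupp.mem_support_iff.1 hm)
    rw [Finset.mem_Icc]
    refine ⟨one_le, ?_⟩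
    rw [← PNat.coe_le_coe, Nat.succPNat_coe]
    nlinarith
  · rw [Finset.mem_range]
    by_cases hm : m ∈ ν.support
    · have h1 := weight_le_mul ν hm
      have h2 : 0 < (m : ℕ) := m.pos
      nlinarith
    · rw [Finsupp.notMem_support_iff.1 hm]; omega

theorem prod_mul_pow_weight (x : ℕ+ → ℕ → ℂ) (w : ℂ) (ν : ℕ+ →₀ ℕ) :
    (ν.prod fun m k => x m k * (w ^ (m : ℕ)) ^ k) = (ν.prod fun m k => x m k) * w ^ weight ν := by
  rw [Finsupp.prod_mul, weight, Finsupp.sum, ← Finset.prod_pow_eq_pow_sum]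
  congr 1
  exact Finset.prod_congr rfl fun m _ => by rw [pow_mul]

/-- Homogeneity for the grading by weight: as a function of `w` each term is a pure power, which a
circle average can select. -/
theorem shiftTerm_mul_pow (a b u : ℕ+ → ℂ) (w : ℂ) (μ ν : ℕ+ →₀ ℕ) :
    shiftTerm a b (fun m => u m * (w ^ (m : ℕ))⁻¹) μ ν =
      (w ^ weight ν)⁻¹ * shiftTerm a b u μ ν := by
  have := prod_mul_pow_weight (fun m k => ((μ m + k).choose k : ℂ) * u m ^ k) w⁻¹ ν
  simp only [inv_pow] at this
  rw [shiftTerm, shiftTerm, ← mul_assoc, mul_comm (w ^ weight ν)⁻¹, ← this]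
  congr 2
  funext m k
  rw [mul_pow]
  ring

theorem coeff_gauss_zero_mul_pow (r : ℕ+ → ℂ) (w : ℂ) (μ : ℕ+ →₀ ℕ) :
    coeff μ (gauss 0 fun m => r m * w ^ (m : ℕ)) = coeff μ (gauss 0 r) * w ^ weight μ := by
  rw [coeff_gauss_zero_left, coeff_gauss_zero_left, ← prod_mul_pow_weight]
  congr 1
  funext m k
  rw [mul_pow]
  ring

section Current

variable {Ω : Type*} [MeasurableSpace Ω] {P : Measure Ω} {f : Ω → ℂ} {a : ℕ+ → ℂ}
  {b : Ω → ℕ+ → ℂ} {B : ℕ+ → ℝ}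

theorem norm_mul_circleMap (c : ℂ) {R : ℝ} (hR : 0 < R) (θ : ℝ) :
    ‖c * circleMap 0 R θ‖ = ‖c‖ * R := by
  rw [norm_mul, norm_circleMap_zero, abs_of_pos hR]

theorem integrable_circ_zpow {c : ℂ} (hc : c ≠ 0) {R : ℝ} (hR : 0 < R) (j : ℤ) :
    Integrable (fun θ => (c * circleMap 0 R θ) ^ j) circ := by
  have hcont : Continuous fun θ : ℝ => (c * circleMap 0 R θ) ^ j := by
    refine Continuous.zpow₀ (by fun_prop) j fun θ => Or.inl ?_
    exact mul_ne_zero hc (circleMap_ne_center hR.ne')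
  refine Integrable.of_bound hcont.aestronglyMeasurable ((‖c‖ * R) ^ j)
    (Eventually.of_forall fun θ => ?_)
  rw [norm_zpow, norm_mul_circleMap c hR]

/-- Expand the translated Gaussian into its terms, each a power `w ^ (-weight ν)`. On the circle the
norm of `w` is constant, so absolute summability there allows termwise integration, and
orthogonality keeps the terms of weight `j`. -/
theorem integral_mode [Nonempty Ω] [SFinite P] (hf : Integrable f P)
    (hb : ∀ m, Measurable fun ω => b ω m) (hB : ∀ ω m, ‖b ω m‖ ≤ B m) {c : ℂ} (hc : c ≠ 0)
    {R : ℝ} (hR : 0 < R) {u : ℕ+ → ℂ}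
    (h : Summable fun m : ℕ+ => ‖a m‖ * (‖u m‖ * ((‖c‖ * R) ^ (m : ℕ))⁻¹) ^ 2 +
      B m * (‖u m‖ * ((‖c‖ * R) ^ (m : ℕ))⁻¹))
    {l : Ω → ℝ → ℂ} (hl : ∀ ω θ, HasSum (fun m : ℕ+ =>
      a m * (u m * ((c * circleMap 0 R θ) ^ (m : ℕ))⁻¹) ^ 2 +
        b ω m * (u m * ((c * circleMap 0 R θ) ^ (m : ℕ))⁻¹)) (l ω θ))
    (j : ℤ) (μ : ℕ+ →₀ ℕ) :
    ∫ p : Ω × ℝ, (c * circleMap 0 R p.2) ^ j * (f p.1 * Complex.exp (l p.1 p.2)) *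
      coeff μ (gauss a fun m =>
        b p.1 m + 2 * a m * (u m * ((c * circleMap 0 R p.2) ^ (m : ℕ))⁻¹)) ∂(P.prod circ) =
      ∑ᶠ (ν : ℕ+ →₀ ℕ) (_ : (weight ν : ℤ) = j), ∫ ω, f ω * shiftTerm a (b ω) u μ ν ∂P := by
  set w : ℝ → ℂ := fun θ => c * circleMap 0 R θ
  have hw : ∀ θ, w θ ≠ 0 := fun θ => mul_ne_zero hc (circleMap_ne_center hR.ne')
  have hwn : ∀ θ, ‖w θ‖ = ‖c‖ * R := norm_mul_circleMap c hR
  -- The translation at the positive real point with the norm of the circle; all points of the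
  -- circle give terms of this same norm.
  set u₁ : ℕ+ → ℂ := fun m => u m * (((‖c‖ * R : ℝ) : ℂ) ^ (m : ℕ))⁻¹
  have hcR : 0 < ‖c‖ * R := mul_pos (norm_pos_iff.2 hc) hR
  have hu₁ : ∀ m, ‖u₁ m‖ = ‖u m‖ * ((‖c‖ * R) ^ (m : ℕ))⁻¹ := fun m => by
    simp only [u₁, norm_mul, norm_inv, norm_pow, Complex.norm_real, Real.norm_eq_abs,
      abs_norm, abs_of_pos hR]
  have h1 : Summable fun m => ‖a m‖ * ‖u₁ m‖ ^ 2 + B m * ‖u₁ m‖ := by simpa only [hu₁] using h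
  set F : (ℕ+ →₀ ℕ) → Ω × ℝ → ℂ := fun ν p =>
    (f p.1 * shiftTerm a (b p.1) u μ ν) * w p.2 ^ (j - weight ν)
  have hFi : ∀ ν, Integrable (F ν) (P.prod circ) := fun ν =>
    (integrable_mul_shiftTerm hf hb hB u μ ν).mul_prod (integrable_circ_zpow hc hR _)
  have hFn : ∀ ν p, ‖F ν p‖ = ‖f p.1 * shiftTerm a (b p.1) u₁ μ ν‖ * (‖c‖ * R) ^ j := by
    intro ν p
    simp only [F, u₁]
    rw [shiftTerm_mul_pow]
    simp only [norm_mul, norm_zpow, hwn, norm_inv, norm_pow, Complex.norm_real, Real.norm_eq_abs,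
      zpow_sub₀ hcR.ne', zpow_natCast]
    rw [abs_norm, abs_of_pos hR]
    ring
  have hFs : Summable fun ν => ∫ p, ‖F ν p‖ ∂(P.prod circ) := by
    simp only [hFn]
    have h2 : ∀ ν, ∫ p : Ω × ℝ, ‖f p.1 * shiftTerm a (b p.1) u₁ μ ν‖ * (‖c‖ * R) ^ j
        ∂(P.prod circ) = (∫ ω, ‖f ω * shiftTerm a (b ω) u₁ μ ν‖ ∂P) *
          ∫ _θ : ℝ, (‖c‖ * R) ^ j ∂circ := fun ν =>
      integral_prod_mul (fun ω => ‖f ω * shiftTerm a (b ω) u₁ μ ν‖) fun _ : ℝ => (‖c‖ * R) ^ j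
    simp only [h2]
    exact (summable_integral_shiftTerm hf hb hB h1 μ).mul_right _
  have key := hasSum_integral_of_summable_integral_norm hFi hFs
  have hInt : ∀ ν, ∫ p, F ν p ∂(P.prod circ) =
      if (weight ν : ℤ) = j then ∫ ω, f ω * shiftTerm a (b ω) u μ ν ∂P else 0 := by
    intro ν
    have h2 : ∫ p, F ν p ∂(P.prod circ) = (∫ ω, f ω * shiftTerm a (b ω) u μ ν ∂P) *
        ∫ θ, w θ ^ (j - weight ν) ∂circ :=
      integral_prod_mul (fun ω => f ω * shiftTerm a (b ω) u μ ν) fun θ => w θ ^ (j - weight ν)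
    rw [h2, integral_circ_zpow c hR]
    by_cases hj : (weight ν : ℤ) = j
    · rw [if_pos hj, if_pos (by omega), mul_one]
    · rw [if_neg hj, if_neg (by omega), mul_zero]
  have htsum : ∀ p : Ω × ℝ, ∑' ν, F ν p = w p.2 ^ j * (f p.1 * Complex.exp (l p.1 p.2)) *
      coeff μ (gauss a fun m => b p.1 m + 2 * a m * (u m * (w p.2 ^ (m : ℕ))⁻¹)) := by
    intro p
    have h3 : Summable fun m : ℕ+ => ‖a m‖ * ‖u m * (w p.2 ^ (m : ℕ))⁻¹‖ ^ 2 +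
        B m * ‖u m * (w p.2 ^ (m : ℕ))⁻¹‖ := by
      simpa only [norm_mul (u _), norm_inv, norm_pow, hwn] using h
    have h4 := (hasSum_shiftTerm (summable_norm_of_bound (hB p.1) h3) (hl p.1 p.2) μ).mul_left
      (w p.2 ^ j * f p.1)
    have h5 : ∀ ν, F ν p = w p.2 ^ j * f p.1 *
        shiftTerm a (b p.1) (fun m => u m * (w p.2 ^ (m : ℕ))⁻¹) μ ν := fun ν => by
      simp only [F]
      rw [shiftTerm_mul_pow, zpow_sub₀ (hw p.2), zpow_natCast]
      ring
    simp only [h5]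
    rw [h4.tsum_eq]
    ring
  simp only [htsum, hInt] at key
  rw [← key.tsum_eq]
  -- No monomial has negative weight, and finitely many have a given one, so the `finsum` in the
  -- definition of the mode is an honest finite sum.
  rcases lt_or_ge j 0 with hj | hj
  · have h6 : ∀ ν : ℕ+ →₀ ℕ, ¬ (weight ν : ℤ) = j := fun ν => by omega
    simp [h6]
  · obtain ⟨N, rfl⟩ := Int.eq_ofNat_of_zero_le hj
    have h6 : ∀ ν : ℕ+ →₀ ℕ, (weight ν : ℤ) = (N : ℤ) ↔ ν ∈ (finite_weight_eq N).toFinset :=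
      fun ν => by simp
    simp only [h6]
    rw [finsum_mem_finset_eq_sum, tsum_eq_sum (s := (finite_weight_eq N).toFinset)
      fun ν hν => if_neg hν]
    exact Finset.sum_congr rfl fun ν hν => if_pos hν

/-- The mode is an algebraic expression in the coefficients; it equals the average over any circle
on which the translated Gaussians converge absolutely. The radius is therefore free within the range
of convergence. -/
theorem currentMode_gaussAvg [Nonempty Ω] [SFinite P] (hf : Integrable f P)
    (hb : ∀ m, Measurable fun ω => b ω m) (hB : ∀ ω m, ‖b ω m‖ ≤ B m) (e s : ℂ) {c : ℂ}
    (hc : c ≠ 0) {R : ℝ} (hR : 0 < R) {u : ℕ+ → ℂ}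
    (hu : ∀ m, bosonNorm (s ^ 2) m * coeffS s m = u m)
    (h : Summable fun m : ℕ+ => ‖a m‖ * (‖u m‖ * ((‖c‖ * R) ^ (m : ℕ))⁻¹) ^ 2 +
      B m * (‖u m‖ * ((‖c‖ * R) ^ (m : ℕ))⁻¹))
    {l E : Ω → ℝ → ℂ} (hl : ∀ ω θ, HasSum (fun m : ℕ+ =>
      a m * (u m * ((c * circleMap 0 R θ) ^ (m : ℕ))⁻¹) ^ 2 +
        b ω m * (u m * ((c * circleMap 0 R θ) ^ (m : ℕ))⁻¹)) (l ω θ))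
    (hE : ∀ ω θ, Complex.exp (l ω θ) = E ω θ) (k : ℤ)
    (hEi : ∀ j : ℤ, Integrable (fun p : Ω × ℝ => (c * circleMap 0 R p.2) ^ j *
      (f p.1 * E p.1 p.2)) (P.prod circ)) :
    currentMode e s 0 (gaussAvg P k f a b) = gaussAvg (P.prod circ) (k - 1)
      (fun p => e * ((c * circleMap 0 R p.2) ^ (-k) * (f p.1 * E p.1 p.2))) a
      (fun p m => b p.1 m + (2 * a m * (u m * ((c * circleMap 0 R p.2) ^ (m : ℕ))⁻¹) +
        coeffR s m * (c * circleMap 0 R p.2) ^ (m : ℕ))) := by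
  simp only [← hE] at hEi ⊢
  set w : ℝ → ℂ := fun θ => c * circleMap 0 R θ
  have hw : ∀ θ, w θ ≠ 0 := fun θ => mul_ne_zero hc (circleMap_ne_center hR.ne')
  have hwn : ∀ θ, ‖w θ‖ = ‖c‖ * R := norm_mul_circleMap c hR
  have hwm : Measurable w := by fun_prop
  funext n μ
  by_cases hn : n = k - 1
  · subst hn
    rw [gaussAvg, if_pos rfl, currentMode, expSeries_linearSeries, sub_add_cancel]
    simp only [coeff_annihilateTerm_gaussAvg, hu]
    -- The zero mode acts as `w ^ (-k)` on the component `k`, so the coefficient of `w ^ 0` pairs a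
    -- creation monomial `p` with annihilation monomials of weight `weight p - k`.
    have hcond : ∀ (p : ℕ+ →₀ ℕ) (ν : ℕ+ →₀ ℕ),
        ((weight p : ℤ) - weight ν - k = -0) = ((weight ν : ℤ) = weight p - k) := fun p ν => by
      rw [eq_iff_iff]; omega
    simp only [hcond, ← integral_mode hf hb hB hc hR h hl]
    rw [Finset.mul_sum]
    simp only [← mul_assoc, ← integral_const_mul]
    rw [← integral_finsetSum]
    · refine integral_congr_ae (Eventually.of_forall fun x => ?_)
      have h2 := congrArg (coeff μ) (gauss_mul_gauss 0 a (fun m => coeffR s m * w x.2 ^ (m : ℕ))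
        (fun m => b x.1 m + 2 * a m * (u m * (w x.2 ^ (m : ℕ))⁻¹)))
      rw [coeff_mul] at h2
      have h3 : (fun m => (0 : ℕ+ → ℂ) m + a m) = a := by funext m; simp
      have h4 : (fun m : ℕ+ => coeffR s m * w x.2 ^ (m : ℕ) + (b x.1 m +
          2 * a m * (u m * (w x.2 ^ (m : ℕ))⁻¹))) = fun m : ℕ+ => b x.1 m +
          (2 * a m * (u m * (w x.2 ^ (m : ℕ))⁻¹) + coeffR s m * w x.2 ^ (m : ℕ)) := by
        funext m; ring
      rw [h3, h4] at h2
      simp only [← mul_assoc] at h2 ⊢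
      rw [← h2, Finset.mul_sum]
      refine Finset.sum_congr rfl fun p _ => ?_
      rw [coeff_gauss_zero_mul_pow, zpow_sub₀ (hw x.2), zpow_natCast, zpow_neg]
      ring
    · intro p _
      have h5 := integrable_mul_coeff_gauss (a := a) (b := fun x : Ω × ℝ => fun m : ℕ+ =>
        b x.1 m + 2 * a m * (u m * (w x.2 ^ (m : ℕ))⁻¹))
        (B := fun m => B m + ‖2 * a m‖ * (‖u m‖ * ((‖c‖ * R) ^ (m : ℕ))⁻¹))
        (hEi (weight p.1 - k)) (fun m => ?_) (fun x m => ?_) p.2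
      · refine (h5.const_mul (e * coeff p.1 (gauss 0 (coeffR s)))).congr
          (Eventually.of_forall fun x => ?_)
        simp only [← mul_assoc, w]
      · have := hb m
        fun_prop
      · refine (norm_add_le _ _).trans (add_le_add (hB x.1 m) ?_)
        rw [norm_mul, norm_mul (u m), norm_inv, norm_pow, hwn]
  · rw [gaussAvg_of_ne hn, currentMode]
    simp only [annihilateTerm_gaussAvg_of_ne (s ^ 2) _ (show n + 1 ≠ k by omega)]
    simp only [finsum_zero, mul_zero, Finset.sum_const_zero]
    rfl

end Current

end IzerginKorepin

namespace IzerginKorepin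

open Filter Topology

/-! ### Exponentials of sums over the modes -/

/-- The family `f` is absolutely summable and the exponential of its sum is `E`. -/
def ExpSum (f : ℕ+ → ℂ) (E : ℂ) : Prop :=
  (Summable fun m => ‖f m‖) ∧ Complex.exp (∑' m, f m) = E

theorem ExpSum.add {f g : ℕ+ → ℂ} {E F : ℂ} (hf : ExpSum f E) (hg : ExpSum g F) :
    ExpSum (fun m => f m + g m) (E * F) := by
  refine ⟨?_, ?_⟩
  · exact Summable.of_nonneg_of_le (fun m => norm_nonneg _) (fun m => norm_add_le _ _)
      (hf.1.add hg.1)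
  · rw [hf.1.of_norm.tsum_add hg.1.of_norm, Complex.exp_add, hf.2, hg.2]

theorem ExpSum.neg {f : ℕ+ → ℂ} {E : ℂ} (hf : ExpSum f E) : ExpSum (fun m => -f m) E⁻¹ := by
  refine ⟨by simpa using hf.1, ?_⟩
  rw [tsum_neg, Complex.exp_neg, hf.2]

theorem ExpSum.congr {f g : ℕ+ → ℂ} {E F : ℂ} (hf : ExpSum f E) (h : ∀ m, g m = f m)
    (hE : E = F) : ExpSum g F := by
  obtain rfl : g = f := funext h
  exact hE ▸ hf

theorem ExpSum.ne_zero {f : ℕ+ → ℂ} {E : ℂ} (hf : ExpSum f E) : E ≠ 0 :=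
  hf.2 ▸ Complex.exp_ne_zero _

theorem ExpSum.hasSum {f : ℕ+ → ℂ} {E : ℂ} (hf : ExpSum f E) : HasSum f (∑' m, f m) :=
  hf.1.of_norm.hasSum

theorem norm_pow_div_le (x : ℂ) (m : ℕ+) : ‖x ^ (m : ℕ) / (m : ℂ)‖ ≤ ‖x‖ ^ (m : ℕ) := by
  rw [norm_div, norm_pow, Complex.norm_natCast]
  refine div_le_self (by positivity) ?_
  exact_mod_cast m.pos

theorem summable_norm_pow {x : ℂ} (hx : ‖x‖ < 1) : Summable fun m : ℕ+ => ‖x‖ ^ (m : ℕ) :=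
  (summable_geometric_of_lt_one (norm_nonneg x) hx).comp_injective PNat.coe_injective

theorem hasSum_pow_div {x : ℂ} (hx : ‖x‖ < 1) :
    HasSum (fun m : ℕ+ => x ^ (m : ℕ) / (m : ℂ)) (-Complex.log (1 - x)) := by
  have h := Complex.hasSum_taylorSeries_neg_log hx
  rw [← PNat.coe_injective.hasSum_iff] at h
  · exact h
  · intro k hk
    have : k = 0 := by
      by_contra h0
      exact hk ⟨⟨k, Nat.pos_of_ne_zero h0⟩, rfl⟩
    simp [this]

theorem one_sub_ne_zero {x : ℂ} (hx : ‖x‖ < 1) : 1 - x ≠ 0 := by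
  intro h
  have : x = 1 := (sub_eq_zero.1 h).symm
  rw [this] at hx
  simp at hx

theorem expSum_pow_div {x : ℂ} (hx : ‖x‖ < 1) :
    ExpSum (fun m : ℕ+ => x ^ (m : ℕ) / (m : ℂ)) (1 - x)⁻¹ := by
  refine ⟨(summable_norm_pow hx).of_nonneg_of_le (fun _ => norm_nonneg _) (norm_pow_div_le x), ?_⟩
  rw [(hasSum_pow_div hx).tsum_eq, Complex.exp_neg, Complex.exp_log (one_sub_ne_zero hx)]

theorem one_sub_pow_ne_zero {p : ℂ} (hp : ‖p‖ < 1) (m : ℕ+) : 1 - p ^ (m : ℕ) ≠ 0 := by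
  refine one_sub_ne_zero ?_
  rw [norm_pow]
  exact pow_lt_one₀ (norm_nonneg _) hp m.ne_zero

/-- Expand `1 / (1 - p ^ m)` geometrically and sum over `m` first: each power `p ^ k` yields `-log
(1 - p ^ k x)`. -/
theorem expSum_qPoch {x p : ℂ} (hx : ‖x‖ < 1) (hp : ‖p‖ < 1) :
    ExpSum (fun m : ℕ+ => x ^ (m : ℕ) / (m : ℂ) / (1 - p ^ (m : ℕ))) (qPoch x p)⁻¹ := by
  set F : ℕ+ × ℕ → ℂ := fun i => (p ^ i.2 * x) ^ (i.1 : ℕ) / (i.1 : ℂ)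
  have hFs : Summable fun i => ‖F i‖ := by
    refine Summable.of_nonneg_of_le (fun i => norm_nonneg _) (fun i => ?_)
      ((summable_norm_pow hx).mul_of_nonneg (summable_geometric_of_lt_one (norm_nonneg p) hp)
        (fun _ => by positivity) fun _ => by positivity)
    refine (norm_pow_div_le _ _).trans ?_
    rw [norm_mul, mul_pow, mul_comm, norm_pow]
    refine mul_le_mul_of_nonneg_left ?_ (by positivity)
    exact pow_le_of_le_one (by positivity) (pow_le_one₀ (norm_nonneg _) hp.le) i.1.ne_zero
  have h1 : ∀ m : ℕ+, HasSum (fun k => F (m, k))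
      (x ^ (m : ℕ) / (m : ℂ) / (1 - p ^ (m : ℕ))) := fun m => by
    have hpm : ‖p ^ (m : ℕ)‖ < 1 := by
      rw [norm_pow]; exact pow_lt_one₀ (norm_nonneg _) hp m.ne_zero
    rw [div_eq_mul_inv _ (1 - p ^ (m : ℕ))]
    refine ((hasSum_geometric_of_norm_lt_one hpm).mul_left (x ^ (m : ℕ) / (m : ℂ))).congr_fun
      fun k => ?_
    simp only [F]
    rw [mul_pow, ← pow_mul, ← pow_mul, mul_comm k]
    ring
  have hpx : ∀ k : ℕ, ‖p ^ k * x‖ < 1 := fun k => by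
    rw [norm_mul, norm_pow]
    exact (mul_le_of_le_one_left (norm_nonneg _) (pow_le_one₀ (norm_nonneg _) hp.le)).trans_lt hx
  refine ⟨?_, ?_⟩
  · have h2 := hFs.prod
    refine Summable.of_nonneg_of_le (fun _ => norm_nonneg _) (fun m => ?_) h2
    simp only
    rw [← (h1 m).tsum_eq]
    exact norm_tsum_le_tsum_norm (hFs.prod_factor m)
  · have h3 : ∑' m : ℕ+, x ^ (m : ℕ) / (m : ℂ) / (1 - p ^ (m : ℕ)) =
        ∑' k : ℕ, -Complex.log (1 - p ^ k * x) := by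
      rw [tsum_congr fun m => (h1 m).tsum_eq.symm,
        ← Summable.tsum_comm (f := fun m k => F (m, k)) hFs.of_norm]
      exact tsum_congr fun k => (hasSum_pow_div (hpx k)).tsum_eq
    rw [h3, tsum_neg, Complex.exp_neg, Complex.cexp_tsum_eq_tprod
      (fun k => one_sub_ne_zero (hpx k)), qPoch]
    have h4 : Summable fun k => ‖-(p ^ k * x)‖ := by
      simp only [norm_neg, norm_mul, norm_pow]
      exact (summable_geometric_of_lt_one (norm_nonneg p) hp).mul_right _
    simpa [sub_eq_add_neg] using Complex.summable_log_one_add_of_summable h4.of_norm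

theorem summable_even {g : ℕ → ℂ} (hg : Summable fun j : ℕ+ => ‖g (2 * (j : ℕ))‖) :
    Summable fun m : ℕ+ => ‖if Even (m : ℕ) then g m else 0‖ := by
  have hinj : Function.Injective (fun j : ℕ+ => 2 * j) := fun i j h => mul_left_cancel h
  rw [← hinj.summable_iff]
  · refine hg.congr fun j => ?_
    simp
  · intro m hm
    rw [if_neg, norm_zero]
    rintro ⟨i, hi⟩
    have hi0 : 0 < i := by have := m.pos; omega
    exact hm ⟨⟨i, hi0⟩, PNat.eq ((two_mul i).trans hi.symm)⟩

theorem tsum_even (g : ℕ → ℂ) :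
    ∑' m : ℕ+, (if Even (m : ℕ) then g m else 0) = ∑' j : ℕ+, g (2 * (j : ℕ)) := by
  have hinj : Function.Injective (fun j : ℕ+ => 2 * j) := fun i j h => mul_left_cancel h
  rw [← hinj.tsum_eq]
  · exact tsum_congr fun j => by simp
  · intro m hm
    have hm' : Even (m : ℕ) := by
      by_contra h
      simp [h] at hm
    obtain ⟨i, hi⟩ := hm'
    have hi0 : 0 < i := by have := m.pos; omega
    exact ⟨⟨i, hi0⟩, PNat.eq ((two_mul i).trans hi.symm)⟩

/-- Terms with even index may be added after halving the index. -/
theorem ExpSum.add_even {f : ℕ+ → ℂ} {g : ℕ → ℂ} {E : ℂ}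
    (h : ExpSum (fun j => f j + g (2 * (j : ℕ))) E) (hf : Summable fun m => ‖f m‖)
    (hg : Summable fun j : ℕ+ => ‖g (2 * (j : ℕ))‖) :
    ExpSum (fun m => f m + if Even (m : ℕ) then g m else 0) E := by
  refine ⟨?_, ?_⟩
  · exact Summable.of_nonneg_of_le (fun m => norm_nonneg _) (fun m => norm_add_le _ _)
      (hf.add (summable_even hg))
  · rw [hf.of_norm.tsum_add (summable_even hg).of_norm, tsum_even,
      ← hf.of_norm.tsum_add hg.of_norm, h.2]

theorem qPoch_zero_left (p : ℂ) : qPoch 0 p = 1 := by simp [qPoch]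

theorem qPoch_ne_zero {x p : ℂ} (hx : ‖x‖ < 1) (hp : ‖p‖ < 1) : qPoch x p ≠ 0 :=
  fun h => (expSum_qPoch hx hp).ne_zero (by rw [h, inv_zero])

theorem multipliable_qPoch (x : ℂ) {p : ℂ} (hp : ‖p‖ < 1) :
    Multipliable fun k : ℕ => 1 - p ^ k * x := by
  have h4 : Summable fun k => ‖-(p ^ k * x)‖ := by
    simp only [norm_neg, norm_mul, norm_pow]
    exact (summable_geometric_of_lt_one (norm_nonneg p) hp).mul_right _
  simpa [sub_eq_add_neg] using Complex.multipliable_one_add_of_summable h4.of_norm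

theorem qPoch_eq_mul (x : ℂ) {p : ℂ} (hp : ‖p‖ < 1) :
    qPoch x p = (1 - x) * qPoch (p * x) p := by
  have h : ∀ k : ℕ, 1 - p ^ (k + 1) * x = 1 - p ^ k * (p * x) := fun k => by ring
  rw [qPoch, qPoch, tprod_eq_zero_mul' (f := fun k : ℕ => 1 - p ^ k * x)
    (by simpa only [h] using multipliable_qPoch (p * x) hp)]
  simp only [h, pow_zero, one_mul]

theorem qPoch_sq (x : ℂ) {p : ℂ} (hp : ‖p‖ < 1) :
    qPoch x p = qPoch x (p ^ 2) * qPoch (p * x) (p ^ 2) := by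
  have hp2 : ‖p ^ 2‖ < 1 := by rw [norm_pow]; exact pow_lt_one₀ (norm_nonneg _) hp two_ne_zero
  have h1 : ∀ k : ℕ, 1 - p ^ (2 * k) * x = 1 - (p ^ 2) ^ k * x := fun k => by rw [pow_mul]
  have h2 : ∀ k : ℕ, 1 - p ^ (2 * k + 1) * x = 1 - (p ^ 2) ^ k * (p * x) := fun k => by
    rw [pow_succ, pow_mul]; ring
  rw [qPoch, ← tprod_even_mul_odd (f := fun k : ℕ => 1 - p ^ k * x)
    (by simpa only [h1] using multipliable_qPoch x hp2)
    (by simpa only [h2] using multipliable_qPoch (p * x) hp2)]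
  simp only [h1, h2, qPoch]

end IzerginKorepin

namespace IzerginKorepin

open Filter Topology

/-! ### Contractions -/

section Contractions

variable {s : ℂ}

theorem norm_pow_lt_one (hs : ‖s‖ < 1) {k : ℕ} (hk : k ≠ 0) : ‖s ^ k‖ < 1 := by
  rw [norm_pow]; exact pow_lt_one₀ (norm_nonneg _) hs hk

theorem qInt_sq_eq (hs0 : s ≠ 0) (m : ℕ) :
    qInt (s ^ 2) (m : ℤ) = (s ^ (4 * m) - 1) / s ^ (2 * m) / (s ^ 2 - (s ^ 2)⁻¹) := by
  have h : s ^ m ≠ 0 := pow_ne_zero _ hs0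
  rw [qInt, zpow_neg, zpow_natCast, ← pow_mul, show s ^ (4 * m) = s ^ (2 * m) * s ^ (2 * m) by
    rw [← pow_add]; ring_nf]
  congr 1
  have h : s ^ (2 * m) ≠ 0 := pow_ne_zero _ hs0
  field_simp

theorem sq_sub_inv_ne_zero (hs0 : s ≠ 0) (hs : ‖s‖ < 1) : s ^ 2 - (s ^ 2)⁻¹ ≠ 0 := by
  intro h
  have h2 : s ^ 2 ≠ 0 := pow_ne_zero _ hs0
  have h3 : 1 - s ^ 4 = 0 := by
    field_simp at h
    linear_combination -h
  exact one_sub_ne_zero (norm_pow_lt_one hs (by norm_num)) h3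

theorem qInt_ne_zero (hs0 : s ≠ 0) (hs : ‖s‖ < 1) (m : ℕ+) : qInt (s ^ 2) (m : ℤ) ≠ 0 := by
  rw [qInt_sq_eq hs0 (m : ℕ)]
  refine div_ne_zero (div_ne_zero ?_ (pow_ne_zero _ hs0)) (sq_sub_inv_ne_zero hs0 hs)
  have := one_sub_ne_zero (norm_pow_lt_one hs (mul_ne_zero four_ne_zero m.ne_zero))
  intro h
  exact this (by linear_combination -h)

/-- With `Q = (-q) ^ m` the commutator contains the factor `1 - Q + Q ^ 2`, a divisor of `1 + Q ^
3`. All closed forms of contractions below rest on this. -/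
theorem den_eq (hs0 : s ≠ 0) (m : ℕ+) :
    den (s ^ 2) m = qInt (s ^ 2) (m : ℤ) *
      ((1 - (-s ^ 2) ^ (m : ℕ) + ((-s ^ 2) ^ (m : ℕ)) ^ 2) / s ^ (2 * (m : ℕ))) := by
  have h1 : qInt (s ^ 2) (2 * (m : ℤ)) = (s ^ (4 * (2 * (m : ℕ))) - 1) / s ^ (2 * (2 * (m : ℕ))) /
      (s ^ 2 - (s ^ 2)⁻¹) := by
    have := qInt_sq_eq hs0 (2 * (m : ℕ))
    push_cast at this
    exact this
  have hx : s ^ (m : ℕ) ≠ 0 := pow_ne_zero _ hs0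
  have hQ : (-s ^ 2) ^ (m : ℕ) = (-1) ^ (m : ℕ) * (s ^ (m : ℕ)) ^ 2 := by
    rw [neg_pow, ← pow_mul, ← pow_mul, mul_comm 2]
  have h2 : ((-1 : ℂ) ^ (m : ℕ)) ^ 2 = 1 := by
    rw [← pow_mul, mul_comm, pow_mul]; simp
  have e : ∀ k : ℕ, s ^ (k * (m : ℕ)) = (s ^ (m : ℕ)) ^ k := fun k => by rw [← pow_mul, mul_comm]
  rw [den, h1, qInt_sq_eq hs0 (m : ℕ), hQ]
  have e2 : s ^ (4 * (2 * (m : ℕ))) = (s ^ (m : ℕ)) ^ 8 := by rw [← e]; ring_nf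
  have e3 : s ^ (2 * (2 * (m : ℕ))) = (s ^ (m : ℕ)) ^ 4 := by rw [← e]; ring_nf
  rw [e2, e3, e, e]
  generalize s ^ (m : ℕ) = x at *
  generalize (-1 : ℂ) ^ (m : ℕ) = σ at *
  generalize s ^ 2 - (s ^ 2)⁻¹ = d
  have key : (x ^ 8 - 1) / x ^ 4 - σ * ((x ^ 4 - 1) / x ^ 2) =
      (x ^ 4 - 1) / x ^ 2 * ((1 - σ * x ^ 2 + (σ * x ^ 2) ^ 2) / x ^ 2) := by
    field_simp
    linear_combination (-(x ^ 4 - 1) * x ^ 4) * h2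
  rw [← mul_div_assoc, ← sub_div, key]
  ring

/-- A zero would give `1 + Q ^ 3 = 0` for `Q = (-q) ^ m`, impossible for `|Q| < 1`. -/
theorem one_sub_add_sq_ne_zero (hs : ‖s‖ < 1) (m : ℕ+) :
    1 - (-s ^ 2) ^ (m : ℕ) + ((-s ^ 2) ^ (m : ℕ)) ^ 2 ≠ 0 := by
  intro h
  have h1 : ‖-(-s ^ 2) ^ (3 * (m : ℕ))‖ < 1 := by
    rw [norm_neg, norm_pow, norm_neg, ← norm_pow, ← pow_mul]
    exact norm_pow_lt_one hs (by have := m.ne_zero; omega)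
  refine one_sub_ne_zero h1 ?_
  rw [mul_comm, pow_mul]
  linear_combination (1 + (-s ^ 2) ^ (m : ℕ)) * h

theorem den_ne_zero (hs0 : s ≠ 0) (hs : ‖s‖ < 1) (m : ℕ+) : den (s ^ 2) m ≠ 0 := by
  rw [den_eq hs0]
  exact mul_ne_zero (qInt_ne_zero hs0 hs m)
    (div_ne_zero (one_sub_add_sq_ne_zero hs m) (pow_ne_zero _ hs0))

theorem neg_sq_pow_six (m : ℕ) : ((-s ^ 2) ^ m) ^ 6 = (s ^ 12) ^ m := by
  rw [← pow_mul, mul_comm, pow_mul]; congr 1; ring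

/-- Since `(1 - Q + Q ^ 2) (1 + Q) (1 - Q ^ 3) = 1 - Q ^ 6` and `Q ^ 6 = q ^ (6 m)`, the quotient
becomes a combination of geometric series with base `q ^ 6`, the base of the infinite products. -/
theorem qInt_div_den (hs0 : s ≠ 0) (hs : ‖s‖ < 1) (m : ℕ+) :
    qInt (s ^ 2) (m : ℤ) / den (s ^ 2) m = s ^ (2 * (m : ℕ)) * (1 + (-s ^ 2) ^ (m : ℕ)) *
      (1 - ((-s ^ 2) ^ (m : ℕ)) ^ 3) / (1 - (s ^ 12) ^ (m : ℕ)) := by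
  have h1 := one_sub_add_sq_ne_zero hs m
  have h2 := one_sub_pow_ne_zero (norm_pow_lt_one hs (k := 12) (by norm_num)) m
  have h3 := qInt_ne_zero hs0 hs m
  have h4 : s ^ (2 * (m : ℕ)) ≠ 0 := pow_ne_zero _ hs0
  rw [den_eq hs0, ← neg_sq_pow_six] at *
  generalize (-s ^ 2) ^ (m : ℕ) = Q at *
  field_simp
  ring

/-- The shift of the linear term produced by `Φ_-(ζ)`. -/
noncomputable def vertexShift (s ζ : ℂ) (m : ℕ+) : ℂ :=
  s ^ (9 * (m : ℕ)) * (ζ ^ (m : ℕ) + (ζ ^ (m : ℕ))⁻¹) / den (s ^ 2) m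

/-- The shift of the linear term produced by the current at `q ^ 4 v`. -/
noncomputable def currentShift (s v : ℂ) (m : ℕ+) : ℂ :=
  -(s ^ (9 * (m : ℕ)) * (v ^ (m : ℕ) + (v ^ (m : ℕ))⁻¹) / qInt (s ^ 2) (m : ℤ))

/-- The translation produced by the annihilation part of `Φ_-(ζ)`. -/
noncomputable def vertexArg (s ζ : ℂ) (m : ℕ+) : ℂ :=
  -(qInt (s ^ 2) (m : ℤ) / (m : ℂ) * ((s ^ (7 * (m : ℕ)))⁻¹ * (ζ ^ (m : ℕ))⁻¹))

/-- The translation produced by the annihilation part of the current at `1`. -/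
noncomputable def currentArg (s : ℂ) (m : ℕ+) : ℂ :=
  s ^ (m : ℕ) * den (s ^ 2) m / (m : ℂ)

theorem natCast_pnat_ne_zero (m : ℕ+) : ((m : ℕ) : ℂ) ≠ 0 := by exact_mod_cast m.ne_zero

theorem bosonNorm_mul_coeffQ (hs0 : s ≠ 0) (hs : ‖s‖ < 1) (ζ : ℂ) (m : ℕ+) :
    bosonNorm (s ^ 2) m * coeffQ s ζ m = vertexArg s ζ m := by
  have h1 := den_ne_zero hs0 hs m
  rw [bosonNorm, coeffQ, vertexArg]
  field_simp

theorem bosonNorm_mul_coeffS (hs0 : s ≠ 0) (hs : ‖s‖ < 1) (m : ℕ+) :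
    bosonNorm (s ^ 2) m * coeffS s m = currentArg s m := by
  have h1 := qInt_ne_zero hs0 hs m
  rw [bosonNorm, coeffS, currentArg]
  field_simp

theorem pow_nat_mul (k : ℕ) (m : ℕ+) : s ^ (k * (m : ℕ)) = (s ^ (m : ℕ)) ^ k := by
  rw [← pow_mul, mul_comm]

theorem pow_pow_pnat (k : ℕ) (m : ℕ+) : (s ^ k) ^ (m : ℕ) = (s ^ (m : ℕ)) ^ k := by
  rw [← pow_mul, ← pow_mul, mul_comm]

/-- The mirror property of the boundary state: its quadratic term turns the annihilation part of
`Φ_-(ζ)` into a creation part with `ζ` inverted, so the total shift is invariant under `ζ ↦ ζ⁻¹`. -/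
theorem vertexShift_eq (hs0 : s ≠ 0) (hs : ‖s‖ < 1) (ζ : ℂ) (m : ℕ+) :
    2 * quadF s m * vertexArg s ζ m + coeffP s ζ m = vertexShift s ζ m := by
  have h1 := den_ne_zero hs0 hs m
  have h2 := qInt_ne_zero hs0 hs m
  have h3 := natCast_pnat_ne_zero m
  have h4 : s ^ (m : ℕ) ≠ 0 := pow_ne_zero _ hs0
  rw [quadF, vertexArg, coeffP, vertexShift]
  simp only [pow_nat_mul]
  by_cases hζ : ζ ^ (m : ℕ) = 0
  · simp [hζ]
  · field_simp
    ring

/-- The mirror property for currents. Placing the current at `q ^ 4 v` makes the reflection `v ↦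
v⁻¹`, with the unit circle as fixed contour. -/
theorem currentShift_eq (hs0 : s ≠ 0) (hs : ‖s‖ < 1) {v : ℂ} (hv : v ≠ 0) (m : ℕ+) :
    2 * quadF s m * (currentArg s m * ((s ^ 8 * v) ^ (m : ℕ))⁻¹) +
      coeffR s m * (s ^ 8 * v) ^ (m : ℕ) = currentShift s v m := by
  have h1 := den_ne_zero hs0 hs m
  have h2 := qInt_ne_zero hs0 hs m
  have h3 := natCast_pnat_ne_zero m
  have h4 : s ^ (m : ℕ) ≠ 0 := pow_ne_zero _ hs0
  have h5 : v ^ (m : ℕ) ≠ 0 := pow_ne_zero _ hv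
  rw [quadF, currentArg, coeffR, currentShift]
  simp only [pow_nat_mul, mul_pow, pow_pow_pnat]
  field_simp
  ring

/-- One factor is the contraction with the current itself, the other with its mirror image at `v⁻¹`.
The same pairing occurs in the contractions that follow. -/
theorem expSum_currentShift_vertexArg (hs0 : s ≠ 0) (hs : ‖s‖ < 1) {v ζ : ℂ} (hv : v ≠ 0)
    (h1 : ‖s ^ 2 * v / ζ‖ < 1) (h2 : ‖s ^ 2 / (v * ζ)‖ < 1) :
    ExpSum (fun m => currentShift s v m * vertexArg s ζ m)
      ((1 - s ^ 2 * v / ζ)⁻¹ * (1 - s ^ 2 / (v * ζ))⁻¹) := by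
  refine ((expSum_pow_div h1).add (expSum_pow_div h2)).congr (fun m => ?_) rfl
  have h2 := qInt_ne_zero hs0 hs m
  have h3 := natCast_pnat_ne_zero m
  have h4 : s ^ (m : ℕ) ≠ 0 := pow_ne_zero _ hs0
  have h5 : v ^ (m : ℕ) ≠ 0 := pow_ne_zero _ hv
  rw [currentShift, vertexArg]
  simp only [pow_nat_mul, div_pow, mul_pow, pow_pow_pnat]
  field_simp

theorem expSum_vertexShift_currentArg (hs0 : s ≠ 0) (hs : ‖s‖ < 1) {v ζ : ℂ} (hv : v ≠ 0)
    (hζ : ζ ≠ 0) (h1 : ‖s ^ 2 * ζ / v‖ < 1) (h2 : ‖s ^ 2 / (ζ * v)‖ < 1) :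
    ExpSum (fun m => vertexShift s ζ m * (currentArg s m * ((s ^ 8 * v) ^ (m : ℕ))⁻¹))
      ((1 - s ^ 2 * ζ / v)⁻¹ * (1 - s ^ 2 / (ζ * v))⁻¹) := by
  refine ((expSum_pow_div h1).add (expSum_pow_div h2)).congr (fun m => ?_) rfl
  have h2 := den_ne_zero hs0 hs m
  have h3 := natCast_pnat_ne_zero m
  have h4 : s ^ (m : ℕ) ≠ 0 := pow_ne_zero _ hs0
  have h5 : v ^ (m : ℕ) ≠ 0 := pow_ne_zero _ hv
  have h6 : ζ ^ (m : ℕ) ≠ 0 := pow_ne_zero _ hζ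
  rw [vertexShift, currentArg]
  simp only [pow_nat_mul, div_pow, mul_pow, pow_pow_pnat]
  field_simp

/-- The contraction of two currents. -/
noncomputable def currentKernel (s y : ℂ) : ℂ := (1 - y) * (1 - s ^ 4 * y) / (1 + s ^ 2 * y)

/-- The three terms of `1 - Q + Q ^ 2` give the logarithms of `1 - y`, of `1 + q y` in the
denominator, and of `1 - q ^ 2 y`. -/
theorem expSum_currentKernel (hs : ‖s‖ < 1) {y : ℂ} (hy : ‖y‖ < 1) :
    ExpSum (fun m : ℕ+ => -((1 - (-s ^ 2) ^ (m : ℕ) + ((-s ^ 2) ^ (m : ℕ)) ^ 2) *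
      (y ^ (m : ℕ) / (m : ℂ)))) (currentKernel s y) := by
  have h1 : ‖s ^ 4 * y‖ < 1 := by
    rw [norm_mul]
    exact mul_lt_one_of_nonneg_of_lt_one_left (norm_nonneg _)
      (norm_pow_lt_one hs (by norm_num)) hy.le
  have h2 : ‖-s ^ 2 * y‖ < 1 := by
    rw [norm_mul, norm_neg]
    exact mul_lt_one_of_nonneg_of_lt_one_left (norm_nonneg _)
      (norm_pow_lt_one hs (by norm_num)) hy.le
  refine (((expSum_pow_div hy).neg.add (expSum_pow_div h1).neg).add (expSum_pow_div h2)).congr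
    (fun m => ?_) ?_
  · have : (s ^ 4) ^ (m : ℕ) = ((-s ^ 2) ^ (m : ℕ)) ^ 2 := by
      rw [← pow_mul (-s ^ 2), mul_comm (m : ℕ) 2, pow_mul]; congr 1; ring
    rw [mul_pow, mul_pow, this]
    ring
  · rw [currentKernel, inv_inv, inv_inv, div_eq_mul_inv]
    congr 2
    ring

theorem expSum_currentShift_currentArg (hs0 : s ≠ 0) (hs : ‖s‖ < 1) {v v' : ℂ} (hv : v ≠ 0)
    (hv' : v' ≠ 0) (h1 : ‖v' / v‖ < 1) (h2 : ‖1 / (v * v')‖ < 1) :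
    ExpSum (fun m => currentShift s v' m * (currentArg s m * ((s ^ 8 * v) ^ (m : ℕ))⁻¹))
      (currentKernel s (v' / v) * currentKernel s (1 / (v * v'))) := by
  refine ((expSum_currentKernel hs h1).add (expSum_currentKernel hs h2)).congr (fun m => ?_) rfl
  have h2 := qInt_ne_zero hs0 hs m
  have h3 := natCast_pnat_ne_zero m
  have h4 : s ^ (m : ℕ) ≠ 0 := pow_ne_zero _ hs0
  have h5 : v ^ (m : ℕ) ≠ 0 := pow_ne_zero _ hv
  have h6 : v' ^ (m : ℕ) ≠ 0 := pow_ne_zero _ hv'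
  rw [currentShift, currentArg, den_eq hs0]
  simp only [pow_nat_mul, div_pow, mul_pow, pow_pow_pnat, one_pow]
  field_simp
  ring

/-- The contraction of two vertex operators. -/
noncomputable def vertexKernel (s y : ℂ) : ℂ :=
  qPoch (s ^ 4 * y) (s ^ 12) * qPoch (-s ^ 6 * y) (s ^ 12) /
    (qPoch (-s ^ 10 * y) (s ^ 12) * qPoch (s ^ 12 * y) (s ^ 12))

theorem norm_pow_mul_lt_one (hs : ‖s‖ < 1) {y : ℂ} {j k : ℕ} (hjk : j ≤ k)
    (h : ‖s ^ j * y‖ < 1) : ‖s ^ k * y‖ < 1 := by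
  refine lt_of_le_of_lt ?_ h
  rw [norm_mul, norm_mul, norm_pow, norm_pow]
  exact mul_le_mul_of_nonneg_right (pow_le_pow_of_le_one (norm_nonneg _) hs.le hjk) (norm_nonneg _)

/-- By `qInt_div_den` the numerator is `(1 + Q) (1 - Q ^ 3)`; its four monomials give the four
infinite products. -/
theorem expSum_vertexKernel (hs0 : s ≠ 0) (hs : ‖s‖ < 1) {y : ℂ} (hy : ‖s ^ 4 * y‖ < 1) :
    ExpSum (fun m : ℕ+ => -(qInt (s ^ 2) (m : ℤ) / den (s ^ 2) m * ((s ^ 2 * y) ^ (m : ℕ) / (m : ℂ))))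
      (vertexKernel s y) := by
  have hp : ‖s ^ 12‖ < 1 := norm_pow_lt_one hs (by norm_num)
  have h6 : ‖-s ^ 6 * y‖ < 1 := by
    rw [neg_mul, norm_neg]; exact norm_pow_mul_lt_one hs (by norm_num) hy
  have h10 : ‖-s ^ 10 * y‖ < 1 := by
    rw [neg_mul, norm_neg]; exact norm_pow_mul_lt_one hs (by norm_num) hy
  have h12 : ‖s ^ 12 * y‖ < 1 := norm_pow_mul_lt_one hs (by norm_num) hy
  refine ((((expSum_qPoch hy hp).neg.add (expSum_qPoch h6 hp).neg).add (expSum_qPoch h10 hp)).add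
    (expSum_qPoch h12 hp)).congr (fun m => ?_) ?_
  · have h2 := one_sub_pow_ne_zero hp m
    have h3 := natCast_pnat_ne_zero m
    have e1 : ∀ k : ℕ, (-s ^ (2 * k)) ^ (m : ℕ) = (-1) ^ (m : ℕ) * ((s ^ (m : ℕ)) ^ 2) ^ k :=
      fun k => by rw [neg_pow, pow_pow_pnat, pow_mul]
    have e2 := e1 1
    have e3 := e1 3
    have e5 := e1 5
    simp only [mul_one, Nat.reduceMul, pow_one] at e2 e3 e5
    have hσ : ((-1 : ℂ) ^ (m : ℕ)) ^ 2 = 1 := by rw [← pow_mul, mul_comm, pow_mul]; simp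
    rw [qInt_div_den hs0 hs, mul_pow, mul_pow, mul_pow, mul_pow, mul_pow, e2, e3, e5]
    simp only [pow_nat_mul, pow_pow_pnat] at h2 ⊢
    generalize (-1 : ℂ) ^ (m : ℕ) = σ at *
    field_simp
    linear_combination y ^ (m : ℕ) * ((s ^ (m : ℕ)) ^ 6 * σ + (s ^ (m : ℕ)) ^ 8 * (σ ^ 2 + 1)) * hσ
  · rw [vertexKernel, inv_inv, inv_inv, div_eq_mul_inv, mul_inv]
    ring

theorem expSum_vertexShift_vertexArg (hs0 : s ≠ 0) (hs : ‖s‖ < 1) {ζ ζ' : ℂ} (hζ : ζ ≠ 0)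
    (h1 : ‖s ^ 4 * (ζ / ζ')‖ < 1) (h2 : ‖s ^ 4 * (1 / (ζ * ζ'))‖ < 1) :
    ExpSum (fun m => vertexShift s ζ m * vertexArg s ζ' m)
      (vertexKernel s (ζ / ζ') * vertexKernel s (1 / (ζ * ζ'))) := by
  refine ((expSum_vertexKernel hs0 hs h1).add (expSum_vertexKernel hs0 hs h2)).congr
    (fun m => ?_) rfl
  have h2 := den_ne_zero hs0 hs m
  have h3 := natCast_pnat_ne_zero m
  have h4 : s ^ (m : ℕ) ≠ 0 := pow_ne_zero _ hs0
  have h6 : ζ ^ (m : ℕ) ≠ 0 := pow_ne_zero _ hζ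
  rw [vertexShift, vertexArg]
  simp only [pow_nat_mul, div_pow, mul_pow, pow_pow_pnat, one_pow]
  field_simp
  ring

end Contractions

end IzerginKorepin

namespace IzerginKorepin

open Filter Topology

/-! ### Self-contractions with the ground state -/

section SelfContractions

variable {s : ℂ}

/-- The linear term at the even mode `2 j` carries the same power of the spectral variable as the
square of mode `j`, so the two are summed together. Only the combination needs a closed form; the
summability of the linear part follows by subtraction. -/
theorem ExpSum.add_even_of_eq {f E : ℕ+ → ℂ} {g : ℕ → ℂ} {e : ℂ} (hE : ExpSum E e)
    (hf : Summable fun m => ‖f m‖) (h : ∀ j : ℕ+, f j + g (2 * (j : ℕ)) = E j) :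
    ExpSum (fun m => f m + if Even (m : ℕ) then g m else 0) e := by
  refine ExpSum.add_even (hE.congr h rfl) hf ?_
  refine Summable.of_nonneg_of_le (fun _ => norm_nonneg _) (fun j => ?_) (hE.1.add hf)
  rw [← h j]
  have := norm_sub_le (f j + g (2 * (j : ℕ))) (f j)
  rwa [add_sub_cancel_left] at this

theorem pow_two_two_mul (j : ℕ) : s ^ (2 * (2 * j)) = ((-s ^ 2) ^ j) ^ 2 := by
  rw [← pow_mul, mul_comm j 2, pow_mul (-s ^ 2), neg_sq, ← pow_mul, ← pow_mul]

theorem summable_quadF_currentArg (hs0 : s ≠ 0) (hs : ‖s‖ < 1) {v : ℂ} (hv : v ≠ 0)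
    (h1 : ‖1 / v ^ 2‖ < 1) : Summable fun m : ℕ+ =>
      ‖quadF s m * (currentArg s m * ((s ^ 8 * v) ^ (m : ℕ))⁻¹) ^ 2‖ := by
  have := ((expSum_currentKernel hs h1).1.mul_left (1 / 2))
  refine this.congr fun m => ?_
  rw [show (1 / 2 : ℝ) = ‖(1 / 2 : ℂ)‖ by simp, ← norm_mul]
  congr 1
  have h2 := qInt_ne_zero hs0 hs m
  have h7 := den_ne_zero hs0 hs m
  have h3 := natCast_pnat_ne_zero m
  have h4 : s ^ (m : ℕ) ≠ 0 := pow_ne_zero _ hs0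
  have h5 : v ^ (m : ℕ) ≠ 0 := pow_ne_zero _ hv
  have h6 := one_sub_add_sq_ne_zero hs m
  rw [quadF, currentArg, den_eq hs0]
  simp only [pow_nat_mul, div_pow, mul_pow, pow_pow_pnat, one_pow]
  field_simp

/-- The terms `θ_m` of `F(ε)` are chosen so that, with the quadratic part, they leave only `1 - 1 /
v ^ 2`; the `ε`-dependent linear term gives the last factor. -/
theorem expSum_currentArg_self (hs0 : s ≠ 0) (hs : ‖s‖ < 1) {v : ℂ} (hv : v ≠ 0) (ε : SignType)
    (h1 : ‖1 / v ^ 2‖ < 1) (h2 : ‖(ε : ℂ) * Complex.I / (s * v)‖ < 1) :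
    ExpSum (fun m : ℕ+ => quadF s m * (currentArg s m * ((s ^ 8 * v) ^ (m : ℕ))⁻¹) ^ 2 +
      linF s ε m * (currentArg s m * ((s ^ 8 * v) ^ (m : ℕ))⁻¹))
      ((1 - 1 / v ^ 2) * (1 - (ε : ℂ) * Complex.I / (s * v))) := by
  -- With `Q = (-q) ^ j` the quadratic part contributes `-(1 - Q + Q ^ 2) / 2` and the linear part
  -- at `2 j` contributes `(Q ^ 2 - 1 - Q) / 2`; their sum is `-1`.
  have key := ExpSum.add_even_of_eq (expSum_pow_div h1).neg
    (summable_quadF_currentArg hs0 hs hv h1)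
    (g := fun k => (s ^ (2 * k) - 1 - (Complex.I * s) ^ k) * (1 / v ^ k) / (k : ℂ)) (fun j => ?_)
  · refine (key.add (expSum_pow_div h2).neg).congr (fun m => ?_) (by rw [inv_inv, inv_inv])
    have h7 := den_ne_zero hs0 hs m
    have h3 := natCast_pnat_ne_zero m
    have h4 : s ^ (m : ℕ) ≠ 0 := pow_ne_zero _ hs0
    have h5 : v ^ (m : ℕ) ≠ 0 := pow_ne_zero _ hv
    rw [linF, add_assoc]
    congr 1
    rw [currentArg]
    simp only [pow_nat_mul, div_pow, mul_pow, pow_pow_pnat]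
    split_ifs
    · field_simp
      ring
    · field_simp
      ring
  · have h2 := qInt_ne_zero hs0 hs j
    have h7 := den_ne_zero hs0 hs j
    have h3 := natCast_pnat_ne_zero j
    have h4 : s ^ (j : ℕ) ≠ 0 := pow_ne_zero _ hs0
    have h5 : v ^ (j : ℕ) ≠ 0 := pow_ne_zero _ hv
    have h6 := one_sub_add_sq_ne_zero hs j
    have e1 : (Complex.I * s) ^ (2 * (j : ℕ)) = (-s ^ 2) ^ (j : ℕ) := by
      rw [pow_mul, mul_pow, Complex.I_sq]; congr 1; ring
    have e2 : s ^ (2 * (2 * (j : ℕ))) = ((-s ^ 2) ^ (j : ℕ)) ^ 2 := pow_two_two_mul j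
    rw [e1, e2, quadF, currentArg, den_eq hs0]
    have e3 : v ^ (2 * (j : ℕ)) = (v ^ (j : ℕ)) ^ 2 := by rw [mul_comm, pow_mul]
    rw [e3]
    push_cast
    simp only [pow_nat_mul, div_pow, mul_pow, pow_pow_pnat, one_pow]
    field_simp
    ring

theorem summable_quadF_vertexArg (hs0 : s ≠ 0) (hs : ‖s‖ < 1) {ζ : ℂ} (hζ : ζ ≠ 0)
    (h1 : ‖s ^ 4 * (1 / ζ ^ 2)‖ < 1) : Summable fun m : ℕ+ =>
      ‖quadF s m * vertexArg s ζ m ^ 2‖ := by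
  have := ((expSum_vertexKernel hs0 hs h1).1.mul_left (1 / 2))
  refine this.congr fun m => ?_
  rw [show (1 / 2 : ℝ) = ‖(1 / 2 : ℂ)‖ by simp, ← norm_mul]
  congr 1
  have h2 := qInt_ne_zero hs0 hs m
  have h7 := den_ne_zero hs0 hs m
  have h3 := natCast_pnat_ne_zero m
  have h4 : s ^ (m : ℕ) ≠ 0 := pow_ne_zero _ hs0
  have h5 : ζ ^ (m : ℕ) ≠ 0 := pow_ne_zero _ hζ
  rw [quadF, vertexArg]
  simp only [pow_nat_mul, div_pow, mul_pow, pow_pow_pnat, one_pow]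
  field_simp

/-- The `ε`-independent factor of `φ_ε`. Its base is `q ^ 12` because the modes `2 j` bring in the
denominator `1 - Q ^ 12`, `Q = (-q) ^ j`. -/
theorem expSum_phi_zero (hs : ‖s‖ < 1) {x : ℂ} (hx : ‖s ^ 4 * x‖ < 1) :
    ExpSum (fun j : ℕ+ => (((-s ^ 2) ^ (j : ℕ)) ^ 5 - ((-s ^ 2) ^ (j : ℕ)) ^ 8 -
      ((-s ^ 2) ^ (j : ℕ)) ^ 9 + ((-s ^ 2) ^ (j : ℕ)) ^ 12) * (x ^ (j : ℕ) / (j : ℂ)) /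
        (1 - ((-s ^ 2) ^ (j : ℕ)) ^ 12))
      (qPoch (s ^ 16 * x) (s ^ 24) * qPoch (-s ^ 18 * x) (s ^ 24) /
        (qPoch (s ^ 24 * x) (s ^ 24) * qPoch (-s ^ 10 * x) (s ^ 24))) := by
  have hp : ‖s ^ 24‖ < 1 := norm_pow_lt_one hs (by norm_num)
  have h16 : ‖s ^ 16 * x‖ < 1 := norm_pow_mul_lt_one hs (by norm_num) hx
  have h24 : ‖s ^ 24 * x‖ < 1 := norm_pow_mul_lt_one hs (by norm_num) hx
  have h10 : ‖-s ^ 10 * x‖ < 1 := by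
    rw [neg_mul, norm_neg]; exact norm_pow_mul_lt_one hs (by norm_num) hx
  have h18 : ‖-s ^ 18 * x‖ < 1 := by
    rw [neg_mul, norm_neg]; exact norm_pow_mul_lt_one hs (by norm_num) hx
  refine ((((expSum_qPoch h16 hp).neg.add (expSum_qPoch h18 hp).neg).add (expSum_qPoch h24 hp)).add
    (expSum_qPoch h10 hp)).congr (fun j => ?_) ?_
  · have e : ∀ k : ℕ, ((-s ^ 2) ^ (j : ℕ)) ^ k = ((-s ^ 2) ^ k) ^ (j : ℕ) := fun k => by
      rw [← pow_mul, ← pow_mul, mul_comm]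
    rw [e 5, e 8, e 9, e 12, show (-s ^ 2) ^ 5 = -s ^ 10 by ring,
      show (-s ^ 2) ^ 8 = s ^ 16 by ring, show (-s ^ 2) ^ 9 = -s ^ 18 by ring,
      show (-s ^ 2) ^ 12 = s ^ 24 by ring, mul_pow, mul_pow, mul_pow, mul_pow]
    ring
  · rw [inv_inv, inv_inv, div_eq_mul_inv, mul_inv]
    ring

/-- The origin of `φ_ε`: it is the scalar that `Φ_-(ζ)` produces on the boundary state, at `ζ⁻¹`. -/
theorem expSum_vertexArg_self (hs0 : s ≠ 0) (hs : ‖s‖ < 1) {ζ : ℂ} (hζ : ζ ≠ 0) (ε : SignType)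
    (h1 : ‖s ^ 4 * (1 / ζ ^ 2)‖ < 1) (h2 : ‖(ε : ℂ) * Complex.I * s / ζ‖ < 1) :
    ExpSum (fun m : ℕ+ => quadF s m * vertexArg s ζ m ^ 2 + linF s ε m * vertexArg s ζ m)
      (phi s ε ζ⁻¹) := by
  have h2' : ‖s ^ 4 * ((ε : ℂ) * Complex.I / (s ^ 3 * ζ))‖ < 1 := by
    convert h2 using 2
    field_simp
  have key := ExpSum.add_even_of_eq (expSum_phi_zero hs h1)
    (summable_quadF_vertexArg hs0 hs hζ h1)
    (g := fun k => -(s ^ (2 * k) * (1 + (-s ^ 2) ^ k) * (1 - ((-s ^ 2) ^ k) ^ 3) /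
      (1 - (s ^ 12) ^ k) * ((s ^ (2 * k) - 1 - (Complex.I * s) ^ k) * (1 / ζ ^ k) / (k : ℂ))))
    (fun j => ?_)
  -- The `ε`-dependent linear term has the form of the inverse of a vertex contraction at the point
  -- `ε √-1 / (s ^ 3 ζ)`, which yields the second factor of `φ_ε`.
  · refine (key.add (expSum_vertexKernel hs0 hs h2').neg).congr (fun m => ?_) ?_
    · have h7 := den_ne_zero hs0 hs m
      have h3 := natCast_pnat_ne_zero m
      have h4 : s ^ (m : ℕ) ≠ 0 := pow_ne_zero _ hs0
      have h5 : ζ ^ (m : ℕ) ≠ 0 := pow_ne_zero _ hζ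
      rw [← qInt_div_den hs0 hs, linF, add_assoc]
      congr 1
      rw [vertexArg]
      simp only [pow_nat_mul, div_pow, mul_pow, pow_pow_pnat]
      split_ifs
      · field_simp
        ring
      · field_simp
        ring
    · rw [phi]
      congr 1
      · simp only [one_div, inv_pow]
      · have e1 : s ^ 4 * ((ε : ℂ) * Complex.I / (s ^ 3 * ζ)) = ε * Complex.I * s * ζ⁻¹ := by
          field_simp
        have e2 : -s ^ 6 * ((ε : ℂ) * Complex.I / (s ^ 3 * ζ)) =
            -ε * Complex.I * s ^ 3 * ζ⁻¹ := by field_simp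
        have e3 : -s ^ 10 * ((ε : ℂ) * Complex.I / (s ^ 3 * ζ)) =
            -ε * Complex.I * s ^ 7 * ζ⁻¹ := by field_simp
        have e4 : s ^ 12 * ((ε : ℂ) * Complex.I / (s ^ 3 * ζ)) = ε * Complex.I * s ^ 9 * ζ⁻¹ := by
          field_simp
        rw [vertexKernel, e1, e2, e3, e4, inv_div]
        split_ifs with hε
        · subst hε
          simp [qPoch_zero_left]
        · ring
  · have h2 := qInt_ne_zero hs0 hs j
    have h7 := den_ne_zero hs0 hs j
    have h3 := natCast_pnat_ne_zero j
    have h4 : s ^ (j : ℕ) ≠ 0 := pow_ne_zero _ hs0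
    have h5 : ζ ^ (j : ℕ) ≠ 0 := pow_ne_zero _ hζ
    have h8 : quadF s j * vertexArg s ζ j ^ 2 = -(1 / 2) * (qInt (s ^ 2) (j : ℤ) / den (s ^ 2) j) *
        s ^ (2 * (j : ℕ)) * ((1 / ζ ^ 2) ^ (j : ℕ) / (j : ℂ)) := by
      rw [quadF, vertexArg]
      simp only [pow_nat_mul, div_pow, pow_pow_pnat, one_pow]
      field_simp
    have e1 : (Complex.I * s) ^ (2 * (j : ℕ)) = (-s ^ 2) ^ (j : ℕ) := by
      rw [pow_mul, mul_pow, Complex.I_sq]; congr 1; ring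
    have e2 : s ^ (2 * (2 * (j : ℕ))) = ((-s ^ 2) ^ (j : ℕ)) ^ 2 := pow_two_two_mul j
    have e4 : (-s ^ 2) ^ (2 * (j : ℕ)) = ((-s ^ 2) ^ (j : ℕ)) ^ 2 := by
      rw [← pow_mul, mul_comm]
    have e5 : (s ^ 12) ^ (2 * (j : ℕ)) = ((-s ^ 2) ^ (j : ℕ)) ^ 12 := by
      rw [mul_comm, pow_mul, ← neg_sq_pow_six]; ring
    have e6 : s ^ (2 * (j : ℕ)) * s ^ (2 * (j : ℕ)) = ((-s ^ 2) ^ (j : ℕ)) ^ 2 := by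
      rw [← e2, ← pow_add]; ring_nf
    have e3 : 1 / ζ ^ (2 * (j : ℕ)) = (1 / ζ ^ 2) ^ (j : ℕ) := by rw [div_pow, one_pow, pow_mul]
    have hn1 := one_sub_pow_ne_zero (norm_pow_lt_one hs (k := 12) (by norm_num)) j
    have hn2 := one_sub_pow_ne_zero (norm_pow_lt_one hs (k := 12) (by norm_num)) (2 * j)
    rw [PNat.mul_coe, show ((2 : ℕ+) : ℕ) = 2 from rfl, e5] at hn2
    rw [← neg_sq_pow_six] at hn1
    rw [h8, qInt_div_den hs0 hs, e1, e2, e3, e4, e5, ← neg_sq_pow_six]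
    push_cast
    have e7 : ∀ A B C D X : ℂ, -(1 / 2) * (s ^ (2 * (j : ℕ)) * A * B / C) * s ^ (2 * (j : ℕ)) * X =
      -(1 / 2) * (((-s ^ 2) ^ (j : ℕ)) ^ 2 * A * B / C) * X := fun A B C D X => by
        rw [← e6]; ring
    rw [e7 _ _ _ 0]
    generalize (-s ^ 2) ^ (j : ℕ) = Q at *
    field_simp
    ring

theorem ExpSum.summable_right {f g : ℕ+ → ℂ} {E : ℂ} (h : ExpSum (fun m => f m + g m) E)
    (hf : Summable fun m => ‖f m‖) : Summable fun m => ‖g m‖ := by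
  refine Summable.of_nonneg_of_le (fun _ => norm_nonneg _) (fun m => ?_) (h.1.add hf)
  have := norm_sub_le (f m + g m) (f m)
  rwa [add_sub_cancel_left] at this

end SelfContractions

end IzerginKorepin

namespace IzerginKorepin

open MvPowerSeries Filter Topology MeasureTheory

/-! ### Vertex operators on Gaussian vectors -/

section Admissible

variable {Ω : Type*} [MeasurableSpace Ω]

/-- The data `f`, `b` define a vector `gaussAvg P k f a b`, with `b` bounded by `B`. -/
structure Admissible (P : Measure Ω) (f : Ω → ℂ) (b : Ω → ℕ+ → ℂ) (B : ℕ+ → ℝ) : Prop where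
  integrable : Integrable f P
  measurable : ∀ m, Measurable fun ω => b ω m
  bound : ∀ ω m, ‖b ω m‖ ≤ B m

variable {P : Measure Ω} {f : Ω → ℂ} {a : ℕ+ → ℂ} {b : Ω → ℕ+ → ℂ} {B : ℕ+ → ℝ}

theorem measurable_of_hasSum {g : Ω → ℕ+ → ℂ} {l : Ω → ℂ} (hg : ∀ m, Measurable fun ω => g ω m)
    (hl : ∀ ω, HasSum (g ω) (l ω)) : Measurable l := by
  refine measurable_of_tendsto_metrizable' (atTop : Filter (Finset ℕ+))
    (f := fun S ω => ∑ m ∈ S, g ω m) (fun S => ?_) (tendsto_pi_nhds.2 fun ω => hl ω)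
  exact Finset.measurable_fun_sum S fun m _ => hg m

theorem norm_exp_le_of_hasSum {g : ℕ+ → ℂ} {l : ℂ} {G : ℕ+ → ℝ} (hl : HasSum g l)
    (hG : Summable G) (h : ∀ m, ‖g m‖ ≤ G m) : ‖Complex.exp l‖ ≤ Real.exp (∑' m, G m) := by
  rw [Complex.norm_exp, Real.exp_le_exp, ← hl.tsum_eq]
  exact (Complex.re_le_norm _).trans (tsum_of_norm_bounded hG.hasSum h)

theorem Admissible.sub {f' : Ω → ℂ} (h : Admissible P f b B) (h' : Admissible P f' b B) :
    Admissible P (fun ω => f ω - f' ω) b B :=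
  ⟨h.integrable.sub h'.integrable, h.measurable, h.bound⟩

theorem Admissible.const_mul (h : Admissible P f b B) (c : ℂ) :
    Admissible P (fun ω => c * f ω) b B :=
  ⟨h.integrable.const_mul c, h.measurable, h.bound⟩

theorem integrable_mul_of_hasSum (h : Admissible P f b B) {u : ℕ+ → ℂ}
    (hs : Summable fun m => ‖a m‖ * ‖u m‖ ^ 2 + B m * ‖u m‖) {l : Ω → ℂ}
    (hl : ∀ ω, HasSum (fun m => a m * u m ^ 2 + b ω m * u m) (l ω)) :
    Integrable (fun ω => f ω * Complex.exp (l ω)) P := by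
  have hm : Measurable l := measurable_of_hasSum (fun m => by have := h.measurable m; fun_prop) hl
  refine h.integrable.mul_bdd (c := Real.exp (∑' m, (‖a m‖ * ‖u m‖ ^ 2 + B m * ‖u m‖)))
    (Complex.measurable_exp.comp hm).aestronglyMeasurable (Eventually.of_forall fun ω => ?_)
  refine norm_exp_le_of_hasSum (hl ω) hs fun m => (norm_add_le _ _).trans ?_
  rw [norm_mul, norm_mul, norm_pow]
  gcongr
  exact h.bound ω m

theorem Admissible.vertexMinus [Nonempty Ω] (h : Admissible P f b B) {e s ζ : ℂ} {u d : ℕ+ → ℂ}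
    (hu : ∀ m, bosonNorm (s ^ 2) m * coeffQ s ζ m = u m)
    (hd : ∀ m, 2 * a m * u m + coeffP s ζ m = d m)
    (hs : Summable fun m => ‖a m‖ * ‖u m‖ ^ 2 + B m * ‖u m‖) {E : Ω → ℂ}
    (hE : ∀ ω, ExpSum (fun m => a m * u m ^ 2 + b ω m * u m) (E ω)) (k : ℤ) :
    VertexMinusConverges s ζ (gaussAvg P k f a b) ∧
    vertexMinus e s ζ (gaussAvg P k f a b) =
      gaussAvg P (k + 1) (fun ω => e⁻¹ * (-ζ * s ^ 8) ^ (k + 1) * (f ω * E ω)) a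
        (fun ω m => b ω m + d m) ∧
    Admissible P (fun ω => e⁻¹ * (-ζ * s ^ 8) ^ (k + 1) * (f ω * E ω))
      (fun ω m => b ω m + d m) (fun m => B m + ‖d m‖) := by
  have hi := integrable_mul_of_hasSum h hs fun ω => (hE ω).hasSum
  simp only [(hE _).2] at hi
  refine ⟨?_, ?_, ?_⟩
  · exact annihilateExpConverges_gaussAvg h.integrable h.measurable h.bound _ _
      (by simpa only [hu] using hs) k
  · rw [vertexMinus_gaussAvg h.integrable h.measurable h.bound e s ζ hu hs
      (fun ω => (hE ω).hasSum) (fun ω => (hE ω).2) k hi]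
    simp only [hd]
  · refine ⟨hi.const_mul _, fun m => (h.measurable m).add_const _, fun ω m => ?_⟩
    exact (norm_add_le _ _).trans (add_le_add_left (h.bound ω m) _)

theorem Admissible.currentMode [Nonempty Ω] [SFinite P] (h : Admissible P f b B) {e s : ℂ}
    (hs0 : s ≠ 0) {R : ℝ} (hR : 0 < R) {u : ℕ+ → ℂ} {d : ℂ → ℕ+ → ℂ} {D : ℕ+ → ℝ}
    (hu : ∀ m, bosonNorm (s ^ 2) m * coeffS s m = u m)
    (hd : ∀ v : ℂ, v ≠ 0 → ∀ m : ℕ+, 2 * a m * (u m * ((s ^ 8 * v) ^ (m : ℕ))⁻¹) +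
      coeffR s m * (s ^ 8 * v) ^ (m : ℕ) = d v m)
    (hD : ∀ v : ℂ, ‖v‖ = R → ∀ m, ‖d v m‖ ≤ D m)
    (hs : Summable fun m : ℕ+ => ‖a m‖ * ‖u m * ((s ^ 8 * (R : ℂ)) ^ (m : ℕ))⁻¹‖ ^ 2 +
      B m * ‖u m * ((s ^ 8 * (R : ℂ)) ^ (m : ℕ))⁻¹‖) {E : Ω → ℂ → ℂ}
    (hE : ∀ ω v, ‖v‖ = R → ExpSum (fun m : ℕ+ => a m * (u m * ((s ^ 8 * v) ^ (m : ℕ))⁻¹) ^ 2 +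
      b ω m * (u m * ((s ^ 8 * v) ^ (m : ℕ))⁻¹)) (E ω v)) (k : ℤ) :
    currentMode e s 0 (gaussAvg P k f a b) = gaussAvg (P.prod circ) (k - 1)
      (fun p => e * ((s ^ 8 * circleMap 0 R p.2) ^ (-k) * (f p.1 * E p.1 (circleMap 0 R p.2)))) a
      (fun p m => b p.1 m + d (circleMap 0 R p.2) m) ∧
    Admissible (P.prod circ)
      (fun p => e * ((s ^ 8 * circleMap 0 R p.2) ^ (-k) * (f p.1 * E p.1 (circleMap 0 R p.2))))
      (fun p m => b p.1 m + d (circleMap 0 R p.2) m) (fun m => B m + D m) := by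
  have hc : s ^ 8 ≠ 0 := pow_ne_zero _ hs0
  have hcm : ∀ θ, ‖circleMap 0 R θ‖ = R := fun θ => by rw [norm_circleMap_zero, abs_of_pos hR]
  have hc0 : ∀ θ, circleMap 0 R θ ≠ 0 := fun θ => circleMap_ne_center hR.ne'
  have hun : ∀ (v : ℂ), ‖v‖ = R → ∀ m : ℕ+, ‖u m * ((s ^ 8 * v) ^ (m : ℕ))⁻¹‖ =
      ‖u m‖ * ((‖s ^ 8‖ * R) ^ (m : ℕ))⁻¹ := fun v hv m => by
    rw [norm_mul, norm_inv, norm_pow, norm_mul, hv]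
  have hRn : ‖(R : ℂ)‖ = R := by rw [Complex.norm_real, Real.norm_eq_abs, abs_of_pos hR]
  simp only [hun _ hRn] at hs
  have hmb : ∀ m, Measurable fun p : Ω × ℝ => b p.1 m := fun m =>
    (h.measurable m).comp measurable_fst
  have hw : Measurable fun p : Ω × ℝ => s ^ 8 * circleMap 0 R p.2 :=
    (continuous_const.mul (continuous_circleMap 0 R)).measurable.comp measurable_snd
  have hwm : ∀ m : ℕ+, Measurable fun p : Ω × ℝ =>
      u m * ((s ^ 8 * circleMap 0 R p.2) ^ (m : ℕ))⁻¹ := fun m =>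
    (hw.pow_const _).inv.const_mul _
  have hi : Integrable (fun p : Ω × ℝ => f p.1 * E p.1 (circleMap 0 R p.2)) (P.prod circ) := by
    have hf1 : Integrable (fun p : Ω × ℝ => f p.1) (P.prod circ) := h.integrable.comp_fst circ
    have hl := fun p : Ω × ℝ => hE p.1 _ (hcm p.2)
    have hm := measurable_of_hasSum (fun m => (((hwm m).pow_const 2).const_mul (a m)).add
      ((hmb m).mul (hwm m))) fun p => (hl p).hasSum
    have := hf1.mul_bdd (c := Real.exp (∑' m : ℕ+, (‖a m‖ * (‖u m‖ * ((‖s ^ 8‖ * R) ^ (m : ℕ))⁻¹) ^ 2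
      + B m * (‖u m‖ * ((‖s ^ 8‖ * R) ^ (m : ℕ))⁻¹))))
      (Complex.measurable_exp.comp hm).aestronglyMeasurable (Eventually.of_forall fun p => ?_)
    · simp only [Function.comp_def, (hl _).2] at this
      exact this
    refine norm_exp_le_of_hasSum (hl p).hasSum hs fun m => (norm_add_le _ _).trans ?_
    rw [norm_mul, norm_mul, norm_pow, hun _ (hcm p.2)]
    gcongr
    exact h.bound p.1 m
  have hij : ∀ j : ℤ, Integrable (fun p : Ω × ℝ => (s ^ 8 * circleMap 0 R p.2) ^ j *
      (f p.1 * E p.1 (circleMap 0 R p.2))) (P.prod circ) := fun j => by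
    refine hi.bdd_mul (c := (‖s ^ 8‖ * R) ^ j) ?_ (Eventually.of_forall fun p => ?_)
    · exact (by fun_prop : Measurable fun p : Ω × ℝ => (s ^ 8 * circleMap 0 R p.2) ^ j)
        |>.aestronglyMeasurable
    · rw [norm_zpow, norm_mul, hcm]
  refine ⟨?_, ?_⟩
  · rw [currentMode_gaussAvg h.integrable h.measurable h.bound e s hc hR hu hs
      (fun ω θ => (hE ω _ (hcm θ)).hasSum) (fun ω θ => (hE ω _ (hcm θ)).2) k hij]
    simp only [hd _ (hc0 _)]
  · refine ⟨(hij (-k)).const_mul e, fun m => ?_, fun p m => ?_⟩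
    · simp only [← hd _ (hc0 _)]
      exact (hmb m).add (((hwm m).const_mul _).add ((hw.pow_const _).const_mul _))
    · exact (norm_add_le _ _).trans (add_le_add (h.bound p.1 m) (hD _ (hcm p.2) m))

end Admissible

end IzerginKorepin

namespace IzerginKorepin

open MvPowerSeries Filter Topology MeasureTheory

/-! ### Vertex operators and currents on the boundary state -/

/-- The linear coefficients after the application of vertex operators at `Z` and currents at
`q ^ 4 v`, `v ∈ V`. -/
noncomputable def stateShift (s : ℂ) (ε : SignType) (Z V : List ℂ) (m : ℕ+) : ℂ :=
  linF s ε m + (Z.map fun ζ => vertexShift s ζ m).sum + (V.map fun v => currentShift s v m).sum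

/-- A bound of `stateShift` for currents on circles of radii `rs`. -/
noncomputable def stateBound (s : ℂ) (ε : SignType) (Z : List ℂ) (rs : List ℝ) (m : ℕ+) : ℝ :=
  ‖linF s ε m‖ + (Z.map fun ζ => ‖vertexShift s ζ m‖).sum +
    (rs.map fun r : ℝ => ‖currentShift s (r : ℂ) m‖).sum

theorem stateShift_cons_vertex (s : ℂ) (ε : SignType) (ζ : ℂ) (Z V : List ℂ) (m : ℕ+) :
    stateShift s ε Z V m + vertexShift s ζ m = stateShift s ε (ζ :: Z) V m := by
  simp only [stateShift, List.map_cons, List.sum_cons]; ring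

theorem stateShift_cons_current (s : ℂ) (ε : SignType) (v : ℂ) (Z V : List ℂ) (m : ℕ+) :
    stateShift s ε Z V m + currentShift s v m = stateShift s ε Z (v :: V) m := by
  simp only [stateShift, List.map_cons, List.sum_cons]; ring

theorem stateBound_cons_vertex (s : ℂ) (ε : SignType) (ζ : ℂ) (Z : List ℂ) (rs : List ℝ)
    (m : ℕ+) : stateBound s ε Z rs m + ‖vertexShift s ζ m‖ = stateBound s ε (ζ :: Z) rs m := by
  simp only [stateBound, List.map_cons, List.sum_cons]; ring

theorem stateBound_cons_current (s : ℂ) (ε : SignType) (r : ℝ) (Z : List ℂ) (rs : List ℝ)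
    (m : ℕ+) : stateBound s ε Z rs m + ‖currentShift s (r : ℂ) m‖ =
      stateBound s ε Z (r :: rs) m := by
  simp only [stateBound, List.map_cons, List.sum_cons]; ring

/-- On a circle the bound is attained at the positive real point, so a real radius suffices to
record the bound. -/
theorem norm_currentShift_le (s : ℂ) {v : ℂ} {r : ℝ} (hr : 0 < r) (hv : ‖v‖ = r) (m : ℕ+) :
    ‖currentShift s v m‖ ≤ ‖currentShift s (r : ℂ) m‖ := by
  rw [currentShift, currentShift, norm_neg, norm_neg, norm_div, norm_div, norm_mul, norm_mul]
  have h1 : ‖(r : ℂ) ^ (m : ℕ) + ((r : ℂ) ^ (m : ℕ))⁻¹‖ = r ^ (m : ℕ) + (r ^ (m : ℕ))⁻¹ := by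
    rw [← Complex.ofReal_pow, ← Complex.ofReal_inv, ← Complex.ofReal_add, Complex.norm_real,
      Real.norm_eq_abs, abs_of_pos (by positivity)]
  have h2 : ‖v ^ (m : ℕ) + (v ^ (m : ℕ))⁻¹‖ ≤ r ^ (m : ℕ) + (r ^ (m : ℕ))⁻¹ := by
    refine (norm_add_le _ _).trans (le_of_eq ?_)
    rw [norm_inv, norm_pow, hv]
  rw [h1]
  gcongr

theorem ExpSum.add_list {α : Type*} {f : ℕ+ → ℂ} {E : ℂ} (hf : ExpSum f E) {g : α → ℕ+ → ℂ}
    {G : α → ℂ} (l : List α) (h : ∀ x ∈ l, ExpSum (g x) (G x)) :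
    ExpSum (fun m => f m + (l.map fun x => g x m).sum) (E * (l.map G).prod) := by
  induction l with
  | nil => simpa using hf
  | cons x l ih =>
    refine ((ih fun y hy => h y (List.mem_cons_of_mem _ hy)).add
      (h x List.mem_cons_self)).congr (fun m => ?_) ?_
    · simp only [List.map_cons, List.sum_cons]; ring
    · simp only [List.map_cons, List.prod_cons]; ring

theorem summable_list {α : Type*} {g : α → ℕ+ → ℝ} (l : List α) (h : ∀ x ∈ l, Summable (g x)) :
    Summable fun m => (l.map fun x => g x m).sum := by
  induction l with
  | nil => simp
  | cons x l ih =>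
    simpa only [List.map_cons, List.sum_cons] using
      (h x List.mem_cons_self).add (ih fun y hy => h y (List.mem_cons_of_mem _ hy))

/-- The contraction of `Φ_-(ζ)` with a current to its right. -/
noncomputable def vertexCurrent (s ζ v : ℂ) : ℂ :=
  (1 - s ^ 2 * v / ζ)⁻¹ * (1 - s ^ 2 / (v * ζ))⁻¹

/-- The contraction of a current with `Φ_-(ζ)` to its right. -/
noncomputable def currentVertex (s ζ v : ℂ) : ℂ :=
  (1 - s ^ 2 * ζ / v)⁻¹ * (1 - s ^ 2 / (ζ * v))⁻¹

/-- The contraction of a current at `v` with a current at `w` to its right. -/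
noncomputable def currentCurrent (s v w : ℂ) : ℂ :=
  currentKernel s (w / v) * currentKernel s (1 / (v * w))

/-- The contraction of a current with the boundary state. -/
noncomputable def currentSelf (s : ℂ) (ε : SignType) (v : ℂ) : ℂ :=
  (1 - 1 / v ^ 2) * (1 - (ε : ℂ) * Complex.I / (s * v))

/-- The scalar produced by `Φ_-(ζ)`. -/
noncomputable def vertexFactor (s : ℂ) (ε : SignType) (ζ : ℂ) (Z V : List ℂ) : ℂ :=
  phi s ε ζ⁻¹ * (Z.map fun ζ' => vertexKernel s (ζ' / ζ) * vertexKernel s (1 / (ζ' * ζ))).prod *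
    (V.map (vertexCurrent s ζ)).prod

/-- The scalar produced by the current at `q ^ 4 v`. -/
noncomputable def currentFactor (s : ℂ) (ε : SignType) (v : ℂ) (Z V : List ℂ) : ℂ :=
  currentSelf s ε v * (Z.map fun ζ => currentVertex s ζ v).prod *
    (V.map (currentCurrent s v)).prod

/-- The convergence conditions for `Φ_-(ζ)`. -/
structure VertexAllowed (s : ℂ) (ε : SignType) (ζ : ℂ) (Z : List ℂ) (rs : List ℝ) : Prop where
  ne_zero : ζ ≠ 0
  sq_lt : ‖s ^ 4 * (1 / ζ ^ 2)‖ < 1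
  lt : ‖(ε : ℂ) * Complex.I * s / ζ‖ < 1
  vertex_ne_zero : ∀ ζ' ∈ Z, ζ' ≠ 0
  vertex_lt : ∀ ζ' ∈ Z, ‖s ^ 4 * (ζ' / ζ)‖ < 1
  vertex_lt' : ∀ ζ' ∈ Z, ‖s ^ 4 * (1 / (ζ' * ζ))‖ < 1
  pos : ∀ r ∈ rs, 0 < r
  current_lt : ∀ r ∈ rs, ‖s‖ ^ 2 * r < ‖ζ‖
  current_lt' : ∀ r ∈ rs, ‖s‖ ^ 2 < r * ‖ζ‖

/-- The convergence conditions for the current on the circle of radius `R`. -/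
structure CurrentAllowed (s : ℂ) (ε : SignType) (R : ℝ) (Z : List ℂ) (rs : List ℝ) : Prop where
  one_lt : 1 < R
  lt : ‖(ε : ℂ) * Complex.I / s‖ < R
  vertex_ne_zero : ∀ ζ ∈ Z, ζ ≠ 0
  vertex_lt : ∀ ζ ∈ Z, ‖s‖ ^ 2 * ‖ζ‖ < R
  vertex_lt' : ∀ ζ ∈ Z, ‖s‖ ^ 2 < ‖ζ‖ * R
  one_lt_radius : ∀ r ∈ rs, 1 < r
  radius_lt : ∀ r ∈ rs, r < R

section Factors

variable {s : ℂ} {ε : SignType} {ζ : ℂ} {Z V : List ℂ} {rs : List ℝ}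

theorem VertexAllowed.expSum_current (h : VertexAllowed s ε ζ Z rs) (hs0 : s ≠ 0) (hs : ‖s‖ < 1)
    {v : ℂ} (hv : ‖v‖ ∈ rs) : ExpSum (fun m => currentShift s v m * vertexArg s ζ m)
      (vertexCurrent s ζ v) := by
  have hr := h.pos _ hv
  have hz := norm_pos_iff.2 h.ne_zero
  refine expSum_currentShift_vertexArg hs0 hs (norm_pos_iff.1 hr) ?_ ?_
  · rw [norm_div, norm_mul, norm_pow, div_lt_one hz]
    exact h.current_lt _ hv
  · rw [norm_div, norm_mul, norm_pow, div_lt_one (by positivity)]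
    exact h.current_lt' _ hv

theorem VertexAllowed.expSum (h : VertexAllowed s ε ζ Z rs) (hs0 : s ≠ 0) (hs : ‖s‖ < 1)
    (hV : V.map norm = rs) : ExpSum (fun m => quadF s m * vertexArg s ζ m ^ 2 +
      stateShift s ε Z V m * vertexArg s ζ m) (vertexFactor s ε ζ Z V) := by
  refine ((ExpSum.add_list (expSum_vertexArg_self hs0 hs h.ne_zero ε h.sq_lt h.lt) Z
    fun ζ' hζ' => expSum_vertexShift_vertexArg hs0 hs (h.vertex_ne_zero _ hζ')
      (h.vertex_lt _ hζ') (h.vertex_lt' _ hζ')).add_list V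
      fun v hv => h.expSum_current hs0 hs (hV ▸ List.mem_map_of_mem hv)).congr (fun m => ?_) rfl
  simp only [stateShift, List.sum_map_mul_right]
  ring

/-- The bounds in `stateBound` are norms of actual shifts, at the vertex parameters and at real
points of the circles, so the absolute convergence of the contractions there is the required uniform
convergence. -/
theorem VertexAllowed.summable (h : VertexAllowed s ε ζ Z rs) (hs0 : s ≠ 0) (hs : ‖s‖ < 1) :
    Summable fun m => ‖quadF s m‖ * ‖vertexArg s ζ m‖ ^ 2 +
      stateBound s ε Z rs m * ‖vertexArg s ζ m‖ := by
  have h1 := summable_quadF_vertexArg hs0 hs h.ne_zero h.sq_lt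
  have h2 := (expSum_vertexArg_self hs0 hs h.ne_zero ε h.sq_lt h.lt).summable_right h1
  have h3 := summable_list (g := fun ζ' m => ‖vertexShift s ζ' m * vertexArg s ζ m‖) Z
    fun ζ' hζ' => (expSum_vertexShift_vertexArg hs0 hs (h.vertex_ne_zero _ hζ')
      (h.vertex_lt _ hζ') (h.vertex_lt' _ hζ')).1
  have h4 := summable_list (g := fun (r : ℝ) m => ‖currentShift s (r : ℂ) m * vertexArg s ζ m‖) rs
    fun r hr => (h.expSum_current hs0 hs (v := r) (by
      rwa [Complex.norm_real, Real.norm_eq_abs, abs_of_pos (h.pos r hr)])).1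
  refine (((h1.add h2).add h3).add h4).congr fun m => ?_
  simp only [stateBound, norm_mul, norm_pow, List.sum_map_mul_right]
  ring

theorem CurrentAllowed.norm_inv_sq {R : ℝ} (h : CurrentAllowed s ε R Z rs) {v : ℂ}
    (hv : ‖v‖ = R) : ‖1 / v ^ 2‖ < 1 := by
  have := h.one_lt
  rw [norm_div, norm_one, norm_pow, hv, div_lt_one (by positivity)]
  exact one_lt_pow₀ this two_ne_zero

theorem CurrentAllowed.expSum_self {R : ℝ} (h : CurrentAllowed s ε R Z rs) (hs0 : s ≠ 0)
    (hs : ‖s‖ < 1) {v : ℂ} (hv : ‖v‖ = R) :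
    ExpSum (fun m : ℕ+ => quadF s m * (currentArg s m * ((s ^ 8 * v) ^ (m : ℕ))⁻¹) ^ 2 +
      linF s ε m * (currentArg s m * ((s ^ 8 * v) ^ (m : ℕ))⁻¹)) (currentSelf s ε v) := by
  have hR : 0 < R := zero_lt_one.trans h.one_lt
  refine expSum_currentArg_self hs0 hs (norm_pos_iff.1 (hv ▸ hR)) ε (h.norm_inv_sq hv) ?_
  rw [← div_div, norm_div, hv, div_lt_one hR]
  exact h.lt

theorem CurrentAllowed.expSum_vertex {R : ℝ} (h : CurrentAllowed s ε R Z rs) (hs0 : s ≠ 0)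
    (hs : ‖s‖ < 1) {v : ℂ} (hv : ‖v‖ = R) {ζ : ℂ} (hζ : ζ ∈ Z) :
    ExpSum (fun m => vertexShift s ζ m * (currentArg s m * ((s ^ 8 * v) ^ (m : ℕ))⁻¹))
      (currentVertex s ζ v) := by
  have hR : 0 < R := zero_lt_one.trans h.one_lt
  have hz := norm_pos_iff.2 (h.vertex_ne_zero _ hζ)
  refine expSum_vertexShift_currentArg hs0 hs (norm_pos_iff.1 (hv ▸ hR))
    (h.vertex_ne_zero _ hζ) ?_ ?_
  · rw [norm_div, norm_mul, norm_pow, hv, div_lt_one hR]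
    exact h.vertex_lt _ hζ
  · rw [norm_div, norm_mul, norm_pow, hv, div_lt_one (by positivity)]
    exact h.vertex_lt' _ hζ

theorem CurrentAllowed.expSum_current {R : ℝ} (h : CurrentAllowed s ε R Z rs) (hs0 : s ≠ 0)
    (hs : ‖s‖ < 1) {v : ℂ} (hv : ‖v‖ = R) {v' : ℂ} (hv' : ‖v'‖ ∈ rs) :
    ExpSum (fun m => currentShift s v' m * (currentArg s m * ((s ^ 8 * v) ^ (m : ℕ))⁻¹))
      (currentCurrent s v v') := by
  have hR : 0 < R := zero_lt_one.trans h.one_lt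
  have h1 := h.one_lt_radius _ hv'
  have hr : 0 < ‖v'‖ := zero_lt_one.trans h1
  refine expSum_currentShift_currentArg hs0 hs (norm_pos_iff.1 (hv ▸ hR)) (norm_pos_iff.1 hr) ?_ ?_
  · rw [norm_div, hv, div_lt_one hR]
    exact h.radius_lt _ hv'
  · rw [norm_div, norm_one, norm_mul, hv, div_lt_one (by positivity)]
    exact one_lt_mul_of_le_of_lt h.one_lt.le h1

theorem CurrentAllowed.expSum {R : ℝ} (h : CurrentAllowed s ε R Z rs) (hs0 : s ≠ 0)
    (hs : ‖s‖ < 1) (hV : V.map norm = rs) {v : ℂ} (hv : ‖v‖ = R) :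
    ExpSum (fun m : ℕ+ => quadF s m * (currentArg s m * ((s ^ 8 * v) ^ (m : ℕ))⁻¹) ^ 2 +
      stateShift s ε Z V m * (currentArg s m * ((s ^ 8 * v) ^ (m : ℕ))⁻¹))
      (currentFactor s ε v Z V) := by
  refine ((ExpSum.add_list (h.expSum_self hs0 hs hv) Z
    fun ζ hζ => h.expSum_vertex hs0 hs hv hζ).add_list V
      fun v' hv' => h.expSum_current hs0 hs hv (hV ▸ List.mem_map_of_mem hv')).congr
      (fun m => ?_) rfl
  simp only [stateShift, List.sum_map_mul_right]
  ring

theorem CurrentAllowed.summable {R : ℝ} (h : CurrentAllowed s ε R Z rs) (hs0 : s ≠ 0)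
    (hs : ‖s‖ < 1) :
    Summable fun m : ℕ+ => ‖quadF s m‖ * ‖currentArg s m * ((s ^ 8 * (R : ℂ)) ^ (m : ℕ))⁻¹‖ ^ 2 +
      stateBound s ε Z rs m * ‖currentArg s m * ((s ^ 8 * (R : ℂ)) ^ (m : ℕ))⁻¹‖ := by
  have hR : 0 < R := zero_lt_one.trans h.one_lt
  have hn : ‖(R : ℂ)‖ = R := by rw [Complex.norm_real, Real.norm_eq_abs, abs_of_pos hR]
  have h1 := summable_quadF_currentArg hs0 hs (norm_pos_iff.1 (hn.symm ▸ hR)) (h.norm_inv_sq hn)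
  have h2 := (h.expSum_self hs0 hs hn).summable_right h1
  have h3 := summable_list (g := fun ζ' m => ‖vertexShift s ζ' m *
    (currentArg s m * ((s ^ 8 * (R : ℂ)) ^ (m : ℕ))⁻¹)‖) Z
    fun ζ hζ => (h.expSum_vertex hs0 hs hn hζ).1
  have h4 := summable_list (g := fun (r : ℝ) m => ‖currentShift s (r : ℂ) m *
    (currentArg s m * ((s ^ 8 * (R : ℂ)) ^ (m : ℕ))⁻¹)‖) rs
    fun r hr => (h.expSum_current hs0 hs hn (v' := r) (by
      rwa [Complex.norm_real, Real.norm_eq_abs, abs_of_pos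
        (zero_lt_one.trans (h.one_lt_radius r hr))])).1
  refine (((h1.add h2).add h3).add h4).congr fun m => ?_
  simp only [stateBound, norm_mul, norm_pow, List.sum_map_mul_right]
  ring

end Factors

section Ket

variable {Ω : Type*} [MeasurableSpace Ω] {P : Measure Ω}

/-- The average over `ω` of `f ω` times the state with vertex operators at `Z` and currents at
`q ^ 4 v`, `v ∈ V ω`, in the sector `k`. -/
noncomputable def ket (s : ℂ) (ε : SignType) (P : Measure Ω) (k : ℤ) (f : Ω → ℂ) (Z : List ℂ)
    (V : Ω → List ℂ) : Fock :=
  gaussAvg P k f (quadF s) fun ω => stateShift s ε Z (V ω)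

/-- The data of `ket` are admissible, the currents being on circles of radii `rs`. -/
structure IsKet (s : ℂ) (ε : SignType) (P : Measure Ω) (f : Ω → ℂ) (Z : List ℂ)
    (V : Ω → List ℂ) (rs : List ℝ) : Prop where
  admissible : Admissible P f (fun ω => stateShift s ε Z (V ω)) (stateBound s ε Z rs)
  norm_eq : ∀ ω, (V ω).map norm = rs

variable {s : ℂ} {ε : SignType} {f f' : Ω → ℂ} {Z : List ℂ} {V : Ω → List ℂ} {rs : List ℝ}

theorem IsKet.sub (h : IsKet s ε P f Z V rs) (h' : IsKet s ε P f' Z V rs) :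
    IsKet s ε P (fun ω => f ω - f' ω) Z V rs :=
  ⟨h.admissible.sub h'.admissible, h.norm_eq⟩

theorem IsKet.const_mul (h : IsKet s ε P f Z V rs) (c : ℂ) :
    IsKet s ε P (fun ω => c * f ω) Z V rs :=
  ⟨h.admissible.const_mul c, h.norm_eq⟩

theorem ket_sub (h : IsKet s ε P f Z V rs) (h' : IsKet s ε P f' Z V rs) (k : ℤ) :
    ket s ε P k f Z V - ket s ε P k f' Z V = ket s ε P k (fun ω => f ω - f' ω) Z V :=
  gaussAvg_sub h.admissible.integrable h'.admissible.integrable h.admissible.measurable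
    h.admissible.bound k

theorem smul_ket (c : ℂ) (k : ℤ) :
    c • ket s ε P k f Z V = ket s ε P k (fun ω => c * f ω) Z V :=
  smul_gaussAvg c k

theorem IsKet.vertexMinus [Nonempty Ω] (h : IsKet s ε P f Z V rs) (hs0 : s ≠ 0) (hs : ‖s‖ < 1)
    (e : ℂ) {ζ : ℂ} (hζ : VertexAllowed s ε ζ Z rs) (k : ℤ) :
    VertexMinusConverges s ζ (ket s ε P k f Z V) ∧
    vertexMinus e s ζ (ket s ε P k f Z V) = ket s ε P (k + 1)
      (fun ω => e⁻¹ * (-ζ * s ^ 8) ^ (k + 1) * (f ω * vertexFactor s ε ζ Z (V ω))) (ζ :: Z) V ∧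
    IsKet s ε P (fun ω => e⁻¹ * (-ζ * s ^ 8) ^ (k + 1) * (f ω * vertexFactor s ε ζ Z (V ω)))
      (ζ :: Z) V rs := by
  have key := h.admissible.vertexMinus (a := quadF s) (e := e) (bosonNorm_mul_coeffQ hs0 hs ζ)
    (vertexShift_eq hs0 hs ζ) (hζ.summable hs0 hs) (fun ω => hζ.expSum hs0 hs (h.norm_eq ω)) k
  simp only [stateShift_cons_vertex, stateBound_cons_vertex] at key
  exact ⟨key.1, key.2.1, key.2.2, h.norm_eq⟩

/-- Normal ordering for a current: it joins the list `V` at the price of one more circle variable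
and of its contractions with all operators to its right and with the boundary state. -/
theorem IsKet.currentMode [Nonempty Ω] [SFinite P] (h : IsKet s ε P f Z V rs) (hs0 : s ≠ 0)
    (hs : ‖s‖ < 1) (e : ℂ) {R : ℝ} (hR : CurrentAllowed s ε R Z rs) (k : ℤ) :
    currentMode e s 0 (ket s ε P k f Z V) = ket s ε (P.prod circ) (k - 1)
      (fun p => e * ((s ^ 8 * circleMap 0 R p.2) ^ (-k) *
        (f p.1 * currentFactor s ε (circleMap 0 R p.2) Z (V p.1)))) Z
      (fun p => circleMap 0 R p.2 :: V p.1) ∧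
    IsKet s ε (P.prod circ) (fun p => e * ((s ^ 8 * circleMap 0 R p.2) ^ (-k) *
        (f p.1 * currentFactor s ε (circleMap 0 R p.2) Z (V p.1)))) Z
      (fun p => circleMap 0 R p.2 :: V p.1) (R :: rs) := by
  have hR0 : 0 < R := zero_lt_one.trans hR.one_lt
  have key := h.admissible.currentMode (a := quadF s) (e := e) hs0 hR0
    (bosonNorm_mul_coeffS hs0 hs) (fun v hv => currentShift_eq hs0 hs hv)
    (fun v hv => norm_currentShift_le s hR0 hv) (hR.summable hs0 hs)
    (fun ω v hv => hR.expSum hs0 hs (h.norm_eq ω) hv) k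
  simp only [stateShift_cons_current, stateBound_cons_current] at key
  refine ⟨key.1, key.2, fun p => ?_⟩
  rw [List.map_cons, h.norm_eq, norm_circleMap_zero, abs_of_pos hR0]

end Ket

end IzerginKorepin

namespace IzerginKorepin

open MvPowerSeries Filter Topology MeasureTheory

/-! ### The components `Φ_0`, `Φ_+` of the vertex operator on kets -/

/-- The combination of contractions in `Φ_0(ζ)`. -/
noncomputable def zeroKernel (s ζ v : ℂ) : ℂ :=
  vertexCurrent s ζ v + s ^ 2 * (ζ / v) * currentVertex s ζ v

/-- The combination of contractions in `Φ_+(ζ)`, the current at `v₁` being to the left. -/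
noncomputable def plusKernel (s ζ v₁ v₂ : ℂ) : ℂ :=
  -(v₁ / ζ) * vertexCurrent s ζ v₂ * zeroKernel s ζ v₁ -
    zeroKernel s ζ v₂ * currentVertex s ζ v₁

/-- The scalar produced by `Φ_0(ζ)` on the sector `k`. -/
noncomputable def zeroFactor (s : ℂ) (ε : SignType) (k : ℤ) (ζ v : ℂ) (Z V : List ℂ) : ℂ :=
  (-ζ / v) ^ k * (vertexFactor s ε ζ Z V * currentFactor s ε v Z V * zeroKernel s ζ v)

/-- The scalar produced by `Φ_+(ζ)` on the sector `k`. -/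
noncomputable def plusFactor (e s : ℂ) (ε : SignType) (k : ℤ) (ζ v₁ v₂ : ℂ) (Z V : List ℂ) : ℂ :=
  s * e * (-ζ / (s ^ 8 * (v₁ * v₂))) ^ k * (vertexFactor s ε ζ Z V * currentFactor s ε v₂ Z V *
    currentFactor s ε v₁ Z (v₂ :: V) * plusKernel s ζ v₁ v₂)

theorem vertexFactor_cons (s : ℂ) (ε : SignType) (ζ v : ℂ) (Z V : List ℂ) :
    vertexFactor s ε ζ Z (v :: V) = vertexFactor s ε ζ Z V * vertexCurrent s ζ v := by
  simp only [vertexFactor, List.map_cons, List.prod_cons]; ring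

theorem currentFactor_cons_vertex (s : ℂ) (ε : SignType) (v ζ : ℂ) (Z V : List ℂ) :
    currentFactor s ε v (ζ :: Z) V = currentFactor s ε v Z V * currentVertex s ζ v := by
  simp only [currentFactor, List.map_cons, List.prod_cons]; ring

theorem VertexAllowed.tail {s : ℂ} {ε : SignType} {ζ : ℂ} {Z : List ℂ} {r : ℝ} {rs : List ℝ}
    (h : VertexAllowed s ε ζ Z (r :: rs)) : VertexAllowed s ε ζ Z rs :=
  ⟨h.ne_zero, h.sq_lt, h.lt, h.vertex_ne_zero, h.vertex_lt, h.vertex_lt',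
    fun x hx => h.pos x (List.mem_cons_of_mem _ hx),
    fun x hx => h.current_lt x (List.mem_cons_of_mem _ hx),
    fun x hx => h.current_lt' x (List.mem_cons_of_mem _ hx)⟩

theorem CurrentAllowed.tail_vertex {s : ℂ} {ε : SignType} {R : ℝ} {ζ : ℂ} {Z : List ℂ}
    {rs : List ℝ} (h : CurrentAllowed s ε R (ζ :: Z) rs) : CurrentAllowed s ε R Z rs :=
  ⟨h.one_lt, h.lt, fun x hx => h.vertex_ne_zero x (List.mem_cons_of_mem _ hx),
    fun x hx => h.vertex_lt x (List.mem_cons_of_mem _ hx),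
    fun x hx => h.vertex_lt' x (List.mem_cons_of_mem _ hx), h.one_lt_radius, h.radius_lt⟩

section Ket

variable {Ω : Type*} [MeasurableSpace Ω] {P : Measure Ω}
variable {s : ℂ} {ε : SignType} {f f' : Ω → ℂ} {Z : List ℂ} {V : Ω → List ℂ} {rs : List ℝ}

theorem IsKet.congr (h : IsKet s ε P f Z V rs) (hf : ∀ ω, f ω = f' ω) :
    IsKet s ε P f' Z V rs := by
  obtain rfl : f = f' := funext hf
  exact h

theorem ket_congr (hf : ∀ ω, f ω = f' ω) (k : ℤ) : ket s ε P k f Z V = ket s ε P k f' Z V := by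
  obtain rfl : f = f' := funext hf
  rfl

/-- Both orders of `Φ_-` and the current converge on one circle, as `q |ζ| < R < |ζ| / q`, and both
produce the same Gaussian. So the `q`-commutator acts on the scalars alone, through `zeroKernel`. -/
theorem IsKet.vertexZero [Nonempty Ω] [SFinite P] (h : IsKet s ε P f Z V rs) (hs0 : s ≠ 0)
    (hs : ‖s‖ < 1) {e : ℂ} (he : e ≠ 0) {ζ : ℂ} {R : ℝ} (hζ : VertexAllowed s ε ζ Z (R :: rs))
    (hR : CurrentAllowed s ε R (ζ :: Z) rs) (k : ℤ) :
    VertexZeroConverges e s ζ (ket s ε P k f Z V) ∧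
    vertexZero e s ζ (ket s ε P k f Z V) = ket s ε (P.prod circ) k
      (fun p => f p.1 * zeroFactor s ε k ζ (circleMap 0 R p.2) Z (V p.1)) (ζ :: Z)
      (fun p => circleMap 0 R p.2 :: V p.1) ∧
    IsKet s ε (P.prod circ)
      (fun p => f p.1 * zeroFactor s ε k ζ (circleMap 0 R p.2) Z (V p.1)) (ζ :: Z)
      (fun p => circleMap 0 R p.2 :: V p.1) (R :: rs) := by
  obtain ⟨a1, a2⟩ := h.currentMode hs0 hs e hR.tail_vertex k
  obtain ⟨b1, b2, b3⟩ := a2.vertexMinus hs0 hs e hζ (k - 1)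
  obtain ⟨c1, c2, c3⟩ := h.vertexMinus hs0 hs e hζ.tail k
  obtain ⟨d1, d2⟩ := c3.currentMode hs0 hs e hR (k + 1)
  have hR0 : 0 < R := zero_lt_one.trans hR.one_lt
  have hc0 : ∀ θ, circleMap 0 R θ ≠ 0 := fun θ => circleMap_ne_center hR0.ne'
  have hz := hζ.ne_zero
  -- The ratio of the zero mode factors of the two orders is `-ζ / v`, which turns the coefficient
  -- `-q` of the commutator into the `+ q ζ / v` of `zeroKernel`.
  have key : ∀ p : Ω × ℝ, e⁻¹ * (-ζ * s ^ 8) ^ (k - 1 + 1) *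
      ((e * ((s ^ 8 * circleMap 0 R p.2) ^ (-k) *
        (f p.1 * currentFactor s ε (circleMap 0 R p.2) Z (V p.1)))) *
          vertexFactor s ε ζ Z (circleMap 0 R p.2 :: V p.1)) -
      s ^ 2 * (e * ((s ^ 8 * circleMap 0 R p.2) ^ (-(k + 1)) *
        (e⁻¹ * (-ζ * s ^ 8) ^ (k + 1) * (f p.1 * vertexFactor s ε ζ Z (V p.1)) *
          currentFactor s ε (circleMap 0 R p.2) (ζ :: Z) (V p.1)))) =
      f p.1 * zeroFactor s ε k ζ (circleMap 0 R p.2) Z (V p.1) := fun p => by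
    have hv := hc0 p.2
    rw [vertexFactor_cons, currentFactor_cons_vertex, zeroFactor, zeroKernel]
    generalize circleMap 0 R p.2 = v at *
    rw [sub_add_cancel, zpow_neg, zpow_neg, zpow_add_one₀ (by positivity), zpow_add_one₀
      (by simpa using ⟨hz, hs0⟩), mul_zpow, mul_zpow, div_zpow]
    have h1 := zpow_ne_zero k hv
    have h2 := zpow_ne_zero k (pow_ne_zero 8 hs0)
    field_simp
    ring
  have e1 := (b3.sub (d2.const_mul (s ^ 2))).congr key
  refine ⟨⟨c1, a1 ▸ b1⟩, ?_, e1⟩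
  rw [IzerginKorepin.vertexZero, a1, b2, c2, d1, smul_ket, show k + 1 - 1 = k - 1 + 1 by ring,
    ket_sub b3 (d2.const_mul _), ket_congr key, sub_add_cancel]

/-- In both terms of the commutator the right current can run on the circle `R₂` and the left one on
`R₁`, the radii growing to the left as convergence demands. So again only scalars are subtracted. -/
theorem IsKet.vertexPlus [Nonempty Ω] [SFinite P] (h : IsKet s ε P f Z V rs) (hs0 : s ≠ 0)
    (hs : ‖s‖ < 1) {e : ℂ} (he : e ≠ 0) {ζ : ℂ} {R₁ R₂ : ℝ}
    (hζ : VertexAllowed s ε ζ Z (R₁ :: R₂ :: rs)) (hR₂ : CurrentAllowed s ε R₂ (ζ :: Z) rs)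
    (hR₁ : CurrentAllowed s ε R₁ (ζ :: Z) (R₂ :: rs)) (k : ℤ) :
    VertexPlusConverges e s ζ (ket s ε P k f Z V) ∧
    vertexPlus e s ζ (ket s ε P k f Z V) = ket s ε ((P.prod circ).prod circ) (k - 1)
      (fun p => f p.1.1 * plusFactor e s ε k ζ (circleMap 0 R₁ p.2) (circleMap 0 R₂ p.1.2) Z
        (V p.1.1)) (ζ :: Z)
      (fun p => circleMap 0 R₁ p.2 :: circleMap 0 R₂ p.1.2 :: V p.1.1) ∧
    IsKet s ε ((P.prod circ).prod circ)
      (fun p => f p.1.1 * plusFactor e s ε k ζ (circleMap 0 R₁ p.2) (circleMap 0 R₂ p.1.2) Z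
        (V p.1.1)) (ζ :: Z)
      (fun p => circleMap 0 R₁ p.2 :: circleMap 0 R₂ p.1.2 :: V p.1.1) (R₁ :: R₂ :: rs) := by
  obtain ⟨a1, a2⟩ := h.currentMode hs0 hs e hR₂.tail_vertex k
  obtain ⟨b1, b2, b3⟩ := a2.vertexZero hs0 hs he hζ hR₁ (k - 1)
  obtain ⟨c1, c2, c3⟩ := h.vertexZero hs0 hs he hζ.tail hR₂ k
  obtain ⟨d1, d2⟩ := c3.currentMode hs0 hs e hR₁ k
  have hR0 : 0 < R₁ := zero_lt_one.trans hR₁.one_lt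
  have hR0' : 0 < R₂ := zero_lt_one.trans hR₂.one_lt
  have hc0 : ∀ θ, circleMap 0 R₁ θ ≠ 0 := fun θ => circleMap_ne_center hR0.ne'
  have hc0' : ∀ θ, circleMap 0 R₂ θ ≠ 0 := fun θ => circleMap_ne_center hR0'.ne'
  have hz := hζ.ne_zero
  have key : ∀ p : (Ω × ℝ) × ℝ, s *
      (e * ((s ^ 8 * circleMap 0 R₂ p.1.2) ^ (-k) *
        (f p.1.1 * currentFactor s ε (circleMap 0 R₂ p.1.2) Z (V p.1.1))) *
          zeroFactor s ε (k - 1) ζ (circleMap 0 R₁ p.2) Z (circleMap 0 R₂ p.1.2 :: V p.1.1) -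
      e * ((s ^ 8 * circleMap 0 R₁ p.2) ^ (-k) *
        (f p.1.1 * zeroFactor s ε k ζ (circleMap 0 R₂ p.1.2) Z (V p.1.1) *
          currentFactor s ε (circleMap 0 R₁ p.2) (ζ :: Z) (circleMap 0 R₂ p.1.2 :: V p.1.1)))) =
      f p.1.1 * plusFactor e s ε k ζ (circleMap 0 R₁ p.2) (circleMap 0 R₂ p.1.2) Z (V p.1.1) :=
      fun p => by
    have hv := hc0 p.2
    have hv' := hc0' p.1.2
    rw [zeroFactor, zeroFactor, vertexFactor_cons, currentFactor_cons_vertex, plusFactor,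
      plusKernel]
    generalize circleMap 0 R₁ p.2 = v at *
    generalize circleMap 0 R₂ p.1.2 = v' at *
    generalize currentFactor s ε v Z (v' :: V p.1.1) = X
    rw [zpow_neg, zpow_neg, zpow_sub_one₀ (div_ne_zero (neg_ne_zero.2 hz) hv), mul_zpow, mul_zpow,
      div_zpow, div_zpow, div_zpow, mul_zpow, mul_zpow]
    have h1 := zpow_ne_zero k hv
    have h3 := zpow_ne_zero k hv'
    have h2 := zpow_ne_zero k (pow_ne_zero 8 hs0)
    have h4 : (-ζ / v)⁻¹ = -(v / ζ) := by field_simp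
    rw [h4]
    generalize zeroKernel s ζ v = A
    generalize zeroKernel s ζ v' = B
    field_simp
  have e1 := ((b3.sub d2).const_mul s).congr key
  refine ⟨⟨c1, a1 ▸ b1⟩, ?_, e1⟩
  rw [IzerginKorepin.vertexPlus, a1, b2, c2, d1, ket_sub b3 d2, smul_ket, ket_congr key]

end Ket

end IzerginKorepin

namespace IzerginKorepin

open MvPowerSeries Filter Topology MeasureTheory

/-! ### The zero vector -/

section Zero

variable (e s z : ℂ)

theorem coeff_annihilateTerm_zero (q : ℂ) (t : ℕ+ → ℂ) (ν μ : ℕ+ →₀ ℕ) (n : ℤ) :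
    coeff μ (annihilateTerm q t ν 0 n) = 0 := by
  have : annihilatePow q ν 0 = 0 := by
    funext n μ
    change _ * coeff (μ + ν) (0 : MvPowerSeries ℕ+ ℂ) = 0
    rw [map_zero, mul_zero]
  rw [annihilateTerm, this, smul_zero]
  exact map_zero _

theorem vertexMinusConverges_zero : VertexMinusConverges s z 0 := fun n μ => by
  simp only [coeff_annihilateTerm_zero]
  exact summable_zero

theorem vertexMinus_zero : vertexMinus e s z 0 = 0 := by
  have : annihilateExp (s ^ 2) (coeffQ s z) 0 = 0 := by
    funext n μ
    change ∑' ν : ℕ+ →₀ ℕ, coeff μ (annihilateTerm _ _ ν 0 n) = 0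
    simp only [coeff_annihilateTerm_zero, tsum_zero]
  funext n
  rw [vertexMinus, this]
  change _ • (_ * (0 : MvPowerSeries ℕ+ ℂ)) = 0
  rw [mul_zero, smul_zero]

theorem currentMode_zero : currentMode e s 0 0 = 0 := by
  funext n μ
  simp only [currentMode, coeff_annihilateTerm_zero, finsum_zero, mul_zero, Finset.sum_const_zero]
  rfl

theorem vertexZero_zero : vertexZero e s z 0 = 0 := by
  rw [vertexZero, currentMode_zero, vertexMinus_zero, currentMode_zero, smul_zero, sub_zero]

theorem vertexPlus_zero : vertexPlus e s z 0 = 0 := by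
  rw [vertexPlus, currentMode_zero, vertexZero_zero, currentMode_zero, sub_zero, smul_zero]

theorem vertexConverges_zero (j : SignType) : VertexConverges e s j z 0 := by
  have h := vertexMinusConverges_zero s z
  have h0 : VertexZeroConverges e s z 0 := ⟨h, by rwa [currentMode_zero]⟩
  cases j
  · exact h0
  · exact h
  · exact ⟨h0, by rwa [currentMode_zero]⟩

theorem dualVertex_zero (j : SignType) : dualVertex e s j z 0 = 0 := by
  have : ∀ k ζ, vertex e s k ζ 0 = 0 := fun k ζ => by
    cases k
    · exact vertexZero_zero e s ζ
    · exact vertexMinus_zero e s ζ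
    · exact vertexPlus_zero e s ζ
  rw [dualVertex, this, smul_zero]

end Zero

/-! ### The transfer matrix as a sum of torus averages -/

/-- The boundary state as a ket. -/
theorem groundState_eq_ket (s : ℂ) (ε : SignType) :
    groundState s ε = ket s ε (Measure.dirac ()) (-1) (fun _ => 1) [] (fun _ => []) := by
  funext n
  refine MvPowerSeries.ext fun μ => ?_
  rw [groundState, expSeries_eq_gauss]
  change _ = (if n = -1 then _ else _ : ℂ)
  have h : stateShift s ε [] [] = linF s ε := by
    funext m
    simp [stateShift]
  rw [integral_dirac]
  simp only [h, one_mul, shift, highest, sub_neg_eq_add]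
  by_cases hn : n = -1
  · subst hn
    simp
  · have : n + 1 ≠ 0 := fun h => hn (by omega)
    rw [if_neg hn, Pi.single_eq_of_ne this, mul_zero, map_zero]

theorem isKet_groundState (s : ℂ) (ε : SignType) :
    IsKet s ε (Measure.dirac ()) (fun _ => 1) [] (fun _ => []) [] := by
  refine ⟨⟨integrable_const _, fun m => measurable_const, fun _ m => ?_⟩, fun _ => rfl⟩
  simp [stateShift, stateBound]

/-- The average of `G` over the torus of radii `r₁`, `r₂`. -/
noncomputable def torusAvg (G : ℂ → ℂ → ℂ) (r₁ r₂ : ℝ) : ℂ :=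
  ∫ p : ℝ × ℝ, G (circleMap 0 r₁ p.2) (circleMap 0 r₂ p.1) ∂(circ.prod circ)

theorem integral_dirac_prod_prod (g : ℝ → ℝ → ℂ) :
    ∫ p : (Unit × ℝ) × ℝ, g p.1.2 p.2 ∂(((Measure.dirac ()).prod circ).prod circ) =
      ∫ p : ℝ × ℝ, g p.1 p.2 ∂(circ.prod circ) := by
  have h := (measurePreserving_snd (μ := Measure.dirac ()) (ν := circ)).prod
    (MeasurePreserving.id circ)
  have he : MeasurableEmbedding (Prod.map (Prod.snd : Unit × ℝ → ℝ) (id : ℝ → ℝ)) :=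
    ((MeasurableEquiv.punitProd (α := ℝ)).prodCongr (MeasurableEquiv.refl ℝ)).measurableEmbedding
  exact h.integral_comp he fun p : ℝ × ℝ => g p.1 p.2

/-- The contractions of two currents with each other and with the boundary state. -/
noncomputable def currentPair (s : ℂ) (ε : SignType) (v₁ v₂ : ℂ) : ℂ :=
  currentSelf s ε v₁ * currentSelf s ε v₂ * currentCurrent s v₁ v₂

/-- The dual spectral parameter. -/
noncomputable def dualArg (s z : ℂ) : ℂ := -(s ^ 6)⁻¹ * z⁻¹

/-- The integrand of `Φ_-(z') Φ_+(z)`. -/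
noncomputable def plusIntegrand (s z v₁ v₂ : ℂ) : ℂ :=
  s ^ 8 * (v₁ * v₂) * plusKernel s z v₁ v₂ *
    (vertexCurrent s (dualArg s z) v₁ * vertexCurrent s (dualArg s z) v₂)

/-- The integrand of `Φ_0(z') Φ_0(z)`. -/
noncomputable def zeroIntegrand (s z v₁ v₂ : ℂ) : ℂ :=
  -s ^ 6 * (v₁ * v₂) * (zeroKernel s z v₂ * vertexCurrent s (dualArg s z) v₂) *
    (currentVertex s z v₁ * zeroKernel s (dualArg s z) v₁)

/-- The integrand of `Φ_+(z') Φ_-(z)`. -/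
noncomputable def minusIntegrand (s z v₁ v₂ : ℂ) : ℂ :=
  -(plusKernel s (dualArg s z) v₁ v₂ * (currentVertex s z v₁ * currentVertex s z v₂))

/-- The coefficients of the state with vertex operators at `z`, `z'` and two currents. -/
noncomputable def pairCoeff (s : ℂ) (ε : SignType) (z : ℂ) (μ : ℕ+ →₀ ℕ) (v₁ v₂ : ℂ) : ℂ :=
  coeff μ (gauss (quadF s) (stateShift s ε [dualArg s z, z] [v₁, v₂]))

/-- The scalar contractions of the two vertex operators. -/
noncomputable def transferScalar (s : ℂ) (ε : SignType) (z : ℂ) : ℂ :=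
  gConst s * (phi s ε z / phi s ε z⁻¹) * (phi s ε z⁻¹ * (phi s ε (dualArg s z)⁻¹ *
    (vertexKernel s (z / dualArg s z) * vertexKernel s (1 / (z * dualArg s z)))))

/-- The radii of the contours used for the transfer matrix. -/
structure RadiiAllowed (s : ℂ) (ε : SignType) (z : ℂ) (p₁ p₂ m₁ m₂ : ℝ) : Prop where
  lt_norm : ‖s‖ ^ 2 < ‖z‖
  sign_lt_norm : ‖(ε : ℂ) * Complex.I * s‖ < ‖z‖
  norm_lt : ‖s‖ ^ 4 * ‖z‖ < 1
  one_lt : 1 < p₂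
  sign_lt : ‖(ε : ℂ) * Complex.I / s‖ < p₂
  mul_norm_lt : ‖s‖ ^ 2 * ‖z‖ < p₂
  lt_norm_mul : ‖s‖ ^ 2 < ‖z‖ * p₂
  p_lt : p₂ < p₁
  p_lt_norm : ‖s‖ ^ 2 * p₁ < ‖z‖
  p_lt_m : p₁ < m₂
  one_lt_m : 1 < ‖s‖ ^ 4 * ‖z‖ * m₂
  m_lt : m₂ < m₁
  m_lt_norm : ‖s‖ ^ 8 * ‖z‖ * m₁ < 1

end IzerginKorepin

/-! ### Convergence conditions on the contours -/

namespace IzerginKorepin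

open MvPowerSeries Filter Topology MeasureTheory

section Radii

variable {s : ℂ} {ε : SignType} {z : ℂ} {p₁ p₂ m₁ m₂ : ℝ}

theorem norm_dualArg (s z : ℂ) : ‖dualArg s z‖ = 1 / (‖s‖ ^ 6 * ‖z‖) := by
  rw [dualArg, norm_mul, norm_neg, norm_inv, norm_inv, norm_pow, one_div, mul_inv]

theorem RadiiAllowed.pos (h : RadiiAllowed s ε z p₁ p₂ m₁ m₂) : 0 < ‖z‖ :=
  lt_of_le_of_lt (by positivity) h.lt_norm

theorem RadiiAllowed.vertexAllowed (h : RadiiAllowed s ε z p₁ p₂ m₁ m₂) {rs : List ℝ}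
    (hrs : ∀ r ∈ rs, p₂ ≤ r ∧ r ≤ p₁) : VertexAllowed s ε z [] rs := by
  have hz := h.pos
  refine ⟨norm_pos_iff.1 hz, ?_, ?_, by simp, by simp, by simp, fun r hr => ?_, fun r hr => ?_,
    fun r hr => ?_⟩
  · rw [mul_one_div, norm_div, norm_pow, norm_pow, div_lt_one (by positivity)]
    have := pow_lt_pow_left₀ h.lt_norm (by positivity) two_ne_zero
    linarith
  · rw [norm_div, div_lt_one hz]
    exact h.sign_lt_norm
  · exact zero_lt_one.trans (h.one_lt.trans_le (hrs r hr).1)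
  · exact lt_of_le_of_lt (mul_le_mul_of_nonneg_left (hrs r hr).2 (by positivity)) h.p_lt_norm
  · rw [mul_comm]
    exact lt_of_lt_of_le h.lt_norm_mul (mul_le_mul_of_nonneg_left (hrs r hr).1 hz.le)

theorem RadiiAllowed.dualArg_ne_zero (h : RadiiAllowed s ε z p₁ p₂ m₁ m₂) (hs0 : s ≠ 0) :
    dualArg s z ≠ 0 :=
  mul_ne_zero (neg_ne_zero.2 (inv_ne_zero (pow_ne_zero _ hs0)))
    (inv_ne_zero (norm_pos_iff.1 h.pos))

theorem mul_dualArg (hs0 : s ≠ 0) (hz : z ≠ 0) : z * dualArg s z = -(s ^ 6)⁻¹ := by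
  rw [dualArg]; field_simp

/-- The second vertex operator sits at `z' = -q⁻³ z⁻¹`. Its contractions with `Φ_-(z)` converge
because `q ^ 2 |z| < 1`, those with the currents because `q` times the largest radius is below
`|z'|`. -/
theorem RadiiAllowed.vertexAllowed_dual (h : RadiiAllowed s ε z p₁ p₂ m₁ m₂) (hs0 : s ≠ 0)
    (hs : ‖s‖ < 1) {rs : List ℝ} (hrs : ∀ r ∈ rs, p₂ ≤ r ∧ r ≤ m₁) :
    VertexAllowed s ε (dualArg s z) [z] rs := by
  have hz := h.pos
  have ht : 0 < ‖s‖ := norm_pos_iff.2 hs0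
  have hz0 := norm_pos_iff.1 hz
  have hd := h.dualArg_ne_zero hs0
  have hdn := norm_dualArg s z
  -- Indeed `|s| ^ 6 |z| ≤ |s| ^ 4 |z| < 1`.
  have hdn1 : 1 < ‖dualArg s z‖ := by
    rw [hdn, lt_div_iff₀ (by positivity), one_mul]
    refine lt_of_le_of_lt (mul_le_mul_of_nonneg_right ?_ hz.le) h.norm_lt
    exact pow_le_pow_of_le_one ht.le hs.le (by norm_num)
  have hr0 : ∀ r ∈ rs, 1 < r := fun r hr => h.one_lt.trans_le (hrs r hr).1
  have hs4 : ‖s‖ ^ 4 < 1 := pow_lt_one₀ ht.le hs (by norm_num)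
  have hs2 : ‖s‖ ^ 2 < 1 := pow_lt_one₀ ht.le hs (by norm_num)
  refine ⟨hd, ?_, ?_, by simpa using hz0, ?_, ?_, fun r hr => ?_, fun r hr => ?_, fun r hr => ?_⟩
  · rw [mul_one_div, norm_div, norm_pow, norm_pow, div_lt_one (by positivity)]
    exact hs4.trans (one_lt_pow₀ hdn1 two_ne_zero)
  · rw [norm_div, div_lt_one (by positivity)]
    refine lt_of_le_of_lt ?_ hdn1
    rw [norm_mul, norm_mul, Complex.norm_I, mul_one]
    refine mul_le_one₀ ?_ ht.le hs.le
    cases ε <;> simp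
  · simp only [List.mem_singleton, forall_eq]
    rw [norm_mul, norm_div, hdn, norm_pow, div_div_eq_mul_div, div_one]
    have h1 : ‖s‖ ^ 4 * (‖z‖ * (‖s‖ ^ 6 * ‖z‖)) = ‖s‖ ^ 2 * ((‖s‖ ^ 4 * ‖z‖) * (‖s‖ ^ 4 * ‖z‖)) := by
      ring
    rw [h1]
    have h2 : (‖s‖ ^ 4 * ‖z‖) * (‖s‖ ^ 4 * ‖z‖) < 1 :=
      mul_lt_one_of_nonneg_of_lt_one_left (by positivity) h.norm_lt h.norm_lt.le
    exact mul_lt_one_of_nonneg_of_lt_one_left (by positivity) hs2 h2.le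
  · simp only [List.mem_singleton, forall_eq]
    rw [mul_dualArg hs0 hz0, one_div, inv_neg, inv_inv, mul_neg, norm_neg, ← pow_add]
    exact norm_pow_lt_one hs (by norm_num)
  · exact zero_lt_one.trans (hr0 r hr)
  · rw [hdn, lt_div_iff₀ (by positivity)]
    refine lt_of_le_of_lt (le_of_eq (by ring)) ((mul_le_mul_of_nonneg_left (hrs r hr).2
      (by positivity : 0 ≤ ‖s‖ ^ 8 * ‖z‖)).trans_lt h.m_lt_norm)
  · exact hs2.trans (one_lt_mul_of_lt_of_le (hr0 r hr) hdn1.le)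

theorem RadiiAllowed.currentAllowed (h : RadiiAllowed s ε z p₁ p₂ m₁ m₂) {R : ℝ} {rs : List ℝ}
    (hR : p₂ ≤ R) (hrs : ∀ r ∈ rs, p₂ ≤ r ∧ r < R) : CurrentAllowed s ε R [z] rs := by
  have hz := h.pos
  refine ⟨h.one_lt.trans_le hR, h.sign_lt.trans_le hR, by simpa using norm_pos_iff.1 hz, ?_, ?_,
    fun r hr => h.one_lt.trans_le (hrs r hr).1, fun r hr => (hrs r hr).2⟩
  · simpa using h.mul_norm_lt.trans_le hR
  · simpa using h.lt_norm_mul.trans_le (mul_le_mul_of_nonneg_left hR hz.le)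

/-- A current to the left of `Φ_-(z')` needs a radius above `q |z'| = 1 / (q ^ 2 |z|)`, which is the
condition `one_lt_m`; hence the second pair of larger radii. -/
theorem RadiiAllowed.currentAllowed_dual (h : RadiiAllowed s ε z p₁ p₂ m₁ m₂) (hs0 : s ≠ 0)
    (hs : ‖s‖ < 1) {R : ℝ} {rs : List ℝ} (hR : m₂ ≤ R) (hrs : ∀ r ∈ rs, p₂ ≤ r ∧ r < R) :
    CurrentAllowed s ε R [dualArg s z, z] rs := by
  have hz := h.pos
  have ht : 0 < ‖s‖ := norm_pos_iff.2 hs0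
  have hp : p₂ ≤ R := (h.p_lt.trans h.p_lt_m).le.trans hR
  have hR1 := h.one_lt.trans_le hp
  have hR0 : 0 < R := zero_lt_one.trans hR1
  have k := h.currentAllowed hp hrs
  have hs2 : ‖s‖ ^ 2 < 1 := pow_lt_one₀ ht.le hs (by norm_num)
  refine ⟨k.one_lt, k.lt, ?_, ?_, ?_, k.one_lt_radius, k.radius_lt⟩
  · intro ζ hζ
    rcases List.mem_cons.1 hζ with rfl | hζ
    · exact h.dualArg_ne_zero hs0
    · exact k.vertex_ne_zero _ hζ
  · intro ζ hζ
    rcases List.mem_cons.1 hζ with rfl | hζ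
    · rw [norm_dualArg, mul_one_div, div_lt_iff₀ (by positivity)]
      have h1 : 1 < ‖s‖ ^ 4 * ‖z‖ * R :=
        h.one_lt_m.trans_le (mul_le_mul_of_nonneg_left hR (by positivity))
      have h2 := mul_lt_mul_of_pos_left h1 (by positivity : 0 < ‖s‖ ^ 2)
      linarith
    · exact k.vertex_lt _ hζ
  · intro ζ hζ
    rcases List.mem_cons.1 hζ with rfl | hζ
    · rw [norm_dualArg, one_div_mul_eq_div, lt_div_iff₀ (by positivity)]
      have h1 : ‖s‖ ^ 2 * (‖s‖ ^ 6 * ‖z‖) = ‖s‖ ^ 4 * (‖s‖ ^ 4 * ‖z‖) := by ring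
      rw [h1]
      refine lt_of_lt_of_le ?_ hR1.le
      exact mul_lt_one_of_nonneg_of_lt_one_left (by positivity)
        (pow_lt_one₀ ht.le hs (by norm_num)) h.norm_lt.le
    · exact k.vertex_lt' _ hζ

end Radii

/-! ### The diagonal terms of the transfer matrix -/

section Transfer

variable {s : ℂ} {ε : SignType} {z : ℂ} {p₁ p₂ m₁ m₂ : ℝ}

theorem ket_dirac_apply {f : (Unit × ℝ) × ℝ → ℂ} {Z : List ℂ} {r₁ r₂ : ℝ} {G : ℂ → ℂ → ℂ} {c : ℂ}
    (hf : ∀ p, f p = c * G (circleMap 0 r₁ p.2) (circleMap 0 r₂ p.1.2)) (n : ℤ) (μ : ℕ+ →₀ ℕ) :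
    ket s ε (((Measure.dirac ()).prod circ).prod circ) (-1) f Z
      (fun p => [circleMap 0 r₁ p.2, circleMap 0 r₂ p.1.2]) n μ =
    if n = -1 then c * torusAvg (fun v₁ v₂ => G v₁ v₂ *
      coeff μ (gauss (quadF s) (stateShift s ε Z [v₁, v₂]))) r₁ r₂ else 0 := by
  simp only [ket, gaussAvg]
  split_ifs with hn
  · rw [torusAvg, ← integral_const_mul, ← integral_dirac_prod_prod fun x y => c *
      (G (circleMap 0 r₁ y) (circleMap 0 r₂ x) * coeff μ (gauss (quadF s) (stateShift s ε Z
        [circleMap 0 r₁ y, circleMap 0 r₂ x])))]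
    simp only [hf, mul_assoc]
  · rfl

theorem vertexFactor_pair (ζ ζ' v₁ v₂ : ℂ) : vertexFactor s ε ζ [ζ'] [v₁, v₂] =
    phi s ε ζ⁻¹ * (vertexKernel s (ζ' / ζ) * vertexKernel s (1 / (ζ' * ζ))) *
      (vertexCurrent s ζ v₁ * vertexCurrent s ζ v₂) := by
  simp [vertexFactor]

/-- Both currents belong to `Φ_+(z)` and act before `Φ_-(z')`, so both use the small radii. The
constant `c` is a slot for the entry of the `K`-matrix; the factors `e⁻¹` of two vertex operators
cancel the factors `e` of two currents. -/
theorem dualVertex_pos_ket (hs0 : s ≠ 0) (hs : ‖s‖ < 1) {e : ℂ} (he : e ≠ 0)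
    (h : RadiiAllowed s ε z p₁ p₂ m₁ m₂) (c : ℂ) :
    VertexPlusConverges e s z (groundState s ε) ∧
    VertexMinusConverges s (dualArg s z) (c • vertexPlus e s z (groundState s ε)) ∧
    ∀ n μ, ((-s) • vertexMinus e s (dualArg s z) (c • vertexPlus e s z (groundState s ε))) n μ =
      if n = -1 then c * (phi s ε z⁻¹ * (phi s ε (dualArg s z)⁻¹ *
        (vertexKernel s (z / dualArg s z) * vertexKernel s (1 / (z * dualArg s z))))) *
        torusAvg (fun v₁ v₂ => currentPair s ε v₁ v₂ * plusIntegrand s z v₁ v₂ *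
          pairCoeff s ε z μ v₁ v₂) p₁ p₂ else 0 := by
  have hz := norm_pos_iff.1 h.pos
  rw [groundState_eq_ket]
  obtain ⟨a1, a2, a3⟩ := (isKet_groundState s ε).vertexPlus hs0 hs he (R₁ := p₁) (R₂ := p₂)
    (h.vertexAllowed (by simp [h.p_lt.le])) (h.currentAllowed le_rfl (by simp))
    (h.currentAllowed h.p_lt.le (by simp [h.p_lt])) (-1)
  have hm := h.p_lt_m.trans h.m_lt
  obtain ⟨b1, b2, b3⟩ := (a3.const_mul c).vertexMinus hs0 hs e
    (h.vertexAllowed_dual hs0 hs (by simp [h.p_lt.le, hm.le, (h.p_lt.trans hm).le])) (-1 - 1)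
  rw [a2, smul_ket]
  refine ⟨a1, b1, fun n μ => ?_⟩
  rw [b2, smul_ket]
  refine ket_dirac_apply (fun p => ?_) n μ
  have hp0 := zero_lt_one.trans h.one_lt
  have hv1 : circleMap 0 p₁ p.2 ≠ 0 := circleMap_ne_center (hp0.trans h.p_lt).ne'
  have hv2 : circleMap 0 p₂ p.1.2 ≠ 0 := circleMap_ne_center hp0.ne'
  generalize circleMap 0 p₁ p.2 = v₁ at *
  generalize circleMap 0 p₂ p.1.2 = v₂ at *
  rw [vertexFactor_pair, plusFactor, plusIntegrand, currentPair]
  simp only [vertexFactor, currentFactor, List.map_nil, List.prod_nil, List.map_cons,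
    List.prod_cons, mul_one]
  rw [show (-1 - 1 + 1 : ℤ) = -1 by norm_num, zpow_neg_one, zpow_neg_one, inv_div]
  generalize vertexKernel s (z / dualArg s z) * vertexKernel s (1 / (z * dualArg s z)) = X
  generalize plusKernel s z v₁ v₂ = Y
  generalize vertexCurrent s (dualArg s z) v₁ * vertexCurrent s (dualArg s z) v₂ = Y'
  generalize phi s ε (dualArg s z)⁻¹ = Y''
  rw [dualArg]
  field_simp

-- One current belongs to `Φ_0(z)`, on a small circle, and one to `Φ_0(z')`, on a large circle.
set_option maxHeartbeats 1000000 in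
theorem dualVertex_zero_ket (hs0 : s ≠ 0) (hs : ‖s‖ < 1) {e : ℂ} (he : e ≠ 0)
    (h : RadiiAllowed s ε z p₁ p₂ m₁ m₂) (c : ℂ) :
    VertexZeroConverges e s z (groundState s ε) ∧
    VertexZeroConverges e s (dualArg s z) (c • vertexZero e s z (groundState s ε)) ∧
    ∀ n μ, (vertexZero e s (dualArg s z) (c • vertexZero e s z (groundState s ε))) n μ =
      if n = -1 then c * (phi s ε z⁻¹ * (phi s ε (dualArg s z)⁻¹ *
        (vertexKernel s (z / dualArg s z) * vertexKernel s (1 / (z * dualArg s z))))) *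
        torusAvg (fun v₁ v₂ => currentPair s ε v₁ v₂ * zeroIntegrand s z v₁ v₂ *
          pairCoeff s ε z μ v₁ v₂) m₁ p₂ else 0 := by
  have hz := norm_pos_iff.1 h.pos
  have hm := h.p_lt_m.trans h.m_lt
  rw [groundState_eq_ket]
  obtain ⟨a1, a2, a3⟩ := (isKet_groundState s ε).vertexZero hs0 hs he (R := p₂)
    (h.vertexAllowed (by simp [h.p_lt.le])) (h.currentAllowed le_rfl (by simp)) (-1)
  obtain ⟨b1, b2, b3⟩ := (a3.const_mul c).vertexZero hs0 hs he (R := m₁)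
    (h.vertexAllowed_dual hs0 hs (by simp [(h.p_lt.trans hm).le]))
    (h.currentAllowed_dual hs0 hs h.m_lt.le (by simp [h.p_lt.trans hm])) (-1)
  rw [a2, smul_ket]
  refine ⟨a1, b1, fun n μ => ?_⟩
  rw [b2]
  refine ket_dirac_apply (fun p => ?_) n μ
  have hp0 := zero_lt_one.trans h.one_lt
  have hv1 : circleMap 0 m₁ p.2 ≠ 0 := circleMap_ne_center (hp0.trans (h.p_lt.trans hm)).ne'
  have hv2 : circleMap 0 p₂ p.1.2 ≠ 0 := circleMap_ne_center hp0.ne'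
  generalize circleMap 0 m₁ p.2 = v₁ at *
  generalize circleMap 0 p₂ p.1.2 = v₂ at *
  simp only [zeroFactor, zeroIntegrand, currentPair, vertexFactor, currentFactor, List.map_nil,
    List.prod_nil, List.map_cons, List.prod_cons, mul_one]
  rw [zpow_neg_one, zpow_neg_one, inv_div, inv_div]
  generalize vertexKernel s (z / dualArg s z) * vertexKernel s (1 / (z * dualArg s z)) = X
  generalize zeroKernel s z v₂ = Y
  generalize zeroKernel s (dualArg s z) v₁ = Y₁
  generalize vertexCurrent s (dualArg s z) v₂ = Y'
  generalize phi s ε (dualArg s z)⁻¹ = Y''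
  generalize currentVertex s z v₁ = Y₂
  generalize currentSelf s ε v₁ = Y₃
  generalize currentSelf s ε v₂ = Y₄
  generalize currentCurrent s v₁ v₂ = Y₅
  have hd : v₂ / -z * (v₁ / -dualArg s z) = -s ^ 6 * (v₁ * v₂) := by
    rw [dualArg]; field_simp
  linear_combination (c * phi s ε z⁻¹ * Y₄ * Y * Y'' * X * Y' * Y₃ * Y₂ * Y₅ * Y₁) * hd

/-- Both currents belong to `Φ_+(z')` and need the large radii. -/
theorem dualVertex_neg_ket (hs0 : s ≠ 0) (hs : ‖s‖ < 1) {e : ℂ} (he : e ≠ 0)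
    (h : RadiiAllowed s ε z p₁ p₂ m₁ m₂) (c : ℂ) :
    VertexMinusConverges s z (groundState s ε) ∧
    VertexPlusConverges e s (dualArg s z) (c • vertexMinus e s z (groundState s ε)) ∧
    ∀ n μ, ((-s)⁻¹ • vertexPlus e s (dualArg s z)
        (c • vertexMinus e s z (groundState s ε))) n μ =
      if n = -1 then c * (phi s ε z⁻¹ * (phi s ε (dualArg s z)⁻¹ *
        (vertexKernel s (z / dualArg s z) * vertexKernel s (1 / (z * dualArg s z))))) *
        torusAvg (fun v₁ v₂ => currentPair s ε v₁ v₂ * minusIntegrand s z v₁ v₂ *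
          pairCoeff s ε z μ v₁ v₂) m₁ m₂ else 0 := by
  have hz := norm_pos_iff.1 h.pos
  have hm := h.p_lt.trans h.p_lt_m
  rw [groundState_eq_ket]
  obtain ⟨a1, a2, a3⟩ := (isKet_groundState s ε).vertexMinus hs0 hs e
    (h.vertexAllowed (by simp)) (-1)
  obtain ⟨b1, b2, b3⟩ := (a3.const_mul c).vertexPlus hs0 hs he (R₁ := m₁) (R₂ := m₂)
    (h.vertexAllowed_dual hs0 hs (by simp [hm.le, h.m_lt.le, (hm.trans h.m_lt).le]))
    (h.currentAllowed_dual hs0 hs le_rfl (by simp))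
    (h.currentAllowed_dual hs0 hs h.m_lt.le (by simp [h.m_lt, hm.le])) (-1 + 1)
  rw [a2, smul_ket]
  refine ⟨a1, b1, fun n μ => ?_⟩
  rw [b2, smul_ket]
  refine ket_dirac_apply (fun p => ?_) n μ
  simp only [plusFactor, minusIntegrand, currentPair, vertexFactor, currentFactor, List.map_nil,
    List.prod_nil, List.map_cons, List.prod_cons, mul_one, neg_add_cancel, zpow_zero]
  generalize vertexKernel s (z / dualArg s z) * vertexKernel s (1 / (z * dualArg s z)) = X
  generalize plusKernel s _ _ _ = Y
  field_simp

/-- The transfer matrix on the boundary state, as a combination of torus averages. -/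
theorem transfer_groundState (hs0 : s ≠ 0) (hs : ‖s‖ < 1) {e : ℂ} (he : e ≠ 0)
    (h : RadiiAllowed s ε z p₁ p₂ m₁ m₂) :
    TransferConverges e s ε z (groundState s ε) ∧
    ∀ n μ, transfer e s ε z (groundState s ε) n μ =
      if n = -1 then transferScalar s ε z *
        (kDiag s ε z 1 * torusAvg (fun v₁ v₂ => currentPair s ε v₁ v₂ * plusIntegrand s z v₁ v₂ *
            pairCoeff s ε z μ v₁ v₂) p₁ p₂ +
          kDiag s ε z 0 * torusAvg (fun v₁ v₂ => currentPair s ε v₁ v₂ * zeroIntegrand s z v₁ v₂ *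
            pairCoeff s ε z μ v₁ v₂) m₁ p₂ +
          kDiag s ε z (-1) * torusAvg (fun v₁ v₂ => currentPair s ε v₁ v₂ *
            minusIntegrand s z v₁ v₂ * pairCoeff s ε z μ v₁ v₂) m₁ m₂) else 0 := by
  have hp := fun c => dualVertex_pos_ket hs0 hs he h c
  have h0 := fun c => dualVertex_zero_ket hs0 hs he h c
  have hn := fun c => dualVertex_neg_ket hs0 hs he h c
  have hoff : ∀ j k, j ≠ k → kMatrix s ε z j k = 0 := fun j k hjk => by
    rw [kMatrix, Matrix.smul_apply, Matrix.diagonal_apply_ne _ hjk, smul_zero]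
  have hdiag : ∀ j, kMatrix s ε z j j = phi s ε z / phi s ε z⁻¹ * kDiag s ε z j := fun j => by
    rw [kMatrix, Matrix.smul_apply, Matrix.diagonal_apply_eq, smul_eq_mul]
  refine ⟨⟨fun k => ?_, fun j k => ?_⟩, fun n μ => ?_⟩
  · cases k
    · exact (h0 0).1
    · exact (hn 0).1
    · exact (hp 0).1
  · by_cases hjk : j = k
    · subst hjk
      cases j
      · exact (h0 _).2.1
      · exact (hn _).2.1
      · exact (hp _).2.1
    · rw [hoff j k hjk, zero_smul]
      exact vertexConverges_zero _ _ _ _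
  · have hsum : ∀ j, ∑ k, dualVertex e s j z⁻¹ (kMatrix s ε z j k • vertex e s k z
        (groundState s ε)) = dualVertex e s j z⁻¹ ((phi s ε z / phi s ε z⁻¹ * kDiag s ε z j) •
          vertex e s j z (groundState s ε)) := fun j => by
      rw [Finset.sum_eq_single j, hdiag]
      · intro k _ hkj
        rw [hoff j k hkj.symm, zero_smul, dualVertex_zero]
      · simp
    rw [transfer]
    simp only [hsum]
    have huniv : (Finset.univ : Finset SignType) = {1, 0, -1} := by decide
    rw [huniv, Finset.sum_insert (by decide), Finset.sum_insert (by decide),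
      Finset.sum_singleton]
    have e1 : ∀ v, dualVertex e s 1 z⁻¹ v = (-s) • vertexMinus e s (dualArg s z) v := fun v => by
      rw [dualVertex]
      simp only [SignType.coe_one, zpow_one]
      rfl
    have e2 : ∀ v, dualVertex e s 0 z⁻¹ v = vertexZero e s (dualArg s z) v := fun v => by
      rw [dualVertex]
      simp only [SignType.coe_zero, zpow_zero, one_smul]
      rfl
    have e3 : ∀ v, dualVertex e s (-1) z⁻¹ v = (-s)⁻¹ • vertexPlus e s (dualArg s z) v := fun v => by
      rw [dualVertex]
      simp only [SignType.coe_neg_one, zpow_neg_one]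
      rfl
    rw [e1, e2, e3]
    change gConst s * (((-s) • vertexMinus e s (dualArg s z) (_ • vertexPlus e s z _)) n μ +
      ((vertexZero e s (dualArg s z) (_ • vertexZero e s z _)) n μ +
        ((-s)⁻¹ • vertexPlus e s (dualArg s z) (_ • vertexMinus e s z _)) n μ)) = _
    rw [(hp _).2.2, (h0 _).2.2, (hn _).2.2]
    split_ifs
    · rw [transferScalar]; ring
    · ring

end Transfer

end IzerginKorepin

namespace IzerginKorepin

open Filter Topology MeasureTheory Metric

/-! ### Contour shifts -/

/-- The closed annulus around the origin. -/
def annulus (r R : ℝ) : Set ℂ := {v | r ≤ ‖v‖ ∧ ‖v‖ ≤ R}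

theorem annulus_eq (r R : ℝ) : annulus r R = closedBall 0 R \ ball 0 r := by
  ext v
  simp [annulus, and_comm]

theorem sphere_subset_annulus {r R ρ : ℝ} (h1 : r ≤ ρ) (h2 : ρ ≤ R) :
    sphere (0 : ℂ) ρ ⊆ annulus r R := fun v hv => by
  rw [mem_sphere_zero_iff_norm] at hv
  exact ⟨hv ▸ h1, hv ▸ h2⟩

theorem circleMap_mem_sphere_zero {r : ℝ} (hr : 0 < r) (θ : ℝ) :
    circleMap 0 r θ ∈ sphere (0 : ℂ) r := circleMap_mem_sphere 0 hr.le θ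

theorem circleAverage_annulus_of_continuousOn {f : ℂ → ℂ} {r R : ℝ} (hr : 0 < r) (hrR : r ≤ R)
    {S : Set ℂ} (hS : S.Countable) (hc : ContinuousOn f (annulus r R))
    (hd : ∀ v ∈ annulus r R \ S, DifferentiableAt ℂ f v) :
    Real.circleAverage f 0 R = Real.circleAverage f 0 r := by
  rw [Real.circleAverage_eq_circleIntegral (hr.trans_le hrR).ne',
    Real.circleAverage_eq_circleIntegral hr.ne',
    Complex.circleIntegral_sub_center_inv_smul_eq_of_differentiable_on_annulus_off_countable hr hrR
      hS (by rwa [← annulus_eq]) fun v hv => hd v ⟨?_, hv.2⟩]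
  rw [annulus_eq]
  exact ⟨ball_subset_closedBall hv.1.1, fun h => hv.1.2 (ball_subset_closedBall h)⟩

theorem circleAverage_shift {f : ℂ → ℂ} {r R : ℝ} (hr : 0 < r) (hrR : r ≤ R)
    (hd : ∀ v ∈ annulus r R, DifferentiableAt ℂ f v) :
    Real.circleAverage f 0 R = Real.circleAverage f 0 r :=
  circleAverage_annulus_of_continuousOn hr hrR Set.countable_empty
    (fun v hv => (hd v hv).continuousAt.continuousWithinAt) fun v hv => hd v hv.1

theorem circleIntegrable_of_differentiableAt {f : ℂ → ℂ} {r : ℝ} (hr : 0 < r)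
    (hd : ∀ v ∈ sphere (0 : ℂ) r, DifferentiableAt ℂ f v) : CircleIntegrable f 0 r :=
  ContinuousOn.circleIntegrable hr.le fun v hv => (hd v hv).continuousAt.continuousWithinAt

theorem circleAverage_div_sub_of_lt {p : ℂ} {R : ℝ} (h : ‖p‖ < R) :
    Real.circleAverage (fun v => v / (v - p)) 0 R = 1 := by
  have hR : 0 < R := (norm_nonneg p).trans_lt h
  rw [Real.circleAverage_eq_circleIntegral hR.ne']
  have h1 : ∮ v in C(0, R), (v - 0)⁻¹ • (v / (v - p)) = ∮ v in C(0, R), (v - p)⁻¹ := by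
    refine circleIntegral.integral_congr hR.le fun v hv => ?_
    have hv0 : v ≠ 0 := norm_pos_iff.1 (by rw [mem_sphere_zero_iff_norm.1 hv]; exact hR)
    simp only [sub_zero, smul_eq_mul]
    field_simp
  rw [h1, circleIntegral.integral_sub_inv_of_mem_ball (by simpa using h), smul_eq_mul,
    inv_mul_cancel₀ Complex.two_pi_I_ne_zero]

theorem circleAverage_div_sub_of_gt {p : ℂ} {r : ℝ} (hr : 0 < r) (h : r < ‖p‖) :
    Real.circleAverage (fun v => v / (v - p)) 0 r = 0 := by
  have hne : ∀ v ∈ closedBall (0 : ℂ) |r|, v - p ≠ 0 := fun v hv h0 => by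
    rw [abs_of_pos hr, mem_closedBall_zero_iff, sub_eq_zero.1 h0] at hv
    exact absurd hv (not_le.2 h)
  have hd : ∀ v ∈ closedBall (0 : ℂ) |r|, DifferentiableAt ℂ (fun v => v / (v - p)) v :=
    fun v hv => by have := hne v hv; fun_prop (disch := assumption)
  rw [circleAverage_of_differentiable_on_off_countable Set.countable_empty
    (fun v hv => (hd v hv).continuousAt.continuousWithinAt)
    fun v hv => hd v (ball_subset_closedBall hv.1), zero_div]

/-- A circle average is the integral against `dv / (2 π i v)`. The pole is written as `v / (v - p)`
so that crossing it adds exactly `g p`. -/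
theorem circleAverage_residue {g : ℂ → ℂ} {p : ℂ} {r R : ℝ} (hr : 0 < r) (hrp : r < ‖p‖)
    (hpR : ‖p‖ < R) (hd : ∀ v ∈ annulus r R, DifferentiableAt ℂ g v) :
    Real.circleAverage (fun v => g v * (v / (v - p))) 0 R =
      Real.circleAverage (fun v => g v * (v / (v - p))) 0 r + g p := by
  have hR : 0 < R := (norm_nonneg p).trans_lt hpR
  have hrR : r ≤ R := (hrp.trans hpR).le
  have hp : p ∈ annulus r R := ⟨hrp.le, hpR.le⟩
  -- Split `g v = (v - p) * dslope g p v + g p`. The first part cancels the pole and its average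
  -- does not depend on the radius; the second is `v / (v - p)`, with average `1` outside and `0`
  -- inside.
  have hne : ∀ v ∈ annulus r R \ {p}, DifferentiableAt ℂ (fun v => v * dslope g p v) v :=
    fun v hv => differentiableAt_id.mul ((differentiableAt_dslope_of_ne hv.2).2 (hd v hv.1))
  have hc : ContinuousOn (fun v => v * dslope g p v) (annulus r R) := fun v hv => by
    refine ContinuousAt.continuousWithinAt ?_
    by_cases hvp : v = p
    · subst hvp
      exact continuousAt_id.mul (continuousAt_dslope_same.2 (hd v hv))
    · exact (hne v ⟨hv, hvp⟩).continuousAt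
  have h1 := circleAverage_annulus_of_continuousOn hr hrR (Set.countable_singleton p) hc hne
  have key : ∀ ρ, 0 < ρ → ρ ≠ ‖p‖ → r ≤ ρ → ρ ≤ R →
      Real.circleAverage (fun v => g v * (v / (v - p))) 0 ρ =
        Real.circleAverage (fun v => v * dslope g p v) 0 ρ +
          g p * Real.circleAverage (fun v => v / (v - p)) 0 ρ := by
    intro ρ hρ hρp h2 h3
    have hsub := sphere_subset_annulus h2 h3
    have hvp : ∀ v ∈ sphere (0 : ℂ) ρ, v ≠ p := fun v hv h => by
      rw [mem_sphere_zero_iff_norm, h] at hv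
      exact hρp hv.symm
    have i1 : CircleIntegrable (fun v => v * dslope g p v) 0 ρ :=
      circleIntegrable_of_differentiableAt hρ fun v hv => hne v ⟨hsub hv, hvp v hv⟩
    have i2 : CircleIntegrable (fun v => g p • (v / (v - p))) 0 ρ :=
      circleIntegrable_of_differentiableAt hρ fun v hv => by
        have := sub_ne_zero.2 (hvp v hv)
        fun_prop (disch := assumption)
    rw [← smul_eq_mul (g p), ← Real.circleAverage_fun_smul, ← Real.circleAverage_fun_add i1 i2]
    refine Real.circleAverage_congr_sphere fun v hv => ?_
    rw [abs_of_pos hρ] at hv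
    have h4 := hvp v hv
    have h5 := sub_ne_zero.2 h4
    simp only [dslope_of_ne g h4, slope_def_field, smul_eq_mul]
    field_simp
    ring
  rw [key R hR hpR.ne' hrR le_rfl, key r hr hrp.ne le_rfl hrR, h1, circleAverage_div_sub_of_lt hpR,
    circleAverage_div_sub_of_gt hr hrp]
  ring

/-- Joint holomorphy of `g` at the points of `A × B`. -/
def HolOn (g : ℂ → ℂ → ℂ) (A B : Set ℂ) : Prop :=
  ∀ a ∈ A, ∀ b ∈ B, DifferentiableAt ℂ (fun x : ℂ × ℂ => g x.1 x.2) (a, b)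

theorem HolOn.mono {g : ℂ → ℂ → ℂ} {A B A' B' : Set ℂ} (h : HolOn g A B) (hA : A' ⊆ A)
    (hB : B' ⊆ B) : HolOn g A' B' := fun a ha b hb => h a (hA ha) b (hB hb)

theorem HolOn.left {g : ℂ → ℂ → ℂ} {A B : Set ℂ} (h : HolOn g A B) {a b : ℂ} (ha : a ∈ A)
    (hb : b ∈ B) : DifferentiableAt ℂ (fun a => g a b) a :=
  DifferentiableAt.comp (g := fun x : ℂ × ℂ => g x.1 x.2) (f := fun a => (a, b)) a (h a ha b hb)
    (by fun_prop)

theorem HolOn.right {g : ℂ → ℂ → ℂ} {A B : Set ℂ} (h : HolOn g A B) {a b : ℂ} (ha : a ∈ A)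
    (hb : b ∈ B) : DifferentiableAt ℂ (fun b => g a b) b :=
  DifferentiableAt.comp (g := fun x : ℂ × ℂ => g x.1 x.2) (f := fun b => (a, b)) b (h a ha b hb)
    (by fun_prop)

theorem HolOn.swap {g : ℂ → ℂ → ℂ} {A B : Set ℂ} (h : HolOn g A B) :
    HolOn (fun a b => g b a) B A := fun a ha b hb =>
  DifferentiableAt.comp (g := fun x : ℂ × ℂ => g x.1 x.2) (f := fun x : ℂ × ℂ => (x.2, x.1)) (a, b)
    (h b hb a ha) (by fun_prop)

theorem HolOn.integrable {G : ℂ → ℂ → ℂ} {r₁ r₂ : ℝ} (h₁ : 0 < r₁) (h₂ : 0 < r₂)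
    (h : HolOn G (sphere 0 r₁) (sphere 0 r₂)) :
    Integrable (fun p : ℝ × ℝ => G (circleMap 0 r₁ p.2) (circleMap 0 r₂ p.1)) (circ.prod circ) := by
  have hc : Continuous fun p : ℝ × ℝ => G (circleMap 0 r₁ p.2) (circleMap 0 r₂ p.1) := by
    rw [continuous_iff_continuousAt]
    intro p
    refine ContinuousAt.comp (g := fun x : ℂ × ℂ => G x.1 x.2)
      (f := fun p : ℝ × ℝ => (circleMap 0 r₁ p.2, circleMap 0 r₂ p.1))
      (h _ (circleMap_mem_sphere_zero h₁ p.2) _ (circleMap_mem_sphere_zero h₂ p.1)).continuousAt ?_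
    fun_prop
  have hK : IsCompact (sphere (0 : ℂ) r₁ ×ˢ sphere (0 : ℂ) r₂) :=
    (isCompact_sphere _ _).prod (isCompact_sphere _ _)
  obtain ⟨C, hC⟩ := hK.exists_bound_of_continuousOn (f := fun x : ℂ × ℂ => G x.1 x.2)
    fun x hx => (h x.1 hx.1 x.2 hx.2).continuousAt.continuousWithinAt
  refine Integrable.of_bound hc.aestronglyMeasurable C (Eventually.of_forall fun p => ?_)
  exact hC (_, _) ⟨circleMap_mem_sphere_zero h₁ p.2, circleMap_mem_sphere_zero h₂ p.1⟩

theorem torusAvg_eq {G : ℂ → ℂ → ℂ} {r₁ r₂ : ℝ} (h₁ : 0 < r₁) (h₂ : 0 < r₂)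
    (h : HolOn G (sphere 0 r₁) (sphere 0 r₂)) :
    torusAvg G r₁ r₂ =
      Real.circleAverage (fun b => Real.circleAverage (fun a => G a b) 0 r₁) 0 r₂ := by
  rw [torusAvg, integral_prod _ (h.integrable h₁ h₂), ← integral_circ]
  simp only [← integral_circ]

theorem torusAvg_swap (G : ℂ → ℂ → ℂ) (r₁ r₂ : ℝ) :
    torusAvg G r₁ r₂ = torusAvg (fun a b => G b a) r₂ r₁ := by
  rw [torusAvg, torusAvg, ← integral_prod_swap]
  rfl

theorem torusAvg_congr {G G' : ℂ → ℂ → ℂ} {r₁ r₂ : ℝ} (h₁ : 0 < r₁) (h₂ : 0 < r₂)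
    (h : ∀ a ∈ sphere (0 : ℂ) r₁, ∀ b ∈ sphere (0 : ℂ) r₂, G a b = G' a b) :
    torusAvg G r₁ r₂ = torusAvg G' r₁ r₂ := by
  unfold torusAvg
  congr 1
  funext p
  exact h _ (circleMap_mem_sphere_zero h₁ p.2) _ (circleMap_mem_sphere_zero h₂ p.1)

theorem torusAvg_add {G G' : ℂ → ℂ → ℂ} {r₁ r₂ : ℝ} (h₁ : 0 < r₁) (h₂ : 0 < r₂)
    (h : HolOn G (sphere 0 r₁) (sphere 0 r₂)) (h' : HolOn G' (sphere 0 r₁) (sphere 0 r₂)) :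
    torusAvg (fun a b => G a b + G' a b) r₁ r₂ = torusAvg G r₁ r₂ + torusAvg G' r₁ r₂ :=
  integral_add (h.integrable h₁ h₂) (h'.integrable h₁ h₂)

theorem torusAvg_const_mul (c : ℂ) (G : ℂ → ℂ → ℂ) (r₁ r₂ : ℝ) :
    torusAvg (fun a b => c * G a b) r₁ r₂ = c * torusAvg G r₁ r₂ :=
  integral_const_mul _ _

theorem torusAvg_shift_left {G : ℂ → ℂ → ℂ} {r R r₂ : ℝ} (hr : 0 < r) (hrR : r ≤ R) (h₂ : 0 < r₂)
    (h : HolOn G (annulus r R) (sphere 0 r₂)) : torusAvg G R r₂ = torusAvg G r r₂ := by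
  have hR := hr.trans_le hrR
  rw [torusAvg_eq hR h₂ (h.mono (sphere_subset_annulus hrR le_rfl) subset_rfl),
    torusAvg_eq hr h₂ (h.mono (sphere_subset_annulus le_rfl hrR) subset_rfl)]
  refine Real.circleAverage_congr_sphere fun b hb => ?_
  rw [abs_of_pos h₂] at hb
  exact circleAverage_shift hr hrR fun a ha => h.left ha hb

theorem torusAvg_shift_right {G : ℂ → ℂ → ℂ} {r R r₁ : ℝ} (hr : 0 < r) (hrR : r ≤ R) (h₁ : 0 < r₁)
    (h : HolOn G (sphere 0 r₁) (annulus r R)) : torusAvg G r₁ R = torusAvg G r₁ r := by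
  rw [torusAvg_swap, torusAvg_swap G r₁ r]
  exact torusAvg_shift_left hr hrR h₁ h.swap

/-- The residue formula in one variable under the average over the other. The values of `G` at the
pole itself are irrelevant, as neither bounding circle passes through it. -/
theorem torusAvg_residue_left {G g : ℂ → ℂ → ℂ} {p : ℂ} {r R r₂ : ℝ} (hr : 0 < r) (hrp : r < ‖p‖)
    (hpR : ‖p‖ < R) (h₂ : 0 < r₂) (h : HolOn g (annulus r R) (sphere 0 r₂))
    (hG : ∀ a ∈ annulus r R, a ≠ p → ∀ b ∈ sphere (0 : ℂ) r₂, G a b = g a b * (a / (a - p))) :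
    torusAvg G R r₂ = torusAvg G r r₂ + Real.circleAverage (fun b => g p b) 0 r₂ := by
  have hrR : r ≤ R := (hrp.trans hpR).le
  have hR := hr.trans_le hrR
  have hp : p ∈ annulus r R := ⟨hrp.le, hpR.le⟩
  have hne : ∀ {ρ : ℝ}, ρ ≠ ‖p‖ → ∀ a ∈ sphere (0 : ℂ) ρ, a ≠ p := fun hρ a ha h => by
    rw [mem_sphere_zero_iff_norm, h] at ha
    exact hρ ha.symm
  have hsph : ∀ {ρ : ℝ}, 0 < ρ → ρ ≠ ‖p‖ → r ≤ ρ → ρ ≤ R →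
      torusAvg G ρ r₂ = Real.circleAverage (fun b => Real.circleAverage (fun a =>
        g a b * (a / (a - p))) 0 ρ) 0 r₂ ∧ CircleIntegrable (fun b => Real.circleAverage (fun a =>
        g a b * (a / (a - p))) 0 ρ) 0 r₂ := fun {ρ} hρ hρp h3 h4 => by
    have hh : HolOn (fun a b => g a b * (a / (a - p))) (sphere 0 ρ) (sphere 0 r₂) :=
      fun a ha b hb => by
        have h5 := h a (sphere_subset_annulus h3 h4 ha) b hb
        have h6 := sub_ne_zero.2 (hne hρp a ha)
        fun_prop (disch := assumption)
    refine ⟨?_, ?_⟩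
    · rw [← torusAvg_eq hρ h₂ hh]
      exact torusAvg_congr hρ h₂ fun a ha b hb =>
        hG a (sphere_subset_annulus h3 h4 ha) (hne hρp a ha) b hb
    · have h7 := (hh.integrable hρ h₂).integral_prod_left
      have h9 : ∀ x, ∫ y, g (circleMap 0 ρ y) (circleMap 0 r₂ x) * (circleMap 0 ρ y /
          (circleMap 0 ρ y - p)) ∂circ = Real.circleAverage (fun a =>
            g a (circleMap 0 r₂ x) * (a / (a - p))) 0 ρ := fun x =>
        integral_circ (fun a => g a (circleMap 0 r₂ x) * (a / (a - p))) ρ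
      simp only [h9] at h7
      rw [CircleIntegrable, intervalIntegrable_iff_integrableOn_Ioc_of_le (by positivity)]
      have h8 : ENNReal.ofReal (2 * Real.pi) ≠ 0 := by simpa using Real.pi_pos
      rw [circ, integrable_smul_measure (ENNReal.inv_ne_zero.2 ENNReal.ofReal_ne_top)
        (ENNReal.inv_ne_top.2 h8)] at h7
      exact h7
  have e1 := hsph hR hpR.ne' hrR le_rfl
  have e2 := hsph hr hrp.ne le_rfl hrR
  rw [e1.1, e2.1, ← Real.circleAverage_fun_add e2.2
    (circleIntegrable_of_differentiableAt h₂ fun b hb => h.right hp hb)]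
  refine Real.circleAverage_congr_sphere fun b hb => ?_
  rw [abs_of_pos h₂] at hb
  exact circleAverage_residue hr hrp hpR fun a ha => h.left ha hb

theorem torusAvg_residue_right {G g : ℂ → ℂ → ℂ} {p : ℂ} {r R r₁ : ℝ} (hr : 0 < r) (hrp : r < ‖p‖)
    (hpR : ‖p‖ < R) (h₁ : 0 < r₁) (h : HolOn g (sphere 0 r₁) (annulus r R))
    (hG : ∀ a ∈ sphere (0 : ℂ) r₁, ∀ b ∈ annulus r R, b ≠ p → G a b = g a b * (b / (b - p))) :
    torusAvg G r₁ R = torusAvg G r₁ r + Real.circleAverage (fun a => g a p) 0 r₁ := by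
  rw [torusAvg_swap, torusAvg_swap G r₁ r]
  exact torusAvg_residue_left hr hrp hpR h₁ h.swap fun b hb hbp a ha => hG a ha b hb hbp

theorem torusAvg_eq_zero_of_antisymm {G : ℂ → ℂ → ℂ} {r : ℝ} (hr : 0 < r)
    (h : HolOn G (sphere 0 r) (sphere 0 r))
    (hG : ∀ a ∈ sphere (0 : ℂ) r, ∀ b ∈ sphere (0 : ℂ) r, G a b + G b a = 0) :
    torusAvg G r r = 0 := by
  have h1 := torusAvg_add hr hr h h.swap
  rw [torusAvg_congr hr hr (G' := fun _ _ => 0) hG] at h1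
  have h2 : torusAvg (fun _ _ => 0) r r = 0 := by simp [torusAvg]
  rw [h2] at h1
  linear_combination -h1 / 2 + torusAvg_swap G r r / 2

theorem circleAverage_inv (f : ℂ → ℂ) :
    Real.circleAverage (fun v => f v⁻¹) 0 1 = Real.circleAverage f 0 1 :=
  Real.circleAverage_zero_one_congr_inv

end IzerginKorepin

namespace IzerginKorepin

open Filter Topology MeasureTheory Metric

/-! ### The contour identity behind unitarity -/

/-- The part of the contraction of two currents that is not symmetric. -/
noncomputable def crossKernel (q a b : ℂ) : ℂ := (a - b) * (a - q ^ 2 * b) / (a + q * b)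

/-- The non-symmetric part of the integrand of `Φ_- Φ_+`. -/
noncomputable def plusPart (q m a b : ℂ) : ℂ :=
  -((1 - q) * a * b - q ^ 2 * m * b + q ^ 3 * m * a) / ((a + q * m) * (b + q * m))

/-- The non-symmetric part of the integrand of `Φ_0 Φ_0`. -/
noncomputable def zeroPart (q m a b : ℂ) : ℂ :=
  (1 - q ^ 2) * (a * b) / ((a - m) * (b + q * m))

/-- The non-symmetric part of the integrand of `Φ_+ Φ_-`. -/
noncomputable def minusPart (q m a b : ℂ) : ℂ :=
  -(q * (1 - q) * a * b + m * b - q * m * a) / ((a - m) * (b - m))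

theorem add_mul_ne_zero {q a b : ℂ} (h : ‖q‖ * ‖b‖ < ‖a‖) : a + q * b ≠ 0 := fun h0 => by
  rw [eq_neg_of_add_eq_zero_left h0, norm_neg, norm_mul] at h
  exact lt_irrefl _ h

/-- Once all three integrands are on the same contour, symmetrization in the two variables
annihilates their sum. This is where the relative coefficients of the three terms of the transfer
matrix matter. -/
theorem unitarity_symm {q m a b : ℂ} (h1 : a + q * b ≠ 0) (h2 : b + q * a ≠ 0)
    (ha : a + q * m ≠ 0) (hb : b + q * m ≠ 0) (ha' : a - m ≠ 0) (hb' : b - m ≠ 0) :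
    crossKernel q a b * (plusPart q m a b + zeroPart q m a b + minusPart q m a b) +
      crossKernel q b a * (plusPart q m b a + zeroPart q m b a + minusPart q m b a) = 0 := by
  simp only [crossKernel, plusPart, zeroPart, minusPart]
  generalize e1 : a + q * b = D1 at *
  generalize e2 : b + q * a = D2 at *
  generalize e3 : a + q * m = D3 at *
  generalize e4 : b + q * m = D4 at *
  field_simp
  subst e1 e2 e3 e4
  ring

/-- The single residues at `-q m`: two from `plusPart`, one in each variable, against one from
`zeroPart`. -/
theorem unitarity_residue_plus {q m b : ℂ} (hq : q ≠ 0) (h2 : b + q * -(q * m) ≠ 0)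
    (hb : b - m ≠ 0) :
    (b - q ^ 2 * -(q * m)) * (-(q * m) - q ^ 2 * b) / (-(q * m) + q * b) +
      -((b - q ^ 2 * -(q * m)) * ((1 - q) * b + q * -(q * m) - q ^ 2 * b) /
        (b + q * -(q * m))) +
      (1 - q ^ 2) * (crossKernel q b (-(q * m)) * (b / (b - m))) = 0 := by
  rw [show -(q * m) + q * b = q * (b - m) by ring]
  simp only [crossKernel]
  generalize e1 : b + q * -(q * m) = D1 at *
  field_simp
  subst e1
  ring

/-- The single residues at `m`: one from `zeroPart` against two from `minusPart`. -/
theorem unitarity_residue_minus {q m b : ℂ} (h1 : m + q * b ≠ 0) (h2 : b + q * m ≠ 0) :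
    (1 - q ^ 2) * (crossKernel q m b * (b / (b + q * m))) +
      (m - q ^ 2 * b) * ((q * (1 - q) + 1) * b - q * m) / (m + q * b) +
      -((b - q ^ 2 * m) * (m - q ^ 2 * b) / (b + q * m)) = 0 := by
  simp only [crossKernel]
  generalize e1 : m + q * b = D1 at *
  generalize e2 : b + q * m = D2 at *
  field_simp
  subst e1 e2
  ring

section Unitarity

variable {F : ℂ → ℂ → ℂ} {q m : ℂ} {r R₁ R₂ : ℝ}

theorem sub_ne_zero_of_norm_lt {a b : ℂ} (h : ‖a‖ < ‖b‖) : a - b ≠ 0 := fun h0 => by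
  rw [sub_eq_zero.1 h0] at h
  exact lt_irrefl _ h

theorem sub_ne_zero_of_lt_norm {a b : ℂ} (h : ‖b‖ < ‖a‖) : a - b ≠ 0 := fun h0 => by
  rw [sub_eq_zero.1 h0] at h
  exact lt_irrefl _ h

/-- Both contours start inside the poles at `-q m` and are moved outwards across them. The left
variable moves first, so that `|a| > |q b|` throughout and the pole of `crossKernel` is never met.
-/
theorem torusAvg_plusPart (hq0 : q ≠ 0) (hq : ‖q‖ < 1) (hm : m ≠ 0) (h1 : 1 < ‖q * m‖)
    (hr : ‖q * m‖ < r) (hrm : r < ‖m‖) (hF : HolOn F (annulus 1 r) (annulus 1 r)) :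
    torusAvg (fun a b => F a b * crossKernel q a b * plusPart q m a b) 1 1 =
      torusAvg (fun a b => F a b * crossKernel q a b * plusPart q m a b) r r -
      Real.circleAverage (fun b => F (-(q * m)) b * ((b - q ^ 2 * -(q * m)) *
        (-(q * m) - q ^ 2 * b) / (-(q * m) + q * b))) 0 r -
      Real.circleAverage (fun b => F b (-(q * m)) * -((b - q ^ 2 * -(q * m)) *
        ((1 - q) * b + q * -(q * m) - q ^ 2 * b) / (b + q * -(q * m)))) 0 r := by
  have hp0 : -(q * m) ≠ 0 := neg_ne_zero.2 (mul_ne_zero hq0 hm)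
  have hpn : ‖-(q * m)‖ = ‖q * m‖ := norm_neg _
  have hsub : ∀ a, a + q * m = a - -(q * m) := fun a => by ring
  have hr0 : 0 < r := by linarith
  have hr1 : (1 : ℝ) < r := h1.trans hr
  have hqq := norm_nonneg q
  have hs1 := sphere_subset_annulus le_rfl hr1.le
  have hsr := sphere_subset_annulus hr1.le le_rfl
  have hpa : -(q * m) ∈ annulus 1 r := ⟨by rw [hpn]; exact h1.le, by rw [hpn]; exact hr.le⟩
  have e1 := torusAvg_residue_left (G := fun a b => F a b * crossKernel q a b * plusPart q m a b)
    (g := fun a b => F a b * crossKernel q a b * (-((1 - q) * a * b - q ^ 2 * m * b +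
      q ^ 3 * m * a) / (a * (b + q * m)))) (p := -(q * m)) one_pos (hpn ▸ h1) (hpn ▸ hr) one_pos
    (fun a ha b hb => ?_) (fun a ha hap b hb => ?_)
  rotate_left
  · have hF' := hF a ha b (hs1 hb)
    rw [mem_sphere_zero_iff_norm] at hb
    have h2 : a + q * b ≠ 0 := add_mul_ne_zero (by rw [hb]; linarith [ha.1])
    have h3 : b + q * m ≠ 0 := by
      rw [hsub]; exact sub_ne_zero_of_norm_lt (by rw [hb, hpn]; exact h1)
    have h4 : a * (b + q * m) ≠ 0 := mul_ne_zero (norm_pos_iff.1 (one_pos.trans_le ha.1)) h3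
    simp only [crossKernel]
    fun_prop (disch := assumption)
  · rw [mem_sphere_zero_iff_norm] at hb
    have h3 : b + q * m ≠ 0 := by
      rw [hsub]; exact sub_ne_zero_of_norm_lt (by rw [hb, hpn]; exact h1)
    have h4 : a ≠ 0 := norm_pos_iff.1 (one_pos.trans_le ha.1)
    have h5 := sub_ne_zero.2 hap
    rw [plusPart, hsub a]
    generalize a - -(q * m) = D at *
    generalize b + q * m = D' at *
    field_simp
  -- At `a = -q m` the factor `a - b` of `crossKernel` cancels the pole at `b = -q m`. The remaining
  -- pole is at `b = m`, beyond `r`, so the circle of the residue can be moved from `1` to `r`.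
  have e2 : Real.circleAverage (fun b => F (-(q * m)) b * crossKernel q (-(q * m)) b *
      (-((1 - q) * -(q * m) * b - q ^ 2 * m * b + q ^ 3 * m * -(q * m)) /
        (-(q * m) * (b + q * m)))) 0 1 = Real.circleAverage (fun b => F (-(q * m)) b *
          ((b - q ^ 2 * -(q * m)) * (-(q * m) - q ^ 2 * b) / (-(q * m) + q * b))) 0 r := by
    have hne : ∀ b ∈ annulus 1 r, -(q * m) + q * b ≠ 0 := fun b hb => add_mul_ne_zero (by
      rw [hpn, norm_mul]
      exact mul_lt_mul_of_pos_left (hb.2.trans_lt hrm) (norm_pos_iff.2 hq0))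
    rw [circleAverage_shift one_pos hr1.le fun b hb => ?_]
    · refine Real.circleAverage_congr_sphere fun b hb => ?_
      rw [abs_one] at hb
      have h2 := hne b (hs1 hb)
      rw [mem_sphere_zero_iff_norm] at hb
      have h3 : b + q * m ≠ 0 := by
        rw [hsub]; exact sub_ne_zero_of_norm_lt (by rw [hb, hpn]; exact h1)
      simp only [crossKernel]
      generalize e1 : -(q * m) + q * b = D1 at *
      generalize e3 : b + q * m = D3 at *
      field_simp
      subst e3
      ring
    · have h2 := hne b hb
      have h3 := hF.right hpa hb
      fun_prop (disch := assumption)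
  have e3 := torusAvg_residue_right (G := fun a b => F a b * crossKernel q a b * plusPart q m a b)
    (g := fun a b => F a b * crossKernel q a b * (-((1 - q) * a * b - q ^ 2 * m * b +
      q ^ 3 * m * a) / (b * (a + q * m)))) (p := -(q * m)) one_pos (hpn ▸ h1) (hpn ▸ hr) hr0
    (fun a ha b hb => ?_) (fun a ha b hb hbp => ?_)
  rotate_left
  · have hF' := hF a (hsr ha) b hb
    rw [mem_sphere_zero_iff_norm] at ha
    have h2 : a + q * b ≠ 0 := add_mul_ne_zero (by
      rw [ha]; exact (mul_le_mul_of_nonneg_left hb.2 hqq).trans_lt (mul_lt_of_lt_one_left hr0 hq))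
    have h3 : a + q * m ≠ 0 := by
      rw [hsub]; exact sub_ne_zero_of_lt_norm (by rw [ha, hpn]; exact hr)
    have h4 : b * (a + q * m) ≠ 0 := mul_ne_zero (norm_pos_iff.1 (one_pos.trans_le hb.1)) h3
    simp only [crossKernel]
    fun_prop (disch := assumption)
  · rw [mem_sphere_zero_iff_norm] at ha
    have h3 : a + q * m ≠ 0 := by
      rw [hsub]; exact sub_ne_zero_of_lt_norm (by rw [ha, hpn]; exact hr)
    have h4 : b ≠ 0 := norm_pos_iff.1 (one_pos.trans_le hb.1)
    have h5 := sub_ne_zero.2 hbp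
    rw [plusPart, hsub b]
    generalize b - -(q * m) = D at *
    generalize a + q * m = D' at *
    field_simp
  have e4 : Real.circleAverage (fun a => F a (-(q * m)) * crossKernel q a (-(q * m)) *
      (-((1 - q) * a * -(q * m) - q ^ 2 * m * -(q * m) + q ^ 3 * m * a) /
        (-(q * m) * (a + q * m)))) 0 r = Real.circleAverage (fun b => F b (-(q * m)) *
        -((b - q ^ 2 * -(q * m)) * ((1 - q) * b + q * -(q * m) - q ^ 2 * b) /
          (b + q * -(q * m)))) 0 r := by
    refine Real.circleAverage_congr_sphere fun a ha => ?_
    rw [abs_of_pos hr0, mem_sphere_zero_iff_norm] at ha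
    have h2 : a + q * -(q * m) ≠ 0 := add_mul_ne_zero (by
      rw [ha, hpn]; exact (mul_le_of_le_one_left (norm_nonneg _) hq.le).trans_lt hr)
    have h3 : a + q * m ≠ 0 := by
      rw [hsub]; exact sub_ne_zero_of_lt_norm (by rw [ha, hpn]; exact hr)
    simp only [crossKernel]
    generalize e1 : a + q * -(q * m) = D1 at *
    generalize e3 : a + q * m = D3 at *
    field_simp
    subst e3
    ring
  rw [← e2, ← e4]
  linear_combination -e1 - e3

/-- The left contour comes in across `m`, the right contour goes out across `-q m`. The residue at
`a = m` still has the pole at `b = -q m`, and this double residue has no partner in the other two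
terms. -/
theorem torusAvg_zeroPart (hq : ‖q‖ < 1) (h1 : 1 < ‖q * m‖)
    (hr : ‖q * m‖ < r) (hrm : r < ‖m‖) (hR : ‖m‖ < R₁)
    (hF : HolOn F (annulus 1 R₁) (annulus 1 R₁)) :
    torusAvg (fun a b => F a b * crossKernel q a b * zeroPart q m a b) R₁ 1 =
      torusAvg (fun a b => F a b * crossKernel q a b * zeroPart q m a b) r r +
      Real.circleAverage (fun b => F m b * ((1 - q ^ 2) * (crossKernel q m b *
        (b / (b + q * m))))) 0 r -
      Real.circleAverage (fun b => F b (-(q * m)) * ((1 - q ^ 2) * (crossKernel q b (-(q * m)) *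
        (b / (b - m))))) 0 r -
      F m (-(q * m)) * ((1 - q ^ 2) * crossKernel q m (-(q * m))) := by
  have hpn : ‖-(q * m)‖ = ‖q * m‖ := norm_neg _
  have hsub : ∀ a, a + q * m = a - -(q * m) := fun a => by ring
  have hr0 : 0 < r := by linarith
  have hr1 : (1 : ℝ) < r := h1.trans hr
  have hrR : r < R₁ := hrm.trans hR
  have hqq := norm_nonneg q
  have hs1 : sphere (0 : ℂ) 1 ⊆ annulus 1 R₁ := sphere_subset_annulus le_rfl (hr1.trans hrR).le
  have hsr : sphere (0 : ℂ) r ⊆ annulus 1 R₁ := sphere_subset_annulus hr1.le hrR.le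
  have hsub1 : annulus r R₁ ⊆ annulus 1 R₁ := fun a ha => ⟨hr1.le.trans ha.1, ha.2⟩
  have hsub2 : annulus 1 r ⊆ annulus 1 R₁ := fun a ha => ⟨ha.1, ha.2.trans hrR.le⟩
  have hma : m ∈ annulus 1 R₁ := ⟨(hr1.trans hrm).le, hR.le⟩
  have e1 := torusAvg_residue_left (G := fun a b => F a b * crossKernel q a b * zeroPart q m a b)
    (g := fun a b => F a b * ((1 - q ^ 2) * (crossKernel q a b * (b / (b + q * m))))) (p := m)
    hr0 hrm hR one_pos (fun a ha b hb => ?_) (fun a ha hap b hb => ?_)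
  rotate_left
  · have hF' := hF a (hsub1 ha) b (hs1 hb)
    rw [mem_sphere_zero_iff_norm] at hb
    have h2 : a + q * b ≠ 0 := add_mul_ne_zero (by rw [hb]; linarith [ha.1])
    have h3 : b + q * m ≠ 0 := by
      rw [hsub]; exact sub_ne_zero_of_norm_lt (by rw [hb, hpn]; exact h1)
    simp only [crossKernel]
    fun_prop (disch := assumption)
  · rw [zeroPart, div_eq_mul_inv, mul_inv, div_eq_mul_inv, div_eq_mul_inv]
    ring
  -- Moving the circle of the residue at `a = m` from `1` to `r` crosses `b = -q m` and splits off
  -- the double residue.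
  have e2 := circleAverage_residue (g := fun b => F m b * ((1 - q ^ 2) * crossKernel q m b))
    (p := -(q * m)) one_pos (hpn ▸ h1) (hpn ▸ hr) (fun b hb => by
      have h2 : m + q * b ≠ 0 := add_mul_ne_zero (by
        have := mul_le_of_le_one_left (norm_nonneg b) hq.le
        linarith [hb.2])
      have h3 := hF.right hma (hsub2 hb)
      simp only [crossKernel]
      fun_prop (disch := assumption))
  have e3 := torusAvg_residue_right (G := fun a b => F a b * crossKernel q a b * zeroPart q m a b)
    (g := fun a b => F a b * ((1 - q ^ 2) * (crossKernel q a b * (a / (a - m)))))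
    (p := -(q * m)) one_pos (hpn ▸ h1) (hpn ▸ hr) hr0
    (fun a ha b hb => ?_) (fun a ha b hb hbp => ?_)
  rotate_left
  · have hF' := hF a (hsr ha) b (hsub2 hb)
    rw [mem_sphere_zero_iff_norm] at ha
    have h2 : a + q * b ≠ 0 := add_mul_ne_zero (by
      rw [ha]; exact (mul_le_mul_of_nonneg_left hb.2 hqq).trans_lt (mul_lt_of_lt_one_left hr0 hq))
    have h3 : a - m ≠ 0 := sub_ne_zero_of_norm_lt (by rw [ha]; exact hrm)
    simp only [crossKernel]
    fun_prop (disch := assumption)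
  · rw [zeroPart, hsub b, div_eq_mul_inv, mul_inv, div_eq_mul_inv, div_eq_mul_inv]
    ring
  simp only [hsub, mul_assoc] at e1 e2 e3 ⊢
  linear_combination e1 - e2 - e3

/-- Both contours come in across `m`. Here the right variable moves first, again to keep `|a| > |q
b|`. -/
theorem torusAvg_minusPart (hq : ‖q‖ < 1) (h1 : 1 < ‖q * m‖)
    (hr : ‖q * m‖ < r) (hrm : r < ‖m‖) (hR₂ : ‖m‖ < R₂) (hR : R₂ < R₁)
    (hF : HolOn F (annulus 1 R₁) (annulus 1 R₁)) :
    torusAvg (fun a b => F a b * crossKernel q a b * minusPart q m a b) R₁ R₂ =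
      torusAvg (fun a b => F a b * crossKernel q a b * minusPart q m a b) r r +
      Real.circleAverage (fun b => F m b * ((m - q ^ 2 * b) * ((q * (1 - q) + 1) * b - q * m) /
        (m + q * b))) 0 r +
      Real.circleAverage (fun b => F b m * -((b - q ^ 2 * m) * (m - q ^ 2 * b) /
        (b + q * m))) 0 r := by
  have hr0 : 0 < r := by linarith
  have hr1 : (1 : ℝ) < r := h1.trans hr
  have hmR : ‖m‖ < R₁ := hR₂.trans hR
  have hrR : r < R₁ := hrm.trans hmR
  have hR0 : 0 < R₁ := hr0.trans hrR
  have hm0 : 0 < ‖m‖ := hr0.trans hrm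
  have hm : m ≠ 0 := norm_pos_iff.1 hm0
  have hqq := norm_nonneg q
  have hsr : sphere (0 : ℂ) r ⊆ annulus 1 R₁ := sphere_subset_annulus hr1.le hrR.le
  have hsR : sphere (0 : ℂ) R₁ ⊆ annulus 1 R₁ := sphere_subset_annulus (hr1.trans hrR).le le_rfl
  have hsub1 : annulus r R₁ ⊆ annulus 1 R₁ := fun a ha => ⟨hr1.le.trans ha.1, ha.2⟩
  have hsub2 : annulus r R₂ ⊆ annulus 1 R₁ := fun a ha => ⟨hr1.le.trans ha.1, ha.2.trans hR.le⟩
  have hma : m ∈ annulus 1 R₁ := ⟨(hr1.trans hrm).le, hmR.le⟩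
  have e1 := torusAvg_residue_right (G := fun a b => F a b * crossKernel q a b * minusPart q m a b)
    (g := fun a b => F a b * crossKernel q a b * (-(q * (1 - q) * a * b + m * b - q * m * a) /
      (b * (a - m)))) (p := m) hr0 hrm hR₂ hR0
    (fun a ha b hb => ?_) (fun a ha b hb hbp => ?_)
  rotate_left
  · have hF' := hF a (hsR ha) b (hsub2 hb)
    rw [mem_sphere_zero_iff_norm] at ha
    have h2 : a + q * b ≠ 0 := add_mul_ne_zero (by
      have := mul_le_of_le_one_left (norm_nonneg b) hq.le
      rw [ha]; linarith [hb.2])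
    have h3 : a - m ≠ 0 := sub_ne_zero_of_lt_norm (by rw [ha]; exact hmR)
    have h4 : b * (a - m) ≠ 0 := mul_ne_zero (norm_pos_iff.1 (hr0.trans_le hb.1)) h3
    simp only [crossKernel]
    fun_prop (disch := assumption)
  · rw [mem_sphere_zero_iff_norm] at ha
    have h3 : a - m ≠ 0 := sub_ne_zero_of_lt_norm (by rw [ha]; exact hmR)
    have h4 : b ≠ 0 := norm_pos_iff.1 (hr0.trans_le hb.1)
    have h5 := sub_ne_zero.2 hbp
    rw [minusPart]
    field_simp
  -- At `b = m` the factor `a - b` of `crossKernel` cancels the pole at `a = m`, so the remaining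
  -- circle can be moved from `R₁` to `r`.
  have e2 : Real.circleAverage (fun a => F a m * crossKernel q a m *
      (-(q * (1 - q) * a * m + m * m - q * m * a) / (m * (a - m)))) 0 R₁ =
      Real.circleAverage (fun b => F b m * -((b - q ^ 2 * m) * (m - q ^ 2 * b) /
        (b + q * m))) 0 r := by
    have hne : ∀ a ∈ annulus r R₁, a + q * m ≠ 0 := fun a ha => add_mul_ne_zero (by
      rw [← norm_mul]; exact hr.trans_le ha.1)
    rw [← circleAverage_shift hr0 hrR.le fun a ha => ?_]
    · refine Real.circleAverage_congr_sphere fun a ha => ?_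
      rw [abs_of_pos hR0] at ha
      have h2 := hne a (sphere_subset_annulus hrR.le le_rfl ha)
      rw [mem_sphere_zero_iff_norm] at ha
      have h3 : a - m ≠ 0 := sub_ne_zero_of_lt_norm (by rw [ha]; exact hmR)
      simp only [crossKernel]
      generalize e1 : a + q * m = D1 at *
      field_simp
      ring
    · have h2 := hne a ha
      have h3 := hF.left (hsub1 ha) hma
      fun_prop (disch := assumption)
  have e3 := torusAvg_residue_left (G := fun a b => F a b * crossKernel q a b * minusPart q m a b)
    (g := fun a b => F a b * crossKernel q a b * (-(q * (1 - q) * a * b + m * b - q * m * a) /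
      (a * (b - m)))) (p := m) hr0 hrm hmR hr0
    (fun a ha b hb => ?_) (fun a ha hap b hb => ?_)
  rotate_left
  · have hF' := hF a (hsub1 ha) b (hsr hb)
    rw [mem_sphere_zero_iff_norm] at hb
    have h2 : a + q * b ≠ 0 := add_mul_ne_zero (by
      rw [hb]; exact (mul_lt_of_lt_one_left hr0 hq).trans_le ha.1)
    have h3 : b - m ≠ 0 := sub_ne_zero_of_norm_lt (by rw [hb]; exact hrm)
    have h4 : a * (b - m) ≠ 0 := mul_ne_zero (norm_pos_iff.1 (hr0.trans_le ha.1)) h3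
    simp only [crossKernel]
    fun_prop (disch := assumption)
  · rw [mem_sphere_zero_iff_norm] at hb
    have h3 : b - m ≠ 0 := sub_ne_zero_of_norm_lt (by rw [hb]; exact hrm)
    have h4 : a ≠ 0 := norm_pos_iff.1 (hr0.trans_le ha.1)
    have h5 := sub_ne_zero.2 hap
    rw [minusPart]
    field_simp
  have e4 : Real.circleAverage (fun b => F m b * crossKernel q m b *
      (-(q * (1 - q) * m * b + m * b - q * m * m) / (m * (b - m)))) 0 r =
      Real.circleAverage (fun b => F m b * ((m - q ^ 2 * b) * ((q * (1 - q) + 1) * b - q * m) /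
        (m + q * b))) 0 r := by
    refine Real.circleAverage_congr_sphere fun b hb => ?_
    rw [abs_of_pos hr0, mem_sphere_zero_iff_norm] at hb
    have h2 : m + q * b ≠ 0 := add_mul_ne_zero (by
      rw [hb]; exact (mul_lt_of_lt_one_left hr0 hq).trans hrm)
    have h3 : b - m ≠ 0 := sub_ne_zero_of_norm_lt (by rw [hb]; exact hrm)
    simp only [crossKernel]
    generalize e1 : m + q * b = D1 at *
    field_simp
    ring
  rw [← e2, ← e4]
  linear_combination e1 + e3

/-- The sum of the three torus averages is a double residue. -/
theorem torusAvg_unitarity (hq0 : q ≠ 0) (hq : ‖q‖ < 1) (h1 : 1 < ‖q * m‖) (hR₂ : ‖m‖ < R₂)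
    (hR : R₂ < R₁) (hF : HolOn F (annulus 1 R₁) (annulus 1 R₁)) (hsymm : ∀ a b, F a b = F b a) :
    torusAvg (fun a b => F a b * crossKernel q a b * plusPart q m a b) 1 1 +
      torusAvg (fun a b => F a b * crossKernel q a b * zeroPart q m a b) R₁ 1 +
      torusAvg (fun a b => F a b * crossKernel q a b * minusPart q m a b) R₁ R₂ =
      -(F m (-(q * m)) * ((1 - q ^ 2) * crossKernel q m (-(q * m)))) := by
  have hm0 : 0 < ‖m‖ := by
    rw [norm_mul] at h1
    exact pos_of_mul_pos_right (one_pos.trans h1) (norm_nonneg q)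
  have hm : m ≠ 0 := norm_pos_iff.1 hm0
  -- The common contour separates the two poles `-q m` and `m`.
  obtain ⟨r, hr, hrm⟩ : ∃ r, ‖q * m‖ < r ∧ r < ‖m‖ := exists_between (by
    rw [norm_mul]; exact mul_lt_of_lt_one_left hm0 hq)
  have hr1 : 1 < r := h1.trans hr
  have hr0 : 0 < r := one_pos.trans hr1
  have hmR : ‖m‖ < R₁ := hR₂.trans hR
  have hrR : r < R₁ := hrm.trans hmR
  have hsub2 : annulus 1 r ⊆ annulus 1 R₁ := fun a ha => ⟨ha.1, ha.2.trans hrR.le⟩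
  have hsr : sphere (0 : ℂ) r ⊆ annulus 1 R₁ := sphere_subset_annulus hr1.le hrR.le
  have hpn : ‖-(q * m)‖ = ‖q * m‖ := norm_neg _
  have hpa : -(q * m) ∈ annulus 1 R₁ :=
    ⟨by rw [hpn]; exact h1.le, by rw [hpn]; exact (hr.trans hrR).le⟩
  have hma : m ∈ annulus 1 R₁ := ⟨(hr1.trans hrm).le, hmR.le⟩
  have hn1 : ∀ a ∈ sphere (0 : ℂ) r, ∀ b ∈ sphere (0 : ℂ) r, a + q * b ≠ 0 := fun a ha b hb => by
    rw [mem_sphere_zero_iff_norm] at ha hb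
    exact add_mul_ne_zero (by rw [ha, hb]; exact mul_lt_of_lt_one_left hr0 hq)
  have hn2 : ∀ a ∈ sphere (0 : ℂ) r, a + q * m ≠ 0 := fun a ha => by
    rw [mem_sphere_zero_iff_norm] at ha
    exact add_mul_ne_zero (by rw [← norm_mul, ha]; exact hr)
  have hn3 : ∀ a ∈ sphere (0 : ℂ) r, a - m ≠ 0 := fun a ha => by
    rw [mem_sphere_zero_iff_norm] at ha
    exact sub_ne_zero_of_norm_lt (by rw [ha]; exact hrm)
  have hn4 : ∀ a ∈ sphere (0 : ℂ) r, m + q * a ≠ 0 := fun a ha => by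
    rw [mem_sphere_zero_iff_norm] at ha
    exact add_mul_ne_zero (by rw [ha]; exact (mul_lt_of_lt_one_left hr0 hq).trans hrm)
  have hn5 : ∀ a ∈ sphere (0 : ℂ) r, a + q * -(q * m) ≠ 0 := fun a ha => by
    rw [mem_sphere_zero_iff_norm] at ha
    exact add_mul_ne_zero (by
      rw [ha, hpn]; exact (mul_le_of_le_one_left (norm_nonneg _) hq.le).trans_lt hr)
  have hn6 : ∀ a ∈ sphere (0 : ℂ) r, -(q * m) + q * a ≠ 0 := fun a ha h => by
    refine mul_ne_zero hq0 (hn3 a ha) ?_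
    linear_combination h
  have i1 : HolOn (fun a b => F a b * crossKernel q a b * plusPart q m a b)
      (sphere 0 r) (sphere 0 r) := fun a ha b hb => by
    have := hF a (hsr ha) b (hsr hb)
    have := hn1 a ha b hb
    have := mul_ne_zero (hn2 a ha) (hn2 b hb)
    simp only [crossKernel, plusPart]
    fun_prop (disch := assumption)
  have i2 : HolOn (fun a b => F a b * crossKernel q a b * zeroPart q m a b)
      (sphere 0 r) (sphere 0 r) := fun a ha b hb => by
    have := hF a (hsr ha) b (hsr hb)
    have := hn1 a ha b hb
    have := mul_ne_zero (hn3 a ha) (hn2 b hb)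
    simp only [crossKernel, zeroPart]
    fun_prop (disch := assumption)
  have i3 : HolOn (fun a b => F a b * crossKernel q a b * minusPart q m a b)
      (sphere 0 r) (sphere 0 r) := fun a ha b hb => by
    have := hF a (hsr ha) b (hsr hb)
    have := hn1 a ha b hb
    have := mul_ne_zero (hn3 a ha) (hn3 b hb)
    simp only [crossKernel, minusPart]
    fun_prop (disch := assumption)
  have i12 : HolOn (fun a b => F a b * crossKernel q a b * plusPart q m a b +
      F a b * crossKernel q a b * zeroPart q m a b) (sphere 0 r) (sphere 0 r) :=
    fun a ha b hb => (i1 a ha b hb).add (i2 a ha b hb)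
  have i123 : HolOn (fun a b => (F a b * crossKernel q a b *
      plusPart q m a b + F a b * crossKernel q a b * zeroPart q m a b) +
      F a b * crossKernel q a b * minusPart q m a b) (sphere 0 r) (sphere 0 r) :=
    fun a ha b hb => (i12 a ha b hb).add (i3 a ha b hb)
  -- The symmetric function `F` factors out of the antisymmetric sum.
  have key := torusAvg_eq_zero_of_antisymm hr0 i123 (fun a ha b hb => by
      have h := unitarity_symm (hn1 a ha b hb) (hn1 b hb a ha) (hn2 a ha) (hn2 b hb) (hn3 a ha)
        (hn3 b hb)
      simp only [hsymm b a]
      linear_combination F a b * h)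
  rw [torusAvg_add hr0 hr0 i12 i3, torusAvg_add hr0 hr0 i1 i2] at key
  have ci : ∀ {f : ℂ → ℂ}, (∀ v ∈ sphere (0 : ℂ) r, DifferentiableAt ℂ f v) →
    CircleIntegrable f 0 r := circleIntegrable_of_differentiableAt hr0
  have j1 : CircleIntegrable (fun b => F (-(q * m)) b * ((b - q ^ 2 * -(q * m)) *
        (-(q * m) - q ^ 2 * b) / (-(q * m) + q * b))) 0 r := ci fun b hb => by
    have := hF.right hpa (hsr hb)
    have := hn6 b hb
    fun_prop (disch := assumption)
  have j2 : CircleIntegrable (fun b => F b (-(q * m)) * -((b - q ^ 2 * -(q * m)) *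
        ((1 - q) * b + q * -(q * m) - q ^ 2 * b) / (b + q * -(q * m)))) 0 r := ci fun b hb => by
    have := hF.left (hsr hb) hpa
    have := hn5 b hb
    fun_prop (disch := assumption)
  have j3 : CircleIntegrable (fun b => F b (-(q * m)) * ((1 - q ^ 2) *
      (crossKernel q b (-(q * m)) * (b / (b - m))))) 0 r := ci fun b hb => by
    have := hF.left (hsr hb) hpa
    have := hn5 b hb
    have := hn3 b hb
    simp only [crossKernel]
    fun_prop (disch := assumption)
  have j4 : CircleIntegrable (fun b => F m b * ((1 - q ^ 2) * (crossKernel q m b *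
        (b / (b + q * m))))) 0 r := ci fun b hb => by
    have := hF.right hma (hsr hb)
    have := hn2 b hb
    have := hn4 b hb
    simp only [crossKernel]
    fun_prop (disch := assumption)
  have j5 : CircleIntegrable (fun b => F m b * ((m - q ^ 2 * b) *
      ((q * (1 - q) + 1) * b - q * m) / (m + q * b))) 0 r := ci fun b hb => by
    have := hF.right hma (hsr hb)
    have := hn4 b hb
    fun_prop (disch := assumption)
  have j6 : CircleIntegrable (fun b => F b m * -((b - q ^ 2 * m) * (m - q ^ 2 * b) /
        (b + q * m))) 0 r := ci fun b hb => by
    have := hF.left (hsr hb) hma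
    have := hn2 b hb
    fun_prop (disch := assumption)
  have z0 : Real.circleAverage (fun _ => (0 : ℂ)) 0 r = 0 := Real.circleAverage_const 0 0 r
  -- The symmetry of `F` brings the residues in the first and in the second variable to one circle
  -- integral, whose integrand vanishes identically.
  have c1 := Real.circleAverage_fun_add (j1.add j2) j3
  simp only [Pi.add_apply] at c1
  rw [Real.circleAverage_congr_sphere (f₂ := fun _ => (0 : ℂ)) (fun b hb => by
    rw [abs_of_pos hr0] at hb
    have h := unitarity_residue_plus hq0 (hn5 b hb) (hn3 b hb)
    simp only [hsymm (-(q * m)) b]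
    linear_combination F b (-(q * m)) * h), z0, Real.circleAverage_add j1 j2] at c1
  have c2 := Real.circleAverage_fun_add (j4.add j5) j6
  simp only [Pi.add_apply] at c2
  rw [Real.circleAverage_congr_sphere (f₂ := fun _ => (0 : ℂ)) (fun b hb => by
    rw [abs_of_pos hr0] at hb
    have h := unitarity_residue_minus (hn4 b hb) (hn2 b hb)
    simp only [hsymm m b]
    linear_combination F b m * h), z0, Real.circleAverage_add j4 j5] at c2
  rw [torusAvg_plusPart hq0 hq hm h1 hr hrm (hF.mono hsub2 hsub2),
    torusAvg_zeroPart hq h1 hr hrm hmR hF, torusAvg_minusPart hq h1 hr hrm hR₂ hR hF]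
  linear_combination key + c1 - c2

end Unitarity

end IzerginKorepin

namespace IzerginKorepin

open MvPowerSeries Filter Topology MeasureTheory Metric

/-! ### Regularity of the integrands -/

section Regularity

variable {E : Type*} [NormedAddCommGroup E] [NormedSpace ℂ E] {s : ℂ} {ε : SignType}
  {f g h : E → ℂ} {x : E}

theorem one_sub_ne_zero_of_norm_lt {a b : ℂ} (h : ‖a‖ < ‖b‖) : 1 - a / b ≠ 0 := by
  refine one_sub_ne_zero ?_
  rwa [norm_div, div_lt_one ((norm_nonneg _).trans_lt h)]

theorem one_add_ne_zero_of_norm_lt {a b : ℂ} (h : ‖a‖ < ‖b‖) : 1 + a / b ≠ 0 := by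
  have := one_sub_ne_zero_of_norm_lt (a := -a) (b := b) (by rwa [norm_neg])
  rwa [neg_div, sub_neg_eq_add] at this

theorem ne_zero_of_lt_mul_norm {s v ζ : ℂ} (h : ‖s‖ ^ 2 < ‖v‖ * ‖ζ‖) : v ≠ 0 ∧ ζ ≠ 0 := by
  have h0 : 0 < ‖v‖ * ‖ζ‖ := lt_of_le_of_lt (by positivity) h
  exact ⟨norm_pos_iff.1 (pos_of_mul_pos_left h0 (norm_nonneg _)),
    norm_pos_iff.1 (pos_of_mul_pos_right h0 (norm_nonneg _))⟩

theorem differentiableAt_vertexCurrent (hh : DifferentiableAt ℂ h x) (hf : DifferentiableAt ℂ f x)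
    (h1 : ‖s‖ ^ 2 * ‖f x‖ < ‖h x‖) (h2 : ‖s‖ ^ 2 < ‖f x‖ * ‖h x‖) :
    DifferentiableAt ℂ (fun x => vertexCurrent s (h x) (f x)) x := by
  obtain ⟨h3, h4⟩ := ne_zero_of_lt_mul_norm h2
  have h5 : 1 - s ^ 2 * f x / h x ≠ 0 :=
    one_sub_ne_zero_of_norm_lt (by rwa [norm_mul, norm_pow])
  have h6 : 1 - s ^ 2 / (f x * h x) ≠ 0 :=
    one_sub_ne_zero_of_norm_lt (by rwa [norm_mul, norm_pow])
  have h7 : f x * h x ≠ 0 := mul_ne_zero h3 h4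
  simp only [vertexCurrent]
  fun_prop (disch := assumption)

theorem differentiableAt_currentVertex (hh : DifferentiableAt ℂ h x) (hf : DifferentiableAt ℂ f x)
    (h1 : ‖s‖ ^ 2 * ‖h x‖ < ‖f x‖) (h2 : ‖s‖ ^ 2 < ‖f x‖ * ‖h x‖) :
    DifferentiableAt ℂ (fun x => currentVertex s (h x) (f x)) x := by
  obtain ⟨h3, h4⟩ := ne_zero_of_lt_mul_norm h2
  have h5 : 1 - s ^ 2 * h x / f x ≠ 0 :=
    one_sub_ne_zero_of_norm_lt (by rwa [norm_mul, norm_pow])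
  have h6 : 1 - s ^ 2 / (h x * f x) ≠ 0 :=
    one_sub_ne_zero_of_norm_lt (by rwa [norm_mul, norm_pow, mul_comm])
  have h7 : h x * f x ≠ 0 := mul_ne_zero h4 h3
  simp only [currentVertex]
  fun_prop (disch := assumption)

theorem differentiableAt_zeroKernel (hh : DifferentiableAt ℂ h x) (hf : DifferentiableAt ℂ f x)
    (h1 : ‖s‖ ^ 2 * ‖f x‖ < ‖h x‖) (h1' : ‖s‖ ^ 2 * ‖h x‖ < ‖f x‖)
    (h2 : ‖s‖ ^ 2 < ‖f x‖ * ‖h x‖) :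
    DifferentiableAt ℂ (fun x => zeroKernel s (h x) (f x)) x := by
  have h3 := (ne_zero_of_lt_mul_norm h2).1
  have h4 := differentiableAt_vertexCurrent hh hf h1 h2
  have h5 := differentiableAt_currentVertex hh hf h1' h2
  simp only [zeroKernel]
  fun_prop (disch := assumption)

theorem differentiableAt_plusKernel (hh : DifferentiableAt ℂ h x) (hf : DifferentiableAt ℂ f x)
    (hg : DifferentiableAt ℂ g x)
    (h1 : ‖s‖ ^ 2 * ‖f x‖ < ‖h x‖) (h1' : ‖s‖ ^ 2 * ‖h x‖ < ‖f x‖)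
    (h2 : ‖s‖ ^ 2 < ‖f x‖ * ‖h x‖)
    (k1 : ‖s‖ ^ 2 * ‖g x‖ < ‖h x‖) (k1' : ‖s‖ ^ 2 * ‖h x‖ < ‖g x‖)
    (k2 : ‖s‖ ^ 2 < ‖g x‖ * ‖h x‖) :
    DifferentiableAt ℂ (fun x => plusKernel s (h x) (f x) (g x)) x := by
  have h3 := (ne_zero_of_lt_mul_norm h2).2
  have h4 := differentiableAt_vertexCurrent hh hg k1 k2
  have h5 := differentiableAt_currentVertex hh hf h1' h2
  have h6 := differentiableAt_zeroKernel hh hf h1 h1' h2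
  have h7 := differentiableAt_zeroKernel hh hg k1 k1' k2
  simp only [plusKernel]
  fun_prop (disch := assumption)

theorem differentiableAt_currentPair (hs0 : s ≠ 0) (hf : DifferentiableAt ℂ f x)
    (hg : DifferentiableAt ℂ g x) (h1 : ‖s‖ ^ 2 * ‖g x‖ < ‖f x‖) (h2 : ‖s‖ ^ 2 < ‖f x‖ * ‖g x‖) :
    DifferentiableAt ℂ (fun x => currentPair s ε (f x) (g x)) x := by
  obtain ⟨h3, h4⟩ := ne_zero_of_lt_mul_norm h2
  have h5 : 1 + s ^ 2 * (g x / f x) ≠ 0 := by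
    rw [← mul_div_assoc]
    exact one_add_ne_zero_of_norm_lt (by rwa [norm_mul, norm_pow])
  have h6 : 1 + s ^ 2 * (1 / (f x * g x)) ≠ 0 := by
    rw [mul_one_div]
    exact one_add_ne_zero_of_norm_lt (by rwa [norm_mul, norm_pow])
  have h7 : f x * g x ≠ 0 := mul_ne_zero h3 h4
  have h8 : s * f x ≠ 0 := mul_ne_zero hs0 h3
  have h9 : s * g x ≠ 0 := mul_ne_zero hs0 h4
  have h10 : f x ^ 2 ≠ 0 := pow_ne_zero _ h3
  have h11 : g x ^ 2 ≠ 0 := pow_ne_zero _ h4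
  simp only [currentPair, currentSelf, currentCurrent, currentKernel]
  fun_prop (disch := assumption)

theorem differentiableAt_dualArg (hh : DifferentiableAt ℂ h x) (h0 : h x ≠ 0) :
    DifferentiableAt ℂ (fun x => dualArg s (h x)) x := by
  simp only [dualArg]
  fun_prop (disch := assumption)

theorem differentiableAt_coeff_gauss {a : ℕ+ → ℂ} {b : E → ℕ+ → ℂ}
    (hb : ∀ m, DifferentiableAt ℂ (fun x => b x m) x) (μ : ℕ+ →₀ ℕ) :
    DifferentiableAt ℂ (fun x => coeff μ (gauss a (b x))) x := by
  simp only [coeff_gauss, Finsupp.prod, hermiteCoeff]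
  have h : ∀ m ∈ μ.support, DifferentiableAt ℂ (fun x => ∑ p ∈
      Finset.HasAntidiagonal.antidiagonal (μ m), sqExpCoeff (a m) p.1 *
        (b x m ^ p.2 / (p.2.factorial : ℂ))) x := fun m _ => by
    refine DifferentiableAt.fun_sum fun p _ => ?_
    have := hb m
    fun_prop
  exact (HasFDerivAt.finsetProd fun m hm => (h m hm).hasFDerivAt).differentiableAt

theorem differentiableAt_pairCoeff (hs0 : s ≠ 0) (hh : DifferentiableAt ℂ h x)
    (hf : DifferentiableAt ℂ f x) (hg : DifferentiableAt ℂ g x) (h0 : h x ≠ 0) (hf0 : f x ≠ 0)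
    (hg0 : g x ≠ 0) (μ : ℕ+ →₀ ℕ) :
    DifferentiableAt ℂ (fun x => pairCoeff s ε (h x) μ (f x) (g x)) x := by
  refine differentiableAt_coeff_gauss (fun m => ?_) μ
  have hd := differentiableAt_dualArg (s := s) hh h0
  have hd0 : dualArg s (h x) ^ (m : ℕ) ≠ 0 := pow_ne_zero _
    (mul_ne_zero (neg_ne_zero.2 (inv_ne_zero (pow_ne_zero _ hs0))) (inv_ne_zero h0))
  have h1 : h x ^ (m : ℕ) ≠ 0 := pow_ne_zero _ h0
  have h2 : f x ^ (m : ℕ) ≠ 0 := pow_ne_zero _ hf0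
  have h3 : g x ^ (m : ℕ) ≠ 0 := pow_ne_zero _ hg0
  simp only [stateShift, List.map_cons, List.map_nil, List.sum_cons, List.sum_nil, vertexShift,
    currentShift]
  fun_prop (disch := assumption)

/-- The conditions on the norms under which the integrands are regular: `x = ‖z‖`, and `r₁`, `r₂`
are the radii of the contours. -/
structure PlusRegular (t x r₁ r₂ : ℝ) : Prop where
  cross : t ^ 2 * r₂ < r₁
  cross' : t ^ 2 < r₁ * r₂
  left : t ^ 2 * r₁ < x
  left' : t ^ 2 * x < r₁
  left'' : t ^ 2 < r₁ * x
  right : t ^ 2 * r₂ < x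
  right' : t ^ 2 * x < r₂
  right'' : t ^ 2 < r₂ * x
  dual_left : t ^ 8 * x * r₁ < 1
  dual_left' : t ^ 8 * x < r₁
  dual_right : t ^ 8 * x * r₂ < 1
  dual_right' : t ^ 8 * x < r₂

/-- See `PlusRegular`. -/
structure ZeroRegular (t x r₁ r₂ : ℝ) : Prop where
  cross : t ^ 2 * r₂ < r₁
  cross' : t ^ 2 < r₁ * r₂
  left' : t ^ 2 * x < r₁
  left'' : t ^ 2 < r₁ * x
  right : t ^ 2 * r₂ < x
  right' : t ^ 2 * x < r₂
  right'' : t ^ 2 < r₂ * x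
  dual_left : t ^ 8 * x * r₁ < 1
  dual_left' : t ^ 8 * x < r₁
  dual_left'' : 1 < t ^ 4 * x * r₁
  dual_right : t ^ 8 * x * r₂ < 1
  dual_right' : t ^ 8 * x < r₂

/-- See `PlusRegular`. -/
structure MinusRegular (t x r₁ r₂ : ℝ) : Prop where
  cross : t ^ 2 * r₂ < r₁
  cross' : t ^ 2 < r₁ * r₂
  left' : t ^ 2 * x < r₁
  left'' : t ^ 2 < r₁ * x
  right' : t ^ 2 * x < r₂
  right'' : t ^ 2 < r₂ * x
  dual_left : t ^ 8 * x * r₁ < 1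
  dual_left' : t ^ 8 * x < r₁
  dual_left'' : 1 < t ^ 4 * x * r₁
  dual_right : t ^ 8 * x * r₂ < 1
  dual_right' : t ^ 8 * x < r₂
  dual_right'' : 1 < t ^ 4 * x * r₂

/-- The convergence conditions at `z'` in terms of `|z|`, using `|z'| = 1 / (|s| ^ 6 |z|)`. -/
theorem dualArg_norm_conditions (hs0 : s ≠ 0) {z : ℂ} (hz : z ≠ 0) (r : ℝ) :
    (‖s‖ ^ 8 * ‖z‖ * r < 1 → ‖s‖ ^ 2 * r < ‖dualArg s z‖) ∧
    (‖s‖ ^ 8 * ‖z‖ < r → ‖s‖ ^ 2 < r * ‖dualArg s z‖) ∧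
    (1 < ‖s‖ ^ 4 * ‖z‖ * r → ‖s‖ ^ 2 * ‖dualArg s z‖ < r) := by
  have ht : 0 < ‖s‖ := norm_pos_iff.2 hs0
  have hx : 0 < ‖z‖ := norm_pos_iff.2 hz
  rw [norm_dualArg]
  refine ⟨fun h => ?_, fun h => ?_, fun h => ?_⟩
  · rw [lt_div_iff₀ (by positivity)]; linarith
  · rw [mul_one_div, lt_div_iff₀ (by positivity)]; linarith
  · rw [mul_one_div, div_lt_iff₀ (by positivity)]
    have := mul_lt_mul_of_pos_left h (by positivity : 0 < ‖s‖ ^ 2)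
    linarith

theorem differentiableAt_plusIntegrand (hs0 : s ≠ 0) (hh : DifferentiableAt ℂ h x)
    (hf : DifferentiableAt ℂ f x) (hg : DifferentiableAt ℂ g x)
    (hr : PlusRegular ‖s‖ ‖h x‖ ‖f x‖ ‖g x‖) (μ : ℕ+ →₀ ℕ) :
    DifferentiableAt ℂ (fun x => currentPair s ε (f x) (g x) * plusIntegrand s (h x) (f x) (g x) *
      pairCoeff s ε (h x) μ (f x) (g x)) x := by
  obtain ⟨h3, h4⟩ := ne_zero_of_lt_mul_norm hr.left''
  have h5 := (ne_zero_of_lt_mul_norm hr.right'').1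
  have hd := differentiableAt_dualArg (s := s) hh h4
  obtain ⟨a1, a2, -⟩ := dualArg_norm_conditions hs0 h4 ‖f x‖
  obtain ⟨b1, b2, -⟩ := dualArg_norm_conditions hs0 h4 ‖g x‖
  have k1 := differentiableAt_currentPair (ε := ε) hs0 hf hg hr.cross hr.cross'
  have k2 := differentiableAt_pairCoeff (ε := ε) hs0 hh hf hg h4 h3 h5 μ
  have k3 := differentiableAt_plusKernel hh hf hg hr.left hr.left' hr.left'' hr.right hr.right'
    hr.right''
  have k4 := differentiableAt_vertexCurrent hd hf (a1 hr.dual_left) (a2 hr.dual_left')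
  have k5 := differentiableAt_vertexCurrent hd hg (b1 hr.dual_right) (b2 hr.dual_right')
  simp only [plusIntegrand]
  fun_prop

theorem differentiableAt_zeroIntegrand (hs0 : s ≠ 0) (hh : DifferentiableAt ℂ h x)
    (hf : DifferentiableAt ℂ f x) (hg : DifferentiableAt ℂ g x)
    (hr : ZeroRegular ‖s‖ ‖h x‖ ‖f x‖ ‖g x‖) (μ : ℕ+ →₀ ℕ) :
    DifferentiableAt ℂ (fun x => currentPair s ε (f x) (g x) * zeroIntegrand s (h x) (f x) (g x) *
      pairCoeff s ε (h x) μ (f x) (g x)) x := by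
  obtain ⟨h3, h4⟩ := ne_zero_of_lt_mul_norm hr.left''
  have h5 := (ne_zero_of_lt_mul_norm hr.right'').1
  have hd := differentiableAt_dualArg (s := s) hh h4
  obtain ⟨a1, a2, a3⟩ := dualArg_norm_conditions hs0 h4 ‖f x‖
  obtain ⟨b1, b2, -⟩ := dualArg_norm_conditions hs0 h4 ‖g x‖
  have k1 := differentiableAt_currentPair (ε := ε) hs0 hf hg hr.cross hr.cross'
  have k2 := differentiableAt_pairCoeff (ε := ε) hs0 hh hf hg h4 h3 h5 μ
  have k3 := differentiableAt_zeroKernel hh hg hr.right hr.right' hr.right''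
  have k4 := differentiableAt_currentVertex hh hf hr.left' hr.left''
  have k5 := differentiableAt_vertexCurrent hd hg (b1 hr.dual_right) (b2 hr.dual_right')
  have k6 := differentiableAt_zeroKernel hd hf (a1 hr.dual_left) (a3 hr.dual_left'')
    (a2 hr.dual_left')
  simp only [zeroIntegrand]
  fun_prop

theorem differentiableAt_minusIntegrand (hs0 : s ≠ 0) (hh : DifferentiableAt ℂ h x)
    (hf : DifferentiableAt ℂ f x) (hg : DifferentiableAt ℂ g x)
    (hr : MinusRegular ‖s‖ ‖h x‖ ‖f x‖ ‖g x‖) (μ : ℕ+ →₀ ℕ) :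
    DifferentiableAt ℂ (fun x => currentPair s ε (f x) (g x) * minusIntegrand s (h x) (f x) (g x) *
      pairCoeff s ε (h x) μ (f x) (g x)) x := by
  obtain ⟨h3, h4⟩ := ne_zero_of_lt_mul_norm hr.left''
  have h5 := (ne_zero_of_lt_mul_norm hr.right'').1
  have hd := differentiableAt_dualArg (s := s) hh h4
  obtain ⟨a1, a2, a3⟩ := dualArg_norm_conditions hs0 h4 ‖f x‖
  obtain ⟨b1, b2, b3⟩ := dualArg_norm_conditions hs0 h4 ‖g x‖
  have k1 := differentiableAt_currentPair (ε := ε) hs0 hf hg hr.cross hr.cross'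
  have k2 := differentiableAt_pairCoeff (ε := ε) hs0 hh hf hg h4 h3 h5 μ
  have k3 := differentiableAt_plusKernel hd hf hg (a1 hr.dual_left) (a3 hr.dual_left'')
    (a2 hr.dual_left') (b1 hr.dual_right) (b3 hr.dual_right'') (b2 hr.dual_right')
  have k4 := differentiableAt_currentVertex hh hf hr.left' hr.left''
  have k5 := differentiableAt_currentVertex hh hg hr.right' hr.right''
  simp only [minusIntegrand]
  fun_prop

end Regularity

end IzerginKorepin

namespace IzerginKorepin

open MvPowerSeries Filter Topology MeasureTheory Metric

/-! ### Reflection of the spectral parameter -/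

section TorusReflection

theorem HolOn.inv_left {G : ℂ → ℂ → ℂ} {B : Set ℂ} (h : HolOn G (sphere 0 1) B) :
    HolOn (fun a b => G a⁻¹ b) (sphere 0 1) B := fun a ha b hb => by
  have ha1 : ‖a‖ = 1 := mem_sphere_zero_iff_norm.1 ha
  have ha0 : a ≠ 0 := norm_pos_iff.1 (by rw [ha1]; exact one_pos)
  have hi : a⁻¹ ∈ sphere (0 : ℂ) 1 := by rw [mem_sphere_zero_iff_norm, norm_inv, ha1, inv_one]
  exact DifferentiableAt.comp (g := fun x : ℂ × ℂ => G x.1 x.2)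
    (f := fun x : ℂ × ℂ => (x.1⁻¹, x.2)) (a, b) (h _ hi b hb) (by fun_prop (disch := assumption))

theorem HolOn.inv_right {G : ℂ → ℂ → ℂ} {A : Set ℂ} (h : HolOn G A (sphere 0 1)) :
    HolOn (fun a b => G a b⁻¹) A (sphere 0 1) := h.swap.inv_left.swap

theorem torusAvg_inv_left {G : ℂ → ℂ → ℂ} {r : ℝ} (hr : 0 < r)
    (h : HolOn G (sphere 0 1) (sphere 0 r)) :
    torusAvg (fun a b => G a⁻¹ b) 1 r = torusAvg G 1 r := by
  rw [torusAvg_eq one_pos hr h, torusAvg_eq one_pos hr h.inv_left]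
  congr 1
  funext b
  exact circleAverage_inv fun a => G a b

theorem torusAvg_inv_right {G : ℂ → ℂ → ℂ} {r : ℝ} (hr : 0 < r)
    (h : HolOn G (sphere 0 r) (sphere 0 1)) :
    torusAvg (fun a b => G a b⁻¹) r 1 = torusAvg G r 1 := by
  rw [torusAvg_swap, torusAvg_swap G]
  exact torusAvg_inv_left hr h.swap

theorem torusAvg_zero (r₁ r₂ : ℝ) : torusAvg (fun _ _ => 0) r₁ r₂ = 0 := by simp [torusAvg]

theorem torusAvg_eq_zero_of_inv_antisymm {G : ℂ → ℂ → ℂ} {r : ℝ} (hr : 0 < r)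
    (h : HolOn G (sphere 0 r) (sphere 0 1))
    (hG : ∀ a ∈ sphere (0 : ℂ) r, ∀ b ∈ sphere (0 : ℂ) 1, G a b + G a b⁻¹ = 0) :
    torusAvg G r 1 = 0 := by
  have h1 := torusAvg_add hr one_pos h h.inv_right
  rw [torusAvg_congr hr one_pos (G' := fun _ _ => 0) hG, torusAvg_inv_right hr h,
    torusAvg_zero] at h1
  linear_combination -h1 / 2

/-- The measure of the unit torus is invariant under both inversions and the exchange of the
variables, a group of order eight; the average equals that of the mean over the group. -/
theorem torusAvg_eq_zero_of_weyl {G : ℂ → ℂ → ℂ} (h : HolOn G (sphere 0 1) (sphere 0 1))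
    (hG : ∀ a ∈ sphere (0 : ℂ) 1, ∀ b ∈ sphere (0 : ℂ) 1,
      (G a b + G a⁻¹ b + (G a b⁻¹ + G a⁻¹ b⁻¹)) + (G b a + G b⁻¹ a + (G b a⁻¹ + G b⁻¹ a⁻¹)) = 0) :
    torusAvg G 1 1 = 0 := by
  have i1 : HolOn (fun a b => G a b + G a⁻¹ b) (sphere 0 1) (sphere 0 1) :=
    fun a ha b hb => (h a ha b hb).add (h.inv_left a ha b hb)
  have i2 : HolOn (fun a b => G a b + G a⁻¹ b + (G a b⁻¹ + G a⁻¹ b⁻¹)) (sphere 0 1) (sphere 0 1) :=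
    fun a ha b hb => (i1 a ha b hb).add (i1.inv_right a ha b hb)
  have h0 := torusAvg_eq_zero_of_antisymm one_pos i2 fun a ha b hb => by
    rw [← hG a ha b hb]
  rw [torusAvg_add one_pos one_pos i1 i1.inv_right, torusAvg_inv_right one_pos i1,
    torusAvg_add one_pos one_pos h h.inv_left, torusAvg_inv_left one_pos h] at h0
  linear_combination h0 / 4

end TorusReflection

/-! ### Closed forms and symmetries of the contractions -/

section Kernels

variable {s ζ v v₁ v₂ : ℂ}

theorem vertexCurrent_eq (hζ : ζ ≠ 0) (hv : v ≠ 0) :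
    vertexCurrent s ζ v = ζ ^ 2 * v / ((ζ - s ^ 2 * v) * (v * ζ - s ^ 2)) := by
  rw [vertexCurrent, show 1 - s ^ 2 * v / ζ = (ζ - s ^ 2 * v) / ζ by field_simp,
    show 1 - s ^ 2 / (v * ζ) = (v * ζ - s ^ 2) / (v * ζ) by field_simp, inv_div, inv_div,
    div_mul_div_comm]
  congr 1
  ring

theorem currentVertex_eq (hζ : ζ ≠ 0) (hv : v ≠ 0) :
    currentVertex s ζ v = ζ * v ^ 2 / ((v - s ^ 2 * ζ) * (v * ζ - s ^ 2)) := by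
  rw [currentVertex, show 1 - s ^ 2 * ζ / v = (v - s ^ 2 * ζ) / v by field_simp,
    show 1 - s ^ 2 / (ζ * v) = (v * ζ - s ^ 2) / (v * ζ) by field_simp, inv_div, inv_div,
    div_mul_div_comm]
  congr 1
  ring

/-- Over the common denominator the two orders of the `q`-commutator combine to a monomial
numerator: besides the shared pole from the mirror image, both poles `ζ = q v` and `v = q ζ` are
present. -/
theorem zeroKernel_eq (hζ : ζ ≠ 0) (hv : v ≠ 0) (h1 : ζ - s ^ 2 * v ≠ 0) (h2 : v - s ^ 2 * ζ ≠ 0)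
    (h3 : v * ζ - s ^ 2 ≠ 0) : zeroKernel s ζ v = (1 - s ^ 4) * ζ ^ 2 * v ^ 2 /
      ((ζ - s ^ 2 * v) * (v - s ^ 2 * ζ) * (v * ζ - s ^ 2)) := by
  rw [zeroKernel, vertexCurrent_eq hζ hv, currentVertex_eq hζ hv]
  generalize e1 : ζ - s ^ 2 * v = A at *
  generalize e2 : v - s ^ 2 * ζ = B at *
  generalize e3 : v * ζ - s ^ 2 = C at *
  field_simp
  subst e1 e2
  ring

theorem plusKernel_eq (hζ : ζ ≠ 0) (hv₁ : v₁ ≠ 0) (hv₂ : v₂ ≠ 0) (h1 : ζ - s ^ 2 * v₁ ≠ 0)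
    (h2 : v₁ - s ^ 2 * ζ ≠ 0) (h3 : v₁ * ζ - s ^ 2 ≠ 0) (k1 : ζ - s ^ 2 * v₂ ≠ 0)
    (k2 : v₂ - s ^ 2 * ζ ≠ 0) (k3 : v₂ * ζ - s ^ 2 ≠ 0) :
    plusKernel s ζ v₁ v₂ = -((1 - s ^ 4) * ζ ^ 3 * v₁ ^ 2 * v₂ *
      (ζ * v₂ + (1 - s ^ 2) * v₁ * v₂ - s ^ 2 * ζ * v₁)) /
      ((ζ - s ^ 2 * v₁) * (v₁ - s ^ 2 * ζ) * (v₁ * ζ - s ^ 2) *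
        ((ζ - s ^ 2 * v₂) * (v₂ - s ^ 2 * ζ) * (v₂ * ζ - s ^ 2))) := by
  rw [plusKernel, zeroKernel_eq hζ hv₁ h1 h2 h3, zeroKernel_eq hζ hv₂ k1 k2 k3,
    vertexCurrent_eq hζ hv₂, currentVertex_eq hζ hv₁]
  generalize e1 : ζ - s ^ 2 * v₁ = A₁ at *
  generalize e2 : v₁ - s ^ 2 * ζ = B₁ at *
  generalize e3 : v₁ * ζ - s ^ 2 = C₁ at *
  generalize f1 : ζ - s ^ 2 * v₂ = A₂ at *
  generalize f2 : v₂ - s ^ 2 * ζ = B₂ at *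
  generalize f3 : v₂ * ζ - s ^ 2 = C₂ at *
  field_simp
  subst e1 f2
  ring

theorem currentPair_eq {ε : SignType} (hs0 : s ≠ 0) (hv₁ : v₁ ≠ 0) (hv₂ : v₂ ≠ 0)
    (h1 : v₁ + s ^ 2 * v₂ ≠ 0) (h2 : v₁ * v₂ + s ^ 2 ≠ 0) :
    currentPair s ε v₁ v₂ = (v₁ ^ 2 - 1) * (s * v₁ - ε * Complex.I) * ((v₂ ^ 2 - 1) *
      (s * v₂ - ε * Complex.I)) * ((v₁ - v₂) * (v₁ - s ^ 4 * v₂)) *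
        ((v₁ * v₂ - 1) * (v₁ * v₂ - s ^ 4)) /
      (s ^ 2 * v₁ ^ 5 * v₂ ^ 4 * ((v₁ + s ^ 2 * v₂) * (v₁ * v₂ + s ^ 2))) := by
  rw [currentPair, currentSelf, currentSelf, currentCurrent, currentKernel, currentKernel,
    show 1 + s ^ 2 * (v₂ / v₁) = (v₁ + s ^ 2 * v₂) / v₁ by field_simp,
    show 1 + s ^ 2 * (1 / (v₁ * v₂)) = (v₁ * v₂ + s ^ 2) / (v₁ * v₂) by field_simp]
  generalize v₁ + s ^ 2 * v₂ = A at *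
  generalize v₁ * v₂ + s ^ 2 = B at *
  field_simp

theorem currentShift_inv (s v : ℂ) (m : ℕ+) : currentShift s v⁻¹ m = currentShift s v m := by
  simp only [currentShift, inv_pow, inv_inv]
  ring

theorem pairCoeff_inv_left (s : ℂ) (ε : SignType) (z : ℂ) (μ : ℕ+ →₀ ℕ) (a b : ℂ) :
    pairCoeff s ε z μ a⁻¹ b = pairCoeff s ε z μ a b := by
  unfold pairCoeff
  congr 2
  funext m
  simp only [stateShift, List.map_cons, List.map_nil, currentShift_inv]

theorem pairCoeff_inv_right (s : ℂ) (ε : SignType) (z : ℂ) (μ : ℕ+ →₀ ℕ) (a b : ℂ) :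
    pairCoeff s ε z μ a b⁻¹ = pairCoeff s ε z μ a b := by
  unfold pairCoeff
  congr 2
  funext m
  simp only [stateShift, List.map_cons, List.map_nil, currentShift_inv]

theorem pairCoeff_swap (s : ℂ) (ε : SignType) (z : ℂ) (μ : ℕ+ →₀ ℕ) (a b : ℂ) :
    pairCoeff s ε z μ b a = pairCoeff s ε z μ a b := by
  unfold pairCoeff
  congr 2
  funext m
  simp only [stateShift, List.map_cons, List.map_nil, List.sum_cons, List.sum_nil]
  ring

/-- The two factors are the contractions with a current and with its mirror image, and inversion
exchanges them. -/
theorem vertexCurrent_inv (s ζ v : ℂ) : vertexCurrent s ζ v⁻¹ = vertexCurrent s ζ v := by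
  rw [vertexCurrent, vertexCurrent, mul_comm]
  congr 2
  · rw [div_eq_mul_inv, div_eq_mul_inv, mul_inv, inv_inv]; ring
  · rw [div_eq_mul_inv, div_eq_mul_inv, mul_inv]; ring

/-- Inversion of `ζ` exchanges the vertex operator with its mirror image. Hence the term with
`Φ_-(z)` needs no separate reflection argument. -/
theorem currentVertex_inv (s ζ v : ℂ) : currentVertex s ζ⁻¹ v = currentVertex s ζ v := by
  rw [currentVertex, currentVertex, mul_comm]
  congr 2
  · rw [div_eq_mul_inv, div_eq_mul_inv, mul_inv, inv_inv]; ring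
  · rw [div_eq_mul_inv, div_eq_mul_inv, mul_inv]; ring

end Kernels

end IzerginKorepin

/-! ### Antisymmetrization over the Weyl group -/

namespace IzerginKorepin

open MvPowerSeries Filter Topology MeasureTheory Metric

set_option linter.unusedVariables false

/-- The polynomial part of the antisymmetrized integrand of `Φ_+`. -/
noncomputable def weylPoly (q c d k z a b : ℂ) : ℂ :=
  (c * a - d) * (c * b - d) * ((a - q ^ 2 * b) * (a * b - q ^ 2)) * ((b + q * a) * (1 + q * a * b)) *
    (k * ((z * b + (1 - q) * a * b - q * z * a) * (1 - q * a * z) * (1 - q * b * z)) -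
      z * ((b + (1 - q) * a * b * z - q * a) * (z - q * a) * (z - q * b))) / (a ^ 4 * b ^ 4)

/-- The alternating sum over the Weyl group of type `B₂`. -/
noncomputable def weylSum (f : ℂ → ℂ → ℂ) (a b : ℂ) : ℂ :=
  f a b - f a⁻¹ b - f a b⁻¹ + f a⁻¹ b⁻¹ - (f b a - f b⁻¹ a - f b a⁻¹ + f b⁻¹ a⁻¹)

set_option maxHeartbeats 4000000 in
theorem weylSum_weylPoly_zero (q c z : ℂ) {a b : ℂ} (ha : a ≠ 0) (hb : b ≠ 0) :
    weylSum (weylPoly q c 0 1 z) a b = 0 := by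
  unfold weylSum weylPoly
  field_simp
  ring

-- The parameter `K` with `q = -K ^ 2` absorbs the imaginary unit of the boundary condition, so that
-- the vanishing becomes an identity of Laurent polynomials with integer coefficients.
set_option maxHeartbeats 4000000 in
theorem weylSum_weylPoly_one (K z : ℂ) {a b : ℂ} (ha : a ≠ 0) (hb : b ≠ 0) :
    weylSum (weylPoly (-K ^ 2) K 1 (z ^ 2) z) a b = 0 := by
  unfold weylSum weylPoly
  field_simp
  ring

theorem weylSum_weylPoly {s z a b : ℂ} (ε : SignType) (ha : a ≠ 0) (hb : b ≠ 0) :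
    weylSum (weylPoly (s ^ 2) s (ε * Complex.I) (kDiag s ε z 1) z) a b = 0 := by
  by_cases hε : ε = 0
  · subst hε
    simp only [kDiag, if_true, SignType.coe_zero, zero_mul]
    exact weylSum_weylPoly_zero _ _ _ ha hb
  · have hj : ((ε : ℂ) * Complex.I) ^ 2 = -1 := by
      rw [mul_pow, Complex.I_sq]
      cases ε
      · exact absurd rfl hε
      · simp
      · simp
    have hk : kDiag s ε z 1 = z ^ 2 := by
      change (if ε = 0 then (1 : ℂ) else z ^ 2) = z ^ 2
      rw [if_neg hε]
    rw [hk]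
    generalize (ε : ℂ) * Complex.I = j at hj
    -- With `j ^ 2 = -1` one has `s x - j = j (K x - 1)` for `K = -j s`; the two such factors give
    -- `j ^ 2`.
    have h1 : ∀ x y, weylPoly (s ^ 2) s j (z ^ 2) z x y =
        j ^ 2 * weylPoly (-(-(j * s)) ^ 2) (-(j * s)) 1 (z ^ 2) z x y := fun x y => by
      have e1 : -(-(j * s)) ^ 2 = s ^ 2 := by linear_combination -s ^ 2 * hj
      have e2 : ∀ x, s * x - j = j * (-(j * s) * x - 1) := fun x => by
        linear_combination s * x * hj
      rw [e1, weylPoly, weylPoly, e2, e2]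
      ring
    have h2 := weylSum_weylPoly_one (-(j * s)) z ha hb
    unfold weylSum at h2 ⊢
    simp only [h1]
    linear_combination j ^ 2 * h2

/-- The invariant denominator from the contraction of two currents. -/
noncomputable def weylDen (q a b : ℂ) : ℂ :=
  (a + q * b) * (a * b + q) * ((b + q * a) * (1 + q * a * b)) / (a ^ 2 * b ^ 2)

/-- The invariant denominator from the contraction of a current with a vertex operator. -/
noncomputable def reflDen (q z a : ℂ) : ℂ :=
  (z - q * a) * (a - q * z) * (a * z - q) * (1 - q * a * z) / a ^ 2

/-- The Weyl denominator of type `C₂`. -/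
noncomputable def weylDelta (a b : ℂ) : ℂ :=
  (a ^ 2 - 1) * (b ^ 2 - 1) * (a - b) * (a * b - 1) / (a ^ 2 * b ^ 2)

section Invariance

variable {a b : ℂ} (q z : ℂ)

theorem weylDen_inv_left (ha : a ≠ 0) (hb : b ≠ 0) : weylDen q a⁻¹ b = weylDen q a b := by
  unfold weylDen; field_simp

theorem weylDen_inv_right (ha : a ≠ 0) (hb : b ≠ 0) : weylDen q a b⁻¹ = weylDen q a b := by
  unfold weylDen; field_simp

theorem weylDen_swap : weylDen q b a = weylDen q a b := by
  unfold weylDen; rw [mul_comm (b ^ 2)]; congr 1; ring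

theorem reflDen_inv (ha : a ≠ 0) : reflDen q z a⁻¹ = reflDen q z a := by
  unfold reflDen; field_simp

theorem weylDelta_inv_left (ha : a ≠ 0) (hb : b ≠ 0) : weylDelta a⁻¹ b = -weylDelta a b := by
  unfold weylDelta; field_simp; ring

theorem weylDelta_inv_right (ha : a ≠ 0) (hb : b ≠ 0) : weylDelta a b⁻¹ = -weylDelta a b := by
  unfold weylDelta; field_simp; ring

theorem weylDelta_swap : weylDelta b a = -weylDelta a b := by
  unfold weylDelta; rw [mul_comm (b ^ 2), ← neg_div]; congr 1; ring

end Invariance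

/-- The integrand of `Φ_- Φ_+` after reflection of the first spectral parameter. -/
noncomputable def plusReflected (s z v₁ v₂ : ℂ) : ℂ :=
  s ^ 8 * (v₁ * v₂) * plusKernel s z⁻¹ v₁ v₂ *
    (vertexCurrent s (dualArg s z) v₁ * vertexCurrent s (dualArg s z) v₂)

/-- The integrand of `Φ_0 Φ_0` after reflection of the first spectral parameter. -/
noncomputable def zeroReflected (s z v₁ v₂ : ℂ) : ℂ :=
  -s ^ 6 * (v₁ * v₂) * (zeroKernel s z⁻¹ v₂ * vertexCurrent s (dualArg s z) v₂) *
    (currentVertex s z v₁ * zeroKernel s (dualArg s z) v₁)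

section UnitCircle

variable {s z : ℂ} {ε : SignType}

/-- Multiply numerator and denominator by the factors that complete the denominators to
Weyl-invariant ones. The surplus factors enter `weylPoly`, and the antisymmetric `weylDelta` splits
off, so a sum over the group becomes an alternating sum of `weylPoly`. -/
theorem weyl_integrand (hs0 : s ≠ 0) (hs : ‖s‖ < 1) (hz : ‖z‖ = 1) (k : ℂ) {a b : ℂ}
    (ha : ‖a‖ = 1) (hb : ‖b‖ = 1) :
    currentPair s ε a b * (a * b) * (k * plusKernel s z a b - z ^ 2 * plusKernel s z⁻¹ a b) =
      -((1 - s ^ 4) * z ^ 3 / s ^ 2) * (weylDelta a b * weylPoly (s ^ 2) s (ε * Complex.I) k z a b *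
        (weylDen (s ^ 2) a b * (reflDen (s ^ 2) z a * reflDen (s ^ 2) z b))⁻¹) := by
  have hq : ‖s ^ 2‖ < 1 := norm_pow_lt_one hs two_ne_zero
  have hz0 : z ≠ 0 := norm_pos_iff.1 (hz ▸ one_pos)
  have ha0 : a ≠ 0 := norm_pos_iff.1 (ha ▸ one_pos)
  have hb0 : b ≠ 0 := norm_pos_iff.1 (hb ▸ one_pos)
  have hne : ∀ x y : ℂ, ‖x‖ = 1 → ‖y‖ = 1 → x - s ^ 2 * y ≠ 0 := fun x y hx hy =>
    sub_ne_zero_of_lt_norm (by rw [norm_mul, hx, hy, mul_one]; exact hq)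
  have hne' : ∀ x y : ℂ, ‖x‖ = 1 → ‖y‖ = 1 → x + s ^ 2 * y ≠ 0 := fun x y hx hy =>
    add_mul_ne_zero (by rw [hx, hy, mul_one]; exact hq)
  have hzi : ‖z⁻¹‖ = 1 := by rw [norm_inv, hz, inv_one]
  have hm : ∀ {x y : ℂ}, ‖x‖ = 1 → ‖y‖ = 1 → ‖x * y‖ = 1 := fun hx hy => by
    rw [norm_mul, hx, hy, one_mul]
  have c1 : ∀ x y : ℂ, ‖x‖ = 1 → ‖y‖ = 1 → x * y - s ^ 2 ≠ 0 := fun x y hx hy => by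
    simpa using hne (x * y) 1 (hm hx hy) norm_one
  rw [currentPair_eq hs0 ha0 hb0 (hne' a b ha hb)
      (by simpa using hne' (a * b) 1 (hm ha hb) norm_one),
    plusKernel_eq hz0 ha0 hb0 (hne z a hz ha) (hne a z ha hz) (c1 a z ha hz) (hne z b hz hb)
      (hne b z hb hz) (c1 b z hb hz),
    plusKernel_eq (inv_ne_zero hz0) ha0 hb0 (hne _ a hzi ha) (hne a _ ha hzi) (c1 a _ ha hzi)
      (hne _ b hzi hb) (hne b _ hb hzi) (c1 b _ hb hzi)]
  have e1 : ∀ x, z⁻¹ - s ^ 2 * x = (1 - s ^ 2 * x * z) / z := fun x => by field_simp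
  have e2 : ∀ x, x - s ^ 2 * z⁻¹ = (x * z - s ^ 2) / z := fun x => by field_simp
  have e3 : ∀ x, x * z⁻¹ - s ^ 2 = (x - s ^ 2 * z) / z := fun x => by field_simp
  have e4 : z⁻¹ * b + (1 - s ^ 2) * a * b - s ^ 2 * z⁻¹ * a =
    (b + (1 - s ^ 2) * a * b * z - s ^ 2 * a) / z := by field_simp
  simp only [e1, e2, e3, e4, weylDelta, weylPoly, weylDen, reflDen]
  have n1 := hne z a hz ha
  have n2 := hne a z ha hz
  have n3 := c1 a z ha hz
  have n4 := hne z b hz hb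
  have n5 := hne b z hb hz
  have n6 := c1 b z hb hz
  have n7 := hne' a b ha hb
  have n8 : a * b + s ^ 2 ≠ 0 := by simpa using hne' (a * b) 1 (hm ha hb) norm_one
  have n9 : b + s ^ 2 * a ≠ 0 := hne' b a hb ha
  have n10 : 1 + s ^ 2 * a * b ≠ 0 := by
    rw [mul_assoc]; exact hne' 1 (a * b) norm_one (hm ha hb)
  have n11 : 1 - s ^ 2 * a * z ≠ 0 := by
    rw [mul_assoc]; exact hne 1 (a * z) norm_one (hm ha hz)
  have n12 : 1 - s ^ 2 * b * z ≠ 0 := by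
    rw [mul_assoc]; exact hne 1 (b * z) norm_one (hm hb hz)
  generalize f7 : a + s ^ 2 * b = D7 at *
  generalize f8 : a * b + s ^ 2 = D8 at *
  generalize f9 : b + s ^ 2 * a = D9 at *
  generalize f10 : 1 + s ^ 2 * a * b = D10 at *
  generalize f11 : 1 - s ^ 2 * a * z = D11 at *
  generalize f12 : 1 - s ^ 2 * b * z = D12 at *
  generalize f1 : z - s ^ 2 * a = D1 at *
  generalize f2 : a - s ^ 2 * z = D2 at *
  generalize f3 : a * z - s ^ 2 = D3 at *
  generalize f4 : z - s ^ 2 * b = D4 at *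
  generalize f5 : b - s ^ 2 * z = D5 at *
  generalize f6 : b * z - s ^ 2 = D6 at *
  field_simp
  ring

end UnitCircle

end IzerginKorepin

/-! ### Reflection of `Φ_+` on the unit circle -/

namespace IzerginKorepin

open MvPowerSeries Filter Topology MeasureTheory Metric

section UnitCircle

variable {s z : ℂ} {ε : SignType}

theorem holOn_plusReflected (hs0 : s ≠ 0) (hs : ‖s‖ < 1) (hz : ‖z‖ = 1) (μ : ℕ+ →₀ ℕ) :
    HolOn (fun a b => currentPair s ε a b * plusReflected s z a b * pairCoeff s ε z μ a b)
      (sphere 0 1) (sphere 0 1) := fun a ha b hb => by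
  rw [mem_sphere_zero_iff_norm] at ha hb
  have hz0 : z ≠ 0 := norm_pos_iff.1 (hz ▸ one_pos)
  have ha0 : a ≠ 0 := norm_pos_iff.1 (ha ▸ one_pos)
  have hb0 : b ≠ 0 := norm_pos_iff.1 (hb ▸ one_pos)
  have hzi : ‖z⁻¹‖ = 1 := by rw [norm_inv, hz, inv_one]
  have ht2 : ‖s‖ ^ 2 < 1 := pow_lt_one₀ (norm_nonneg _) hs two_ne_zero
  have ht8 : ‖s‖ ^ 8 < 1 := pow_lt_one₀ (norm_nonneg _) hs (by norm_num)
  have hf : DifferentiableAt ℂ (fun x : ℂ × ℂ => x.1) (a, b) := by fun_prop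
  have hg : DifferentiableAt ℂ (fun x : ℂ × ℂ => x.2) (a, b) := by fun_prop
  have hc : ∀ c : ℂ, DifferentiableAt ℂ (fun _ : ℂ × ℂ => c) (a, b) := fun c => by fun_prop
  obtain ⟨a1, a2, -⟩ := dualArg_norm_conditions hs0 hz0 1
  have k1 := differentiableAt_currentPair (ε := ε) hs0 hf hg (by simpa [ha, hb]) (by simpa [ha, hb])
  have k2 := differentiableAt_pairCoeff (ε := ε) hs0 (hc z) hf hg hz0 ha0 hb0 μ
  have k3 := differentiableAt_plusKernel (s := s) (hc z⁻¹) hf hg (by simpa [ha, hb, hz])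
    (by simpa [ha, hb, hz]) (by simpa [ha, hb, hz]) (by simpa [ha, hb, hz])
    (by simpa [ha, hb, hz]) (by simpa [ha, hb, hz])
  have h1 : ‖s‖ ^ 2 * 1 < ‖dualArg s z‖ := a1 (by simpa [hz])
  have h2 : ‖s‖ ^ 2 < 1 * ‖dualArg s z‖ := a2 (by simpa [hz])
  have k4 := differentiableAt_vertexCurrent (s := s) (hc (dualArg s z)) hf (by rwa [ha]) (by rwa [ha])
  have k5 := differentiableAt_vertexCurrent (s := s) (hc (dualArg s z)) hg (by rwa [hb]) (by rwa [hb])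
  simp only [plusReflected]
  fun_prop

theorem plusRegular_one (hs : ‖s‖ < 1) : PlusRegular ‖s‖ 1 1 1 := by
  have ht2 : ‖s‖ ^ 2 < 1 := pow_lt_one₀ (norm_nonneg _) hs two_ne_zero
  have ht8 : ‖s‖ ^ 8 < 1 := pow_lt_one₀ (norm_nonneg _) hs (by norm_num)
  constructor <;> simpa

theorem holOn_plusIntegrand (hs0 : s ≠ 0) {r₁ r₂ r₁' r₂' : ℝ}
    (h : ∀ x y, r₁ ≤ x → x ≤ r₁' → r₂ ≤ y → y ≤ r₂' → PlusRegular ‖s‖ ‖z‖ x y) (μ : ℕ+ →₀ ℕ) :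
    HolOn (fun a b => currentPair s ε a b * plusIntegrand s z a b * pairCoeff s ε z μ a b)
      (annulus r₁ r₁') (annulus r₂ r₂') := fun a ha b hb =>
  differentiableAt_plusIntegrand (h := fun _ => z) (f := fun x : ℂ × ℂ => x.1)
    (g := fun x : ℂ × ℂ => x.2) hs0 (by fun_prop) (by fun_prop) (by fun_prop)
    (h _ _ ha.1 ha.2 hb.1 hb.2) μ

theorem holOn_zeroIntegrand (hs0 : s ≠ 0) {r₁ r₂ r₁' r₂' : ℝ}
    (h : ∀ x y, r₁ ≤ x → x ≤ r₁' → r₂ ≤ y → y ≤ r₂' → ZeroRegular ‖s‖ ‖z‖ x y) (μ : ℕ+ →₀ ℕ) :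
    HolOn (fun a b => currentPair s ε a b * zeroIntegrand s z a b * pairCoeff s ε z μ a b)
      (annulus r₁ r₁') (annulus r₂ r₂') := fun a ha b hb =>
  differentiableAt_zeroIntegrand (h := fun _ => z) (f := fun x : ℂ × ℂ => x.1)
    (g := fun x : ℂ × ℂ => x.2) hs0 (by fun_prop) (by fun_prop) (by fun_prop)
    (h _ _ ha.1 ha.2 hb.1 hb.2) μ

theorem HolOn.const_mul {G : ℂ → ℂ → ℂ} {A B : Set ℂ} (h : HolOn G A B) (c : ℂ) :
    HolOn (fun a b => c * G a b) A B := fun a ha b hb => (h a ha b hb).const_mul c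

theorem sphere_eq_annulus (r : ℝ) : sphere (0 : ℂ) r = annulus r r := by
  ext v
  rw [mem_sphere_zero_iff_norm]
  exact ⟨fun h => ⟨h.ge, h.le⟩, fun h => le_antisymm h.2 h.1⟩

/-- Reflection of the spectral parameter in `Φ_+`. -/
theorem torusAvg_plusReflected (hs0 : s ≠ 0) (hs : ‖s‖ < 1) (hz : ‖z‖ = 1) (μ : ℕ+ →₀ ℕ) :
    kDiag s ε z 1 * torusAvg (fun a b => currentPair s ε a b * plusIntegrand s z a b *
      pairCoeff s ε z μ a b) 1 1 = z ^ 2 * torusAvg (fun a b => currentPair s ε a b *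
        plusReflected s z a b * pairCoeff s ε z μ a b) 1 1 := by
  have i1 : HolOn (fun a b => currentPair s ε a b * plusIntegrand s z a b * pairCoeff s ε z μ a b)
      (sphere 0 1) (sphere 0 1) := by
    rw [sphere_eq_annulus]
    refine holOn_plusIntegrand hs0 (fun x y h1 h2 h3 h4 => ?_) μ
    rw [le_antisymm h2 h1, le_antisymm h4 h3, hz]
    exact plusRegular_one hs
  have i2 := holOn_plusReflected (ε := ε) hs0 hs hz μ
  have i3 := i1.const_mul (kDiag s ε z 1)
  have i4 := i2.const_mul (-z ^ 2)
  have i5 : HolOn (fun a b => kDiag s ε z 1 * (currentPair s ε a b * plusIntegrand s z a b *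
      pairCoeff s ε z μ a b) + -z ^ 2 * (currentPair s ε a b * plusReflected s z a b *
        pairCoeff s ε z μ a b)) (sphere 0 1) (sphere 0 1) :=
    fun a ha b hb => (i3 a ha b hb).add (i4 a ha b hb)
  have key := torusAvg_eq_zero_of_weyl i5 ?_
  · rw [torusAvg_add one_pos one_pos i3 i4, torusAvg_const_mul, torusAvg_const_mul] at key
    linear_combination key
  -- The remaining factors, the contractions with the dual operator and the Gaussian coefficient,
  -- are invariant under the Weyl group and pass through as a common multiplier.
  have hform : ∀ a b : ℂ, ‖a‖ = 1 → ‖b‖ = 1 → kDiag s ε z 1 * (currentPair s ε a b *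
      plusIntegrand s z a b * pairCoeff s ε z μ a b) + -z ^ 2 * (currentPair s ε a b *
        plusReflected s z a b * pairCoeff s ε z μ a b) =
      -((1 - s ^ 4) * z ^ 3 / s ^ 2) * (s ^ 8 * (vertexCurrent s (dualArg s z) a *
        vertexCurrent s (dualArg s z) b) * pairCoeff s ε z μ a b) * (weylDelta a b *
        weylPoly (s ^ 2) s (ε * Complex.I) (kDiag s ε z 1) z a b *
        (weylDen (s ^ 2) a b * (reflDen (s ^ 2) z a * reflDen (s ^ 2) z b))⁻¹) := by
    intro a b ha hb
    have h := weyl_integrand (ε := ε) hs0 hs hz (kDiag s ε z 1) ha hb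
    rw [plusIntegrand, plusReflected]
    linear_combination (s ^ 8 * (vertexCurrent s (dualArg s z) a *
        vertexCurrent s (dualArg s z) b) * pairCoeff s ε z μ a b) * h
  intro a ha b hb
  rw [mem_sphere_zero_iff_norm] at ha hb
  have ha0 : a ≠ 0 := norm_pos_iff.1 (ha ▸ one_pos)
  have hb0 : b ≠ 0 := norm_pos_iff.1 (hb ▸ one_pos)
  have ha' : ‖a⁻¹‖ = 1 := by rw [norm_inv, ha, inv_one]
  have hb' : ‖b⁻¹‖ = 1 := by rw [norm_inv, hb, inv_one]
  have hai := inv_ne_zero ha0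
  have hbi := inv_ne_zero hb0
  rw [hform a b ha hb, hform _ b ha' hb, hform a _ ha hb', hform _ _ ha' hb', hform b a hb ha,
    hform _ a hb' ha, hform b _ hb ha', hform _ _ hb' ha']
  simp only [vertexCurrent_inv, pairCoeff_inv_left, pairCoeff_inv_right, pairCoeff_swap s ε z μ a b,
    weylDen_inv_left (s ^ 2) ha0 hb0, weylDen_inv_right (s ^ 2) ha0 hb0,
    weylDen_inv_right (s ^ 2) hai hb0, weylDen_inv_left (s ^ 2) hb0 ha0,
    weylDen_inv_right (s ^ 2) hb0 ha0, weylDen_inv_right (s ^ 2) hbi ha0,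
    reflDen_inv (s ^ 2) z ha0, reflDen_inv (s ^ 2) z hb0, weylDelta_inv_left ha0 hb0,
    weylDelta_inv_right ha0 hb0, weylDelta_inv_right hai hb0, weylDelta_inv_left hb0 ha0,
    weylDelta_inv_right hb0 ha0, weylDelta_inv_right hbi ha0, weylDen_swap (a := a) (b := b),
    weylDelta_swap (a := a) (b := b)]
  have h := weylSum_weylPoly (s := s) (z := z) ε ha0 hb0
  unfold weylSum at h
  rw [mul_comm (reflDen (s ^ 2) z b)]
  generalize weylPoly (s ^ 2) s (ε * Complex.I) (kDiag s ε z 1) z = f at *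
  linear_combination -((1 - s ^ 4) * z ^ 3 / s ^ 2) * (s ^ 8 * (vertexCurrent s (dualArg s z) a *
        vertexCurrent s (dualArg s z) b) * pairCoeff s ε z μ a b) * weylDelta a b *
        (weylDen (s ^ 2) a b * (reflDen (s ^ 2) z a * reflDen (s ^ 2) z b))⁻¹ * h

end UnitCircle

end IzerginKorepin

/-! ### Reflection of `Φ_0` on the unit circle -/

namespace IzerginKorepin

open MvPowerSeries Filter Topology MeasureTheory Metric

section UnitCircle

variable {s z : ℂ} {ε : SignType}

theorem sign_mul_I_sq (hε : ε ≠ 0) : ((ε : ℂ) * Complex.I) ^ 2 = -1 := by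
  rw [mul_pow, Complex.I_sq]
  cases ε
  · exact absurd rfl hε
  · simp
  · simp

theorem norm_sign_mul_I_le (ε : SignType) : ‖(ε : ℂ) * Complex.I‖ ≤ 1 := by
  cases ε <;> simp

/-- The linear relation that characterizes the middle entry of `K_ε(z)`. It is exactly the condition
for the bracket in `refl_integrand` to be even under `b ↦ b⁻¹`. -/
theorem kDiag_zero_mul (hs : ‖s‖ < 1) (hz : ‖z‖ = 1) :
    kDiag s ε z 0 * (s ^ 3 * z - ε * Complex.I) = s ^ 3 * z - ε * Complex.I * z ^ 2 := by
  by_cases hε : ε = 0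
  · subst hε
    simp [kDiag]
  have hj := sign_mul_I_sq hε
  have hz0 : z ≠ 0 := norm_pos_iff.1 (hz ▸ one_pos)
  have hk : kDiag s ε z 0 = (ε * Complex.I * s ^ 3 + z) / (ε * Complex.I * s ^ 3 + z⁻¹) := by
    change (if ε = 0 then (1 : ℂ) else _) = _
    rw [if_neg hε]
  have hne : ε * Complex.I * s ^ 3 + z⁻¹ ≠ 0 := by
    rw [add_comm, mul_comm]
    refine add_mul_ne_zero (q := s ^ 3) (b := ε * Complex.I) ?_
    rw [norm_inv, hz, inv_one]
    exact (mul_le_of_le_one_right (norm_nonneg _) (norm_sign_mul_I_le ε)).trans_lt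
      (norm_pow_lt_one hs (by norm_num))
  rw [hk, div_mul_eq_mul_div, div_eq_iff hne]
  field_simp
  linear_combination s ^ 3 * (z ^ 2 - 1) * hj

theorem currentCurrent_inv_right (s a b : ℂ) : currentCurrent s a b⁻¹ = currentCurrent s a b := by
  rw [currentCurrent, currentCurrent, mul_comm]
  congr 2
  · rw [div_eq_mul_inv, div_eq_mul_inv, mul_inv, inv_inv]; ring
  · rw [div_eq_mul_inv, div_eq_mul_inv, mul_inv]; ring

/-- The factor `b - b⁻¹` is odd under inversion and `reflDen` is even, so the parity of the
integrand is decided by the remaining factor. Only one current runs on the unit circle here, so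
inversion of one variable suffices. -/
theorem refl_integrand (hs0 : s ≠ 0) (hs : ‖s‖ < 1) (hz : ‖z‖ = 1) (k : ℂ) {b : ℂ}
    (hb : ‖b‖ = 1) :
    currentSelf s ε b * b * (k * zeroKernel s z b - z ^ 2 * zeroKernel s z⁻¹ b) =
      (1 - s ^ 4) * z ^ 2 / s * ((b - b⁻¹) * ((s * b - ε * Complex.I) / b *
        (k * (1 - s ^ 2 * b * z) - z * (z - s ^ 2 * b))) * (reflDen (s ^ 2) z b)⁻¹) := by
  have hq : ‖s ^ 2‖ < 1 := norm_pow_lt_one hs two_ne_zero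
  have hz0 : z ≠ 0 := norm_pos_iff.1 (hz ▸ one_pos)
  have hb0 : b ≠ 0 := norm_pos_iff.1 (hb ▸ one_pos)
  have hne : ∀ x y : ℂ, ‖x‖ = 1 → ‖y‖ = 1 → x - s ^ 2 * y ≠ 0 := fun x y hx hy =>
    sub_ne_zero_of_lt_norm (by rw [norm_mul, hx, hy, mul_one]; exact hq)
  have hzi : ‖z⁻¹‖ = 1 := by rw [norm_inv, hz, inv_one]
  have hm : ∀ {x y : ℂ}, ‖x‖ = 1 → ‖y‖ = 1 → ‖x * y‖ = 1 := fun hx hy => by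
    rw [norm_mul, hx, hy, one_mul]
  have c1 : ∀ x y : ℂ, ‖x‖ = 1 → ‖y‖ = 1 → x * y - s ^ 2 ≠ 0 := fun x y hx hy => by
    simpa using hne (x * y) 1 (hm hx hy) norm_one
  rw [zeroKernel_eq hz0 hb0 (hne z b hz hb) (hne b z hb hz) (c1 b z hb hz),
    zeroKernel_eq (inv_ne_zero hz0) hb0 (hne _ b hzi hb) (hne b _ hb hzi) (c1 b _ hb hzi)]
  have e1 : ∀ x, z⁻¹ - s ^ 2 * x = (1 - s ^ 2 * x * z) / z := fun x => by field_simp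
  have e2 : ∀ x, x - s ^ 2 * z⁻¹ = (x * z - s ^ 2) / z := fun x => by field_simp
  have e3 : ∀ x, x * z⁻¹ - s ^ 2 = (x - s ^ 2 * z) / z := fun x => by field_simp
  simp only [e1, e2, e3, currentSelf, reflDen]
  have n4 := hne z b hz hb
  have n5 := hne b z hb hz
  have n6 := c1 b z hb hz
  have n12 : 1 - s ^ 2 * b * z ≠ 0 := by
    rw [mul_assoc]; exact hne 1 (b * z) norm_one (hm hb hz)
  generalize f12 : 1 - s ^ 2 * b * z = D12 at *
  generalize f4 : z - s ^ 2 * b = D4 at *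
  generalize f5 : b - s ^ 2 * z = D5 at *
  generalize f6 : b * z - s ^ 2 = D6 at *
  field_simp

/-- The conditions of `ZeroRegular` on the circles of radii `R`, `1` for `‖z‖ = 1`. -/
theorem zeroRegular_one {t R y : ℝ} (ht0 : 0 < t) (ht : t < 1) (hR : 1 < t ^ 4 * R)
    (hR' : t ^ 8 * R < 1) (hy : 1 ≤ y) (hy' : t ^ 2 * y < 1) : ZeroRegular t 1 R y := by
  have h2 : t ^ 2 < 1 := pow_lt_one₀ ht0.le ht two_ne_zero
  have h8 : t ^ 8 < 1 := pow_lt_one₀ ht0.le ht (by norm_num)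
  have h4 : t ^ 4 < 1 := pow_lt_one₀ ht0.le ht (by norm_num)
  have h62 : t ^ 8 ≤ t ^ 2 := pow_le_pow_of_le_one ht0.le ht.le (by norm_num)
  have hR0 : 0 < R := pos_of_mul_pos_right (one_pos.trans hR) (by positivity)
  have hR1 : 1 < R := by nlinarith
  have hy0 : 0 < y := by linarith
  have h82 : t ^ 8 * y ≤ t ^ 2 * y := by gcongr
  refine ⟨by linarith, ?_, by linarith, by linarith, by linarith, by linarith, by linarith,
    by linarith, by linarith, by linarith, by linarith, by linarith⟩
  nlinarith

theorem holOn_zeroReflected (hs0 : s ≠ 0) (hs : ‖s‖ < 1) (hz : ‖z‖ = 1) {R : ℝ}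
    (hR : 1 < ‖s‖ ^ 4 * R) (hR' : ‖s‖ ^ 8 * R < 1) (μ : ℕ+ →₀ ℕ) :
    HolOn (fun a b => currentPair s ε a b * zeroReflected s z a b * pairCoeff s ε z μ a b)
      (sphere 0 R) (sphere 0 1) := fun a ha b hb => by
  have ht0 : 0 < ‖s‖ := norm_pos_iff.2 hs0
  have ht2 : ‖s‖ ^ 2 < 1 := pow_lt_one₀ ht0.le hs two_ne_zero
  rw [mem_sphere_zero_iff_norm] at ha hb
  have hr : ZeroRegular ‖s‖ ‖z‖ ‖a‖ ‖b‖ := by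
    rw [ha, hb, hz]
    exact zeroRegular_one ht0 hs hR hR' le_rfl (by rwa [mul_one])
  have hz0 : z ≠ 0 := norm_pos_iff.1 (hz ▸ one_pos)
  have hzi : ‖z⁻¹‖ = ‖z‖ := by rw [norm_inv, hz, inv_one]
  have hf : DifferentiableAt ℂ (fun x : ℂ × ℂ => x.1) (a, b) := by fun_prop
  have hg : DifferentiableAt ℂ (fun x : ℂ × ℂ => x.2) (a, b) := by fun_prop
  have hc : ∀ c : ℂ, DifferentiableAt ℂ (fun _ : ℂ × ℂ => c) (a, b) := fun c => by fun_prop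
  have h3 := (ne_zero_of_lt_mul_norm hr.left'').1
  have h5 := (ne_zero_of_lt_mul_norm hr.right'').1
  obtain ⟨a1, a2, a3⟩ := dualArg_norm_conditions hs0 hz0 ‖a‖
  obtain ⟨b1, b2, -⟩ := dualArg_norm_conditions hs0 hz0 ‖b‖
  have k1 := differentiableAt_currentPair (ε := ε) hs0 hf hg hr.cross hr.cross'
  have k2 := differentiableAt_pairCoeff (ε := ε) hs0 (hc z) hf hg hz0 h3 h5 μ
  have k3 := differentiableAt_zeroKernel (s := s) (hc z⁻¹) hg (hzi.symm ▸ hr.right)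
    (hzi.symm ▸ hr.right') (hzi.symm ▸ hr.right'')
  have k4 := differentiableAt_currentVertex (hc z) hf hr.left' hr.left''
  have k5 := differentiableAt_vertexCurrent (hc (dualArg s z)) hg (b1 hr.dual_right)
    (b2 hr.dual_right')
  have k6 := differentiableAt_zeroKernel (hc (dualArg s z)) hf (a1 hr.dual_left)
    (a3 hr.dual_left'') (a2 hr.dual_left')
  simp only [zeroReflected]
  fun_prop

/-- Reflection of the spectral parameter in `Φ_0`. -/
theorem torusAvg_zeroReflected (hs0 : s ≠ 0) (hs : ‖s‖ < 1) (hz : ‖z‖ = 1) {R : ℝ}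
    (hR : 1 < ‖s‖ ^ 4 * R) (hR' : ‖s‖ ^ 8 * R < 1) (μ : ℕ+ →₀ ℕ) :
    kDiag s ε z 0 * torusAvg (fun a b => currentPair s ε a b * zeroIntegrand s z a b *
      pairCoeff s ε z μ a b) R 1 = z ^ 2 * torusAvg (fun a b => currentPair s ε a b *
        zeroReflected s z a b * pairCoeff s ε z μ a b) R 1 := by
  have ht0 : 0 < ‖s‖ := norm_pos_iff.2 hs0
  have ht2 : ‖s‖ ^ 2 < 1 := pow_lt_one₀ ht0.le hs two_ne_zero
  have hR0 : 0 < R := pos_of_mul_pos_right (one_pos.trans hR) (by positivity)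
  have i1 : HolOn (fun a b => currentPair s ε a b * zeroIntegrand s z a b * pairCoeff s ε z μ a b)
      (sphere 0 R) (sphere 0 1) := by
    rw [sphere_eq_annulus, sphere_eq_annulus]
    refine holOn_zeroIntegrand hs0 (fun x y h1 h2 h3 h4 => ?_) μ
    rw [le_antisymm h2 h1, le_antisymm h4 h3, hz]
    exact zeroRegular_one ht0 hs hR hR' le_rfl (by rwa [mul_one])
  have i2 := holOn_zeroReflected (ε := ε) hs0 hs hz hR hR' μ
  have i3 := i1.const_mul (kDiag s ε z 0)
  have i4 := i2.const_mul (-z ^ 2)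
  have i5 : HolOn (fun a b => kDiag s ε z 0 * (currentPair s ε a b * zeroIntegrand s z a b *
      pairCoeff s ε z μ a b) + -z ^ 2 * (currentPair s ε a b * zeroReflected s z a b *
        pairCoeff s ε z μ a b)) (sphere 0 R) (sphere 0 1) :=
    fun a ha b hb => (i3 a ha b hb).add (i4 a ha b hb)
  have key := torusAvg_eq_zero_of_inv_antisymm hR0 i5 ?_
  · rw [torusAvg_add hR0 one_pos i3 i4, torusAvg_const_mul, torusAvg_const_mul] at key
    linear_combination key
  intro a ha b hb
  rw [mem_sphere_zero_iff_norm] at hb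
  have hb0 : b ≠ 0 := norm_pos_iff.1 (hb ▸ one_pos)
  have hb' : ‖b⁻¹‖ = 1 := by rw [norm_inv, hb, inv_one]
  have hform : ∀ b : ℂ, ‖b‖ = 1 → kDiag s ε z 0 * (currentPair s ε a b *
      zeroIntegrand s z a b * pairCoeff s ε z μ a b) + -z ^ 2 * (currentPair s ε a b *
        zeroReflected s z a b * pairCoeff s ε z μ a b) =
      -s ^ 6 * (currentSelf s ε a * a * (currentVertex s z a * zeroKernel s (dualArg s z) a)) *
        (currentCurrent s a b * vertexCurrent s (dualArg s z) b * pairCoeff s ε z μ a b) *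
      ((1 - s ^ 4) * z ^ 2 / s * ((b - b⁻¹) * ((s * b - ε * Complex.I) / b *
        (kDiag s ε z 0 * (1 - s ^ 2 * b * z) - z * (z - s ^ 2 * b))) *
          (reflDen (s ^ 2) z b)⁻¹)) := by
    intro b hb
    rw [← refl_integrand hs0 hs hz (kDiag s ε z 0) hb, zeroIntegrand, zeroReflected, currentPair]
    ring
  rw [hform b hb, hform _ hb', currentCurrent_inv_right, vertexCurrent_inv, pairCoeff_inv_right,
    reflDen_inv _ _ hb0, inv_inv]
  have hk := kDiag_zero_mul (ε := ε) hs hz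
  -- As a Laurent polynomial in `b` it has powers `-1`, `0`, `1`; `hk` says that the outer two
  -- coefficients agree.
  have hX : (s * b⁻¹ - ε * Complex.I) / b⁻¹ *
        (kDiag s ε z 0 * (1 - s ^ 2 * b⁻¹ * z) - z * (z - s ^ 2 * b⁻¹)) =
      (s * b - ε * Complex.I) / b *
        (kDiag s ε z 0 * (1 - s ^ 2 * b * z) - z * (z - s ^ 2 * b)) := by
    field_simp
    linear_combination (b ^ 2 - 1) * hk
  rw [hX]
  ring

end UnitCircle

end IzerginKorepin

namespace IzerginKorepin

open MvPowerSeries Filter Topology MeasureTheory Metric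

/-! ### Evaluation on the unit circle -/

/-- The denominators of the contractions of a current with both vertex operators. -/
noncomputable def symmDen (q m v : ℂ) : ℂ :=
  (v + q ^ 3 * m) * (1 + q * m * v) * ((m - q ^ 2 * v) * (m * v - q ^ 2))

/-- The symmetric part of the integrand for the spectral parameter `z⁻¹ = -q ^ 2 m`. -/
noncomputable def symmPart (s : ℂ) (ε : SignType) (m a b : ℂ) : ℂ :=
  -(s ^ 2 * (1 - s ^ 4) * m ^ 5) * ((a ^ 2 - 1) * (s * a - ε * Complex.I) *
    ((b ^ 2 - 1) * (s * b - ε * Complex.I)) * ((a * b - 1) * (a * b - s ^ 4))) /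
      (a * b * (a * b + s ^ 2) * (symmDen (s ^ 2) m a * symmDen (s ^ 2) m b))

theorem symmPart_swap (s : ℂ) (ε : SignType) (m a b : ℂ) :
    symmPart s ε m a b = symmPart s ε m b a := by
  unfold symmPart
  rw [mul_comm b a, mul_comm (symmDen _ m b)]
  ring

section Factor

variable {s z m a b : ℂ} {ε : SignType}

/-- With `z⁻¹ = -q ^ 2 m` and `z' = m / q` the poles separating the contours are at `m` and `-q m`,
as in `torusAvg_unitarity`. -/
theorem dualArg_eq (hs0 : s ≠ 0) (hz : z⁻¹ = -(s ^ 4 * m)) : dualArg s z = m / s ^ 2 := by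
  rw [dualArg, hz]
  field_simp

theorem vertexCurrent_dual (hs0 : s ≠ 0) (hm : m ≠ 0) {v : ℂ} (hv : v ≠ 0) :
    vertexCurrent s (m / s ^ 2) v = m ^ 2 * v / ((m - s ^ 4 * v) * (m * v - s ^ 4)) := by
  rw [vertexCurrent_eq (div_ne_zero hm (pow_ne_zero _ hs0)) hv,
    show m / s ^ 2 - s ^ 2 * v = (m - s ^ 4 * v) / s ^ 2 by field_simp,
    show v * (m / s ^ 2) - s ^ 2 = (m * v - s ^ 4) / s ^ 2 by field_simp]
  field_simp

theorem currentVertex_reflected (hs0 : s ≠ 0) (hz0 : z ≠ 0) (hz : z⁻¹ = -(s ^ 4 * m)) {v : ℂ}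
    (hv : v ≠ 0) : currentVertex s z v =
      s ^ 2 * m * v ^ 2 / ((v + (s ^ 2) ^ 3 * m) * (1 + s ^ 2 * m * v)) := by
  rw [← currentVertex_inv, currentVertex_eq (inv_ne_zero hz0) hv, hz,
    show v - s ^ 2 * -(s ^ 4 * m) = v + (s ^ 2) ^ 3 * m by ring,
    show v * -(s ^ 4 * m) - s ^ 2 = -s ^ 2 * (1 + s ^ 2 * m * v) by ring]
  field_simp

theorem zeroKernel_dual (hs0 : s ≠ 0) (hm : m ≠ 0) {v : ℂ} (hv : v ≠ 0) (h1 : m - s ^ 4 * v ≠ 0)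
    (h2 : m * v - s ^ 4 ≠ 0) (h3 : v - m ≠ 0) :
    zeroKernel s (m / s ^ 2) v = (1 - s ^ 4) * m ^ 2 * v ^ 2 /
      ((m - s ^ 4 * v) * (v - m) * (m * v - s ^ 4)) := by
  have e1 : m / s ^ 2 - s ^ 2 * v = (m - s ^ 4 * v) / s ^ 2 := by field_simp
  have e2 : v * (m / s ^ 2) - s ^ 2 = (m * v - s ^ 4) / s ^ 2 := by field_simp
  have e3 : v - s ^ 2 * (m / s ^ 2) = v - m := by field_simp
  have hp := pow_ne_zero 2 hs0
  rw [zeroKernel_eq (div_ne_zero hm hp) hv (e1 ▸ div_ne_zero h1 hp) (e3 ▸ h3)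
    (e2 ▸ div_ne_zero h2 hp), e1, e2, e3]
  field_simp

theorem zeroKernel_reflected (hs0 : s ≠ 0) (hz0 : z ≠ 0) (hz : z⁻¹ = -(s ^ 4 * m)) {v : ℂ}
    (hv : v ≠ 0) (h1 : v + s ^ 2 * m ≠ 0) (h2 : v + (s ^ 2) ^ 3 * m ≠ 0)
    (h3 : 1 + s ^ 2 * m * v ≠ 0) :
    zeroKernel s z⁻¹ v = (1 - s ^ 4) * s ^ 4 * m ^ 2 * v ^ 2 /
      ((v + s ^ 2 * m) * (v + (s ^ 2) ^ 3 * m) * (1 + s ^ 2 * m * v)) := by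
  have e1 : z⁻¹ - s ^ 2 * v = -s ^ 2 * (v + s ^ 2 * m) := by rw [hz]; ring
  have e2 : v - s ^ 2 * z⁻¹ = v + (s ^ 2) ^ 3 * m := by rw [hz]; ring
  have e3 : v * z⁻¹ - s ^ 2 = -s ^ 2 * (1 + s ^ 2 * m * v) := by rw [hz]; ring
  have hp : -s ^ 2 ≠ 0 := neg_ne_zero.2 (pow_ne_zero 2 hs0)
  rw [zeroKernel_eq (inv_ne_zero hz0) hv (e1 ▸ mul_ne_zero hp h1) (e2 ▸ h2)
    (e3 ▸ mul_ne_zero hp h3), e1, e2, e3, hz]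
  field_simp

theorem plusKernel_dual (hs0 : s ≠ 0) (hm : m ≠ 0) (ha : a ≠ 0) (hb : b ≠ 0)
    (h1 : m - s ^ 4 * a ≠ 0) (h2 : m * a - s ^ 4 ≠ 0) (h3 : a - m ≠ 0)
    (k1 : m - s ^ 4 * b ≠ 0) (k2 : m * b - s ^ 4 ≠ 0) (k3 : b - m ≠ 0) :
    plusKernel s (m / s ^ 2) a b = -((1 - s ^ 4) * m ^ 3 * a ^ 2 * b *
      (s ^ 2 * (1 - s ^ 2) * a * b + m * b - s ^ 2 * m * a)) /
      ((m - s ^ 4 * a) * (a - m) * (m * a - s ^ 4) *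
        ((m - s ^ 4 * b) * (b - m) * (m * b - s ^ 4))) := by
  have e1 : ∀ v, m / s ^ 2 - s ^ 2 * v = (m - s ^ 4 * v) / s ^ 2 := fun v => by field_simp
  have e2 : ∀ v, v * (m / s ^ 2) - s ^ 2 = (m * v - s ^ 4) / s ^ 2 := fun v => by field_simp
  have e3 : ∀ v, v - s ^ 2 * (m / s ^ 2) = v - m := fun v => by field_simp
  have hp := pow_ne_zero 2 hs0
  rw [plusKernel_eq (div_ne_zero hm hp) ha hb (e1 a ▸ div_ne_zero h1 hp) (e3 a ▸ h3)
    (e2 a ▸ div_ne_zero h2 hp) (e1 b ▸ div_ne_zero k1 hp) (e3 b ▸ k3)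
    (e2 b ▸ div_ne_zero k2 hp), e1, e2, e3, e1, e2, e3]
  field_simp
  ring

theorem plusKernel_reflected (hs0 : s ≠ 0) (hz0 : z ≠ 0) (hz : z⁻¹ = -(s ^ 4 * m)) (ha : a ≠ 0)
    (hb : b ≠ 0) (h1 : a + s ^ 2 * m ≠ 0) (h2 : a + (s ^ 2) ^ 3 * m ≠ 0)
    (h3 : 1 + s ^ 2 * m * a ≠ 0) (k1 : b + s ^ 2 * m ≠ 0) (k2 : b + (s ^ 2) ^ 3 * m ≠ 0)
    (k3 : 1 + s ^ 2 * m * b ≠ 0) :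
    plusKernel s z⁻¹ a b = s ^ 4 * ((1 - s ^ 4) * m ^ 3 * a ^ 2 * b *
      ((1 - s ^ 2) * a * b - (s ^ 2) ^ 2 * m * b + (s ^ 2) ^ 3 * m * a)) /
      ((a + s ^ 2 * m) * (a + (s ^ 2) ^ 3 * m) * (1 + s ^ 2 * m * a) *
        ((b + s ^ 2 * m) * (b + (s ^ 2) ^ 3 * m) * (1 + s ^ 2 * m * b))) := by
  have e1 : ∀ v, z⁻¹ - s ^ 2 * v = -s ^ 2 * (v + s ^ 2 * m) := fun v => by rw [hz]; ring
  have e2 : ∀ v, v - s ^ 2 * z⁻¹ = v + (s ^ 2) ^ 3 * m := fun v => by rw [hz]; ring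
  have e3 : ∀ v, v * z⁻¹ - s ^ 2 = -s ^ 2 * (1 + s ^ 2 * m * v) := fun v => by rw [hz]; ring
  have hp : -s ^ 2 ≠ 0 := neg_ne_zero.2 (pow_ne_zero 2 hs0)
  rw [plusKernel_eq (inv_ne_zero hz0) ha hb (e1 a ▸ mul_ne_zero hp h1) (e2 a ▸ h2)
    (e3 a ▸ mul_ne_zero hp h3) (e1 b ▸ mul_ne_zero hp k1) (e2 b ▸ k2)
    (e3 b ▸ mul_ne_zero hp k3), e1, e2, e3, e1, e2, e3, hz]
  field_simp
  ring

/-- The three terms of the transfer matrix share the symmetric factor `symmPart` and `crossKernel`.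
The factor `z ^ 2` is the ratio of the zero mode factors of the vertex operator at `z⁻¹` and at `z`.
-/
theorem currentPair_mul_plusReflected (hs0 : s ≠ 0) (hz0 : z ≠ 0) (hz : z⁻¹ = -(s ^ 4 * m))
    (hm : m ≠ 0) (ha : a ≠ 0) (hb : b ≠ 0) (hab : a + s ^ 2 * b ≠ 0) (hab' : a * b + s ^ 2 ≠ 0)
    (h1 : a + s ^ 2 * m ≠ 0) (h2 : a + (s ^ 2) ^ 3 * m ≠ 0)
    (h3 : 1 + s ^ 2 * m * a ≠ 0) (k1 : b + s ^ 2 * m ≠ 0) (k2 : b + (s ^ 2) ^ 3 * m ≠ 0)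
    (k3 : 1 + s ^ 2 * m * b ≠ 0) :
    z ^ 2 * (currentPair s ε a b * plusReflected s z a b) =
      symmPart s ε m a b * crossKernel (s ^ 2) a b * plusPart (s ^ 2) m a b := by
  have hz' : z = -(s ^ 4 * m)⁻¹ := by rw [← inv_inv z, hz, inv_neg]
  rw [plusReflected, plusKernel_reflected hs0 hz0 hz ha hb h1 h2 h3 k1 k2 k3,
    dualArg_eq hs0 hz, vertexCurrent_dual hs0 hm ha, vertexCurrent_dual hs0 hm hb,
    currentPair_eq hs0 ha hb hab hab', hz', symmPart, crossKernel, plusPart, symmDen, symmDen]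
  simp only [← pow_mul, Nat.reduceMul] at *
  generalize (a ^ 2 - 1) * (s * a - ε * Complex.I) * ((b ^ 2 - 1) * (s * b - ε * Complex.I)) = P1 at *
  generalize (a - b) * (a - s ^ 4 * b) = P2 at *
  generalize (a * b - 1) * (a * b - s ^ 4) = P3 at *
  generalize 1 - s ^ 4 = P4 at *
  generalize (1 - s ^ 2) * a * b - s ^ 4 * m * b + s ^ 6 * m * a = N at *
  generalize a + s ^ 2 * b = D1 at *
  generalize a * b + s ^ 2 = D2 at *
  generalize a + s ^ 2 * m = D3 at *
  generalize b + s ^ 2 * m = D4 at *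
  generalize a + s ^ 6 * m = D5 at *
  generalize b + s ^ 6 * m = D6 at *
  generalize 1 + s ^ 2 * m * a = D7 at *
  generalize 1 + s ^ 2 * m * b = D8 at *
  generalize m - s ^ 4 * a = D9 at *
  generalize m - s ^ 4 * b = D10 at *
  generalize m * a - s ^ 4 = D11 at *
  generalize m * b - s ^ 4 = D12 at *
  field_simp

theorem currentPair_mul_zeroReflected (hs0 : s ≠ 0) (hz0 : z ≠ 0) (hz : z⁻¹ = -(s ^ 4 * m))
    (hm : m ≠ 0) (ha : a ≠ 0) (hb : b ≠ 0) (hab : a + s ^ 2 * b ≠ 0) (hab' : a * b + s ^ 2 ≠ 0)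
    (h1 : m - s ^ 4 * a ≠ 0) (h2 : m * a - s ^ 4 ≠ 0) (h3 : a - m ≠ 0)
    (k1 : b + s ^ 2 * m ≠ 0) (k2 : b + (s ^ 2) ^ 3 * m ≠ 0) (k3 : 1 + s ^ 2 * m * b ≠ 0) :
    z ^ 2 * (currentPair s ε a b * zeroReflected s z a b) =
      symmPart s ε m a b * crossKernel (s ^ 2) a b * zeroPart (s ^ 2) m a b := by
  have hz' : z = -(s ^ 4 * m)⁻¹ := by rw [← inv_inv z, hz, inv_neg]
  rw [zeroReflected, zeroKernel_reflected hs0 hz0 hz hb k1 k2 k3, dualArg_eq hs0 hz,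
    vertexCurrent_dual hs0 hm hb, currentVertex_reflected hs0 hz0 hz ha,
    zeroKernel_dual hs0 hm ha h1 h2 h3,
    currentPair_eq hs0 ha hb hab hab', hz', symmPart, crossKernel, zeroPart, symmDen, symmDen]
  simp only [← pow_mul, Nat.reduceMul] at *
  generalize (a ^ 2 - 1) * (s * a - ε * Complex.I) * ((b ^ 2 - 1) * (s * b - ε * Complex.I)) = P1 at *
  generalize (a - b) * (a - s ^ 4 * b) = P2 at *
  generalize (a * b - 1) * (a * b - s ^ 4) = P3 at *
  generalize 1 - s ^ 4 = P4 at *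
  generalize a + s ^ 2 * b = D1 at *
  generalize a * b + s ^ 2 = D2 at *
  generalize b + s ^ 2 * m = D4 at *
  generalize a + s ^ 6 * m = D5 at *
  generalize b + s ^ 6 * m = D6 at *
  generalize 1 + s ^ 2 * m * a = D7 at *
  generalize 1 + s ^ 2 * m * b = D8 at *
  generalize m - s ^ 4 * a = D9 at *
  generalize m - s ^ 4 * b = D10 at *
  generalize m * a - s ^ 4 = D11 at *
  generalize m * b - s ^ 4 = D12 at *
  generalize a - m = D13 at *
  field_simp

theorem currentPair_mul_minusIntegrand (hs0 : s ≠ 0) (hz0 : z ≠ 0) (hz : z⁻¹ = -(s ^ 4 * m))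
    (hm : m ≠ 0) (ha : a ≠ 0) (hb : b ≠ 0) (hab : a + s ^ 2 * b ≠ 0) (hab' : a * b + s ^ 2 ≠ 0)
    (h1 : m - s ^ 4 * a ≠ 0) (h2 : m * a - s ^ 4 ≠ 0) (h3 : a - m ≠ 0)
    (k1 : m - s ^ 4 * b ≠ 0) (k2 : m * b - s ^ 4 ≠ 0) (k3 : b - m ≠ 0) :
    currentPair s ε a b * minusIntegrand s z a b =
      symmPart s ε m a b * crossKernel (s ^ 2) a b * minusPart (s ^ 2) m a b := by
  rw [minusIntegrand, dualArg_eq hs0 hz, currentVertex_reflected hs0 hz0 hz ha,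
    currentVertex_reflected hs0 hz0 hz hb, plusKernel_dual hs0 hm ha hb h1 h2 h3 k1 k2 k3,
    currentPair_eq hs0 ha hb hab hab', symmPart, crossKernel, minusPart, symmDen, symmDen]
  simp only [← pow_mul, Nat.reduceMul] at *
  generalize (a ^ 2 - 1) * (s * a - ε * Complex.I) * ((b ^ 2 - 1) * (s * b - ε * Complex.I)) = P1 at *
  generalize (a - b) * (a - s ^ 4 * b) = P2 at *
  generalize (a * b - 1) * (a * b - s ^ 4) = P3 at *
  generalize 1 - s ^ 4 = P4 at *
  generalize s ^ 2 * (1 - s ^ 2) * a * b + m * b - s ^ 2 * m * a = N at *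
  generalize a + s ^ 2 * b = D1 at *
  generalize a * b + s ^ 2 = D2 at *
  generalize a + s ^ 6 * m = D5 at *
  generalize b + s ^ 6 * m = D6 at *
  generalize 1 + s ^ 2 * m * a = D7 at *
  generalize 1 + s ^ 2 * m * b = D8 at *
  generalize m - s ^ 4 * a = D9 at *
  generalize m - s ^ 4 * b = D10 at *
  generalize m * a - s ^ 4 = D11 at *
  generalize m * b - s ^ 4 = D12 at *
  generalize a - m = D13 at *
  generalize b - m = D14 at *
  field_simp

end Factor

end IzerginKorepin

namespace IzerginKorepin

open MvPowerSeries Filter Topology MeasureTheory Metric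

/-! ### The scalar factor and the residue -/

section Scalar

variable {s z : ℂ} {ε : SignType}

/-- The constant `g` is chosen against the contraction of `Φ_-(z')` with the mirror image of
`Φ_-(z)`; the products cancel up to their first factors. -/
theorem gConst_mul_vertexKernel (hs : ‖s‖ < 1) :
    gConst s * vertexKernel s (-s ^ 6) = (1 - s ^ 2) * (1 + s ^ 6) := by
  have hp : ‖s ^ 12‖ < 1 := norm_pow_lt_one hs (by norm_num)
  have hn : ∀ k : ℕ, k ≠ 0 → qPoch (s ^ k) (s ^ 12) ≠ 0 := fun k hk =>
    qPoch_ne_zero (norm_pow_lt_one hs hk) hp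
  have hn' : ∀ k : ℕ, k ≠ 0 → qPoch (-s ^ k) (s ^ 12) ≠ 0 := fun k hk =>
    qPoch_ne_zero (by rw [norm_neg]; exact norm_pow_lt_one hs hk) hp
  have e1 := qPoch_eq_mul (s ^ 4) hp
  have e2 := qPoch_eq_mul (-s ^ 6) hp
  rw [show s ^ 12 * s ^ 4 = s ^ 16 by ring] at e1
  rw [show s ^ 12 * -s ^ 6 = -s ^ 18 by ring] at e2
  have h2 : 1 + s ^ 2 ≠ 0 := by
    have := one_sub_ne_zero (x := -s ^ 2) (by rw [norm_neg]; exact norm_pow_lt_one hs two_ne_zero)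
    rwa [sub_neg_eq_add] at this
  rw [gConst, vertexKernel, show s ^ 4 * -s ^ 6 = -s ^ 10 by ring,
    show -s ^ 6 * -s ^ 6 = s ^ 12 by ring, show -s ^ 10 * -s ^ 6 = s ^ 16 by ring,
    show s ^ 12 * -s ^ 6 = -s ^ 18 by ring, e1, e2]
  have a1 := hn 12 (by norm_num)
  have a2 := hn 16 (by norm_num)
  have a3 := hn' 10 (by norm_num)
  have a4 := hn' 18 (by norm_num)
  generalize qPoch (s ^ 12) (s ^ 12) = A1 at *
  generalize qPoch (s ^ 16) (s ^ 12) = A2 at *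
  generalize qPoch (-s ^ 10) (s ^ 12) = A3 at *
  generalize qPoch (-s ^ 18) (s ^ 12) = A4 at *
  field_simp
  ring

/-- Splitting the products of base `q ^ 6` into even and odd factors gives base `q ^ 12` throughout.
Then everything cancels except the first factor of one product and, for `ε = ±`, the first factors
that carry the poles of the `K`-matrix. -/
theorem phi_mul_phi (hs : ‖s‖ < 1) (hz : ‖s ^ 4 * z‖ < 1) :
    phi s ε z * phi s ε (-(s ^ 6 * z)) * vertexKernel s (-(s ^ 6 * z ^ 2)) =
      (1 - s ^ 12 * z ^ 2) / ((1 - ε * Complex.I * s * z) * (1 + ε * Complex.I * s ^ 3 * z)) := by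
  have hp : ‖s ^ 12‖ < 1 := norm_pow_lt_one hs (by norm_num)
  have hp2 : ‖s ^ 24‖ < 1 := norm_pow_lt_one hs (by norm_num)
  have hz2 : ‖s ^ 8 * z ^ 2‖ < 1 := by
    rw [show s ^ 8 * z ^ 2 = (s ^ 4 * z) ^ 2 by ring]; exact norm_pow_lt_one hz two_ne_zero
  have hsq : ∀ x, qPoch x (s ^ 12) = qPoch x (s ^ 24) * qPoch (s ^ 12 * x) (s ^ 24) := fun x => by
    rw [qPoch_sq x hp, ← pow_mul]
  have hn : ∀ k : ℕ, 8 ≤ k → qPoch (s ^ k * z ^ 2) (s ^ 24) ≠ 0 := fun k hk =>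
    qPoch_ne_zero (norm_pow_mul_lt_one hs hk hz2) hp2
  have hn' : ∀ k : ℕ, 8 ≤ k → qPoch (-s ^ k * z ^ 2) (s ^ 24) ≠ 0 := fun k hk =>
    qPoch_ne_zero (by rw [neg_mul, norm_neg]; exact norm_pow_mul_lt_one hs hk hz2) hp2
  have hm : qPoch (s ^ 16 * z ^ 2) (s ^ 24) * qPoch (-s ^ 18 * z ^ 2) (s ^ 24) /
      (qPoch (s ^ 24 * z ^ 2) (s ^ 24) * qPoch (-s ^ 10 * z ^ 2) (s ^ 24)) *
      (qPoch (s ^ 16 * (-(s ^ 6 * z)) ^ 2) (s ^ 24) *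
        qPoch (-s ^ 18 * (-(s ^ 6 * z)) ^ 2) (s ^ 24) /
      (qPoch (s ^ 24 * (-(s ^ 6 * z)) ^ 2) (s ^ 24) *
        qPoch (-s ^ 10 * (-(s ^ 6 * z)) ^ 2) (s ^ 24))) *
      vertexKernel s (-(s ^ 6 * z ^ 2)) = 1 - s ^ 12 * z ^ 2 := by
    have e0 := qPoch_eq_mul (s ^ 12 * z ^ 2) hp2
    rw [show s ^ 24 * (s ^ 12 * z ^ 2) = s ^ 36 * z ^ 2 by ring] at e0
    rw [vertexKernel, hsq, hsq, hsq, hsq,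
      show s ^ 16 * (-(s ^ 6 * z)) ^ 2 = s ^ 28 * z ^ 2 by ring,
      show -s ^ 18 * (-(s ^ 6 * z)) ^ 2 = -s ^ 30 * z ^ 2 by ring,
      show s ^ 24 * (-(s ^ 6 * z)) ^ 2 = s ^ 36 * z ^ 2 by ring,
      show -s ^ 10 * (-(s ^ 6 * z)) ^ 2 = -s ^ 22 * z ^ 2 by ring,
      show s ^ 4 * -(s ^ 6 * z ^ 2) = -s ^ 10 * z ^ 2 by ring,
      show -s ^ 6 * -(s ^ 6 * z ^ 2) = s ^ 12 * z ^ 2 by ring,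
      show -s ^ 10 * -(s ^ 6 * z ^ 2) = s ^ 16 * z ^ 2 by ring,
      show s ^ 12 * -(s ^ 6 * z ^ 2) = -s ^ 18 * z ^ 2 by ring,
      show s ^ 12 * (-s ^ 10 * z ^ 2) = -s ^ 22 * z ^ 2 by ring,
      show s ^ 12 * (s ^ 12 * z ^ 2) = s ^ 24 * z ^ 2 by ring,
      show s ^ 12 * (s ^ 16 * z ^ 2) = s ^ 28 * z ^ 2 by ring,
      show s ^ 12 * (-s ^ 18 * z ^ 2) = -s ^ 30 * z ^ 2 by ring, e0]
    have a1 := hn 16 (by norm_num)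
    have a2 := hn 24 (by norm_num)
    have a3 := hn 28 (by norm_num)
    have a4 := hn 36 (by norm_num)
    have b1 := hn' 10 (by norm_num)
    have b2 := hn' 18 (by norm_num)
    have b3 := hn' 22 (by norm_num)
    have b4 := hn' 30 (by norm_num)
    generalize qPoch (s ^ 16 * z ^ 2) (s ^ 24) = A1 at *
    generalize qPoch (s ^ 24 * z ^ 2) (s ^ 24) = A2 at *
    generalize qPoch (s ^ 28 * z ^ 2) (s ^ 24) = A3 at *
    generalize qPoch (s ^ 36 * z ^ 2) (s ^ 24) = A4 at *
    generalize qPoch (-s ^ 10 * z ^ 2) (s ^ 24) = B1 at *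
    generalize qPoch (-s ^ 18 * z ^ 2) (s ^ 24) = B2 at *
    generalize qPoch (-s ^ 22 * z ^ 2) (s ^ 24) = B3 at *
    generalize qPoch (-s ^ 30 * z ^ 2) (s ^ 24) = B4 at *
    field_simp
  unfold phi
  by_cases hε : ε = 0
  · subst hε
    simp only [if_true]
    rw [mul_one, mul_one, hm]
    simp
  rw [if_neg hε, if_neg hε]
  have hk : ∀ k : ℕ, 4 ≤ k → ‖ε * Complex.I * s ^ k * z‖ < 1 := fun k hk => by
    rw [mul_assoc, norm_mul]
    exact (mul_le_of_le_one_left (norm_nonneg _) (norm_sign_mul_I_le ε)).trans_lt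
      (norm_pow_mul_lt_one hs hk hz)
  have c1 : ∀ k : ℕ, 4 ≤ k → qPoch (ε * Complex.I * s ^ k * z) (s ^ 12) ≠ 0 := fun k h =>
    qPoch_ne_zero (hk k h) hp
  have c2 : ∀ k : ℕ, 4 ≤ k → qPoch (-ε * Complex.I * s ^ k * z) (s ^ 12) ≠ 0 := fun k h =>
    qPoch_ne_zero (by
      rw [show -(ε : ℂ) * Complex.I * s ^ k * z = -(ε * Complex.I * s ^ k * z) by ring, norm_neg]
      exact hk k h) hp
  have f1 := qPoch_eq_mul (ε * Complex.I * s * z) hp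
  have f2 := qPoch_eq_mul (-ε * Complex.I * s ^ 3 * z) hp
  rw [show s ^ 12 * (ε * Complex.I * s * z) = ε * Complex.I * s ^ 13 * z by ring] at f1
  rw [show s ^ 12 * (-ε * Complex.I * s ^ 3 * z) = -ε * Complex.I * s ^ 15 * z by ring] at f2
  have hj : qPoch (ε * Complex.I * s ^ 9 * z) (s ^ 12) *
      qPoch (-ε * Complex.I * s ^ 7 * z) (s ^ 12) / (qPoch (ε * Complex.I * s * z) (s ^ 12) *
        qPoch (-ε * Complex.I * s ^ 3 * z) (s ^ 12)) *
      (qPoch (ε * Complex.I * s ^ 9 * (-(s ^ 6 * z))) (s ^ 12) *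
        qPoch (-ε * Complex.I * s ^ 7 * (-(s ^ 6 * z))) (s ^ 12) /
      (qPoch (ε * Complex.I * s * (-(s ^ 6 * z))) (s ^ 12) *
        qPoch (-ε * Complex.I * s ^ 3 * (-(s ^ 6 * z))) (s ^ 12))) =
      ((1 - ε * Complex.I * s * z) * (1 + ε * Complex.I * s ^ 3 * z))⁻¹ := by
    rw [f1, f2, show ε * Complex.I * s ^ 9 * (-(s ^ 6 * z)) = -ε * Complex.I * s ^ 15 * z by ring,
      show -ε * Complex.I * s ^ 7 * (-(s ^ 6 * z)) = ε * Complex.I * s ^ 13 * z by ring,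
      show ε * Complex.I * s * (-(s ^ 6 * z)) = -ε * Complex.I * s ^ 7 * z by ring,
      show -ε * Complex.I * s ^ 3 * (-(s ^ 6 * z)) = ε * Complex.I * s ^ 9 * z by ring,
      show 1 - -ε * Complex.I * s ^ 3 * z = 1 + ε * Complex.I * s ^ 3 * z by ring]
    have a1 := c1 9 (by norm_num)
    have a2 := c1 13 (by norm_num)
    have a3 := c2 7 (by norm_num)
    have a4 := c2 15 (by norm_num)
    generalize qPoch (ε * Complex.I * s ^ 9 * z) (s ^ 12) = A1 at *
    generalize qPoch (ε * Complex.I * s ^ 13 * z) (s ^ 12) = A2 at *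
    generalize qPoch (-ε * Complex.I * s ^ 7 * z) (s ^ 12) = A3 at *
    generalize qPoch (-ε * Complex.I * s ^ 15 * z) (s ^ 12) = A4 at *
    generalize 1 - ε * Complex.I * s * z = B1 at *
    generalize 1 + ε * Complex.I * s ^ 3 * z = B2 at *
    field_simp
  rw [div_eq_mul_inv (1 - s ^ 12 * z ^ 2), ← hm, ← hj]
  ring

/-- The factor `φ_ε(z⁻¹)` in the denominator of the `K`-matrix cancels the one produced by `Φ_-(z)`
on the boundary state; it does not vanish, being an exponential. -/
theorem transferScalar_eq (hs0 : s ≠ 0) (hs : ‖s‖ < 1) (h1 : ‖s‖ ^ 2 < ‖z‖)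
    (h2 : ‖ε * Complex.I * s‖ < ‖z‖) (h3 : ‖s‖ ^ 4 * ‖z‖ < 1) :
    transferScalar s ε z = (1 - s ^ 2) * (1 + s ^ 6) * (1 - s ^ 12 * z ^ 2) /
      ((1 - ε * Complex.I * s * z) * (1 + ε * Complex.I * s ^ 3 * z)) := by
  have hz0' : 0 < ‖z‖ := (by positivity : 0 ≤ ‖s‖ ^ 2).trans_lt h1
  have hz0 : z ≠ 0 := norm_pos_iff.1 hz0'
  have hphi : phi s ε z⁻¹ ≠ 0 := by
    refine (expSum_vertexArg_self hs0 hs hz0 ε ?_ ?_).ne_zero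
    · rw [show s ^ 4 * (1 / z ^ 2) = (s ^ 2 / z) ^ 2 by field_simp]
      refine norm_pow_lt_one ?_ two_ne_zero
      rw [norm_div, norm_pow, div_lt_one hz0']
      exact h1
    · rw [norm_div, div_lt_one hz0']
      exact h2
  have e1 : (dualArg s z)⁻¹ = -(s ^ 6 * z) := by rw [dualArg]; field_simp
  have e2 : z / dualArg s z = -(s ^ 6 * z ^ 2) := by rw [dualArg]; field_simp
  have e3 : 1 / (z * dualArg s z) = -s ^ 6 := by rw [dualArg]; field_simp
  rw [transferScalar, e1, e2, e3]
  have k1 := gConst_mul_vertexKernel hs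
  have k2 := phi_mul_phi (ε := ε) hs (z := z) (by rwa [norm_mul, norm_pow])
  rw [mul_div_assoc, ← k1, ← k2]
  generalize phi s ε z⁻¹ = X at *
  field_simp

end Scalar

section Residue

variable {s m : ℂ} {ε : SignType}

/-- The scalar part of the double residue. Its sign cancels the one in `torusAvg_unitarity`, and
under `z⁻¹ = -q ^ 2 m` it is the inverse of the scalar prefactor. -/
theorem symmPart_mul_crossKernel (hs0 : s ≠ 0) (hm : m ≠ 0) (h1 : 1 + s ^ 2 * m ^ 2 ≠ 0)
    (h2 : m ^ 2 - s ^ 4 ≠ 0) (h3 : m ^ 2 + s ^ 2 ≠ 0) (h4 : 1 - m ^ 2 ≠ 0)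
    (h5 : 1 - s ^ 4 * m ^ 2 ≠ 0) (h6 : 1 - s ^ 2 ≠ 0) (h7 : 1 + s ^ 2 ≠ 0) (h8 : 1 + s ^ 6 ≠ 0) :
    symmPart s ε m m (-(s ^ 2 * m)) *
      ((1 - (s ^ 2) ^ 2) * crossKernel (s ^ 2) m (-(s ^ 2 * m))) =
      -((s * m - ε * Complex.I) * (s ^ 3 * m + ε * Complex.I)) /
        (s ^ 4 * ((1 - s ^ 2) * (1 + s ^ 6) * (m ^ 2 - s ^ 4))) := by
  rw [symmPart, crossKernel, symmDen, symmDen,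
    show m * -(s ^ 2 * m) - 1 = -(1 + s ^ 2 * m ^ 2) by ring,
    show m * -(s ^ 2 * m) - s ^ 4 = -(s ^ 2 * (m ^ 2 + s ^ 2)) by ring,
    show m * -(s ^ 2 * m) + s ^ 2 = s ^ 2 * (1 - m ^ 2) by ring,
    show (-(s ^ 2 * m)) ^ 2 - 1 = -(1 - s ^ 4 * m ^ 2) by ring,
    show m ^ 2 - 1 = -(1 - m ^ 2) by ring,
    show m + (s ^ 2) ^ 3 * m = m * (1 + s ^ 6) by ring,
    show 1 + s ^ 2 * m * m = 1 + s ^ 2 * m ^ 2 by ring,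
    show m - (s ^ 2) ^ 2 * m = m * ((1 - s ^ 2) * (1 + s ^ 2)) by ring,
    show m * m - (s ^ 2) ^ 2 = m ^ 2 - s ^ 4 by ring,
    show -(s ^ 2 * m) + (s ^ 2) ^ 3 * m = -(s ^ 2 * m) * ((1 - s ^ 2) * (1 + s ^ 2)) by ring,
    show 1 + s ^ 2 * m * -(s ^ 2 * m) = 1 - s ^ 4 * m ^ 2 by ring,
    show m - (s ^ 2) ^ 2 * -(s ^ 2 * m) = m * (1 + s ^ 6) by ring,
    show m * -(s ^ 2 * m) - (s ^ 2) ^ 2 = -(s ^ 2 * (m ^ 2 + s ^ 2)) by ring,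
    show m - -(s ^ 2 * m) = m * (1 + s ^ 2) by ring,
    show m + s ^ 2 * -(s ^ 2 * m) = m * ((1 - s ^ 2) * (1 + s ^ 2)) by ring,
    show 1 - (s ^ 2) ^ 2 = (1 - s ^ 2) * (1 + s ^ 2) by ring,
    show 1 - s ^ 4 = (1 - s ^ 2) * (1 + s ^ 2) by ring,
    show s * -(s ^ 2 * m) - ε * Complex.I = -(s ^ 3 * m + ε * Complex.I) by ring]
  generalize s ^ 3 * m + ε * Complex.I = P1 at *
  generalize s * m - ε * Complex.I = P2 at *
  generalize 1 + s ^ 2 * m ^ 2 = D1 at *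
  generalize m ^ 2 - s ^ 4 = D2 at *
  generalize m ^ 2 + s ^ 2 = D3 at *
  generalize 1 - m ^ 2 = D4 at *
  generalize 1 - s ^ 4 * m ^ 2 = D5 at *
  generalize 1 - s ^ 2 = D6 at *
  generalize 1 + s ^ 2 = D7 at *
  generalize 1 + s ^ 6 = D8 at *
  field_simp

/-- At the double residue the operators annihilate each other mode by mode. With `Q = (-q) ^ k` the
cancellation is `1 + Q ^ 3 = (1 + Q) (1 - Q + Q ^ 2)`: the vertex shifts give the left side over `1
- Q + Q ^ 2`, the current shifts give `1 + Q`. -/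
theorem stateShift_residue (hs0 : s ≠ 0) (hs : ‖s‖ < 1) (hm : m ≠ 0) {z : ℂ}
    (hz : z⁻¹ = -(s ^ 4 * m)) :
    stateShift s ε [dualArg s z, z] [m, -(s ^ 2 * m)] = linF s ε := by
  funext k
  have hz' : z = -(s ^ 4 * m)⁻¹ := by rw [← inv_inv z, hz, inv_neg]
  rw [dualArg_eq hs0 hz, hz']
  simp only [stateShift, List.map_cons, List.map_nil, List.sum_cons, List.sum_nil, vertexShift,
    currentShift]
  have h1 := qInt_ne_zero hs0 hs k
  have h2 := one_sub_add_sq_ne_zero hs k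
  rw [den_eq hs0]
  have e0 : (-s ^ 2) ^ (k : ℕ) = (-1) ^ (k : ℕ) * (s ^ (k : ℕ)) ^ 2 := by
    rw [neg_pow, ← pow_mul, ← pow_mul, mul_comm 2]
  have e1 : (m / s ^ 2) ^ (k : ℕ) = m ^ (k : ℕ) / (s ^ (k : ℕ)) ^ 2 := by
    rw [div_pow, ← pow_mul, ← pow_mul, mul_comm 2]
  have e2 : (-(s ^ 4 * m)⁻¹) ^ (k : ℕ) = (-1) ^ (k : ℕ) * ((s ^ (k : ℕ)) ^ 4 * m ^ (k : ℕ))⁻¹ := by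
    rw [neg_pow, inv_pow, mul_pow, ← pow_mul, ← pow_mul, mul_comm 4]
  have e3 : (-(s ^ 2 * m)) ^ (k : ℕ) = (-1) ^ (k : ℕ) * ((s ^ (k : ℕ)) ^ 2 * m ^ (k : ℕ)) := by
    rw [neg_pow, mul_pow, ← pow_mul, ← pow_mul, mul_comm 2]
  have e4 : s ^ (2 * (k : ℕ)) = (s ^ (k : ℕ)) ^ 2 := by rw [mul_comm, pow_mul]
  have hσ : ((-1 : ℂ) ^ (k : ℕ)) ^ 2 = 1 := by rw [← pow_mul, mul_comm, pow_mul]; simp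
  rw [e0] at h2 ⊢
  rw [e1, e2, e3, e4]
  have hS : s ^ (k : ℕ) ≠ 0 := pow_ne_zero _ hs0
  have hM : m ^ (k : ℕ) ≠ 0 := pow_ne_zero _ hm
  have hσ0 : (-1 : ℂ) ^ (k : ℕ) ≠ 0 := pow_ne_zero _ (by norm_num)
  have hσi : ∀ x : ℂ, ((-1 : ℂ) ^ (k : ℕ) * x)⁻¹ = (-1 : ℂ) ^ (k : ℕ) * x⁻¹ := fun x => by
    rw [mul_inv]
    congr 1
    exact inv_eq_of_mul_eq_one_right (by rw [← sq, hσ])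
  rw [hσi, hσi, inv_inv]
  generalize (-1 : ℂ) ^ (k : ℕ) = σ at *
  generalize qInt (s ^ 2) (k : ℤ) = N at *
  generalize s ^ (9 * (k : ℕ)) = S9 at *
  generalize s ^ (k : ℕ) = S at *
  generalize m ^ (k : ℕ) = M at *
  generalize e : 1 - σ * S ^ 2 + (σ * S ^ 2) ^ 2 = D at *
  field_simp
  subst e
  linear_combination S9 * (S ^ 2 - σ * S ^ 4 - S ^ 6 - M ^ 2 * σ * S ^ 8) * hσ

end Residue

end IzerginKorepin

/-! ### The transfer matrix on the unit circle -/

namespace IzerginKorepin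

open MvPowerSeries Filter Topology MeasureTheory Metric

/-- The contour integral that gives the coefficients of the transfer matrix. -/
noncomputable def transferIntegral (s : ℂ) (ε : SignType) (z : ℂ) (μ : ℕ+ →₀ ℕ)
    (p₁ p₂ m₁ m₂ : ℝ) : ℂ :=
  kDiag s ε z 1 * torusAvg (fun v₁ v₂ => currentPair s ε v₁ v₂ * plusIntegrand s z v₁ v₂ *
      pairCoeff s ε z μ v₁ v₂) p₁ p₂ +
    kDiag s ε z 0 * torusAvg (fun v₁ v₂ => currentPair s ε v₁ v₂ * zeroIntegrand s z v₁ v₂ *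
      pairCoeff s ε z μ v₁ v₂) m₁ p₂ +
    kDiag s ε z (-1) * torusAvg (fun v₁ v₂ => currentPair s ε v₁ v₂ * minusIntegrand s z v₁ v₂ *
      pairCoeff s ε z μ v₁ v₂) m₁ m₂

section UnitCircle

variable {s z m : ℂ} {ε : SignType}

theorem plusRegular_of_one_le {t x y : ℝ} (ht0 : 0 < t) (ht : t < 1) (hx : 1 ≤ x) (hy : 1 ≤ y)
    (hx' : t ^ 2 * x < 1) (hy' : t ^ 2 * y < 1) : PlusRegular t 1 x y := by
  have h2 : t ^ 2 < 1 := pow_lt_one₀ ht0.le ht two_ne_zero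
  have h82 : t ^ 8 ≤ t ^ 2 := pow_le_pow_of_le_one ht0.le ht.le (by norm_num)
  have a1 : t ^ 8 * x ≤ t ^ 2 * x := by gcongr
  have a2 : t ^ 8 * y ≤ t ^ 2 * y := by gcongr
  refine ⟨by linarith, by nlinarith, by linarith, by linarith, by linarith, by linarith,
    by linarith, by linarith, by linarith, by linarith, by linarith, by linarith⟩

/-- The zeros in `v` are `-q ^ 3 m`, `-1 / (q m)` and `q ^ 2 / m`, inside the unit disc since `|m| =
q⁻²` in modulus, and `q⁻² m`, of modulus `|s| ^ (-8)`. None lies in the annulus swept by the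
contours. -/
theorem symmDen_factors_ne_zero (hs0 : s ≠ 0) (hs : ‖s‖ < 1) (hm : ‖s‖ ^ 4 * ‖m‖ = 1) {v : ℂ}
    (hv : 1 ≤ ‖v‖) (hv' : ‖s‖ ^ 8 * ‖v‖ < 1) :
    v + (s ^ 2) ^ 3 * m ≠ 0 ∧ 1 + s ^ 2 * m * v ≠ 0 ∧ m - s ^ 4 * v ≠ 0 ∧ m * v - s ^ 4 ≠ 0 := by
  have ht0 : 0 < ‖s‖ := norm_pos_iff.2 hs0
  have h2 : ‖s‖ ^ 2 < 1 := pow_lt_one₀ ht0.le hs two_ne_zero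
  have h4 : ‖s‖ ^ 4 < 1 := pow_lt_one₀ ht0.le hs (by norm_num)
  have hm1 : 1 < ‖s‖ ^ 2 * ‖m‖ := by nlinarith [norm_nonneg m, sq_nonneg ‖s‖]
  have hm2 : 1 < ‖m‖ := by nlinarith [norm_nonneg m, sq_nonneg ‖s‖]
  refine ⟨add_mul_ne_zero ?_, ?_, sub_ne_zero_of_lt_norm ?_, sub_ne_zero_of_lt_norm ?_⟩
  · rw [norm_pow, norm_pow, show (‖s‖ ^ 2) ^ 3 * ‖m‖ = ‖s‖ ^ 2 * (‖s‖ ^ 4 * ‖m‖) by ring, hm]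
    linarith
  · intro h
    have e : s ^ 2 * m * v = -1 := by linear_combination h
    have := congrArg norm e
    rw [norm_mul, norm_mul, norm_pow, norm_neg, norm_one] at this
    nlinarith
  · rw [norm_mul, norm_pow]
    have h0 : 0 < ‖s‖ ^ 4 := by positivity
    refine lt_of_mul_lt_mul_left ?_ h0.le
    rw [hm]
    linarith
  · rw [norm_mul, norm_pow]
    nlinarith

theorem holOn_symmPart (hs0 : s ≠ 0) (hs : ‖s‖ < 1) (hz0 : z ≠ 0) (hm : ‖s‖ ^ 4 * ‖m‖ = 1) {R : ℝ}
    (hR : ‖s‖ ^ 8 * R < 1) (μ : ℕ+ →₀ ℕ) :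
    HolOn (fun a b => symmPart s ε m a b * pairCoeff s ε z μ a b) (annulus 1 R) (annulus 1 R) :=
  fun a ha b hb => by
  have hle : ∀ {v : ℂ}, v ∈ annulus 1 R → ‖s‖ ^ 8 * ‖v‖ < 1 := fun hv =>
    (mul_le_mul_of_nonneg_left hv.2 (by positivity)).trans_lt hR
  obtain ⟨a1, a2, a3, a4⟩ := symmDen_factors_ne_zero hs0 hs hm ha.1 (hle ha)
  obtain ⟨b1, b2, b3, b4⟩ := symmDen_factors_ne_zero hs0 hs hm hb.1 (hle hb)
  have ha0 : a ≠ 0 := norm_pos_iff.1 (one_pos.trans_le ha.1)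
  have hb0 : b ≠ 0 := norm_pos_iff.1 (one_pos.trans_le hb.1)
  have hf : DifferentiableAt ℂ (fun x : ℂ × ℂ => x.1) (a, b) := by fun_prop
  have hg : DifferentiableAt ℂ (fun x : ℂ × ℂ => x.2) (a, b) := by fun_prop
  have hc : DifferentiableAt ℂ (fun _ : ℂ × ℂ => z) (a, b) := by fun_prop
  have k2 := differentiableAt_pairCoeff (ε := ε) hs0 hc hf hg hz0 ha0 hb0 μ
  have hab : a * b + s ^ 2 ≠ 0 := by
    have := add_mul_ne_zero (q := s ^ 2) (a := a * b) (b := 1) (by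
      rw [norm_one, mul_one, norm_mul]
      have h1 := norm_pow_lt_one hs two_ne_zero
      nlinarith [ha.1, hb.1])
    rwa [mul_one] at this
  have hda : symmDen (s ^ 2) m a ≠ 0 :=
    mul_ne_zero (mul_ne_zero a1 a2) (mul_ne_zero (by convert a3 using 2; ring) (by
      convert a4 using 1; ring))
  have hdb : symmDen (s ^ 2) m b ≠ 0 :=
    mul_ne_zero (mul_ne_zero b1 b2) (mul_ne_zero (by convert b3 using 2; ring) (by
      convert b4 using 1; ring))
  have k3 : DifferentiableAt ℂ (fun x : ℂ × ℂ => symmPart s ε m x.1 x.2) (a, b) := by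
    have hden : a * b * (a * b + s ^ 2) * (symmDen (s ^ 2) m a * symmDen (s ^ 2) m b) ≠ 0 :=
      mul_ne_zero (mul_ne_zero (mul_ne_zero ha0 hb0) hab) (mul_ne_zero hda hdb)
    unfold symmPart
    unfold symmDen at hden ⊢
    fun_prop (disch := assumption)
  exact k3.mul k2

/-- For `|z| = 1` the unit circle avoids the poles at `z` and at `z⁻¹` alike, so the reflection and
the inversion relation can both be carried out there. -/
theorem transferIntegral_of_norm_eq_one (hs0 : s ≠ 0) (hs : ‖s‖ < 1) (hz : ‖z‖ = 1)
    {p₁ p₂ m₁ m₂ : ℝ} (h : RadiiAllowed s ε z p₁ p₂ m₁ m₂) (μ : ℕ+ →₀ ℕ) :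
    transferIntegral s ε z μ p₁ p₂ m₁ m₂ =
      (1 - ε * Complex.I * s * z) * (1 + ε * Complex.I * s ^ 3 * z) /
        ((1 - s ^ 2) * (1 + s ^ 6) * (1 - s ^ 12 * z ^ 2)) *
          coeff μ (gauss (quadF s) (linF s ε)) := by
  have ht0 : 0 < ‖s‖ := norm_pos_iff.2 hs0
  have ht2 : ‖s‖ ^ 2 < 1 := pow_lt_one₀ ht0.le hs two_ne_zero
  have ht4 : ‖s‖ ^ 4 < 1 := pow_lt_one₀ ht0.le hs (by norm_num)
  have hz0 : z ≠ 0 := norm_pos_iff.1 (hz ▸ one_pos)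
  obtain ⟨-, -, -, hp2, -, -, -, hp, hp1, hpm, hm2, hm12, hm1⟩ := h
  rw [hz] at hp1 hm2 hm1
  rw [mul_one] at hm2 hm1
  have hp₂0 : 0 < p₂ := by linarith
  have hp2' : ‖s‖ ^ 2 * p₂ < 1 := (mul_le_mul_of_nonneg_left hp.le (by positivity)).trans_lt hp1
  have hm1' : 1 < ‖s‖ ^ 4 * m₁ := hm2.trans_le (mul_le_mul_of_nonneg_left hm12.le (by positivity))
  have hm₂0 : 0 < m₂ := by linarith
  have hm₁0 : 0 < m₁ := by linarith
  have hplus : ∀ x y, 1 ≤ x → x ≤ p₁ → 1 ≤ y → y ≤ p₂ → PlusRegular ‖s‖ ‖z‖ x y :=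
    fun x y h1 h2 h3 h4 => by
      rw [hz]
      exact plusRegular_of_one_le ht0 hs h1 h3
        ((mul_le_mul_of_nonneg_left h2 (by positivity)).trans_lt hp1)
        ((mul_le_mul_of_nonneg_left h4 (by positivity)).trans_lt hp2')
  have hP := holOn_plusIntegrand (ε := ε) hs0 hplus μ
  have hZ : HolOn (fun a b => currentPair s ε a b * zeroIntegrand s z a b * pairCoeff s ε z μ a b)
      (annulus m₁ m₁) (annulus 1 p₂) := holOn_zeroIntegrand hs0 (fun x y h1 h2 h3 h4 => by
        rw [hz, le_antisymm h2 h1]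
        exact zeroRegular_one ht0 hs hm1' hm1 h3
          ((mul_le_mul_of_nonneg_left h4 (by positivity)).trans_lt hp2')) μ
  -- The lower bounds on the small radii came only from the convergence of the boundary contraction,
  -- a polynomial in `v⁻¹`. As functions, the integrands stay regular down to the unit circle.
  rw [transferIntegral,
    torusAvg_shift_left one_pos (hp2.trans hp).le hp₂0
      (hP.mono subset_rfl (sphere_subset_annulus hp2.le le_rfl)),
    torusAvg_shift_right one_pos hp2.le one_pos
      (hP.mono (sphere_subset_annulus le_rfl (hp2.trans hp).le) subset_rfl),
    torusAvg_shift_right one_pos hp2.le hm₁0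
      (hZ.mono (sphere_subset_annulus le_rfl le_rfl) subset_rfl),
    torusAvg_plusReflected hs0 hs hz, torusAvg_zeroReflected hs0 hs hz hm1' hm1,
    ← torusAvg_const_mul, ← torusAvg_const_mul]
  have hk : kDiag s ε z (-1) = 1 := by
    change (if ε = 0 then (1 : ℂ) else 1) = 1
    simp
  rw [hk, one_mul]
  obtain ⟨m, hzm⟩ : ∃ m, z⁻¹ = -(s ^ 4 * m) := ⟨-(z⁻¹ / s ^ 4), by field_simp⟩
  have hmn : ‖s‖ ^ 4 * ‖m‖ = 1 := by
    rw [← norm_pow, ← norm_mul, ← norm_neg, ← hzm, norm_inv, hz, inv_one]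
  have hmpos : 0 < ‖m‖ := pos_of_mul_pos_right (hmn ▸ one_pos) (by positivity)
  have hm0 : m ≠ 0 := norm_pos_iff.1 hmpos
  have h2m : 1 < ‖s‖ ^ 2 * ‖m‖ := by nlinarith [sq_nonneg ‖s‖]
  have h1m : 1 < ‖m‖ := by nlinarith
  have hmm₂ : ‖m‖ < m₂ := by
    refine lt_of_mul_lt_mul_left (a := ‖s‖ ^ 4) ?_ (by positivity)
    rwa [hmn]
  have hmm₁ : ‖m‖ < m₁ := hmm₂.trans hm12
  have hfac : ∀ {v : ℂ}, 1 ≤ ‖v‖ → ‖v‖ ≤ m₁ → _ := fun {v} h1 h2 =>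
    symmDen_factors_ne_zero hs0 hs hmn h1
      ((mul_le_mul_of_nonneg_left h2 (by positivity)).trans_lt hm1)
  have hne : ∀ {v : ℂ}, 1 ≤ ‖v‖ → v ≠ 0 := fun h => norm_pos_iff.1 (one_pos.trans_le h)
  have hcross : ∀ {a b : ℂ}, ‖s‖ ^ 2 * ‖b‖ < ‖a‖ → a + s ^ 2 * b ≠ 0 := fun h =>
    add_mul_ne_zero (by rwa [norm_pow])
  have hcross' : ∀ {a b : ℂ}, 1 ≤ ‖a‖ → 1 ≤ ‖b‖ → a * b + s ^ 2 ≠ 0 := fun {a b} h1 h2 => by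
    have := add_mul_ne_zero (q := s ^ 2) (a := a * b) (b := 1) (by
      rw [norm_one, mul_one, norm_mul, norm_pow]
      nlinarith)
    rwa [mul_one] at this
  have hone : ∀ {v : ℂ}, ‖v‖ = 1 → v + s ^ 2 * m ≠ 0 := fun {v} hv h0 => by
    rw [eq_neg_of_add_eq_zero_left h0, norm_neg, norm_mul, norm_pow] at hv
    linarith
  have hsub : ∀ {v : ℂ}, ‖m‖ < ‖v‖ → v - m ≠ 0 := fun h => sub_ne_zero_of_lt_norm h
  have hm₁1 : 1 ≤ m₁ := by linarith
  have hm₂1 : 1 ≤ m₂ := by linarith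
  rw [torusAvg_congr one_pos one_pos (G' := fun a b => symmPart s ε m a b * pairCoeff s ε z μ a b *
      crossKernel (s ^ 2) a b * plusPart (s ^ 2) m a b) fun a ha b hb => ?_,
    torusAvg_congr hm₁0 one_pos (G' := fun a b => symmPart s ε m a b * pairCoeff s ε z μ a b *
      crossKernel (s ^ 2) a b * zeroPart (s ^ 2) m a b) fun a ha b hb => ?_,
    torusAvg_congr hm₁0 hm₂0 (G' := fun a b => symmPart s ε m a b * pairCoeff s ε z μ a b *
      crossKernel (s ^ 2) a b * minusPart (s ^ 2) m a b) fun a ha b hb => ?_,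
    torusAvg_unitarity (F := fun a b => symmPart s ε m a b * pairCoeff s ε z μ a b)
      (pow_ne_zero 2 hs0) (norm_pow_lt_one hs two_ne_zero) (by rwa [norm_mul, norm_pow]) hmm₂ hm12
      (holOn_symmPart hs0 hs hz0 hmn hm1 μ)
      (fun a b => by rw [symmPart_swap, pairCoeff_swap s ε z μ b a])]
  · have hms : 1 < ‖m ^ 2‖ := by rw [norm_pow]; nlinarith
    have hsm : 1 < ‖s ^ 2 * m ^ 2‖ := by rw [norm_mul, norm_pow, norm_pow]; nlinarith
    have hsm4 : 1 < ‖s ^ 4 * m ^ 2‖ := by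
      rw [norm_mul, norm_pow, norm_pow, sq, ← mul_assoc, hmn, one_mul]
      exact h1m
    have hne1 : ∀ {v : ℂ}, 1 < ‖v‖ → 1 - v ≠ 0 := fun {v} hv h0 => by
      rw [← sub_eq_zero.1 h0, norm_one] at hv
      exact lt_irrefl _ hv
    have n1 : 1 + s ^ 2 * m ^ 2 ≠ 0 := by
      have := hne1 (v := -(s ^ 2 * m ^ 2)) (by rwa [norm_neg])
      rwa [sub_neg_eq_add] at this
    have n2 : m ^ 2 - s ^ 4 ≠ 0 :=
      sub_ne_zero_of_lt_norm ((norm_pow_lt_one hs (by norm_num)).trans hms)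
    have n3 : m ^ 2 + s ^ 2 ≠ 0 := by
      have := sub_ne_zero_of_lt_norm (a := m ^ 2) (b := -s ^ 2) (by
        rw [norm_neg]; exact (norm_pow_lt_one hs (by norm_num)).trans hms)
      rwa [sub_neg_eq_add] at this
    have n6 : 1 - s ^ 2 ≠ 0 := one_sub_ne_zero (norm_pow_lt_one hs two_ne_zero)
    have n7 : 1 + s ^ 2 ≠ 0 := by
      have := one_sub_ne_zero (x := -s ^ 2) (by
        rw [norm_neg]; exact norm_pow_lt_one hs two_ne_zero)
      rwa [sub_neg_eq_add] at this
    have n8 : 1 + s ^ 6 ≠ 0 := by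
      have := one_sub_ne_zero (x := -s ^ 6) (by
        rw [norm_neg]; exact norm_pow_lt_one hs (by norm_num))
      rwa [sub_neg_eq_add] at this
    have key := symmPart_mul_crossKernel (ε := ε) hs0 hm0 n1 n2 n3 (hne1 hms) (hne1 hsm4) n6 n7 n8
    have hpc : pairCoeff s ε z μ m (-(s ^ 2 * m)) = coeff μ (gauss (quadF s) (linF s ε)) := by
      rw [pairCoeff, stateShift_residue hs0 hs hm0 hzm]
    rw [show symmPart s ε m m (-(s ^ 2 * m)) * pairCoeff s ε z μ m (-(s ^ 2 * m)) *
      ((1 - (s ^ 2) ^ 2) * crossKernel (s ^ 2) m (-(s ^ 2 * m))) =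
      symmPart s ε m m (-(s ^ 2 * m)) * ((1 - (s ^ 2) ^ 2) *
        crossKernel (s ^ 2) m (-(s ^ 2 * m))) * pairCoeff s ε z μ m (-(s ^ 2 * m)) by ring, key,
      hpc, ← neg_mul]
    congr 1
    have hz' : z = -(s ^ 4 * m)⁻¹ := by rw [← inv_inv z, hzm, inv_neg]
    have e1 : 1 - s ^ 12 * z ^ 2 = (m ^ 2 - s ^ 4) / m ^ 2 := by rw [hz']; field_simp
    have e2 : 1 - ε * Complex.I * s * z = (s ^ 3 * m + ε * Complex.I) / (s ^ 3 * m) := by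
      rw [hz']; field_simp; ring
    have e3 : 1 + ε * Complex.I * s ^ 3 * z = (s * m - ε * Complex.I) / (s * m) := by
      rw [hz']; field_simp; ring
    rw [e1, e2, e3]
    generalize s ^ 3 * m + ε * Complex.I = P1 at *
    generalize s * m - ε * Complex.I = P2 at *
    generalize m ^ 2 - s ^ 4 = D2 at *
    generalize 1 - s ^ 2 = D6 at *
    generalize 1 + s ^ 6 = D8 at *
    field_simp
  · rw [mem_sphere_zero_iff_norm] at ha hb
    obtain ⟨a1, a2, a3, a4⟩ := hfac (v := a) (ha ▸ hm₁1) ha.le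
    obtain ⟨b1, b2, b3, b4⟩ := hfac (v := b) (hb ▸ hm₂1) (hb ▸ hm12.le)
    have := currentPair_mul_minusIntegrand (ε := ε) hs0 hz0 hzm hm0 (hne (v := a) (ha ▸ hm₁1))
      (hne (v := b) (hb ▸ hm₂1)) (hcross (by rw [ha, hb]; nlinarith)) (hcross' (a := a) (b := b) (ha ▸ hm₁1) (hb ▸ hm₂1))
      a3 a4 (hsub (v := a) (ha ▸ hmm₁)) b3 b4 (hsub (v := b) (hb ▸ hmm₂))
    linear_combination pairCoeff s ε z μ a b * this
  · rw [mem_sphere_zero_iff_norm] at ha hb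
    obtain ⟨a1, a2, a3, a4⟩ := hfac (v := a) (ha ▸ hm₁1) ha.le
    obtain ⟨b1, b2, b3, b4⟩ := hfac (v := b) hb.ge (hb ▸ hm₁1)
    have := currentPair_mul_zeroReflected (ε := ε) hs0 hz0 hzm hm0 (hne (v := a) (ha ▸ hm₁1)) (hne hb.ge)
      (hcross (by rw [ha, hb, mul_one]; linarith)) (hcross' (a := a) (b := b) (ha ▸ hm₁1) hb.ge) a3 a4
      (hsub (v := a) (ha ▸ hmm₁)) (hone hb) b1 b2
    linear_combination pairCoeff s ε z μ a b * this
  · rw [mem_sphere_zero_iff_norm] at ha hb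
    obtain ⟨a1, a2, a3, a4⟩ := hfac (v := a) ha.ge (ha ▸ hm₁1)
    obtain ⟨b1, b2, b3, b4⟩ := hfac (v := b) hb.ge (hb ▸ hm₁1)
    have := currentPair_mul_plusReflected (ε := ε) hs0 hz0 hzm hm0 (hne ha.ge) (hne hb.ge)
      (hcross (by rw [ha, hb, mul_one]; exact ht2)) (hcross' (a := a) (b := b) ha.ge hb.ge) (hone ha) a1 a2 (hone hb)
      b1 b2
    linear_combination pairCoeff s ε z μ a b * this

end UnitCircle

end IzerginKorepin

namespace IzerginKorepin

open MvPowerSeries Filter Topology MeasureTheory Metric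

/-! ### Holomorphic dependence on the spectral parameter -/

/-- A torus average depends holomorphically on a parameter. -/
theorem differentiableAt_torusAvg {G : ℂ → ℂ → ℂ → ℂ} {z₀ : ℂ} {r₁ r₂ : ℝ} (h₁ : 0 < r₁)
    (h₂ : 0 < r₂) (hG : ∀ᶠ z in 𝓝 z₀, ∀ a ∈ sphere (0 : ℂ) r₁, ∀ b ∈ sphere (0 : ℂ) r₂,
      DifferentiableAt ℂ (fun x : ℂ × ℂ × ℂ => G x.1 x.2.1 x.2.2) (z, a, b)) :
    DifferentiableAt ℂ (fun z => torusAvg (G z) r₁ r₂) z₀ := by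
  obtain ⟨δ', hδ', hball⟩ := Metric.eventually_nhds_iff_ball.1 hG
  -- A disc of radius `δ` around any point within `δ` of `z₀` must stay in the region of regularity,
  -- for the Cauchy estimate.
  obtain ⟨δ, hδ, hδδ⟩ : ∃ δ, 0 < δ ∧ 2 * δ < δ' := ⟨δ' / 4, by linarith, by linarith⟩
  have hK : ∀ z ∈ closedBall z₀ (2 * δ), z ∈ ball z₀ δ' := fun z hz =>
    closedBall_subset_ball hδδ hz
  have hslice : ∀ z ∈ ball z₀ δ', ∀ a ∈ sphere (0 : ℂ) r₁, ∀ b ∈ sphere (0 : ℂ) r₂,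
      DifferentiableAt ℂ (fun z => G z a b) z := fun z hz a ha b hb =>
    DifferentiableAt.comp (g := fun x : ℂ × ℂ × ℂ => G x.1 x.2.1 x.2.2) (f := fun z => (z, a, b)) z
      (hball z hz a ha b hb) (by fun_prop)
  have hhol : ∀ z ∈ ball z₀ δ', HolOn (G z) (sphere 0 r₁) (sphere 0 r₂) := fun z hz a ha b hb =>
    DifferentiableAt.comp (g := fun x : ℂ × ℂ × ℂ => G x.1 x.2.1 x.2.2)
      (f := fun x : ℂ × ℂ => (z, x.1, x.2)) (a, b) (hball z hz a ha b hb) (by fun_prop)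
  obtain ⟨C, hC⟩ : ∃ C, ∀ x ∈ closedBall z₀ (2 * δ) ×ˢ (sphere (0 : ℂ) r₁ ×ˢ sphere (0 : ℂ) r₂),
      ‖G x.1 x.2.1 x.2.2‖ ≤ C := by
    refine IsCompact.exists_bound_of_continuousOn ((isCompact_closedBall _ _).prod
      ((isCompact_sphere _ _).prod (isCompact_sphere _ _))) fun x hx => ?_
    exact (hball x.1 (hK _ hx.1) x.2.1 hx.2.1 x.2.2 hx.2.2).continuousAt.continuousWithinAt
  have hm : ∀ (p : ℝ × ℝ), circleMap 0 r₁ p.2 ∈ sphere (0 : ℂ) r₁ ∧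
      circleMap 0 r₂ p.1 ∈ sphere (0 : ℂ) r₂ := fun p =>
    ⟨circleMap_mem_sphere_zero h₁ p.2, circleMap_mem_sphere_zero h₂ p.1⟩
  have hsub : ball z₀ δ ⊆ ball z₀ δ' := ball_subset_ball (by linarith)
  have hz₀ : z₀ ∈ ball z₀ δ' := mem_ball_self hδ'
  have hInt : ∀ z ∈ ball z₀ δ', Integrable
      (fun p : ℝ × ℝ => G z (circleMap 0 r₁ p.2) (circleMap 0 r₂ p.1)) (circ.prod circ) :=
    fun z hz => (hhol z hz).integrable h₁ h₂
  have hd : ∀ p : ℝ × ℝ, ∀ z ∈ ball z₀ δ, HasDerivAt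
      (fun z => G z (circleMap 0 r₁ p.2) (circleMap 0 r₂ p.1))
      (deriv (fun z => G z (circleMap 0 r₁ p.2) (circleMap 0 r₂ p.1)) z) z := fun p z hz =>
    (hslice z (hsub hz) _ (hm p).1 _ (hm p).2).hasDerivAt
  refine (hasDerivAt_integral_of_dominated_loc_of_deriv_le (μ := circ.prod circ)
    (F := fun z (p : ℝ × ℝ) => G z (circleMap 0 r₁ p.2) (circleMap 0 r₂ p.1))
    (F' := fun z p => deriv (fun z => G z (circleMap 0 r₁ p.2) (circleMap 0 r₂ p.1)) z)
    (bound := fun _ => C / δ) (ball_mem_nhds z₀ hδ)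
    ?_ (hInt z₀ hz₀) ?_ (ae_of_all _ fun p z hz => ?_) (integrable_const _)
    (ae_of_all _ hd)).2.differentiableAt
  · filter_upwards [ball_mem_nhds z₀ hδ'] with z hz
    exact (hInt z hz).aestronglyMeasurable
  -- Measurability of the derivative at `z₀` in the circle parameters, as a limit of difference
  -- quotients along a sequence tending to `z₀`.
  · have hu : Tendsto (fun n : ℕ => z₀ + (δ : ℂ) * (1 / ((n : ℂ) + 1))) atTop (𝓝[≠] z₀) := by
      refine tendsto_nhdsWithin_iff.2 ⟨?_, .of_forall fun n => ?_⟩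
      · have h := (tendsto_one_div_add_atTop_nhds_zero_nat (𝕜 := ℂ)).const_mul (δ : ℂ)
        simpa using h.const_add z₀
      · have h0 : ((n : ℂ) + 1) ≠ 0 := by exact_mod_cast n.succ_ne_zero
        have h1 : (δ : ℂ) ≠ 0 := by exact_mod_cast hδ.ne'
        simp [h0, h1]
    have hun : ∀ n : ℕ, z₀ + (δ : ℂ) * (1 / ((n : ℂ) + 1)) ∈ ball z₀ δ' := fun n => by
      rw [mem_ball, dist_self_add_left, norm_mul, norm_div, norm_one, Complex.norm_real,
        Real.norm_of_nonneg hδ.le]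
      have h0 : (1 : ℝ) ≤ ‖(n : ℂ) + 1‖ := by
        rw [show (n : ℂ) + 1 = ((n + 1 : ℕ) : ℂ) by push_cast; ring, Complex.norm_natCast]
        exact_mod_cast Nat.succ_pos n
      have : 1 / ‖(n : ℂ) + 1‖ ≤ 1 := by
        rw [div_le_one (one_pos.trans_le h0)]; exact h0
      nlinarith
    refine aestronglyMeasurable_of_tendsto_ae atTop (f := fun (n : ℕ) (p : ℝ × ℝ) =>
      slope (fun z => G z (circleMap 0 r₁ p.2) (circleMap 0 r₂ p.1)) z₀
        (z₀ + (δ : ℂ) * (1 / ((n : ℂ) + 1)))) (fun n => ?_) (ae_of_all _ fun p => ?_)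
    · simp only [slope_def_module]
      exact (((hInt _ (hun n)).sub (hInt _ hz₀)).smul
        ((z₀ + (δ : ℂ) * (1 / ((n : ℂ) + 1)) - z₀)⁻¹)).aestronglyMeasurable
    · exact (hasDerivAt_iff_tendsto_slope.1 (hd p z₀ (mem_ball_self hδ))).comp hu
  -- The Cauchy estimate bounds the derivative by `C / δ`, the constant dominating function.
  · refine Complex.norm_deriv_le_of_forall_mem_sphere_norm_le hδ ?_ fun w hw => ?_
    · refine (DifferentiableOn.diffContOnCl fun w hw => ?_)
      rw [closure_ball _ hδ.ne'] at hw
      refine (hslice w (hK w ?_) _ (hm p).1 _ (hm p).2).differentiableWithinAt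
      rw [mem_closedBall] at hw ⊢
      rw [mem_ball] at hz
      linarith [dist_triangle w z z₀]
    · refine hC (w, _, _) ⟨?_, (hm p).1, (hm p).2⟩
      rw [mem_sphere] at hw
      rw [mem_ball] at hz
      rw [mem_closedBall]
      linarith [dist_triangle w z z₀]

section Radii

variable {s z : ℂ} {ε : SignType} {p₁ p₂ m₁ m₂ : ℝ}

/-- The conditions are finitely many strict inequalities, continuous in `z`; so the radii can be
kept fixed for nearby spectral parameters. -/
theorem RadiiAllowed.eventually (h : RadiiAllowed s ε z p₁ p₂ m₁ m₂) :
    ∀ᶠ w in 𝓝 z, RadiiAllowed s ε w p₁ p₂ m₁ m₂ := by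
  have hc : ContinuousAt (fun w : ℂ => ‖w‖) z := by fun_prop
  have k : ∀ c : ℝ, ContinuousAt (fun _ : ℂ => c) z := fun c => continuousAt_const
  filter_upwards [(k _).eventually_lt hc h.lt_norm, (k _).eventually_lt hc h.sign_lt_norm,
    ((k _).mul hc).eventually_lt (k _) h.norm_lt, ((k _).mul hc).eventually_lt (k _) h.mul_norm_lt,
    (k _).eventually_lt (hc.mul (k _)) h.lt_norm_mul, (k _).eventually_lt hc h.p_lt_norm,
    (k _).eventually_lt (((k _).mul hc).mul (k _)) h.one_lt_m,
    (((k _).mul hc).mul (k _)).eventually_lt (k _) h.m_lt_norm] with w h1 h2 h3 h4 h5 h6 h7 h8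
  exact ⟨h1, h2, h3, h.one_lt, h.sign_lt, h4, h5, h.p_lt, h6, h.p_lt_m, h7, h.m_lt, h8⟩

theorem RadiiAllowed.plusRegular (hs0 : s ≠ 0) (hs : ‖s‖ < 1)
    (h : RadiiAllowed s ε z p₁ p₂ m₁ m₂) : PlusRegular ‖s‖ ‖z‖ p₁ p₂ := by
  obtain ⟨h1, -, h3, h4, -, h6, h7, h8, h9, h10, -, h12, h13⟩ := h
  have ht0 : 0 < ‖s‖ := norm_pos_iff.2 hs0
  have ht2 : ‖s‖ ^ 2 < 1 := pow_lt_one₀ ht0.le hs two_ne_zero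
  have h84 : ‖s‖ ^ 8 ≤ ‖s‖ ^ 4 := pow_le_pow_of_le_one ht0.le hs.le (by norm_num)
  have a1 : ‖s‖ ^ 8 * ‖z‖ ≤ ‖s‖ ^ 4 * ‖z‖ := by gcongr
  have a2 : ‖s‖ ^ 8 * ‖z‖ * p₁ ≤ ‖s‖ ^ 8 * ‖z‖ * m₁ := by gcongr; linarith
  have a3 : ‖s‖ ^ 8 * ‖z‖ * p₂ ≤ ‖s‖ ^ 8 * ‖z‖ * m₁ := by gcongr; linarith
  have a4 : ‖s‖ ^ 2 * p₂ ≤ ‖s‖ ^ 2 * p₁ := by gcongr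
  have a5 : ‖z‖ * p₂ ≤ ‖z‖ * p₁ := by gcongr
  refine ⟨by nlinarith, by nlinarith, h9, by linarith, by linarith, by linarith, h6, by linarith,
    by linarith, by linarith, by linarith, by linarith⟩

theorem RadiiAllowed.zeroRegular (hs0 : s ≠ 0) (hs : ‖s‖ < 1)
    (h : RadiiAllowed s ε z p₁ p₂ m₁ m₂) : ZeroRegular ‖s‖ ‖z‖ m₁ p₂ := by
  obtain ⟨h1, -, h3, h4, -, h6, h7, h8, h9, h10, h11, h12, h13⟩ := h
  have ht0 : 0 < ‖s‖ := norm_pos_iff.2 hs0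
  have ht2 : ‖s‖ ^ 2 < 1 := pow_lt_one₀ ht0.le hs two_ne_zero
  have h84 : ‖s‖ ^ 8 ≤ ‖s‖ ^ 4 := pow_le_pow_of_le_one ht0.le hs.le (by norm_num)
  have a1 : ‖s‖ ^ 8 * ‖z‖ ≤ ‖s‖ ^ 4 * ‖z‖ := by gcongr
  have a3 : ‖s‖ ^ 8 * ‖z‖ * p₂ ≤ ‖s‖ ^ 8 * ‖z‖ * m₁ := by gcongr; linarith
  have a4 : ‖s‖ ^ 2 * p₂ ≤ ‖s‖ ^ 2 * p₁ := by gcongr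
  have a5 : ‖z‖ * p₂ ≤ ‖z‖ * m₁ := by gcongr; linarith
  have a6 : ‖s‖ ^ 4 * ‖z‖ * m₂ ≤ ‖s‖ ^ 4 * ‖z‖ * m₁ := by gcongr
  refine ⟨by nlinarith, by nlinarith, by linarith, by linarith, by linarith, h6, by linarith,
    by linarith, by linarith, by linarith, by linarith, by linarith⟩

theorem RadiiAllowed.minusRegular (hs0 : s ≠ 0) (hs : ‖s‖ < 1)
    (h : RadiiAllowed s ε z p₁ p₂ m₁ m₂) : MinusRegular ‖s‖ ‖z‖ m₁ m₂ := by
  obtain ⟨h1, -, h3, h4, -, h6, h7, h8, h9, h10, h11, h12, h13⟩ := h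
  have ht0 : 0 < ‖s‖ := norm_pos_iff.2 hs0
  have ht2 : ‖s‖ ^ 2 < 1 := pow_lt_one₀ ht0.le hs two_ne_zero
  have h84 : ‖s‖ ^ 8 ≤ ‖s‖ ^ 4 := pow_le_pow_of_le_one ht0.le hs.le (by norm_num)
  have a1 : ‖s‖ ^ 8 * ‖z‖ ≤ ‖s‖ ^ 4 * ‖z‖ := by gcongr
  have a3 : ‖s‖ ^ 8 * ‖z‖ * m₂ ≤ ‖s‖ ^ 8 * ‖z‖ * m₁ := by gcongr
  have a5 : ‖z‖ * p₂ ≤ ‖z‖ * m₁ := by gcongr; linarith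
  have a7 : ‖z‖ * p₂ ≤ ‖z‖ * m₂ := by gcongr; linarith
  have a6 : ‖s‖ ^ 4 * ‖z‖ * m₂ ≤ ‖s‖ ^ 4 * ‖z‖ * m₁ := by gcongr
  refine ⟨by nlinarith, by nlinarith, by linarith, by linarith, by linarith, by linarith,
    by linarith, by linarith, by linarith, by linarith, by linarith, by linarith⟩

/-- Suitable contours exist in the annulus of the theorem. -/
theorem exists_radiiAllowed (hs0 : s ≠ 0) (hs : ‖s‖ < 1) (h1 : ‖s‖ ^ 2 < ‖z‖)
    (h2 : ‖(ε : ℂ) * Complex.I * s‖ < ‖z‖) (h3 : ‖s‖ ^ 4 * ‖z‖ < 1) :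
    ∃ p₁ p₂ m₁ m₂, RadiiAllowed s ε z p₁ p₂ m₁ m₂ := by
  have ht0 : 0 < ‖s‖ := norm_pos_iff.2 hs0
  have hj := norm_sign_mul_I_le ε
  have hj0 := norm_nonneg ((ε : ℂ) * Complex.I)
  have h2' := h2
  rw [norm_mul] at h2'
  have hd : ‖(ε : ℂ) * Complex.I / s‖ = ‖(ε : ℂ) * Complex.I‖ / ‖s‖ := norm_div _ _
  generalize ‖(ε : ℂ) * Complex.I‖ = J at *
  generalize hx : ‖z‖ = x at *
  generalize ht : ‖s‖ = t at *
  have hx0 : 0 < x := (by positivity : 0 ≤ t ^ 2).trans_lt h1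
  have ht2 : t ^ 2 < 1 := pow_lt_one₀ ht0.le hs two_ne_zero
  have ht4 : t ^ 4 < 1 := pow_lt_one₀ ht0.le hs (by norm_num)
  have ht3 : t ^ 3 < 1 := pow_lt_one₀ ht0.le hs (by norm_num)
  have ht10 : t ^ 10 < 1 := pow_lt_one₀ ht0.le hs (by norm_num)
  have hu : t ^ 8 * x < 1 := by nlinarith [pow_pos ht0 4]
  -- The lower bounds are those for the small circles. The upper bounds are `|z| / q`, from the
  -- contraction with `Φ_-(z)`, and `1 / (q ^ 4 |z|)`, which leaves room for the large circles. Each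
  -- of the eight comparisons follows from the annulus condition on `z`.
  obtain ⟨p₂, hp, hp'⟩ : ∃ p₂, max (max 1 (J / t)) (max (t ^ 2 * x) (t ^ 2 / x)) < p₂ ∧
      p₂ < min (x / t ^ 2) (1 / (t ^ 8 * x)) := by
    refine exists_between (lt_min (max_lt (max_lt ?_ ?_) (max_lt ?_ ?_))
      (max_lt (max_lt ?_ ?_) (max_lt ?_ ?_)))
    · rwa [lt_div_iff₀ (by positivity), one_mul]
    · rw [div_lt_div_iff₀ ht0 (by positivity)]
      nlinarith
    · rw [lt_div_iff₀ (by positivity)]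
      nlinarith
    · rw [div_lt_div_iff₀ hx0 (by positivity)]
      nlinarith [pow_pos ht0 2]
    · rwa [lt_div_iff₀ (by positivity), one_mul]
    · rw [div_lt_div_iff₀ ht0 (by positivity), one_mul,
        show J * (t ^ 8 * x) = J * (t ^ 3 * (t ^ 4 * x)) * t by ring]
      refine mul_lt_of_lt_one_left ht0 ?_
      have : t ^ 3 * (t ^ 4 * x) < 1 := mul_lt_one_of_nonneg_of_lt_one_left (by positivity) ht3 h3.le
      nlinarith [mul_nonneg (pow_pos ht0 3).le (by positivity : 0 ≤ t ^ 4 * x)]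
    · rw [lt_div_iff₀ (by positivity), show t ^ 2 * x * (t ^ 8 * x) = t ^ 2 * (t ^ 4 * x) ^ 2 by ring]
      have : (t ^ 4 * x) ^ 2 < 1 := pow_lt_one₀ (by positivity) h3 two_ne_zero
      nlinarith [pow_pos ht0 2]
    · rw [div_lt_div_iff₀ hx0 (by positivity)]
      nlinarith
  simp only [max_lt_iff, lt_min_iff] at hp hp'
  obtain ⟨p₁, hp1, hp1'⟩ := exists_between (lt_min hp'.1 hp'.2)
  rw [lt_min_iff] at hp1'
  obtain ⟨m₂, hm, hm'⟩ : ∃ m₂, max p₁ (1 / (t ^ 4 * x)) < m₂ ∧ m₂ < 1 / (t ^ 8 * x) := by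
    refine exists_between (max_lt hp1'.2 ?_)
    refine one_div_lt_one_div_of_lt (by positivity) ?_
    have : t ^ 8 < t ^ 4 := pow_lt_pow_right_of_lt_one₀ ht0 hs (by norm_num)
    gcongr
  rw [max_lt_iff] at hm
  obtain ⟨m₁, hm1, hm1'⟩ := exists_between hm'
  refine ⟨p₁, p₂, m₁, m₂, ?_⟩
  have hp2 := hp.2.2
  rw [div_lt_iff₀ hx0] at hp2
  have hp3 := hp1'.1
  rw [lt_div_iff₀ (by positivity)] at hp3
  have hm2 := hm.2
  rw [div_lt_iff₀ (by positivity)] at hm2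
  rw [lt_div_iff₀ (by positivity)] at hm1'
  exact ⟨by rw [ht, hx]; exact h1, by rw [hx]; exact h2, by rw [ht, hx]; exact h3, hp.1.1,
    by rw [hd]; exact hp.1.2, by rw [ht, hx]; exact hp.2.1, by rw [ht, hx]; linarith, hp1,
    by rw [ht, hx]; linarith, hm.1, by rw [ht, hx]; linarith, hm1, by rw [ht, hx]; linarith⟩

end Radii

end IzerginKorepin

namespace IzerginKorepin

open MvPowerSeries Filter Topology MeasureTheory Metric

/-! ### Analytic continuation in the spectral parameter -/

/-- The contour integral for the transfer matrix, without the pole of the `K`-matrix. -/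
noncomputable def clearedIntegral (s : ℂ) (ε : SignType) (μ : ℕ+ →₀ ℕ) (p₁ p₂ m₁ m₂ : ℝ)
    (z : ℂ) : ℂ :=
  (1 + ε * Complex.I * s ^ 3 * z) * (if ε = 0 then 1 else z ^ 2) *
    torusAvg (fun v₁ v₂ => currentPair s ε v₁ v₂ * plusIntegrand s z v₁ v₂ *
      pairCoeff s ε z μ v₁ v₂) p₁ p₂ +
    (if ε = 0 then 1 else z * (ε * Complex.I * s ^ 3 + z)) *
      torusAvg (fun v₁ v₂ => currentPair s ε v₁ v₂ * zeroIntegrand s z v₁ v₂ *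
        pairCoeff s ε z μ v₁ v₂) m₁ p₂ +
    (1 + ε * Complex.I * s ^ 3 * z) *
      torusAvg (fun v₁ v₂ => currentPair s ε v₁ v₂ * minusIntegrand s z v₁ v₂ *
        pairCoeff s ε z μ v₁ v₂) m₁ m₂

section Continuation

variable {s z : ℂ} {ε : SignType} {p₁ p₂ m₁ m₂ : ℝ}

/-- The prefactor removes the pole of the middle entry of the `K`-matrix, which is a spurious
singularity for the continuation. -/
theorem clearedIntegral_eq (hz0 : z ≠ 0) (hK' : 1 + ε * Complex.I * s ^ 3 * z ≠ 0)
    (μ : ℕ+ →₀ ℕ) (p₁ p₂ m₁ m₂ : ℝ) : clearedIntegral s ε μ p₁ p₂ m₁ m₂ z =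
      (1 + ε * Complex.I * s ^ 3 * z) * transferIntegral s ε z μ p₁ p₂ m₁ m₂ := by
  have k1 : kDiag s ε z 1 = if ε = 0 then 1 else z ^ 2 := rfl
  have k2 : kDiag s ε z (-1) = 1 := by
    change (if ε = 0 then (1 : ℂ) else 1) = 1
    simp
  have k3 : (1 + ε * Complex.I * s ^ 3 * z) * kDiag s ε z 0 =
      if ε = 0 then 1 else z * (ε * Complex.I * s ^ 3 + z) := by
    change _ * (if ε = 0 then (1 : ℂ) else
      (ε * Complex.I * s ^ 3 + z) / (ε * Complex.I * s ^ 3 + z⁻¹)) = _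
    by_cases hε : ε = 0
    · subst hε
      simp
    rw [if_neg hε, if_neg hε,
      show ε * Complex.I * s ^ 3 + z⁻¹ = (1 + ε * Complex.I * s ^ 3 * z) / z by field_simp; ring]
    generalize 1 + ε * Complex.I * s ^ 3 * z = D at *
    field_simp
  rw [clearedIntegral, transferIntegral, k1, k2, ← k3]
  ring

theorem differentiableAt_clearedIntegral (hs0 : s ≠ 0) (hs : ‖s‖ < 1)
    (h : RadiiAllowed s ε z p₁ p₂ m₁ m₂) (μ : ℕ+ →₀ ℕ) :
    DifferentiableAt ℂ (clearedIntegral s ε μ p₁ p₂ m₁ m₂) z := by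
  have hp₂ : 0 < p₂ := one_pos.trans h.one_lt
  have hp₁ : 0 < p₁ := hp₂.trans h.p_lt
  have hm₂ : 0 < m₂ := hp₁.trans h.p_lt_m
  have hm₁ : 0 < m₁ := hm₂.trans h.m_lt
  have d1 := differentiableAt_torusAvg (G := fun z v₁ v₂ => currentPair s ε v₁ v₂ *
      plusIntegrand s z v₁ v₂ * pairCoeff s ε z μ v₁ v₂) hp₁ hp₂ (by
    filter_upwards [h.eventually] with w hw a ha b hb
    refine differentiableAt_plusIntegrand (h := fun x : ℂ × ℂ × ℂ => x.1)
      (f := fun x : ℂ × ℂ × ℂ => x.2.1) (g := fun x : ℂ × ℂ × ℂ => x.2.2) hs0 (by fun_prop)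
      (by fun_prop) (by fun_prop) ?_ μ
    rw [mem_sphere_zero_iff_norm] at ha hb
    simp only [ha, hb]
    exact hw.plusRegular hs0 hs)
  have d2 := differentiableAt_torusAvg (G := fun z v₁ v₂ => currentPair s ε v₁ v₂ *
      zeroIntegrand s z v₁ v₂ * pairCoeff s ε z μ v₁ v₂) hm₁ hp₂ (by
    filter_upwards [h.eventually] with w hw a ha b hb
    refine differentiableAt_zeroIntegrand (h := fun x : ℂ × ℂ × ℂ => x.1)
      (f := fun x : ℂ × ℂ × ℂ => x.2.1) (g := fun x : ℂ × ℂ × ℂ => x.2.2) hs0 (by fun_prop)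
      (by fun_prop) (by fun_prop) ?_ μ
    rw [mem_sphere_zero_iff_norm] at ha hb
    simp only [ha, hb]
    exact hw.zeroRegular hs0 hs)
  have d3 := differentiableAt_torusAvg (G := fun z v₁ v₂ => currentPair s ε v₁ v₂ *
      minusIntegrand s z v₁ v₂ * pairCoeff s ε z μ v₁ v₂) hm₁ hm₂ (by
    filter_upwards [h.eventually] with w hw a ha b hb
    refine differentiableAt_minusIntegrand (h := fun x : ℂ × ℂ × ℂ => x.1)
      (f := fun x : ℂ × ℂ × ℂ => x.2.1) (g := fun x : ℂ × ℂ × ℂ => x.2.2) hs0 (by fun_prop)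
      (by fun_prop) (by fun_prop) ?_ μ
    rw [mem_sphere_zero_iff_norm] at ha hb
    simp only [ha, hb]
    exact hw.minusRegular hs0 hs)
  have d4 : DifferentiableAt ℂ (fun z : ℂ => if ε = 0 then (1 : ℂ) else z ^ 2) z := by
    split_ifs <;> fun_prop
  have d5 : DifferentiableAt ℂ
      (fun z : ℂ => if ε = 0 then (1 : ℂ) else z * (ε * Complex.I * s ^ 3 + z)) z := by
    split_ifs <;> fun_prop
  unfold clearedIntegral
  fun_prop

theorem one_sub_pow_mul_sq_ne_zero (hs : ‖s‖ < 1) (h : ‖s‖ ^ 4 * ‖z‖ < 1) :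
    1 - s ^ 12 * z ^ 2 ≠ 0 := by
  rw [show s ^ 12 * z ^ 2 = s ^ 4 * (s ^ 4 * z) ^ 2 by ring]
  refine one_sub_ne_zero ?_
  rw [norm_mul]
  refine mul_lt_one_of_nonneg_of_lt_one_left (norm_nonneg _) (norm_pow_lt_one hs (by norm_num)) ?_
  exact (norm_pow_lt_one (by rwa [norm_mul, norm_pow]) two_ne_zero).le

theorem RadiiAllowed.ne_zero (h : RadiiAllowed s ε z p₁ p₂ m₁ m₂) : z ≠ 0 :=
  norm_pos_iff.1 ((by positivity : 0 ≤ ‖s‖ ^ 2).trans_lt h.lt_norm)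

theorem one_sub_sq_mul_ne_zero (hs : ‖s‖ < 1) : (1 - s ^ 2) * (1 + s ^ 6) ≠ 0 := by
  refine mul_ne_zero (one_sub_ne_zero (norm_pow_lt_one hs two_ne_zero)) ?_
  have := one_sub_ne_zero (x := -s ^ 6) (by rw [norm_neg]; exact norm_pow_lt_one hs (by norm_num))
  rwa [sub_neg_eq_add] at this

/-- No contour deformation is needed: for either choice of radii the integral times the nonzero
scalar is the same coefficient of the transfer matrix, which does not involve radii. -/
theorem clearedIntegral_eq_of_ne (hs0 : s ≠ 0) (hs : ‖s‖ < 1) {p₁' p₂' m₁' m₂' : ℝ}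
    (h : RadiiAllowed s ε z p₁ p₂ m₁ m₂) (h' : RadiiAllowed s ε z p₁' p₂' m₁' m₂')
    (hK : 1 - ε * Complex.I * s * z ≠ 0) (hK' : 1 + ε * Complex.I * s ^ 3 * z ≠ 0)
    (μ : ℕ+ →₀ ℕ) :
    clearedIntegral s ε μ p₁ p₂ m₁ m₂ z = clearedIntegral s ε μ p₁' p₂' m₁' m₂' z := by
  have e1 := (transfer_groundState (e := 1) hs0 hs one_ne_zero h).2 (-1) μ
  have e2 := (transfer_groundState (e := 1) hs0 hs one_ne_zero h').2 (-1) μ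
  rw [if_pos rfl] at e1 e2
  have hT : transferScalar s ε z ≠ 0 := by
    rw [transferScalar_eq hs0 hs h.lt_norm h.sign_lt_norm h.norm_lt]
    exact div_ne_zero (mul_ne_zero (one_sub_sq_mul_ne_zero hs)
      (one_sub_pow_mul_sq_ne_zero hs h.norm_lt)) (mul_ne_zero hK hK')
  rw [clearedIntegral_eq h.ne_zero hK', clearedIntegral_eq h.ne_zero hK']
  congr 1
  exact mul_left_cancel₀ hT (e1.symm.trans e2)

theorem eventually_linear_ne_zero (c z : ℂ) : ∀ᶠ w in 𝓝[≠] z, 1 + c * w ≠ 0 := by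
  by_cases h : 1 + c * z = 0
  · filter_upwards [self_mem_nhdsWithin] with w hw h0
    have hc : c ≠ 0 := fun hc => by simp [hc] at h
    exact hw (mul_left_cancel₀ hc (by linear_combination h0 - h))
  · have hc : ContinuousAt (fun w => 1 + c * w) z := by fun_prop
    exact (hc.eventually_ne h).filter_mono nhdsWithin_le_nhds

/-- The integral does not depend on the contours. -/
theorem clearedIntegral_congr (hs0 : s ≠ 0) (hs : ‖s‖ < 1) {p₁' p₂' m₁' m₂' : ℝ}
    (h : RadiiAllowed s ε z p₁ p₂ m₁ m₂) (h' : RadiiAllowed s ε z p₁' p₂' m₁' m₂')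
    (μ : ℕ+ →₀ ℕ) :
    clearedIntegral s ε μ p₁ p₂ m₁ m₂ z = clearedIntegral s ε μ p₁' p₂' m₁' m₂' z := by
  have c1 := (differentiableAt_clearedIntegral hs0 hs h μ).continuousAt.continuousWithinAt
    (s := {z}ᶜ)
  have c2 := (differentiableAt_clearedIntegral hs0 hs h' μ).continuousAt.continuousWithinAt
    (s := {z}ᶜ)
  refine tendsto_nhds_unique (c1.tendsto.congr' ?_) c2.tendsto
  -- Both sides are continuous at `z`, and the excluded parameters are isolated, so equality on a
  -- punctured neighbourhood is enough.
  filter_upwards [h.eventually.filter_mono nhdsWithin_le_nhds,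
    h'.eventually.filter_mono nhdsWithin_le_nhds,
    eventually_linear_ne_zero (-(ε * Complex.I * s)) z,
    eventually_linear_ne_zero (ε * Complex.I * s ^ 3) z] with w h1 h2 h3 h4
  refine clearedIntegral_eq_of_ne hs0 hs h1 h2 (fun h0 => h3 ?_) h4 μ
  linear_combination h0

/-- The annulus of spectral parameters. -/
def spectralAnnulus (s : ℂ) (ε : SignType) : Set ℂ :=
  {z | max (‖s‖ ^ 2) ‖(ε : ℂ) * Complex.I * s‖ < ‖z‖ ∧ ‖s‖ ^ 4 * ‖z‖ < 1}

theorem isOpen_spectralAnnulus (s : ℂ) (ε : SignType) : IsOpen (spectralAnnulus s ε) :=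
  (isOpen_lt continuous_const continuous_norm).inter
    (isOpen_lt (continuous_const.mul continuous_norm) continuous_const)

/-- The annulus is the image of a vertical strip, which is convex, under the exponential. -/
theorem isPreconnected_spectralAnnulus (hs0 : s ≠ 0) (ε : SignType) :
    IsPreconnected (spectralAnnulus s ε) := by
  have ht0 : 0 < ‖s‖ := norm_pos_iff.2 hs0
  have hm : 0 < max (‖s‖ ^ 2) ‖(ε : ℂ) * Complex.I * s‖ := lt_max_of_lt_left (by positivity)
  have he : spectralAnnulus s ε = Complex.exp '' {w : ℂ |
      Real.log (max (‖s‖ ^ 2) ‖(ε : ℂ) * Complex.I * s‖) < w.re ∧ w.re < -Real.log (‖s‖ ^ 4)} := by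
    ext z
    simp only [spectralAnnulus, Set.mem_ofPred_eq, Set.mem_image]
    have key : ∀ w : ℂ, (max (‖s‖ ^ 2) ‖(ε : ℂ) * Complex.I * s‖ < ‖Complex.exp w‖ ∧
        ‖s‖ ^ 4 * ‖Complex.exp w‖ < 1) ↔
        Real.log (max (‖s‖ ^ 2) ‖(ε : ℂ) * Complex.I * s‖) < w.re ∧
          w.re < -Real.log (‖s‖ ^ 4) := fun w => by
      rw [Complex.norm_exp, ← Real.log_lt_iff_lt_exp hm, ← Real.log_inv,
        Real.lt_log_iff_exp_lt (by positivity), lt_inv_comm₀ (Real.exp_pos _) (by positivity),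
        ← one_div, lt_div_iff₀ (Real.exp_pos _)]
    constructor
    · rintro h
      have hz0 : z ≠ 0 := norm_pos_iff.1 (hm.trans h.1)
      refine ⟨Complex.log z, (key _).1 ?_, Complex.exp_log hz0⟩
      rwa [Complex.exp_log hz0]
    · rintro ⟨w, hw, rfl⟩
      exact (key w).2 hw
  rw [he]
  refine (Convex.isPreconnected ?_).image _ Complex.continuous_exp.continuousOn
  exact (convex_halfSpace_re_gt _).inter (convex_halfSpace_re_lt _)

theorem mem_spectralAnnulus_iff : z ∈ spectralAnnulus s ε ↔
    ‖s‖ ^ 2 < ‖z‖ ∧ ‖(ε : ℂ) * Complex.I * s‖ < ‖z‖ ∧ ‖s‖ ^ 4 * ‖z‖ < 1 := by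
  rw [spectralAnnulus, Set.mem_ofPred_eq, max_lt_iff, and_assoc]

theorem mem_spectralAnnulus_of_norm_eq_one (hs : ‖s‖ < 1) (hz : ‖z‖ = 1) :
    z ∈ spectralAnnulus s ε := by
  rw [mem_spectralAnnulus_iff, hz, mul_one, norm_mul]
  exact ⟨pow_lt_one₀ (norm_nonneg _) hs two_ne_zero,
    (mul_le_of_le_one_left (norm_nonneg _) (norm_sign_mul_I_le ε)).trans_lt hs,
    pow_lt_one₀ (norm_nonneg _) hs (by norm_num)⟩

/-- The points `exp (i / (n + 1))` accumulate at `1`; this is the accumulation required by the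
identity theorem. -/
theorem frequently_norm_eq_one : ∃ᶠ w : ℂ in 𝓝[≠] 1, ‖w‖ = 1 := by
  have hu : Tendsto (fun n : ℕ => Complex.exp ((1 / ((n : ℝ) + 1) : ℝ) * Complex.I)) atTop
      (𝓝[≠] 1) := by
    refine tendsto_nhdsWithin_iff.2 ⟨?_, .of_forall fun n => ?_⟩
    · have hc : Continuous fun x : ℝ => Complex.exp (x * Complex.I) := by fun_prop
      have := (hc.tendsto 0).comp (tendsto_one_div_add_atTop_nhds_zero_nat (𝕜 := ℝ))
      rw [Complex.ofReal_zero, zero_mul, Complex.exp_zero] at this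
      exact this
    · intro h
      have hpos : (0 : ℝ) < 1 / ((n : ℝ) + 1) := Nat.one_div_pos_of_nat
      have hle : 1 / ((n : ℝ) + 1) ≤ 1 := by
        rw [div_le_one (by positivity)]
        linarith [(Nat.cast_nonneg n : (0 : ℝ) ≤ n)]
      have him := congrArg Complex.im h
      rw [Complex.exp_ofReal_mul_I_im, Complex.one_im] at him
      exact (Real.sin_pos_of_pos_of_lt_pi hpos (by linarith [Real.pi_gt_three])).ne' him
  exact hu.frequently (Eventually.frequently (.of_forall fun n => Complex.norm_exp_ofReal_mul_I _))

/-- Both sides are holomorphic in `z` on the connected annulus and agree on the unit circle by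
`transferIntegral_of_norm_eq_one`. -/
theorem clearedIntegral_eval (hs0 : s ≠ 0) (hs : ‖s‖ < 1) (h : RadiiAllowed s ε z p₁ p₂ m₁ m₂)
    (μ : ℕ+ →₀ ℕ) :
    clearedIntegral s ε μ p₁ p₂ m₁ m₂ z * ((1 - s ^ 2) * (1 + s ^ 6) * (1 - s ^ 12 * z ^ 2)) =
      (1 - ε * Complex.I * s * z) * (1 + ε * Complex.I * s ^ 3 * z) ^ 2 *
        coeff μ (gauss (quadF s) (linF s ε)) := by
  have hex : ∀ w ∈ spectralAnnulus s ε, ∃ r : ℝ × ℝ × ℝ × ℝ,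
      RadiiAllowed s ε w r.1 r.2.1 r.2.2.1 r.2.2.2 := fun w hw => by
    obtain ⟨h1, h2, h3⟩ := mem_spectralAnnulus_iff.1 hw
    obtain ⟨a, b, c, d, hr⟩ := exists_radiiAllowed hs0 hs h1 h2 h3
    exact ⟨(a, b, c, d), hr⟩
  -- The radii are chosen pointwise without any continuity; `clearedIntegral_congr` shows that
  -- locally they may be replaced by fixed ones, so `Φ` is holomorphic.
  choose! r hr using hex
  have hmem : ∀ {w : ℂ} {a b c d : ℝ}, RadiiAllowed s ε w a b c d → w ∈ spectralAnnulus s ε :=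
    fun h => mem_spectralAnnulus_iff.2 ⟨h.lt_norm, h.sign_lt_norm, h.norm_lt⟩
  set Φ : ℂ → ℂ := fun w => clearedIntegral s ε μ (r w).1 (r w).2.1 (r w).2.2.1 (r w).2.2.2 w
  have hΦ : ∀ {w : ℂ} {a b c d : ℝ}, RadiiAllowed s ε w a b c d →
      clearedIntegral s ε μ a b c d w = Φ w := fun h =>
    clearedIntegral_congr hs0 hs h (hr _ (hmem h)) μ
  have hd : DifferentiableOn ℂ Φ (spectralAnnulus s ε) := fun w hw => by
    have h0 := hr w hw
    refine ((differentiableAt_clearedIntegral hs0 hs h0 μ).congr_of_eventuallyEq ?_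
      ).differentiableWithinAt
    filter_upwards [h0.eventually] with x hx
    exact (hΦ hx).symm
  have a1 : AnalyticOnNhd ℂ (fun w => Φ w * ((1 - s ^ 2) * (1 + s ^ 6) * (1 - s ^ 12 * w ^ 2)))
      (spectralAnnulus s ε) :=
    (hd.mul (by fun_prop)).analyticOnNhd (isOpen_spectralAnnulus s ε)
  have a2 : AnalyticOnNhd ℂ (fun w => (1 - ε * Complex.I * s * w) *
      (1 + ε * Complex.I * s ^ 3 * w) ^ 2 * coeff μ (gauss (quadF s) (linF s ε)))
      (spectralAnnulus s ε) :=
    DifferentiableOn.analyticOnNhd (by fun_prop) (isOpen_spectralAnnulus s ε)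
  have key := a1.eqOn_of_preconnected_of_frequently_eq a2 (isPreconnected_spectralAnnulus hs0 ε)
    (mem_spectralAnnulus_of_norm_eq_one hs norm_one) (frequently_norm_eq_one.mono fun w hw => ?_)
  · rw [hΦ h]
    exact key (hmem h)
  · have hw' := hr w (mem_spectralAnnulus_of_norm_eq_one hs hw)
    have hK' : 1 + ε * Complex.I * s ^ 3 * w ≠ 0 := by
      have := one_sub_ne_zero (x := -(ε * Complex.I * s ^ 3 * w)) (by
        rw [norm_neg, norm_mul, norm_mul, hw, mul_one]
        exact (mul_le_of_le_one_left (norm_nonneg _) (norm_sign_mul_I_le ε)).trans_lt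
          (norm_pow_lt_one hs (by norm_num)))
      rwa [sub_neg_eq_add] at this
    have n1 := one_sub_sq_mul_ne_zero hs
    have n2 := one_sub_pow_mul_sq_ne_zero hs hw'.norm_lt
    simp only [Φ]
    rw [clearedIntegral_eq hw'.ne_zero hK', transferIntegral_of_norm_eq_one hs0 hs hw hw']
    generalize (1 - s ^ 2) * (1 + s ^ 6) = A at *
    generalize 1 - s ^ 12 * w ^ 2 = B at *
    field_simp

theorem transfer_groundState_eq (hs0 : s ≠ 0) (hs : ‖s‖ < 1) {e : ℂ} (he : e ≠ 0)
    (hz : z ∈ spectralAnnulus s ε) (hK : 1 - ε * Complex.I * s * z ≠ 0)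
    (hK' : 1 + ε * Complex.I * s ^ 3 * z ≠ 0) :
    TransferConverges e s ε z (groundState s ε) ∧
      transfer e s ε z (groundState s ε) = groundState s ε := by
  obtain ⟨h1, h2, h3⟩ := mem_spectralAnnulus_iff.1 hz
  obtain ⟨p₁, p₂, m₁, m₂, h⟩ := exists_radiiAllowed hs0 hs h1 h2 h3
  obtain ⟨hc, hv⟩ := transfer_groundState hs0 hs he h
  refine ⟨hc, ?_⟩
  funext n μ
  rw [hv n μ]
  have hg : groundState s ε n μ = if n = -1 then coeff μ (gauss (quadF s) (linF s ε)) else 0 := by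
    rw [groundState, expSeries_eq_gauss]
    by_cases hn : n = -1
    · subst hn
      simp [shift, highest, coeff_apply]
    · have : n - -1 ≠ 0 := by omega
      rw [if_neg hn, shift, highest, Pi.single_eq_of_ne this, mul_zero]
      rfl
  rw [hg]
  split_ifs with hn
  · have key := clearedIntegral_eval hs0 hs h μ
    rw [clearedIntegral_eq h.ne_zero hK'] at key
    change transferScalar s ε z * transferIntegral s ε z μ p₁ p₂ m₁ m₂ = _
    rw [transferScalar_eq hs0 hs h1 h2 h3]
    generalize (1 - s ^ 2) * (1 + s ^ 6) * (1 - s ^ 12 * z ^ 2) = D at *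
    generalize 1 - ε * Complex.I * s * z = A at *
    generalize 1 + ε * Complex.I * s ^ 3 * z = B at *
    rw [div_mul_eq_mul_div, div_eq_iff (mul_ne_zero hK hK')]
    -- `key` carries the clearing factor `1 + ε √-1 s ^ 3 z` once more than the claim.
    refine mul_left_cancel₀ hK' ?_
    linear_combination key
  · rfl

/-- In the sector `-1` the constant term of the Gaussian is `1`. -/
theorem groundState_ne_zero (s : ℂ) (ε : SignType) : groundState s ε ≠ 0 := fun h => by
  have h1 := congrArg (fun v : Fock => constantCoeff (v (-1))) h
  have h2 : constantCoeff (groundState s ε (-1)) = 1 := by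
    rw [groundState, expSeries_eq_gauss, map_mul, constantCoeff_gauss]
    simp [shift, highest]
  simp only [h2] at h1
  simp at h1

end Continuation

end IzerginKorepin

theorem mainTheorem1 (s : ℝ) (hs : -1 < s) (hs0 : s < 0)
    (e : ℂ) (he : e ^ 2 = (s : ℂ) + (s : ℂ)⁻¹)
    (ε : SignType) (z : ℂ)
    (hz : (if ε = 0 then s ^ 2 else |s|) < ‖z‖) (hz' : ‖z‖ < (s ^ 4)⁻¹)
    (hK : 1 - ε * Complex.I * s * z ≠ 0) (hK' : 1 + ε * Complex.I * s ^ 3 * z ≠ 0) :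
    IzerginKorepin.groundState s ε ≠ 0 ∧
      IzerginKorepin.TransferConverges e s ε z (IzerginKorepin.groundState s ε) ∧
      IzerginKorepin.transfer e s ε z (IzerginKorepin.groundState s ε) =
        IzerginKorepin.groundState s ε := by
  have hs0' : (s : ℂ) ≠ 0 := by exact_mod_cast hs0.ne
  have hn : ‖(s : ℂ)‖ = |s| := by rw [Complex.norm_real, Real.norm_eq_abs]
  have ha : |s| < 1 := abs_lt.2 ⟨hs, by linarith⟩
  -- The negativity of `s` enters here: `s + s⁻¹ < 0`, so its square root `e` is invertible.
  have he0 : e ≠ 0 := by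
    rintro rfl
    have h1 : s + s⁻¹ = 0 := by
      rw [zero_pow two_ne_zero] at he
      exact_mod_cast he.symm
    linarith [inv_lt_zero.2 hs0]
  have h4 : 0 < s ^ 4 := (by decide : Even 4).pow_pos hs0.ne
  -- For `ε = ±` the bound `|s|` from the linear boundary term implies the bound `q` from the
  -- quadratic one.
  have hle : s ^ 2 ≤ |s| := by
    rw [← sq_abs, sq]
    exact mul_le_of_le_one_left (abs_nonneg _) ha.le
  refine ⟨IzerginKorepin.groundState_ne_zero _ _,
    IzerginKorepin.transfer_groundState_eq hs0' (hn ▸ ha) he0 ?_ hK hK'⟩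
  rw [IzerginKorepin.mem_spectralAnnulus_iff, norm_mul, hn, sq_abs,
    show |s| ^ 4 = s ^ 4 from (by decide : Even 4).pow_abs s]
  have h3 : s ^ 4 * ‖z‖ < 1 := by
    rwa [← one_div, lt_div_iff₀ h4, mul_comm] at hz'
  by_cases hε : ε = 0
  · rw [if_pos hε] at hz
    subst hε
    refine ⟨hz, ?_, h3⟩
    simpa using (sq_nonneg s).trans_lt hz
  · rw [if_neg hε] at hz
    exact ⟨hle.trans_lt hz, (mul_le_of_le_one_left (abs_nonneg _)
      (IzerginKorepin.norm_sign_mul_I_le ε)).trans_lt hz, h3⟩
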